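/- Let $k$ be a field, $H$ a Hopf algebra over $k$ with bijective antipode $S$, $A$ a left $H$-module algebra (action written $h\rightharpoonup a$) and $B$ a left $H$-comodule algebra (coaction written $b\mapsto \sum b_{-1}\otimes b_0$). The Takeuchi smash product $A\#B$ is the algebra with underlying space $A\otimes B$ and product $(a\#b)(a'\#b')=\sum a(b_{-1}\rightharpoonup a')\#b_0b'$; for $B=H$ it is the usual smash product $A\#H$. A module is called pseudo-coherent if it has a resolution by finitely generated projective modules. Let $M$ be a right $A\#H$-module that is pseudo-coherent as a right $A$-module. Let $X$ be an $(H,B)$-Hopf module, i.e. a right $B$-module with a left $H$-comodule structure such that $\rho(xb)=\rho(x)\rho(b)$, and suppose that $X$ is pseudo-coherent as a right $B$-module. Let $M\#X$ be the right $A\#B$-module $M\otimes X$ with $(m\otimes x)(a\#b)=\sum m(x_{-1}\rightharpoonup a)\otimes x_0b$. Below, $\mathrm{Ext}_{R^{op}}$ denotes Ext of right $R$-modules, and $\mathrm{Ext}^\bullet_{R^{op}}(N,N)=\bigoplus_{n\ge 0}\mathrm{Ext}^n_{R^{op}}(N,N)$ is the Yoneda algebra, in which the product $fg$ is "$g$ followed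 by $f$". (1) $M$ has a resolution $P_\bullet\to M$ by right $A\#H$-modules that are projective over $A$, and $X$ has a resolution $Q_\bullet\to X$ by $(H,B)$-Hopf modules that are finitely generated projective over $B$. (2) $\mathrm{Ext}^\bullet_{A^{op}}(M,M)$ has a structure of graded left $H$-module algebra which, for every such $P_\bullet$, is induced by the $H$-action $(h\rightharpoonup f)(p)=\sum h_1\rightharpoonup f(S(h_2)\rightharpoonup p)$ on $\mathrm{Hom}_{A^{op}}(P_\bullet,M)$, where $h\rightharpoonup m:=m(1\#S(h))$. Similarly $\mathrm{Ext}^\bullet_{B^{op}}(X,X)$ has a structure of graded left $H$-comodule algebra which, for every such $Q_\bullet$, is induced by the coaction on $\mathrm{Hom}_{B^{op}}(Q_\bullet,X)$ with $\sum g_{-1}\otimes g_0(q)=\sum g(q_0)_{-1}S^{-1}(q_{-1})\otimes g(q_0)_0$. (3) With these structures, there is an isomorphism of graded $k$-algebras $$\mathrm{Ext}^\bullet_{(A\#B)^{op}}(M\#X,M\#X)\;\cong\;\mathrm{Ext}^\bullet_{A^{op}}(M,M)\,\#\,\mathrm{Ext}^\bullet_{B^{op}}(X,X),$$ where the right-hand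 side is the graded Takeuchi smash product: the space $\mathrm{Ext}^\bullet_{A^{op}}(M,M)\otimes \mathrm{Ext}^\bullet_{B^{op}}(X,X)$, graded by total degree, with product $$(\lambda\#\gamma)(\lambda'\#\gamma')=\sum(-1)^{|\gamma||\lambda'|}\,\lambda(\gamma_{-1}\rightharpoonup\lambda')\#\gamma_0\gamma'$$ for homogeneous $\gamma$ and $\lambda'$. -/

import Mathlib

open scoped TensorProduct DirectSum
open CategoryTheory CategoryTheory.Abelian MulOpposite

universe u

noncomputable section

/-! ## Twisted tensor products of algebras -/

section Twisted

variable {k A B : Type*} [CommRing k] [Ring A] [Algebra k A] [Ring B] [Algebra k B]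

/-- For `τ : B ⊗ A → A ⊗ B`, the operator `a' ⊗ b' ↦ τ(b ⊗ a') (1 ⊗ b')` on `A ⊗ B`. -/
def twistLeft (τ : B →ₗ[k] A →ₗ[k] A ⊗[k] B) : B →ₗ[k] (A ⊗[k] B) →ₗ[k] A ⊗[k] B :=
  LinearMap.mk₂ k
    (fun b x => TensorProduct.lift
      ((LinearMap.mul k (A ⊗[k] B)).compl₁₂ (τ b)
        (Algebra.TensorProduct.includeRight : B →ₐ[k] A ⊗[k] B).toLinearMap) x)
    (fun b b' x => by
      induction x using TensorProduct.induction_on with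
      | zero => simp
      | tmul a c => simp
      | add x y hx hy =>
        simp only [map_add] at hx hy ⊢
        rw [hx, hy]
        abel)
    (fun r b x => by
      induction x using TensorProduct.induction_on with
      | zero => simp
      | tmul a c => simp
      | add x y hx hy => simp only [map_add, hx, hy, smul_add])
    (fun b x y => by simp)
    (fun r b x => by simp)

@[simp] lemma twistLeft_tmul (τ : B →ₗ[k] A →ₗ[k] A ⊗[k] B) (b b' : B) (a : A) :
    twistLeft τ b (a ⊗ₜ b') = τ b a * (1 ⊗ₜ b') := by
  simp [twistLeft]

/-- The product `(a ⊗ b)(a' ⊗ b') = (a ⊗ 1) τ(b ⊗ a') (1 ⊗ b')` on `A ⊗ B` given by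
`τ : B ⊗ A → A ⊗ B`, that is, `(m_A ⊗ m_B) ∘ (id ⊗ τ ⊗ id)`. -/
def twistMul (τ : B →ₗ[k] A →ₗ[k] A ⊗[k] B) :
    (A ⊗[k] B) →ₗ[k] (A ⊗[k] B) →ₗ[k] A ⊗[k] B :=
  TensorProduct.lift
    (((LinearMap.llcomp k (A ⊗[k] B) (A ⊗[k] B) (A ⊗[k] B)) ∘ₗ
      (LinearMap.mul k (A ⊗[k] B) ∘ₗ
        (Algebra.TensorProduct.includeLeft : A →ₐ[k] A ⊗[k] B).toLinearMap)).compl₂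
      (twistLeft τ))

lemma twistMul_tmul_left (τ : B →ₗ[k] A →ₗ[k] A ⊗[k] B) (a : A) (b : B) (y : A ⊗[k] B) :
    twistMul τ (a ⊗ₜ b) y = (a ⊗ₜ 1) * twistLeft τ b y := by
  simp [twistMul]

lemma twistMul_tmul_tmul (τ : B →ₗ[k] A →ₗ[k] A ⊗[k] B) (a a' : A) (b b' : B) :
    twistMul τ (a ⊗ₜ b) (a' ⊗ₜ b') = (a ⊗ₜ 1) * τ b a' * (1 ⊗ₜ b') := by
  simp [twistMul_tmul_left, mul_assoc]

variable (k A B) in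
/-- A twisting map `τ : B ⊗ A → A ⊗ B`: one for which `twistMul` is associative with unit
`1 ⊗ 1`, in the form of the usual compatibilities of `τ` with units and products. -/
structure TwistingMap where
  τ : B →ₗ[k] A →ₗ[k] A ⊗[k] B
  one_left : ∀ a, τ 1 a = a ⊗ₜ 1
  one_right : ∀ b, τ b 1 = 1 ⊗ₜ b
  mul_left : ∀ b b' a, τ (b * b') a = twistLeft τ b (τ b' a)
  mul_right : ∀ b a a', τ b (a * a') = twistMul τ (τ b a) (a' ⊗ₜ 1)

namespace TwistingMap

variable (t : TwistingMap k A B)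

lemma twistLeft_mul_right (b b' : B) (x : A ⊗[k] B) :
    twistLeft t.τ b (x * (1 ⊗ₜ b')) = twistLeft t.τ b x * (1 ⊗ₜ b') := by
  induction x using TensorProduct.induction_on with
  | zero => simp
  | tmul a c => simp [mul_assoc]
  | add x y hx hy => simp only [add_mul, map_add, hx, hy]

lemma twistMul_mul_right (b' : B) (x y : A ⊗[k] B) :
    twistMul t.τ x (y * (1 ⊗ₜ b')) = twistMul t.τ x y * (1 ⊗ₜ b') := by
  induction x using TensorProduct.induction_on with
  | zero => simp
  | tmul a c => simp [twistMul_tmul_left, twistLeft_mul_right, mul_assoc]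
  | add x z hx hz => simp only [add_mul, map_add, LinearMap.add_apply, hx, hz]

lemma twistLeft_mul (b b' : B) (x : A ⊗[k] B) :
    twistLeft t.τ (b * b') x = twistLeft t.τ b (twistLeft t.τ b' x) := by
  induction x using TensorProduct.induction_on with
  | zero => simp
  | tmul a c => simp [t.mul_left, twistLeft_mul_right]
  | add x y hx hy => simp only [map_add, hx, hy]

lemma twistLeft_mul_left (b : B) (a : A) (y : A ⊗[k] B) :
    twistLeft t.τ b ((a ⊗ₜ 1) * y) = twistMul t.τ (t.τ b a) y := by
  induction y using TensorProduct.induction_on with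
  | zero => simp
  | tmul a' c =>
    have h : (a' ⊗ₜ[k] c : A ⊗[k] B) = (a' ⊗ₜ 1) * (1 ⊗ₜ c) := by simp
    rw [h, twistMul_mul_right, ← t.mul_right]
    simp
  | add x y hx hy => simp only [mul_add, map_add, hx, hy]

lemma twistMul_mul_left (a : A) (b' : B) (x y : A ⊗[k] B) :
    twistMul t.τ ((a ⊗ₜ 1) * x * (1 ⊗ₜ b')) y =
      (a ⊗ₜ 1) * twistMul t.τ x (twistLeft t.τ b' y) := by
  induction x using TensorProduct.induction_on with
  | zero => simp
  | tmul c d =>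
    simp only [Algebra.TensorProduct.tmul_mul_tmul, one_mul, mul_one, twistMul_tmul_left,
      twistLeft_mul, ← mul_assoc]
  | add x z hx hz => simp only [mul_add, add_mul, map_add, LinearMap.add_apply, hx, hz]

lemma twistMul_assoc (x y z : A ⊗[k] B) :
    twistMul t.τ (twistMul t.τ x y) z = twistMul t.τ x (twistMul t.τ y z) := by
  induction x using TensorProduct.induction_on with
  | zero => simp
  | add x w hx hw => simp only [map_add, LinearMap.add_apply, hx, hw]
  | tmul a b =>
    induction y using TensorProduct.induction_on with
    | zero => simp
    | add y w hy hw => simp only [map_add, LinearMap.add_apply, hy, hw]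
    | tmul a' b' =>
      rw [twistMul_tmul_tmul, twistMul_mul_left, twistMul_tmul_left, twistMul_tmul_left,
        twistLeft_mul_left]

lemma twistLeft_one (x : A ⊗[k] B) : twistLeft t.τ 1 x = x := by
  induction x using TensorProduct.induction_on with
  | zero => simp
  | tmul a b => simp [t.one_left]
  | add x y hx hy => simp only [map_add, hx, hy]

lemma one_twistMul (x : A ⊗[k] B) : twistMul t.τ (1 ⊗ₜ 1) x = x := by
  rw [twistMul_tmul_left, twistLeft_one, ← Algebra.TensorProduct.one_def, one_mul]

lemma twistMul_one (x : A ⊗[k] B) : twistMul t.τ x (1 ⊗ₜ 1) = x := by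
  induction x using TensorProduct.induction_on with
  | zero => simp
  | tmul a b => simp [twistMul_tmul_tmul, t.one_right]
  | add x y hx hy => simp only [map_add, LinearMap.add_apply, hx, hy]

end TwistingMap

/-- The twisted tensor product algebra: the space `A ⊗ B` with the product `twistMul`. -/
def TwistedTensor (_t : TwistingMap k A B) : Type _ := A ⊗[k] B

namespace TwistedTensor

variable (t : TwistingMap k A B)

instance : AddCommGroup (TwistedTensor t) := inferInstanceAs (AddCommGroup (A ⊗[k] B))

instance : Module k (TwistedTensor t) := inferInstanceAs (Module k (A ⊗[k] B))

instance : Mul (TwistedTensor t) := ⟨fun x y => twistMul t.τ x y⟩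

instance : One (TwistedTensor t) := ⟨(1 ⊗ₜ 1 : A ⊗[k] B)⟩

instance : Ring (TwistedTensor t) where
  __ := (inferInstance : AddCommGroup (TwistedTensor t))
  left_distrib x y z := (twistMul t.τ x).map_add y z
  right_distrib x y z := (twistMul t.τ).map_add₂ x y z
  zero_mul x := (twistMul t.τ).map_zero₂ x
  mul_zero x := (twistMul t.τ x).map_zero
  mul_assoc x y z := t.twistMul_assoc x y z
  one_mul x := t.one_twistMul x
  mul_one x := t.twistMul_one x

instance : Algebra k (TwistedTensor t) :=
  Algebra.ofModule
    (fun r x y => (twistMul t.τ).map_smul₂ r x y)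
    (fun r x y => (twistMul t.τ x).map_smul r y)

/-- The element `a # b`, that is, `a ⊗ b`. -/
def tmul (a : A) (b : B) : TwistedTensor t := (a ⊗ₜ[k] b : A ⊗[k] B)

end TwistedTensor

end Twisted

/-! ## Module algebras, comodule algebras and the Takeuchi smash product -/

section Smash

variable (k H A B : Type*) [CommRing k] [Ring H] [Bialgebra k H] [Ring A] [Algebra k A]
  [Ring B] [Algebra k B]

/-- A left `H`-module algebra structure on `A`: a left `H`-module structure `h ⇀ a = act h a`
with `h ⇀ (a a') = ∑ (h₁ ⇀ a) (h₂ ⇀ a')` and `h ⇀ 1 = ε(h) 1`. -/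
structure ModuleAlgebra where
  act : H →ₐ[k] Module.End k A
  act_mul : ∀ (h : H) (a a' : A),
    act h (a * a') = TensorProduct.lift ((LinearMap.mul k A).compl₁₂
      (act.toLinearMap.flip a) (act.toLinearMap.flip a')) (Coalgebra.comul (R := k) h)
  act_one : ∀ h : H, act h 1 = algebraMap k A (Coalgebra.counit (R := k) h)

/-- A left `H`-comodule algebra structure on `B`: a coassociative and counital coaction
`ρ = coact : B → H ⊗ B` that is a morphism of algebras. -/
structure ComoduleAlgebra where
  coact : B →ₐ[k] H ⊗[k] B
  coassoc : ∀ b, TensorProduct.assoc k H H B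
      ((Coalgebra.comul (R := k) (A := H)).rTensor B (coact b)) =
    coact.toLinearMap.lTensor H (coact b)
  counit : ∀ b, TensorProduct.lid k B
      ((Coalgebra.counit (R := k) (A := H)).rTensor B (coact b)) = b

/-- `H` as a left comodule algebra over itself. -/
def ComoduleAlgebra.self : ComoduleAlgebra k H H where
  coact := Bialgebra.comulAlgHom k H
  coassoc b := Coalgebra.coassoc_apply b
  counit b := by simp

variable {k H A B}

/-- The map `b ⊗ a ↦ ∑ (b₋₁ ⇀ a) ⊗ b₀`. -/
def smashτ (α : ModuleAlgebra k H A) (β : ComoduleAlgebra k H B) :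
    B →ₗ[k] A →ₗ[k] A ⊗[k] B :=
  LinearMap.mk₂ k (fun b a => (α.act.toLinearMap.flip a).rTensor B (β.coact b))
    (by simp) (by simp) (by simp [LinearMap.rTensor_add]) (by simp [LinearMap.rTensor_smul])

lemma smashτ_apply (α : ModuleAlgebra k H A) (β : ComoduleAlgebra k H B) (b : B) (a : A) :
    smashτ α β b a = (α.act.toLinearMap.flip a).rTensor B (β.coact b) := rfl

/-- `smashτ` with a tensor `∑ h ⊗ b` in the place of `ρ(b)`. -/
lemma twistLeft_smashτ (α : ModuleAlgebra k H A) (β : ComoduleAlgebra k H B) (b : B)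
    (s : H ⊗[k] B) (a : A) :
    twistLeft (smashτ α β) b ((α.act.toLinearMap.flip a).rTensor B s) =
      (α.act.toLinearMap.flip a).rTensor B (β.coact b * s) := by
  induction s using TensorProduct.induction_on with
  | zero => simp
  | add x y hx hy => simp only [map_add, mul_add, hx, hy]
  | tmul h c =>
    simp only [LinearMap.rTensor_tmul, twistLeft_tmul, smashτ_apply]
    generalize β.coact b = u
    induction u using TensorProduct.induction_on with
    | zero => simp
    | add x y hx hy => simp only [map_add, add_mul, hx, hy]
    | tmul g d => simp

/-- The map `h ⊗ h' ⊗ b ↦ (h ⇀ a) (h' ⇀ a') ⊗ b`. -/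
def smashAux (α : ModuleAlgebra k H A) (B : Type*) [Ring B] [Algebra k B] (a a' : A) :
    H ⊗[k] (H ⊗[k] B) →ₗ[k] A ⊗[k] B :=
  TensorProduct.lift ((LinearMap.mul k (A ⊗[k] B)).compl₁₂
    ((Algebra.TensorProduct.includeLeft : A →ₐ[k] A ⊗[k] B).toLinearMap ∘ₗ
      α.act.toLinearMap.flip a)
    ((α.act.toLinearMap.flip a').rTensor B))

lemma smashτ_mul_right (α : ModuleAlgebra k H A) (β : ComoduleAlgebra k H B) (b : B)
    (a a' : A) :
    smashτ α β b (a * a') = twistMul (smashτ α β) (smashτ α β b a) (a' ⊗ₜ 1) := by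
  have h1 : smashτ α β b (a * a') = smashAux α B a a' (TensorProduct.assoc k H H B
      ((Coalgebra.comul (R := k) (A := H)).rTensor B (β.coact b))) := by
    rw [smashτ_apply]
    generalize β.coact b = u
    induction u using TensorProduct.induction_on with
    | zero => simp
    | add x y hx hy => simp only [map_add, hx, hy]
    | tmul g d =>
      simp only [LinearMap.rTensor_tmul, LinearMap.flip_apply, AlgHom.toLinearMap_apply,
        α.act_mul]
      generalize Coalgebra.comul (R := k) g = v
      induction v using TensorProduct.induction_on with
      | zero => simp
      | add x y hx hy => simp only [map_add, TensorProduct.add_tmul, hx, hy]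
      | tmul g d => simp [smashAux]
  rw [h1, β.coassoc, smashτ_apply]
  generalize β.coact b = u
  induction u using TensorProduct.induction_on with
  | zero => simp
  | add x y hx hy => simp only [map_add, LinearMap.add_apply, hx, hy]
  | tmul g d =>
    simp [smashAux, twistMul_tmul_tmul, smashτ_apply, ← Algebra.TensorProduct.one_def]

/-- The twisting map `b ⊗ a ↦ ∑ (b₋₁ ⇀ a) ⊗ b₀`. -/
def smashTwist (α : ModuleAlgebra k H A) (β : ComoduleAlgebra k H B) : TwistingMap k A B where
  τ := smashτ α β
  one_left a := by simp [smashτ_apply, Algebra.TensorProduct.one_def]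
  one_right b := by
    have h : α.act.toLinearMap.flip 1 =
        (Algebra.linearMap k A) ∘ₗ (Coalgebra.counit (R := k) (A := H)) := by
      ext h; simp [α.act_one]
    rw [smashτ_apply, h, LinearMap.rTensor_comp, LinearMap.comp_apply]
    have h2 : (Coalgebra.counit (R := k) (A := H)).rTensor B (β.coact b) = 1 ⊗ₜ b := by
      rw [← (TensorProduct.lid k B).injective.eq_iff, β.counit]; simp
    rw [h2]; simp
  mul_left b b' a := by
    rw [smashτ_apply α β b' a, twistLeft_smashτ, smashτ_apply, map_mul]
  mul_right b a a' := smashτ_mul_right α β b a a'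

/-- The Takeuchi smash product `A # B`: the space `A ⊗ B` with
`(a # b)(a' # b') = ∑ a (b₋₁ ⇀ a') # b₀ b'`. -/
abbrev SmashProduct (α : ModuleAlgebra k H A) (β : ComoduleAlgebra k H B) : Type _ :=
  TwistedTensor (smashTwist α β)

/-- The element `a # b` of `A # B`. -/
abbrev SmashProduct.tmul (α : ModuleAlgebra k H A) (β : ComoduleAlgebra k H B) (a : A) (b : B) :
    SmashProduct α β :=
  TwistedTensor.tmul (smashTwist α β) a b

/-- The usual smash product `A # H`. -/
abbrev SmashHopf (α : ModuleAlgebra k H A) : Type _ := SmashProduct α (ComoduleAlgebra.self k H)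

/-- The element `a # h` of `A # H`. -/
abbrev SmashHopf.tmul (α : ModuleAlgebra k H A) (a : A) (h : H) : SmashHopf α :=
  SmashProduct.tmul α (ComoduleAlgebra.self k H) a h

/-- The defining formula of the Takeuchi smash product, for `ρ(b) = ∑ hᵢ ⊗ bᵢ`. -/
lemma SmashProduct.tmul_mul_tmul (α : ModuleAlgebra k H A) (β : ComoduleAlgebra k H B)
    (a a' : A) (b b' : B) {ι : Type*} (s : Finset ι) (h : ι → H) (c : ι → B)
    (hb : β.coact b = ∑ i ∈ s, h i ⊗ₜ c i) :
    SmashProduct.tmul α β a b * SmashProduct.tmul α β a' b' =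
      ∑ i ∈ s, SmashProduct.tmul α β (a * α.act (h i) a') (c i * b') := by
  change twistMul (smashτ α β) (a ⊗ₜ b) (a' ⊗ₜ b') =
    ∑ i ∈ s, (a * α.act (h i) a') ⊗ₜ (c i * b')
  rw [twistMul_tmul_tmul, smashτ_apply, hb]
  simp [Finset.mul_sum, Finset.sum_mul]

end Smash

/-! ## Hopf modules and the module `N # Y` -/

section HopfModule

variable {k H A B : Type*} [CommRing k] [Ring H] [Bialgebra k H] [Ring A] [Algebra k A]
  [Ring B] [Algebra k B]

variable (k) in
/-- The right action `n ⊗ a ↦ n a` of an algebra as a bilinear map. -/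
def rightAction (A N : Type*) [Ring A] [Algebra k A] [AddCommGroup N] [Module k N]
    [Module Aᵐᵒᵖ N] [IsScalarTower k Aᵐᵒᵖ N] : N →ₗ[k] A →ₗ[k] N :=
  LinearMap.mk₂ k (fun n a => op a • n)
    (by intros; simp) (by intros; rw [smul_comm])
    (by intros; simp [add_smul]) (by intros; simp)

/-- A structure of `(H, B)`-Hopf module on a right `B`-module `X`: a coassociative and counital
left coaction `ρ : X → H ⊗ X` with `ρ(x b) = ρ(x) ρ(b)`. -/
structure HopfModule (β : ComoduleAlgebra k H B) (X : Type*) [AddCommGroup X] [Module k X]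
    [Module Bᵐᵒᵖ X] [IsScalarTower k Bᵐᵒᵖ X] where
  coact : X →ₗ[k] H ⊗[k] X
  coassoc : ∀ x, TensorProduct.assoc k H H X
      ((Coalgebra.comul (R := k) (A := H)).rTensor X (coact x)) = coact.lTensor H (coact x)
  counit : ∀ x, TensorProduct.lid k X
      ((Coalgebra.counit (R := k) (A := H)).rTensor X (coact x)) = x
  coact_smul : ∀ (x : X) (b : B), coact (op b • x) =
    TensorProduct.map₂ (LinearMap.mul k H) (rightAction k B X) (coact x) (β.coact b)

variable (α : ModuleAlgebra k H A) {β : ComoduleAlgebra k H B}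
  (N : Type*) [AddCommGroup N] [Module k N] [Module Aᵐᵒᵖ N] [IsScalarTower k Aᵐᵒᵖ N]
  {Y : Type*} [AddCommGroup Y] [Module k Y] [Module Bᵐᵒᵖ Y] [IsScalarTower k Bᵐᵒᵖ Y]
  (χ : HopfModule β Y)

/-- The operator `n ⊗ y ↦ ∑ n (y₋₁ ⇀ a) ⊗ y₀` on `N ⊗ Y`. -/
def smashModuleA (a : A) : N ⊗[k] Y →ₗ[k] N ⊗[k] Y :=
  TensorProduct.lift (LinearMap.mk₂ k
    (fun n y => (rightAction k A N n ∘ₗ α.act.toLinearMap.flip a).rTensor Y (χ.coact y))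
    (by intros; simp [LinearMap.add_comp, LinearMap.rTensor_add])
    (by intros; simp [LinearMap.smul_comp, LinearMap.rTensor_smul])
    (by intros; simp) (by intros; simp))

lemma smashModuleA_tmul (a : A) (n : N) (y : Y) :
    smashModuleA α N χ a (n ⊗ₜ y) =
      (rightAction k A N n ∘ₗ α.act.toLinearMap.flip a).rTensor Y (χ.coact y) := by
  simp [smashModuleA]

/-- The operator `n ⊗ y ↦ ∑ n (y₋₁ ⇀ a) ⊗ y₀ b` on `N ⊗ Y`, for `a ⊗ b` in `A ⊗ B`. -/
def smashModuleAct : A ⊗[k] B →ₗ[k] Module.End k (N ⊗[k] Y) :=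
  TensorProduct.lift (LinearMap.mk₂ k
    (fun a b => ((rightAction k B Y).flip b).lTensor N ∘ₗ smashModuleA α N χ a)
    (by
      intros; ext n y
      simp [smashModuleA_tmul, LinearMap.comp_add, LinearMap.rTensor_add])
    (by
      intros; ext n y
      simp [smashModuleA_tmul, LinearMap.comp_smul, LinearMap.rTensor_smul])
    (by intros; simp [LinearMap.lTensor_add, LinearMap.add_comp])
    (by intros; simp [LinearMap.lTensor_smul, LinearMap.smul_comp]))

lemma smashModuleAct_tmul (a : A) (b : B) : smashModuleAct α N χ (a ⊗ₜ b) =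
    ((rightAction k B Y).flip b).lTensor N ∘ₗ smashModuleA α N χ a := by
  simp [smashModuleAct]

/-- The map `h ⊗ h' ⊗ y ↦ (n (h ⇀ a)) (h' ⇀ a') ⊗ y`. -/
def smashModuleAux (Y : Type*) [AddCommGroup Y] [Module k Y] (n : N) (a a' : A) :
    H ⊗[k] (H ⊗[k] Y) →ₗ[k] N ⊗[k] Y :=
  TensorProduct.lift (LinearMap.rTensorHom Y ∘ₗ
    LinearMap.lcomp k N (α.act.toLinearMap.flip a') ∘ₗ rightAction k A N ∘ₗ
    rightAction k A N n ∘ₗ α.act.toLinearMap.flip a)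

lemma rightAction_apply (n : N) (a : A) : rightAction k A N n a = op a • n := rfl

lemma smashModuleA_mul (a a' : A) (v : N ⊗[k] Y) :
    smashModuleA α N χ (a * a') v = smashModuleA α N χ a' (smashModuleA α N χ a v) := by
  induction v using TensorProduct.induction_on with
  | zero => simp
  | add x y hx hy => simp only [map_add, hx, hy]
  | tmul n y =>
    have h1 : smashModuleA α N χ (a * a') (n ⊗ₜ y) = smashModuleAux α N Y n a a'
        (TensorProduct.assoc k H H Y
          ((Coalgebra.comul (R := k) (A := H)).rTensor Y (χ.coact y))) := by
      rw [smashModuleA_tmul]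
      generalize χ.coact y = u
      induction u using TensorProduct.induction_on with
      | zero => simp
      | add x y hx hy => simp only [map_add, hx, hy]
      | tmul g d =>
        simp only [LinearMap.rTensor_tmul, LinearMap.comp_apply, LinearMap.flip_apply,
          AlgHom.toLinearMap_apply, α.act_mul]
        generalize Coalgebra.comul (R := k) g = w
        induction w using TensorProduct.induction_on with
        | zero => simp
        | add x y hx hy => simp only [map_add, TensorProduct.add_tmul, hx, hy]
        | tmul g d => simp [smashModuleAux, rightAction_apply, mul_smul]
    rw [h1, χ.coassoc, smashModuleA_tmul]
    generalize χ.coact y = u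
    induction u using TensorProduct.induction_on with
    | zero => simp
    | add x y hx hy => simp only [map_add, hx, hy]
    | tmul g d =>
      simp [smashModuleAux, smashModuleA_tmul, rightAction_apply]
      rfl

lemma smashModuleA_lTensor (a : A) (b : B) (v : N ⊗[k] Y) :
    smashModuleA α N χ a (((rightAction k B Y).flip b).lTensor N v) =
      smashModuleAct α N χ (smashτ α β b a) v := by
  induction v using TensorProduct.induction_on with
  | zero => simp
  | add x y hx hy => simp only [map_add, hx, hy]
  | tmul n y =>
    rw [smashτ_apply, LinearMap.lTensor_tmul, smashModuleA_tmul, LinearMap.flip_apply,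
      rightAction_apply, χ.coact_smul]
    generalize β.coact b = u
    induction u using TensorProduct.induction_on with
    | zero => simp
    | add x y hx hy => simp only [map_add, LinearMap.add_apply, hx, hy]
    | tmul g d =>
      simp only [LinearMap.rTensor_tmul, smashModuleAct_tmul, LinearMap.comp_apply,
        smashModuleA_tmul]
      generalize χ.coact y = w
      induction w using TensorProduct.induction_on with
      | zero => simp
      | add x y hx hy => simp only [map_add, LinearMap.add_apply, hx, hy]
      | tmul h z => simp

lemma smashModuleAct_mul_mul (a : A) (b : B) (x : A ⊗[k] B) (v : N ⊗[k] Y) :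
    smashModuleAct α N χ ((a ⊗ₜ 1) * x * (1 ⊗ₜ b)) v =
      ((rightAction k B Y).flip b).lTensor N
        (smashModuleAct α N χ x (smashModuleA α N χ a v)) := by
  induction x using TensorProduct.induction_on with
  | zero => simp
  | add x y hx hy => simp only [map_add, mul_add, add_mul, LinearMap.add_apply, hx, hy]
  | tmul c d =>
    simp only [Algebra.TensorProduct.tmul_mul_tmul, one_mul, mul_one, smashModuleAct_tmul,
      LinearMap.comp_apply, smashModuleA_mul]
    have h : (rightAction k B Y).flip (d * b) =
        (rightAction k B Y).flip b ∘ₗ (rightAction k B Y).flip d := by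
      ext y; simp [rightAction_apply, mul_smul]
    rw [h, LinearMap.lTensor_comp]
    rfl

lemma smashModuleAct_twistMul (x x' : A ⊗[k] B) (v : N ⊗[k] Y) :
    smashModuleAct α N χ (twistMul (smashτ α β) x x') v =
      smashModuleAct α N χ x' (smashModuleAct α N χ x v) := by
  induction x using TensorProduct.induction_on with
  | zero => simp
  | add x y hx hy => simp only [map_add, LinearMap.add_apply, hx, hy]
  | tmul a b =>
    induction x' using TensorProduct.induction_on with
    | zero => simp
    | add x y hx hy => simp only [map_add, LinearMap.add_apply, hx, hy]
    | tmul a' b' =>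
      rw [twistMul_tmul_tmul, smashModuleAct_mul_mul, ← smashModuleA_lTensor,
        smashModuleAct_tmul, smashModuleAct_tmul]
      rfl

lemma smashModuleAct_one (v : N ⊗[k] Y) : smashModuleAct α N χ (1 ⊗ₜ 1) v = v := by
  induction v using TensorProduct.induction_on with
  | zero => simp
  | add x y hx hy => simp only [map_add, hx, hy]
  | tmul n y =>
    have h1 : (rightAction k B Y).flip 1 = LinearMap.id := by
      ext y; simp [rightAction_apply]
    have h2 : rightAction k A N n ∘ₗ α.act.toLinearMap.flip 1 =
        (LinearMap.toSpanSingleton k N n) ∘ₗ (Coalgebra.counit (R := k) (A := H)) := by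
      ext h; simp [α.act_one, rightAction_apply, Algebra.algebraMap_eq_smul_one]
    have h3 : (Coalgebra.counit (R := k) (A := H)).rTensor Y (χ.coact y) = 1 ⊗ₜ y := by
      rw [← (TensorProduct.lid k Y).injective.eq_iff, χ.counit]; simp
    rw [smashModuleAct_tmul, h1, LinearMap.lTensor_id, LinearMap.id_comp, smashModuleA_tmul,
      h2, LinearMap.rTensor_comp, LinearMap.comp_apply, h3]
    simp

/-- The right `A # B`-module `N # Y`: the space `N ⊗ Y` with
`(n ⊗ y)(a # b) = ∑ n (y₋₁ ⇀ a) ⊗ y₀ b`. -/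
def SmashModule (_α : ModuleAlgebra k H A) (N : Type*) [AddCommGroup N] [Module k N]
    [Module Aᵐᵒᵖ N] [IsScalarTower k Aᵐᵒᵖ N] (_χ : HopfModule β Y) : Type _ := N ⊗[k] Y

instance : AddCommGroup (SmashModule α N χ) := inferInstanceAs (AddCommGroup (N ⊗[k] Y))

instance : Module k (SmashModule α N χ) := inferInstanceAs (Module k (N ⊗[k] Y))

instance : Module (SmashProduct α β)ᵐᵒᵖ (SmashModule α N χ) where
  smul s v := smashModuleAct α N χ s.unop v
  one_smul v := smashModuleAct_one α N χ v
  mul_smul s t v := smashModuleAct_twistMul α N χ t.unop s.unop v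
  smul_zero s := (smashModuleAct α N χ s.unop).map_zero
  zero_smul v := (smashModuleAct α N χ).map_zero₂ v
  smul_add s v w := (smashModuleAct α N χ s.unop).map_add v w
  add_smul s t v := (smashModuleAct α N χ).map_add₂ s.unop t.unop v

instance : IsScalarTower k (SmashProduct α β)ᵐᵒᵖ (SmashModule α N χ) where
  smul_assoc r s v := (smashModuleAct α N χ).map_smul₂ r s.unop v

variable {N} in
/-- The element `n # y` of `N # Y`, that is, `n ⊗ y`. -/
def SmashModule.tmul (n : N) (y : Y) : SmashModule α N χ := (n ⊗ₜ[k] y : N ⊗[k] Y)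

/-- The defining formula of the module `N # Y`, for `ρ(y) = ∑ hᵢ ⊗ yᵢ`. -/
lemma SmashModule.smul_tmul (n : N) (y : Y) (a : A) (b : B) {ι : Type*} (s : Finset ι)
    (h : ι → H) (z : ι → Y) (hy : χ.coact y = ∑ i ∈ s, h i ⊗ₜ z i) :
    op (SmashProduct.tmul α β a b) • SmashModule.tmul α χ n y =
      ∑ i ∈ s, SmashModule.tmul α χ (op (α.act (h i) a) • n) (op b • z i) := by
  change smashModuleAct α N χ (a ⊗ₜ b) (n ⊗ₜ y) =
    ∑ i ∈ s, (op (α.act (h i) a) • n) ⊗ₜ[k] (op b • z i)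
  rw [smashModuleAct_tmul, LinearMap.comp_apply, smashModuleA_tmul, hy]
  simp [rightAction_apply]

end HopfModule

/-! ## Graded module algebras, graded comodule algebras, graded Takeuchi smash products -/

section Graded

variable (k H : Type*) [CommRing k] [Ring H] [Bialgebra k H]
  (Λ Γ : ℕ → Type*)
  [∀ n, AddCommGroup (Λ n)] [∀ n, Module k (Λ n)] [DirectSum.GRing Λ] [DirectSum.GAlgebra k Λ]
  [∀ n, AddCommGroup (Γ n)] [∀ n, Module k (Γ n)] [DirectSum.GRing Γ] [DirectSum.GAlgebra k Γ]

/-- A graded left `H`-module algebra structure on the graded algebra `⨁ n, Λ n`. -/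
structure GradedModuleAlgebra extends ModuleAlgebra k H (⨁ n, Λ n) where
  act_lof : ∀ (h : H) (n : ℕ) (x : Λ n),
    act h (DirectSum.lof k ℕ Λ n x) ∈ LinearMap.range (DirectSum.lof k ℕ Λ n)

/-- A graded left `H`-comodule algebra structure on the graded algebra `⨁ n, Γ n`. -/
structure GradedComoduleAlgebra extends ComoduleAlgebra k H (⨁ n, Γ n) where
  coact_lof : ∀ (n : ℕ) (y : Γ n),
    coact (DirectSum.lof k ℕ Γ n y) ∈ LinearMap.range ((DirectSum.lof k ℕ Γ n).lTensor H)

variable {k H Λ Γ}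

/-- The map `γ ⊗ λ ↦ (-1) ^ (|γ| |λ|) ∑ (γ₋₁ ⇀ λ) ⊗ γ₀`. -/
def gradedSmashτ (α : ModuleAlgebra k H (⨁ n, Λ n)) (β : ComoduleAlgebra k H (⨁ n, Γ n)) :
    (⨁ n, Γ n) →ₗ[k] (⨁ n, Λ n) →ₗ[k] (⨁ n, Λ n) ⊗[k] (⨁ n, Γ n) :=
  DirectSum.toModule k ℕ _ fun j => LinearMap.flip (DirectSum.toModule k ℕ _ fun i =>
    LinearMap.flip ((-1 : k) ^ (j * i) •
      (smashτ α β).compl₁₂ (DirectSum.lof k ℕ Γ j) (DirectSum.lof k ℕ Λ i)))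

lemma gradedSmashτ_lof (α : ModuleAlgebra k H (⨁ n, Λ n)) (β : ComoduleAlgebra k H (⨁ n, Γ n))
    (i j : ℕ) (x : Λ i) (y : Γ j) :
    gradedSmashτ α β (DirectSum.lof k ℕ Γ j y) (DirectSum.lof k ℕ Λ i x) =
      (-1 : k) ^ (j * i) • smashτ α β (DirectSum.lof k ℕ Γ j y) (DirectSum.lof k ℕ Λ i x) := by
  simp [gradedSmashτ]

lemma gradedTwistLeft (α : ModuleAlgebra k H (⨁ n, Λ n)) (β : ComoduleAlgebra k H (⨁ n, Γ n))
    (i j : ℕ) (y : Γ j) (v : Λ i ⊗[k] (⨁ n, Γ n)) :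
    twistLeft (gradedSmashτ α β) (DirectSum.lof k ℕ Γ j y)
        ((DirectSum.lof k ℕ Λ i).rTensor _ v) =
      (-1 : k) ^ (j * i) • twistLeft (smashτ α β) (DirectSum.lof k ℕ Γ j y)
        ((DirectSum.lof k ℕ Λ i).rTensor _ v) := by
  induction v using TensorProduct.induction_on with
  | zero => simp
  | add x y hx hy => simp only [map_add, smul_add, hx, hy]
  | tmul c d => simp [gradedSmashτ_lof]

lemma gradedTwistMul (α : ModuleAlgebra k H (⨁ n, Λ n)) (β : ComoduleAlgebra k H (⨁ n, Γ n))
    (i j : ℕ) (x : Λ i) (v : (⨁ n, Λ n) ⊗[k] Γ j) :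
    twistMul (gradedSmashτ α β) ((DirectSum.lof k ℕ Γ j).lTensor _ v)
        (DirectSum.lof k ℕ Λ i x ⊗ₜ 1) =
      (-1 : k) ^ (j * i) • twistMul (smashτ α β) ((DirectSum.lof k ℕ Γ j).lTensor _ v)
        (DirectSum.lof k ℕ Λ i x ⊗ₜ 1) := by
  induction v using TensorProduct.induction_on with
  | zero => simp
  | add x y hx hy => simp only [map_add, LinearMap.add_apply, smul_add, hx, hy]
  | tmul c d => simp [gradedSmashτ_lof, twistMul_tmul_tmul]

lemma smashτ_lof_left (α : GradedModuleAlgebra k H Λ)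
    (β : ComoduleAlgebra k H (⨁ n, Γ n)) (i : ℕ) (x : Λ i) (y : ⨁ n, Γ n) :
    ∃ v, smashτ α.toModuleAlgebra β y (DirectSum.lof k ℕ Λ i x) =
      (DirectSum.lof k ℕ Λ i).rTensor _ v := by
  rw [smashτ_apply]
  generalize β.coact y = u
  induction u using TensorProduct.induction_on with
  | zero => exact ⟨0, by simp⟩
  | add u w hu hw =>
    obtain ⟨v, hv⟩ := hu
    obtain ⟨v', hv'⟩ := hw
    exact ⟨v + v', by simp only [map_add, hv, hv']⟩
  | tmul h d =>
    obtain ⟨z, hz⟩ := α.act_lof h i x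
    exact ⟨z ⊗ₜ d, by simp [hz]⟩

lemma smashτ_lof_right (α : ModuleAlgebra k H (⨁ n, Λ n))
    (β : GradedComoduleAlgebra k H Γ) (j : ℕ) (y : Γ j) (x : ⨁ n, Λ n) :
    ∃ v, smashτ α β.toComoduleAlgebra (DirectSum.lof k ℕ Γ j y) x =
      (DirectSum.lof k ℕ Γ j).lTensor _ v := by
  obtain ⟨w, hw⟩ := β.coact_lof j y
  refine ⟨(α.act.toLinearMap.flip x).rTensor _ w, ?_⟩
  rw [smashτ_apply, ← hw, ← LinearMap.comp_apply, ← LinearMap.comp_apply,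
    LinearMap.rTensor_comp_lTensor, LinearMap.lTensor_comp_rTensor]

/-- The twisting map `γ ⊗ λ ↦ (-1) ^ (|γ| |λ|) ∑ (γ₋₁ ⇀ λ) ⊗ γ₀`. -/
def gradedSmashTwist (α : GradedModuleAlgebra k H Λ) (β : GradedComoduleAlgebra k H Γ) :
    TwistingMap k (⨁ n, Λ n) (⨁ n, Γ n) where
  τ := gradedSmashτ α.toModuleAlgebra β.toComoduleAlgebra
  one_left a := by
    induction a using DirectSum.induction_on with
    | zero => simp
    | add x y hx hy => simp only [map_add, TensorProduct.add_tmul, hx, hy]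
    | of i x =>
      change gradedSmashτ α.toModuleAlgebra β.toComoduleAlgebra
        (DirectSum.lof k ℕ Γ 0 GradedMonoid.GOne.one) (DirectSum.lof k ℕ Λ i x) = _
      rw [gradedSmashτ_lof, zero_mul, pow_zero, one_smul]
      exact (smashTwist α.toModuleAlgebra β.toComoduleAlgebra).one_left _
  one_right b := by
    induction b using DirectSum.induction_on with
    | zero => simp
    | add x y hx hy => simp only [map_add, LinearMap.add_apply, TensorProduct.tmul_add, hx, hy]
    | of j y =>
      change gradedSmashτ α.toModuleAlgebra β.toComoduleAlgebra
        (DirectSum.lof k ℕ Γ j y) (DirectSum.lof k ℕ Λ 0 GradedMonoid.GOne.one) = _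
      rw [gradedSmashτ_lof, mul_zero, pow_zero, one_smul]
      exact (smashTwist α.toModuleAlgebra β.toComoduleAlgebra).one_right _
  mul_left b b' a := by
    induction b using DirectSum.induction_on with
    | zero => simp
    | add x y hx hy => simp only [add_mul, map_add, LinearMap.add_apply, hx, hy]
    | of j y =>
    induction b' using DirectSum.induction_on with
    | zero => simp
    | add x y hx hy => simp only [mul_add, map_add, LinearMap.add_apply, hx, hy]
    | of j' y' =>
    induction a using DirectSum.induction_on with
    | zero => simp
    | add x y hx hy => simp only [map_add, hx, hy]
    | of i x =>
      rw [DirectSum.of_mul_of]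
      change gradedSmashτ α.toModuleAlgebra β.toComoduleAlgebra
        (DirectSum.lof k ℕ Γ (j + j') (GradedMonoid.GMul.mul y y')) (DirectSum.lof k ℕ Λ i x) =
        twistLeft (gradedSmashτ α.toModuleAlgebra β.toComoduleAlgebra) (DirectSum.lof k ℕ Γ j y)
          (gradedSmashτ α.toModuleAlgebra β.toComoduleAlgebra
            (DirectSum.lof k ℕ Γ j' y') (DirectSum.lof k ℕ Λ i x))
      obtain ⟨v, hv⟩ := smashτ_lof_left α β.toComoduleAlgebra i x (DirectSum.lof k ℕ Γ j' y')
      rw [gradedSmashτ_lof, gradedSmashτ_lof, map_smul, hv, gradedTwistLeft, ← hv, smul_smul]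
      have h := (smashTwist α.toModuleAlgebra β.toComoduleAlgebra).mul_left
        (DirectSum.lof k ℕ Γ j y) (DirectSum.lof k ℕ Γ j' y') (DirectSum.lof k ℕ Λ i x)
      have h' : DirectSum.lof k ℕ Γ j y * DirectSum.lof k ℕ Γ j' y' =
        DirectSum.lof k ℕ Γ (j + j') (GradedMonoid.GMul.mul y y') := DirectSum.of_mul_of _ _
      rw [h'] at h
      change _ = _ • twistLeft (smashTwist α.toModuleAlgebra β.toComoduleAlgebra).τ _
        ((smashTwist α.toModuleAlgebra β.toComoduleAlgebra).τ _ _)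
      rw [← h]
      change _ • smashτ _ _ _ _ = _ • smashτ _ _ _ _
      congr 1
      ring
  mul_right b a a' := by
    induction b using DirectSum.induction_on with
    | zero => simp
    | add x y hx hy => simp only [map_add, LinearMap.add_apply, hx, hy]
    | of j y =>
    induction a using DirectSum.induction_on with
    | zero => simp
    | add x y hx hy => simp only [add_mul, map_add, LinearMap.add_apply, hx, hy]
    | of i x =>
    induction a' using DirectSum.induction_on with
    | zero => simp
    | add x y hx hy => simp only [mul_add, map_add, TensorProduct.add_tmul, hx, hy]
    | of i' x' =>
      rw [DirectSum.of_mul_of]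
      change gradedSmashτ α.toModuleAlgebra β.toComoduleAlgebra
        (DirectSum.lof k ℕ Γ j y) (DirectSum.lof k ℕ Λ (i + i') (GradedMonoid.GMul.mul x x')) =
        twistMul (gradedSmashτ α.toModuleAlgebra β.toComoduleAlgebra)
          (gradedSmashτ α.toModuleAlgebra β.toComoduleAlgebra
            (DirectSum.lof k ℕ Γ j y) (DirectSum.lof k ℕ Λ i x)) (DirectSum.lof k ℕ Λ i' x' ⊗ₜ 1)
      obtain ⟨v, hv⟩ := smashτ_lof_right α.toModuleAlgebra β j y (DirectSum.lof k ℕ Λ i x)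
      rw [gradedSmashτ_lof, gradedSmashτ_lof, map_smul, LinearMap.smul_apply, hv, gradedTwistMul,
        ← hv, smul_smul]
      have h := smashτ_mul_right α.toModuleAlgebra β.toComoduleAlgebra
        (DirectSum.lof k ℕ Γ j y) (DirectSum.lof k ℕ Λ i x) (DirectSum.lof k ℕ Λ i' x')
      have h' : DirectSum.lof k ℕ Λ i x * DirectSum.lof k ℕ Λ i' x' =
        DirectSum.lof k ℕ Λ (i + i') (GradedMonoid.GMul.mul x x') := DirectSum.of_mul_of _ _
      rw [h'] at h
      rw [← h]
      congr 1
      ring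

/-- The graded Takeuchi smash product `Λ # Γ`: the space `Λ ⊗ Γ` with
`(λ # γ)(λ' # γ') = ∑ (-1) ^ (|γ| |λ'|) λ (γ₋₁ ⇀ λ') # γ₀ γ'`. -/
abbrev GradedSmashProduct (α : GradedModuleAlgebra k H Λ) (β : GradedComoduleAlgebra k H Γ) :
    Type _ :=
  TwistedTensor (gradedSmashTwist α β)

/-- The component of degree `n` of `Λ # Γ`, spanned by the `λ # γ` with `|λ| + |γ| = n`. -/
def GradedSmashProduct.degree (α : GradedModuleAlgebra k H Λ) (β : GradedComoduleAlgebra k H Γ)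
    (n : ℕ) : Submodule k (GradedSmashProduct α β) :=
  Submodule.span k {z | ∃ (p q : ℕ) (_ : p + q = n) (x : Λ p) (y : Γ q),
    z = TwistedTensor.tmul _ (DirectSum.lof k ℕ Λ p x) (DirectSum.lof k ℕ Γ q y)}

/-- The defining formula of the graded Takeuchi smash product, for `ρ(γ) = ∑ hᵢ ⊗ γᵢ`. -/
lemma GradedSmashProduct.tmul_mul_tmul (α : GradedModuleAlgebra k H Λ)
    (β : GradedComoduleAlgebra k H Γ) (x : ⨁ n, Λ n) (p : ℕ) (x' : Λ p) (q : ℕ) (y : Γ q)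
    (y' : ⨁ n, Γ n) {ι : Type*} (s : Finset ι) (h : ι → H) (c : ι → ⨁ n, Γ n)
    (hy : β.coact (DirectSum.lof k ℕ Γ q y) = ∑ i ∈ s, h i ⊗ₜ c i) :
    (TwistedTensor.tmul _ x (DirectSum.lof k ℕ Γ q y) *
        TwistedTensor.tmul _ (DirectSum.lof k ℕ Λ p x') y' : GradedSmashProduct α β) =
      (-1 : k) ^ (q * p) • ∑ i ∈ s, TwistedTensor.tmul _
        (x * α.act (h i) (DirectSum.lof k ℕ Λ p x')) (c i * y') := by
  change twistMul (gradedSmashτ α.toModuleAlgebra β.toComoduleAlgebra)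
      (x ⊗ₜ DirectSum.lof k ℕ Γ q y) (DirectSum.lof k ℕ Λ p x' ⊗ₜ y') =
    (-1 : k) ^ (q * p) • ∑ i ∈ s,
      (x * α.act (h i) (DirectSum.lof k ℕ Λ p x')) ⊗ₜ[k] (c i * y')
  rw [twistMul_tmul_tmul, gradedSmashτ_lof, smashτ_apply, hy]
  simp [Finset.mul_sum, Finset.sum_mul]

end Graded

/-! ## The Yoneda Ext-algebra -/

section Yoneda

universe w v v'

variable {C : Type v} [Category.{v'} C] [Abelian C] [HasExt.{w} C]

lemma ext_comp_mk_eq (X : C) {a b c c' : ℕ} (x : Ext X X a) (y : Ext X X b)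
    (h : a + b = c) (h' : a + b = c') :
    (⟨c, x.comp y h⟩ : GradedMonoid (Ext X X)) = ⟨c', x.comp y h'⟩ := by
  subst h; subst h'; rfl

instance (X : C) : GradedMonoid.GOne (Ext X X) := ⟨Ext.mk₀ (𝟙 X)⟩

/-- The Yoneda product on `⨁ n, Ext X X n`, in the order of composition of maps: `x * y` is
`y` followed by `x`. -/
instance (X : C) : GradedMonoid.GMul (Ext X X) := ⟨fun {a b} x y => y.comp x (add_comm b a)⟩

instance (X : C) : GradedMonoid.GMonoid (Ext X X) where
  one_mul := by
    rintro ⟨n, x⟩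
    exact (ext_comp_mk_eq X x (Ext.mk₀ (𝟙 X)) _ (add_zero n)).trans (by rw [Ext.comp_mk₀_id])
  mul_one := by
    rintro ⟨n, x⟩
    exact (ext_comp_mk_eq X (Ext.mk₀ (𝟙 X)) x _ (zero_add n)).trans (by rw [Ext.mk₀_id_comp])
  mul_assoc := by
    rintro ⟨a, x⟩ ⟨b, y⟩ ⟨c, z⟩
    refine (ext_comp_mk_eq X z (y.comp x (add_comm b a)) _
      (show c + (a + b) = a + (b + c) by omega)).trans ?_
    rw [← Ext.comp_assoc z y x (add_comm c b) (add_comm b a) (by omega)]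
    rfl

instance (X : C) : DirectSum.GRing (Ext X X) where
  __ := (inferInstance : GradedMonoid.GMonoid (Ext X X))
  mul_zero x := Ext.zero_comp _ _ x _ _
  zero_mul _ := Ext.comp_zero _ _ _ _ _
  mul_add _ _ _ := Ext.add_comp _ _ _ _
  add_mul _ _ _ := Ext.comp_add _ _ _ _
  natCast n := n • Ext.mk₀ (𝟙 X)
  natCast_zero := zero_smul _ _
  natCast_succ _ := succ_nsmul _ _
  intCast n := n • Ext.mk₀ (𝟙 X)
  intCast_ofNat _ := natCast_zsmul _ _
  intCast_negSucc_ofNat _ := negSucc_zsmul _ _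

instance (k : Type*) [CommRing k] [Linear k C] (X : C) : DirectSum.GAlgebra k (Ext X X) where
  toFun :=
    { toFun r := r • Ext.mk₀ (𝟙 X)
      map_zero' := zero_smul _ _
      map_add' r s := add_smul _ _ _ }
  map_one := one_smul _ _
  map_mul r s := by
    refine .trans ?_ (ext_comp_mk_eq X (s • Ext.mk₀ (𝟙 X)) (r • Ext.mk₀ (𝟙 X)) (add_zero 0) _)
    simp [mul_smul]
    rfl
  commutes r := by
    rintro ⟨n, x⟩
    refine (ext_comp_mk_eq X x (r • Ext.mk₀ (𝟙 X)) _ (add_zero n)).trans ?_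
    refine .trans ?_ (ext_comp_mk_eq X (r • Ext.mk₀ (𝟙 X)) x (zero_add n) _)
    simp
  smul_def r := by
    rintro ⟨n, x⟩
    refine .trans ?_ (ext_comp_mk_eq X x (r • Ext.mk₀ (𝟙 X)) (add_zero n) _)
    simp
    rfl

variable (R : Type u) [Ring R] (M : Type u) [AddCommGroup M] [Module R M]

/-- The family of groups `Ext^n_R(M, M)`. -/
abbrev SelfExt : ℕ → Type u := Ext (ModuleCat.of R M) (ModuleCat.of R M)

/-- The Yoneda Ext-algebra `⨁ n, Ext^n_R(M, M)`. -/
abbrev ExtAlgebra : Type u := ⨁ n, SelfExt R M n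

/-- A module is pseudo-coherent if it has a resolution by finitely generated projectives. -/
def IsPseudoCoherent : Prop :=
  ∃ P : ProjectiveResolution (ModuleCat.of R M), ∀ n, Module.Finite R (P.complex.X n)

end Yoneda

/-! ## The action of `H` on `Ext_A(M, M)` and the coaction of `H` on `Ext_B(X, X)` -/

section Induced

/-- The augmentation of a projective resolution of a module. -/
def resolutionAug {R : Type u} [Ring R] {M : Type u} [AddCommGroup M] [Module R M]
    (P : ProjectiveResolution (ModuleCat.of R M)) : P.complex.X 0 ⟶ ModuleCat.of R M :=
  P.π.f 0 ≫ (HomologicalComplex.singleObjXSelf (ComplexShape.down ℕ) 0 (ModuleCat.of R M)).hom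

variable {k H A B : Type u} [Field k] [Ring H] [HopfAlgebra k H] [Ring A] [Algebra k A]
  [Ring B] [Algebra k B]

/-- The left action `h ⇀ m = m (1 # S h)` of `H` on a right `A # H`-module. -/
def hopfAct (α : ModuleAlgebra k H A) {M : Type u} [AddCommGroup M]
    [Module (SmashHopf α)ᵐᵒᵖ M] (h : H) (m : M) : M :=
  op (SmashHopf.tmul α 1 (HopfAlgebra.antipode k h)) • m

/-- A resolution of `M` in the category of right `A # H`-modules all of whose terms are projective
as `A`-modules: a projective resolution of `M` over `A` with `A # H`-module structures on the
terms that extend the `A`-module structures and are respected by the differentials and by the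
augmentation. -/
structure EquivariantResolution (α : ModuleAlgebra k H A) (M : Type u) [AddCommGroup M]
    [Module Aᵐᵒᵖ M] [Module (SmashHopf α)ᵐᵒᵖ M] where
  res : ProjectiveResolution (ModuleCat.of Aᵐᵒᵖ M)
  [mod : ∀ n, Module (SmashHopf α)ᵐᵒᵖ (res.complex.X n)]
  smul_eq : ∀ (n : ℕ) (a : A) (x : res.complex.X n), op (SmashHopf.tmul α a 1) • x = op a • x
  d_smul : ∀ (n : ℕ) (s : (SmashHopf α)ᵐᵒᵖ) (x : res.complex.X (n + 1)),
    res.complex.d (n + 1) n (s • x) = s • res.complex.d (n + 1) n x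
  aug_smul : ∀ (s : (SmashHopf α)ᵐᵒᵖ) (x : res.complex.X 0),
    resolutionAug res (s • x) = s • (show M from resolutionAug res x)

attribute [instance] EquivariantResolution.mod

/-- A resolution of `X` in the category of `(H, B)`-Hopf modules all of whose terms are finitely
generated projective as `B`-modules: a resolution of `X` by such `B`-modules, with Hopf module
structures on the terms that are respected by the differentials and by the augmentation. -/
structure HopfResolution {β : ComoduleAlgebra k H B} {X : Type u} [AddCommGroup X] [Module k X]
    [Module Bᵐᵒᵖ X] [IsScalarTower k Bᵐᵒᵖ X] (χ : HopfModule β X) where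
  res : ProjectiveResolution (ModuleCat.of Bᵐᵒᵖ X)
  finite : ∀ n, Module.Finite Bᵐᵒᵖ (res.complex.X n)
  [mod : ∀ n, Module k (res.complex.X n)]
  [tower : ∀ n, IsScalarTower k Bᵐᵒᵖ (res.complex.X n)]
  hopf : ∀ n, HopfModule β (res.complex.X n)
  d_coact : ∀ (n : ℕ) (x : res.complex.X (n + 1)),
    (hopf n).coact (res.complex.d (n + 1) n x) =
      ((res.complex.d (n + 1) n).hom.restrictScalars k).lTensor H ((hopf (n + 1)).coact x)
  aug_coact : ∀ x : res.complex.X 0,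
    χ.coact (resolutionAug res x) =
      (LinearMap.restrictScalars k (M₂ := X) (resolutionAug res).hom).lTensor H
        ((hopf 0).coact x)

attribute [instance] HopfResolution.mod HopfResolution.tower

/-- The coaction on maps: for a map `g : Q → X` of Hopf modules over `B`, the map
`x ↦ ∑ g(x₀)₋₁ S⁻¹(x₋₁) ⊗ g(x₀)₀`. -/
def homCoact (hS : Function.Bijective (HopfAlgebra.antipode k (A := H)))
    {β : ComoduleAlgebra k H B} {Q X : Type u} [AddCommGroup Q] [Module k Q]
    [Module Bᵐᵒᵖ Q] [IsScalarTower k Bᵐᵒᵖ Q] [AddCommGroup X] [Module k X]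
    [Module Bᵐᵒᵖ X] [IsScalarTower k Bᵐᵒᵖ X] (θ : HopfModule β Q) (χ : HopfModule β X)
    (g : Q →ₗ[Bᵐᵒᵖ] X) : Q →ₗ[k] H ⊗[k] X :=
  TensorProduct.lift
    (LinearMap.lcomp k (H ⊗[k] X) (χ.coact ∘ₗ g.restrictScalars k) ∘ₗ
      LinearMap.rTensorHom X ∘ₗ (LinearMap.mul k H).flip ∘ₗ
      (LinearEquiv.ofBijective (HopfAlgebra.antipode k (A := H)) hS).symm.toLinearMap) ∘ₗ
  θ.coact

/-- The defining formula of `homCoact`, for `ρ(x) = ∑ hᵢ ⊗ xᵢ`. -/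
lemma homCoact_apply (hS : Function.Bijective (HopfAlgebra.antipode k (A := H)))
    {β : ComoduleAlgebra k H B} {Q X : Type u} [AddCommGroup Q] [Module k Q]
    [Module Bᵐᵒᵖ Q] [IsScalarTower k Bᵐᵒᵖ Q] [AddCommGroup X] [Module k X]
    [Module Bᵐᵒᵖ X] [IsScalarTower k Bᵐᵒᵖ X] (θ : HopfModule β Q) (χ : HopfModule β X)
    (g : Q →ₗ[Bᵐᵒᵖ] X) (x : Q) {ι : Type*} (s : Finset ι) (h : ι → H) (z : ι → Q)
    (hx : θ.coact x = ∑ i ∈ s, h i ⊗ₜ z i) :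
    homCoact hS θ χ g x = ∑ i ∈ s, (LinearMap.mulRight k
      ((LinearEquiv.ofBijective (HopfAlgebra.antipode k (A := H)) hS).symm (h i))).rTensor X
        (χ.coact (g (z i))) := by
  simp only [homCoact, LinearMap.comp_apply, hx, map_sum]
  rfl

/-- The action of `H` on the Ext-algebra of `M` over `A` is the one induced from the `H`-action
`(h ⇀ f)(x) = ∑ h₁ ⇀ f(S h₂ ⇀ x)` on the complex `Hom_A(P, M)`, for the resolution `P` of `M`:
if a cocycle `f : P n → M` represents a class, then `h ⇀ f` represents the image of this class
under `h`. -/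
def IsInducedAction {α : ModuleAlgebra k H A} {M : Type u} [AddCommGroup M]
    [Module Aᵐᵒᵖ M] [Module (SmashHopf α)ᵐᵒᵖ M] (P : EquivariantResolution α M)
    (E : GradedModuleAlgebra k H (SelfExt Aᵐᵒᵖ M)) : Prop :=
  ∀ (n : ℕ) (f : P.res.complex.X n ⟶ ModuleCat.of Aᵐᵒᵖ M)
    (hf : P.res.complex.d (n + 1) n ≫ f = 0) (h : H),
    ∃ (f' : P.res.complex.X n ⟶ ModuleCat.of Aᵐᵒᵖ M)
      (hf' : P.res.complex.d (n + 1) n ≫ f' = 0),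
      (∀ x : P.res.complex.X n, (show M from f' x) =
        ∑ i ∈ (Coalgebra.Repr.arbitrary k h).index,
          hopfAct α ((Coalgebra.Repr.arbitrary k h).left i) (show M from
            f (hopfAct α (HopfAlgebra.antipode k ((Coalgebra.Repr.arbitrary k h).right i)) x))) ∧
      E.act h (DirectSum.lof k ℕ (SelfExt Aᵐᵒᵖ M) n (P.res.extMk f (n + 1) rfl hf)) =
        DirectSum.lof k ℕ (SelfExt Aᵐᵒᵖ M) n (P.res.extMk f' (n + 1) rfl hf')

/-- The coaction of `H` on the Ext-algebra of `X` over `B` is the one induced from the coaction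
`homCoact` on the complex `Hom_B(Q, X)`, for the resolution `Q` of `X`: if `g : Q n → X` is a
cocycle, then its coaction is of the form `∑ hᵢ ⊗ gᵢ` with cocycles `gᵢ`, and the coaction of the
class of `g` is `∑ hᵢ ⊗ [gᵢ]`. -/
def IsInducedCoaction (hS : Function.Bijective (HopfAlgebra.antipode k (A := H)))
    {β : ComoduleAlgebra k H B} {X : Type u} [AddCommGroup X] [Module k X]
    [Module Bᵐᵒᵖ X] [IsScalarTower k Bᵐᵒᵖ X] {χ : HopfModule β X} (Q : HopfResolution χ)
    (F : GradedComoduleAlgebra k H (SelfExt Bᵐᵒᵖ X)) : Prop :=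
  ∀ (n : ℕ) (g : Q.res.complex.X n ⟶ ModuleCat.of Bᵐᵒᵖ X)
    (hg : Q.res.complex.d (n + 1) n ≫ g = 0),
    ∃ (r : ℕ) (h : Fin r → H) (g' : Fin r → (Q.res.complex.X n ⟶ ModuleCat.of Bᵐᵒᵖ X))
      (hg' : ∀ i, Q.res.complex.d (n + 1) n ≫ g' i = 0),
      (∀ x : Q.res.complex.X n, homCoact (X := X) hS (Q.hopf n) χ g.hom x =
        ∑ i, h i ⊗ₜ[k] (show X from g' i x)) ∧
      F.coact (DirectSum.lof k ℕ (SelfExt Bᵐᵒᵖ X) n (Q.res.extMk g (n + 1) rfl hg)) =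
        ∑ i, h i ⊗ₜ[k]
          DirectSum.lof k ℕ (SelfExt Bᵐᵒᵖ X) n (Q.res.extMk (g' i) (n + 1) rfl (hg' i))

end Induced

end

/-! ## Dimension shifting for Ext groups -/

section DimensionShifting

universe w w' v v' v'' u₁ u₂ u₃

open Limits

variable {C : Type u₁} [Category.{v} C] [Abelian C] [HasExt.{w} C]
  {C' : Type u₃} [Category.{v''} C'] [Abelian C'] [HasExt.{w} C'] [EnoughProjectives C']

/-! The isomorphism is assembled from two algebra maps into the Yoneda algebra of M # X, both
defined by exact functors and hence without choosing a resolution. The functor N ↦ N # X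
(`smashFunctor`) sends a class x over A to x # X. In the other variable, for an A # H-module N, the
map n ⊗ x ↦ ∑ n x₋₁ ⊗ x₀ identifies N # X with the space N ⊗ X on which A # B acts through the
algebra map a # b ↦ ∑ (a # b₋₁) ⊗ b₀ (`untwistIso`). The second description is an exact functor of
arbitrary B-modules, so every class γ over B, colinear or not, yields a class N # γ (`rightExt`).

The structures on Ext are described in the same style. The class h ⇀ x is x # H, restricted to A,
placed between a map N → N # H that depends on h and a map N' # H → N' (`hopfExt`). For the coaction
one applies H ⊗ - with the diagonal B-action, composes with the coaction of X and with the
isomorphism h ⊗ x ↦ ∑ x₋₁ S⁻¹(h) ⊗ x₀ that removes the diagonal action, and uses H ⊗ Ext(X, X') ≅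
Ext(X, H ⊗ X'), valid because X has type FP_∞ (`extCoact`). In degree zero these are the formulas of
the theorem, and they are compatible with connecting classes of sequences of A # H-modules,
respectively of Hopf modules. So the module laws, coassociativity and the commutation rule below are
proved by dimension shifting. This works because restriction from A # H to A preserves projectives
when S is bijective, and because a Hopf module of type FP_∞ is covered by a finitely generated
projective Hopf module with kernel of the same kind. The behaviour of an exact functor on cocycles
(`mk₀_comp_mapExactFunctor_extMk`) shows that the structures are the ones induced from any P and any
Q.

The commutation rule (`mapExactFunctor_comp_rightExt`) says that x # X followed by M # γ is, up to
the sign (-1)^(|x||γ|), the sum of the classes M # γ₀ followed by (γ₋₁ ⇀ x) # X. For γ of degree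
zero it comes from the identity ∑ (h₁ ⇀ f)(h₂ ⇀ n) = h ⇀ f(n). Each further degree of γ moves x past
one more connecting class, and the sign is the anticommutation of the two connecting classes in a
three by three diagram (`extClass_comp_extClass_eq_neg`). This rule is the defining relation of the
graded smash product, so the two algebra maps combine into one map on it.

Bijectivity is proved for a general A-module N of type FP_∞ in place of the first M
(`smashExtTotal_bijective`). Comparing long exact sequences (`bijective_of_coverings`) reduces first
to N finitely generated projective, then to N = A, then to X finitely generated projective over B.
There A # X is projective, and what remains is Hom(A # X, M # X') = Hom_B(X, M ⊗ X') = M ⊗ Hom_B(X,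
X'). The comparison map multiplies the two factors in the order opposite to that of the smash
product. The difference is the signed twist λ ⊗ γ ↦ ∑ (γ₋₁ ⇀ λ) ⊗ γ₀, which is invertible by means
of the inverse antipode. -/

/-- Induction on classes in `Ext (R X) Y`: morphisms and products with connecting classes. -/
lemma ext_induction_restrict (R : C' ⥤ C) [R.Additive] [PreservesFiniteLimits R]
    [PreservesFiniteColimits R] [R.PreservesProjectiveObjects] {Y : C}
    {p : ∀ (X : C') (n : ℕ), Ext (R.obj X) Y n → Prop}
    (h₀ : ∀ (X : C') (f : R.obj X ⟶ Y), p X 0 (Ext.mk₀ f))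
    (h₁ : ∀ (S : ShortComplex C') (hS : S.ShortExact) (n : ℕ) (x : Ext (R.obj S.X₁) Y n),
      p S.X₁ n x → p S.X₃ (n + 1) ((hS.extClass.mapExactFunctor R).comp x (add_comm 1 n)))
    (X : C') (n : ℕ) (x : Ext (R.obj X) Y n) : p X n x := by
  induction n generalizing X with
  | zero =>
    obtain ⟨f, rfl⟩ := (Ext.mk₀_bijective _ _).2 x
    exact h₀ X f
  | succ n ih =>
    let P : ProjectivePresentation X := Classical.arbitrary _
    let S := ShortComplex.mk _ _ (kernel.condition P.f)
    -- The middle term stays projective after applying R, so a class of positive degree vanishes on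
    -- it and factors through the connecting class.
    have hP : Projective (R.obj P.p) :=
      Functor.PreservesProjectiveObjects.projective_obj P.projective
    have hS : S.ShortExact := { exact := ShortComplex.exact_kernel P.f }
    have : Projective (S.map R).X₂ := hP
    obtain ⟨y, rfl⟩ := Ext.contravariant_sequence_exact₃ (hS.map_of_exact R) Y x
      (Ext.eq_zero_of_projective _) (add_comm 1 n)
    have := h₁ S hS n y (ih _ y)
    rwa [Ext.mapExactFunctor_extClass] at this

variable [EnoughProjectives C]

/-- Induction on classes in `Ext X Y`: morphisms and products with connecting classes. -/
lemma ext_induction {Y : C} {p : ∀ (X : C) (n : ℕ), Ext X Y n → Prop}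
    (h₀ : ∀ (X : C) (f : X ⟶ Y), p X 0 (Ext.mk₀ f))
    (h₁ : ∀ (S : ShortComplex C) (hS : S.ShortExact) (n : ℕ) (x : Ext S.X₁ Y n),
      p S.X₁ n x → p S.X₃ (n + 1) (hS.extClass.comp x (add_comm 1 n)))
    (X : C) (n : ℕ) (x : Ext X Y n) : p X n x := by
  induction n generalizing X with
  | zero =>
    obtain ⟨f, rfl⟩ := (Ext.mk₀_bijective _ _).2 x
    exact h₀ X f
  | succ n ih =>
    let P : ProjectivePresentation X := Classical.arbitrary _
    let S := ShortComplex.mk _ _ (kernel.condition P.f)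
    have hP : Projective S.X₂ := P.projective
    have hS : S.ShortExact := { exact := ShortComplex.exact_kernel P.f }
    obtain ⟨y, rfl⟩ := Ext.contravariant_sequence_exact₃ hS Y x
      (Ext.eq_zero_of_projective _) (add_comm 1 n)
    exact h₁ S hS n y (ih _ y)

variable {D : Type u₂} [Category.{v'} D] [Abelian D] [HasExt.{w'} D]

/-- Naturality of the images of connecting classes under exact functors. -/
lemma mapExactFunctor_extClass_naturality {C₁ C₂ : Type*} [Category* C₁] [Abelian C₁]
    [HasExt.{w} C₁] [Category* C₂] [Abelian C₂] [HasExt.{w} C₂]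
    (F : C₁ ⥤ D) (G : C₂ ⥤ D) [F.Additive] [PreservesFiniteLimits F]
    [PreservesFiniteColimits F] [G.Additive] [PreservesFiniteLimits G]
    [PreservesFiniteColimits G] {S : ShortComplex C₁} {T : ShortComplex C₂} (hS : S.ShortExact)
    (hT : T.ShortExact) (a₁ : F.obj S.X₁ ⟶ G.obj T.X₁) (a₂ : F.obj S.X₂ ⟶ G.obj T.X₂)
    (a₃ : F.obj S.X₃ ⟶ G.obj T.X₃) (h₁₂ : a₁ ≫ G.map T.f = F.map S.f ≫ a₂)
    (h₂₃ : a₂ ≫ G.map T.g = F.map S.g ≫ a₃) :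
    (hS.extClass.mapExactFunctor F).comp (Ext.mk₀ a₁) (add_zero 1) =
      (Ext.mk₀ a₃).comp (hT.extClass.mapExactFunctor G) (zero_add 1) := by
  rw [Ext.mapExactFunctor_extClass, Ext.mapExactFunctor_extClass]
  exact ShortComplex.ShortExact.extClass_naturality (hS.map_of_exact F) (hT.map_of_exact G)
    { τ₁ := a₁, τ₂ := a₂, τ₃ := a₃, comm₁₂ := h₁₂, comm₂₃ := h₂₃ }

/-- A natural transformation of exact functors induces compatible maps on Ext. -/
lemma mapExactFunctor_comp_natTrans (F G : C ⥤ D) [F.Additive] [PreservesFiniteLimits F]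
    [PreservesFiniteColimits F] [G.Additive] [PreservesFiniteLimits G]
    [PreservesFiniteColimits G] (τ : F ⟶ G) {X Y : C} {n : ℕ} (x : Ext X Y n) :
    (x.mapExactFunctor F).comp (Ext.mk₀ (τ.app Y)) (add_zero n) =
      (Ext.mk₀ (τ.app X)).comp (x.mapExactFunctor G) (zero_add n) := by
  refine ext_induction (Y := Y) (p := fun X n x =>
    (x.mapExactFunctor F).comp (Ext.mk₀ (τ.app Y)) (add_zero n) =
      (Ext.mk₀ (τ.app X)).comp (x.mapExactFunctor G) (zero_add n)) ?_ ?_ X n x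
  · intro X f
    simp [Ext.mapExactFunctor_mk₀]
  · intro S hS n x hx
    rw [Ext.mapExactFunctor_comp, Ext.mapExactFunctor_comp,
      Ext.comp_assoc _ _ _ (add_comm 1 n) (add_zero n) (by omega), hx,
      ← Ext.comp_assoc _ _ _ (add_zero 1) (zero_add n) (by omega),
      ← Ext.comp_assoc _ _ _ (zero_add 1) (add_comm 1 n) (by omega),
      mapExactFunctor_extClass_naturality F G hS hS _ (τ.app S.X₂) (τ.app S.X₃) (by simp)
        (by simp)]

end DimensionShifting

/-! ## The anticommutation of connecting classes -/

section NineLemma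

variable {R : Type u} [Ring R]

/-- In a commutative diagram with exact rows and columns, the two composites of connecting
classes are opposite to each other. -/
lemma extClass_comp_extClass_eq_neg {S₁ S₂ S₃ : ShortComplex (ModuleCat.{u} R)}
    (φ : S₁ ⟶ S₂) (ψ : S₂ ⟶ S₃) (w₁ : φ.τ₁ ≫ ψ.τ₁ = 0) (w₂ : φ.τ₂ ≫ ψ.τ₂ = 0)
    (w₃ : φ.τ₃ ≫ ψ.τ₃ = 0)
    (h₁ : S₁.ShortExact) (h₂ : S₂.ShortExact) (h₃ : S₃.ShortExact)
    (k₁ : (ShortComplex.mk _ _ w₁).ShortExact) (k₂ : (ShortComplex.mk _ _ w₂).ShortExact)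
    (k₃ : (ShortComplex.mk _ _ w₃).ShortExact) :
    k₃.extClass.comp h₁.extClass (rfl : 1 + 1 = 2) =
      -(h₃.extClass.comp k₁.extClass (rfl : 1 + 1 = 2)) := by
  -- Let K be the kernel of the diagonal of the lower right square. The extension of `S₃.X₃` by K
  -- pushes forward to the last row along a : K → `S₃.X₁` and to the last column along b : K →
  -- `S₁.X₃`.
  let p : S₂.X₂ ⟶ S₃.X₃ := ψ.τ₂ ≫ S₃.g
  have hp : p = S₂.g ≫ ψ.τ₃ := ψ.comm₂₃
  have f₁i := h₁.moduleCat_injective_f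
  have f₂i := h₂.moduleCat_injective_f
  have f₃i := h₃.moduleCat_injective_f
  have g₁s := h₁.moduleCat_surjective_g
  have g₂s := h₂.moduleCat_surjective_g
  have g₃s := h₃.moduleCat_surjective_g
  have a₁i : Function.Injective φ.τ₁ := k₁.moduleCat_injective_f
  have a₂i : Function.Injective φ.τ₂ := k₂.moduleCat_injective_f
  have a₃i : Function.Injective φ.τ₃ := k₃.moduleCat_injective_f
  have b₁s : Function.Surjective ψ.τ₁ := k₁.moduleCat_surjective_g
  have b₂s : Function.Surjective ψ.τ₂ := k₂.moduleCat_surjective_g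
  have b₃s : Function.Surjective ψ.τ₃ := k₃.moduleCat_surjective_g
  have x₁ := (ShortComplex.moduleCat_exact_iff _).1 h₁.exact
  have x₂ := (ShortComplex.moduleCat_exact_iff _).1 h₂.exact
  have x₃ := (ShortComplex.moduleCat_exact_iff _).1 h₃.exact
  have y₁ : ∀ x : S₂.X₁, ψ.τ₁ x = 0 → ∃ z : S₁.X₁, φ.τ₁ z = x :=
    (ShortComplex.moduleCat_exact_iff _).1 k₁.exact
  have y₂ : ∀ x : S₂.X₂, ψ.τ₂ x = 0 → ∃ z : S₁.X₂, φ.τ₂ z = x :=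
    (ShortComplex.moduleCat_exact_iff _).1 k₂.exact
  have y₃ : ∀ x : S₂.X₃, ψ.τ₃ x = 0 → ∃ z : S₁.X₃, φ.τ₃ z = x :=
    (ShortComplex.moduleCat_exact_iff _).1 k₃.exact
  have cφ₁ : ∀ x, S₂.f (φ.τ₁ x) = φ.τ₂ (S₁.f x) := fun x => ConcreteCategory.congr_hom φ.comm₁₂ x
  have cφ₂ : ∀ x, S₂.g (φ.τ₂ x) = φ.τ₃ (S₁.g x) := fun x => ConcreteCategory.congr_hom φ.comm₂₃ x
  have cψ₁ : ∀ x, S₃.f (ψ.τ₁ x) = ψ.τ₂ (S₂.f x) := fun x => ConcreteCategory.congr_hom ψ.comm₁₂ x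
  have cψ₂ : ∀ x, S₃.g (ψ.τ₂ x) = ψ.τ₃ (S₂.g x) := fun x => ConcreteCategory.congr_hom ψ.comm₂₃ x
  have z₁ : ∀ x, ψ.τ₁ (φ.τ₁ x) = 0 := fun x => ConcreteCategory.congr_hom w₁ x
  have z₂ : ∀ x, ψ.τ₂ (φ.τ₂ x) = 0 := fun x => ConcreteCategory.congr_hom w₂ x
  have z₃ : ∀ x, ψ.τ₃ (φ.τ₃ x) = 0 := fun x => ConcreteCategory.congr_hom w₃ x
  have t₁ : ∀ x, S₁.g (S₁.f x) = 0 := fun x => ConcreteCategory.congr_hom S₁.zero x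
  have t₂ : ∀ x, S₂.g (S₂.f x) = 0 := fun x => ConcreteCategory.congr_hom S₂.zero x
  have t₃ : ∀ x, S₃.g (S₃.f x) = 0 := fun x => ConcreteCategory.congr_hom S₃.zero x
  let K := ModuleCat.of R (LinearMap.ker p.hom)
  let ι : K ⟶ S₂.X₂ := ModuleCat.ofHom (LinearMap.ker p.hom).subtype
  have hι : ∀ x : K, p (ι x) = 0 := fun x => x.2
  have ιi : Function.Injective ι := Subtype.val_injective
  have wκ : ι ≫ p = 0 := by ext x; exact x.2
  have hκ : (ShortComplex.mk ι p wκ).ShortExact := by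
    refine ModuleCat.shortComplex_shortExact _ ?_ ιi ?_
    · intro x
      constructor
      · intro hx
        exact ⟨⟨x, hx⟩, rfl⟩
      · rintro ⟨y, rfl⟩
        exact hι y
    · exact g₃s.comp b₂s
  have mf₃ : Mono S₃.f := h₃.mono_f
  have ma₃ : Mono φ.τ₃ := k₃.mono_f
  let a : K ⟶ S₃.X₁ := h₃.exact.lift (ι ≫ ψ.τ₂) (by rw [Category.assoc]; exact wκ)
  have ha : a ≫ S₃.f = ι ≫ ψ.τ₂ := h₃.exact.lift_f _ _
  let b : K ⟶ S₁.X₃ := k₃.exact.lift (ι ≫ S₂.g) (by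
    change (ι ≫ S₂.g) ≫ ψ.τ₃ = 0; rw [Category.assoc, ← hp]; exact wκ)
  have hb : b ≫ φ.τ₃ = ι ≫ S₂.g := k₃.exact.lift_f _ _
  have ha' : ∀ x, S₃.f (a x) = ψ.τ₂ (ι x) := fun x => ConcreteCategory.congr_hom ha x
  have hb' : ∀ x, φ.τ₃ (b x) = S₂.g (ι x) := fun x => ConcreteCategory.congr_hom hb x
  have E₁ : hκ.extClass.comp (Ext.mk₀ a) (add_zero 1) = h₃.extClass := by
    have := ShortComplex.ShortExact.extClass_naturality hκ h₃
      { τ₁ := a, τ₂ := ψ.τ₂, τ₃ := 𝟙 _, comm₁₂ := ha, comm₂₃ := (Category.comp_id _).symm }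
    simpa using this
  have E₂ : hκ.extClass.comp (Ext.mk₀ b) (add_zero 1) = k₃.extClass := by
    have := ShortComplex.ShortExact.extClass_naturality hκ k₃
      { τ₁ := b, τ₂ := S₂.g, τ₃ := 𝟙 _, comm₁₂ := hb, comm₂₃ := by simp [hp] }
    simpa using this
  -- The map (a, b) is onto with kernel `S₁.X₁`. This second extension pulls back to the first
  -- column and the first row along the two inclusions into the product.
  let q : K ⟶ ModuleCat.of R (S₃.X₁ × S₁.X₃) := ModuleCat.ofHom (a.hom.prod b.hom)
  let j : S₁.X₁ ⟶ K := ModuleCat.ofHom ((S₂.f.hom ∘ₗ φ.τ₁.hom).codRestrict _ (fun x => by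
    change S₃.g (ψ.τ₂ (S₂.f (φ.τ₁ x))) = 0
    rw [cφ₁, z₂, map_zero]))
  have hj : ∀ x, ι (j x) = S₂.f (φ.τ₁ x) := fun x => rfl
  have ja : ∀ x, a (j x) = 0 := fun x => f₃i (by rw [ha', hj, ← cψ₁, z₁, map_zero])
  have jb : ∀ x, b (j x) = 0 := fun x => a₃i (by rw [hb', hj, t₂, map_zero])
  have wq : j ≫ q = 0 := by
    ext x
    · exact ja x
    · exact jb x
  have qa : ∀ x, (q x : S₃.X₁ × S₁.X₃) = (a x, b x) := fun x => rfl
  let i₁ : S₂.X₁ ⟶ K := ModuleCat.ofHom (S₂.f.hom.codRestrict _ (fun x => by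
    change S₃.g (ψ.τ₂ (S₂.f x)) = 0
    rw [← cψ₁, t₃]))
  have hi₁ : ∀ x, ι (i₁ x) = S₂.f x := fun x => rfl
  let i₂ : S₁.X₂ ⟶ K := ModuleCat.ofHom (φ.τ₂.hom.codRestrict _ (fun x => by
    change S₃.g (ψ.τ₂ (φ.τ₂ x)) = 0
    rw [z₂, map_zero]))
  have hi₂ : ∀ x, ι (i₂ x) = φ.τ₂ x := fun x => rfl
  have i₁a : ∀ x, a (i₁ x) = ψ.τ₁ x := fun x => f₃i (by rw [ha', hi₁, cψ₁])
  have i₁b : ∀ x, b (i₁ x) = 0 := fun x => a₃i (by rw [hb', hi₁, t₂, map_zero])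
  have i₂a : ∀ x, a (i₂ x) = 0 := fun x => f₃i (by rw [ha', hi₂, z₂, map_zero])
  have i₂b : ∀ x, b (i₂ x) = S₁.g x := fun x => a₃i (by rw [hb', hi₂, cφ₂])
  have hq : (ShortComplex.mk j q wq).ShortExact := by
    refine ModuleCat.shortComplex_shortExact _ ?_ ?_ ?_
    · intro x
      constructor
      · intro hx
        have hx₁ : a x = 0 := congrArg Prod.fst hx
        have hx₂ : b x = 0 := congrArg Prod.snd hx
        obtain ⟨y, hy⟩ := x₂ (ι x) (by rw [← hb', hx₂, map_zero])
        obtain ⟨z, hz⟩ := y₁ y (f₃i (by rw [cψ₁, hy, ← ha', hx₁, map_zero]))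
        exact ⟨z, ιi (by change ι (j z) = _; rw [hj, hz, hy])⟩
      · rintro ⟨y, rfl⟩
        exact ConcreteCategory.congr_hom wq y
    · intro x y hxy
      exact a₁i (f₂i (by rw [← hj, ← hj]; exact congrArg ι hxy))
    · rintro ⟨x, y⟩
      obtain ⟨x', rfl⟩ := b₁s x
      obtain ⟨y', rfl⟩ := g₁s y
      refine ⟨i₁ x' + i₂ y', ?_⟩
      change (a (i₁ x' + i₂ y'), b (i₁ x' + i₂ y')) = _
      rw [map_add, map_add, i₁a, i₁b, i₂a, i₂b, add_zero, zero_add]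
  let n₁ : S₃.X₁ ⟶ ModuleCat.of R (S₃.X₁ × S₁.X₃) := ModuleCat.ofHom (LinearMap.inl R _ _)
  let n₂ : S₁.X₃ ⟶ ModuleCat.of R (S₃.X₁ × S₁.X₃) := ModuleCat.ofHom (LinearMap.inr R _ _)
  have E₃ : k₁.extClass = (Ext.mk₀ n₁).comp hq.extClass (zero_add 1) := by
    have := ShortComplex.ShortExact.extClass_naturality k₁ hq
      { τ₁ := 𝟙 _, τ₂ := i₁, τ₃ := n₁
        comm₁₂ := by ext x; rfl
        comm₂₃ := by
          ext x
          · exact i₁a x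
          · exact i₁b x }
    simpa using this
  have E₄ : h₁.extClass = (Ext.mk₀ n₂).comp hq.extClass (zero_add 1) := by
    have := ShortComplex.ShortExact.extClass_naturality h₁ hq
      { τ₁ := 𝟙 _, τ₂ := i₂, τ₃ := n₂
        comm₁₂ := ModuleCat.hom_ext (LinearMap.ext fun x => ιi (cφ₁ x))
        comm₂₃ := by
          ext x
          · exact i₂a x
          · exact i₂b x }
    simpa using this
  have hsum : a ≫ n₁ + b ≫ n₂ = q := by
    ext x
    · change a x + 0 = a x
      rw [add_zero]
    · change 0 + b x = b x
      rw [zero_add]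
  -- An extension becomes zero when pulled back along its own surjection. Splitting that surjection
  -- into its two components gives the two composites with sum zero.
  have E₅ : (Ext.mk₀ (a ≫ n₁ + b ≫ n₂)).comp hq.extClass (zero_add 1) = 0 := by
    rw [hsum]
    exact hq.comp_extClass
  rw [Ext.mk₀_add, Ext.add_comp, ← Ext.mk₀_comp_mk₀, ← Ext.mk₀_comp_mk₀,
    Ext.comp_assoc _ _ _ (zero_add 0) (zero_add 1) (by omega),
    Ext.comp_assoc _ _ _ (zero_add 0) (zero_add 1) (by omega), ← E₃, ← E₄, add_comm] at E₅
  rw [eq_neg_iff_add_eq_zero, ← E₁, ← E₂,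
    Ext.comp_assoc _ _ _ (add_zero 1) (zero_add 1) (by omega),
    Ext.comp_assoc _ _ _ (add_zero 1) (zero_add 1) (by omega), ← Ext.comp_add, E₅,
    Ext.comp_zero]

end NineLemma

/-! ## Short exact sequences of exact functors -/

section FunctorSequence

universe v u₁

open Limits

variable {R : Type u} [Ring R] {C : Type u₁} [Category.{v} C] [Abelian C] [HasExt.{u} C]
  (F₁ F₂ F₃ : C ⥤ ModuleCat.{u} R) [F₁.Additive] [PreservesFiniteLimits F₁]
  [PreservesFiniteColimits F₁] [F₂.Additive] [PreservesFiniteLimits F₂]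
  [PreservesFiniteColimits F₂] [F₃.Additive] [PreservesFiniteLimits F₃]
  [PreservesFiniteColimits F₃] (a : F₁ ⟶ F₂) (b : F₂ ⟶ F₃) (w : ∀ X, a.app X ≫ b.app X = 0)
  (h : ∀ X, (ShortComplex.mk (a.app X) (b.app X) (w X)).ShortExact)

/-- The values of the three functors on S form a diagram with exact rows and columns. This is the
case of degree one, from which the sign in every degree follows. -/
lemma mapExactFunctor_extClass_comp_extClass {S : ShortComplex C} (hS : S.ShortExact) :
    (hS.extClass.mapExactFunctor F₃).comp (h S.X₁).extClass (rfl : 1 + 1 = 2) =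
      -((h S.X₃).extClass.comp (hS.extClass.mapExactFunctor F₁) (rfl : 1 + 1 = 2)) := by
  rw [Ext.mapExactFunctor_extClass, Ext.mapExactFunctor_extClass]
  exact extClass_comp_extClass_eq_neg
    (S₁ := ShortComplex.mk (a.app S.X₁) (b.app S.X₁) (w _))
    (S₂ := ShortComplex.mk (a.app S.X₂) (b.app S.X₂) (w _))
    (S₃ := ShortComplex.mk (a.app S.X₃) (b.app S.X₃) (w _))
    { τ₁ := F₁.map S.f, τ₂ := F₂.map S.f, τ₃ := F₃.map S.f }
    { τ₁ := F₁.map S.g, τ₂ := F₂.map S.g, τ₃ := F₃.map S.g }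
    (S.map F₁).zero (S.map F₂).zero (S.map F₃).zero
    (h S.X₁) (h S.X₂) (h S.X₃)
    (hS.map_of_exact F₁) (hS.map_of_exact F₂) (hS.map_of_exact F₃)

/-- For a short exact sequence of exact functors `0 ⟶ F₁ ⟶ F₂ ⟶ F₃ ⟶ 0`, the connecting classes
commute up to sign with the maps induced on Ext. -/
lemma mapExactFunctor_comp_extClass [EnoughProjectives C] {X Y : C} {n : ℕ} (x : Ext X Y n) :
    (x.mapExactFunctor F₃).comp (h Y).extClass rfl =
      (-1 : ℤ) ^ n • (h X).extClass.comp (x.mapExactFunctor F₁) (add_comm 1 n) := by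
  refine ext_induction (Y := Y) (p := fun X n x =>
    (x.mapExactFunctor F₃).comp (h Y).extClass rfl =
      (-1 : ℤ) ^ n • (h X).extClass.comp (x.mapExactFunctor F₁) (add_comm 1 n)) ?_ ?_ X n x
  · intro X f
    rw [pow_zero, one_smul, Ext.mapExactFunctor_mk₀, Ext.mapExactFunctor_mk₀]
    exact (ShortComplex.ShortExact.extClass_naturality (h X) (h Y)
      { τ₁ := F₁.map f, τ₂ := F₂.map f, τ₃ := F₃.map f }).symm
  · intro S hS n x hx
    rw [Ext.mapExactFunctor_comp, Ext.mapExactFunctor_comp,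
      Ext.comp_assoc _ _ _ (add_comm 1 n) rfl (by omega), hx]
    refine (map_zsmul (Ext.bilinearComp _ _ _ _ _ _ (show 1 + (n + 1) = n + 1 + 1 by omega)
      (hS.extClass.mapExactFunctor F₃)) _ _).trans ?_
    change (-1 : ℤ) ^ n • (hS.extClass.mapExactFunctor F₃).comp
      ((h S.X₁).extClass.comp (x.mapExactFunctor F₁) (add_comm 1 n)) (add_comm 1 (n + 1)) = _
    rw [← Ext.comp_assoc _ _ _ rfl (add_comm 1 n) (by omega),
      mapExactFunctor_extClass_comp_extClass F₁ F₂ F₃ a b w h hS, Ext.neg_comp,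
      Ext.comp_assoc _ _ _ rfl (add_comm 1 n) (by omega), pow_succ, mul_neg_one, smul_neg, neg_smul]

end FunctorSequence

/-! ## Comparison of cohomological functors -/

section Comparison

/-- Two sequences of contravariant functors with long exact sequences, and a comparison map
between them which is bijective on the members `P` of suitable coverings `0 → W → P → N → 0`. -/
lemma bijective_of_coverings {O : Type*} {T T' : ℕ → O → Type*}
    [∀ n N, AddCommGroup (T n N)] [∀ n N, AddCommGroup (T' n N)]
    (μ : ∀ n N, T n N →+ T' n N)
    (h : ∀ N, ∃ (P W : O) (a : ∀ n, T n N →+ T n P) (b : ∀ n, T n P →+ T n W)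
      (δ : ∀ n, T n W →+ T (n + 1) N) (a' : ∀ n, T' n N →+ T' n P)
      (b' : ∀ n, T' n P →+ T' n W) (δ' : ∀ n, T' n W →+ T' (n + 1) N),
      Function.Injective (a 0) ∧ Function.Injective (a' 0) ∧
      (∀ n, Function.Exact (a n) (b n)) ∧ (∀ n, Function.Exact (a' n) (b' n)) ∧
      (∀ n, Function.Exact (b n) (δ n)) ∧ (∀ n, Function.Exact (b' n) (δ' n)) ∧
      (∀ n, Function.Exact (δ n) (a (n + 1))) ∧ (∀ n, Function.Exact (δ' n) (a' (n + 1))) ∧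
      (∀ n x, μ n P (a n x) = a' n (μ n N x)) ∧ (∀ n x, μ n W (b n x) = b' n (μ n P x)) ∧
      (∀ n x, μ (n + 1) N (δ n x) = δ' n (μ n W x)) ∧ ∀ n, Function.Bijective (μ n P))
    (n : ℕ) (N : O) : Function.Bijective (μ n N) := by
  -- Both claims are made for all objects at once, because the induction passes from N to the kernel
  -- W of its covering.
  have key : ∀ n, ((∀ N, Function.Injective (μ n N)) ∧ ∀ N, Function.Surjective (μ n N)) := by
    intro n
    induction n with
    | zero =>
      have inj : ∀ N, Function.Injective (μ 0 N) := by
        intro N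
        obtain ⟨P, W, a, b, δ, a', b', δ', ha, ha', -, -, -, -, -, -, ca, -, -, hP⟩ := h N
        intro x y hxy
        exact ha ((hP 0).1 (by rw [ca, ca, hxy]))
      refine ⟨inj, fun N z => ?_⟩
      obtain ⟨P, W, a, b, δ, a', b', δ', ha, ha', eab, eab', -, -, -, -, ca, cb, -, hP⟩ := h N
      obtain ⟨s, hs⟩ := (hP 0).2 (a' 0 z)
      have : b 0 s = 0 := inj W (by rw [cb, hs, (eab' 0).apply_apply_eq_zero, map_zero])
      obtain ⟨t, rfl⟩ := (eab 0 s).1 this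
      exact ⟨t, ha' (by rw [← ca, hs])⟩
    | succ n ih =>
      obtain ⟨ihi, ihs⟩ := ih
      have inj : ∀ N, Function.Injective (μ (n + 1) N) := by
        intro N
        obtain ⟨P, W, a, b, δ, a', b', δ', -, -, -, -, ebd, ebd', eda, -, ca, cb, cd, hP⟩ := h N
        rw [injective_iff_map_eq_zero]
        intro x hx
        have hax : a (n + 1) x = 0 := (hP _).1 (by rw [ca, hx, map_zero, map_zero])
        obtain ⟨y, rfl⟩ := (eda n x).1 hax
        rw [cd] at hx
        obtain ⟨z, hz⟩ := (ebd' n _).1 hx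
        obtain ⟨s, rfl⟩ := (hP n).2 z
        rw [← cb] at hz
        rw [← ihi W hz]
        exact (ebd n).apply_apply_eq_zero s
      refine ⟨inj, fun N z => ?_⟩
      obtain ⟨P, W, a, b, δ, a', b', δ', -, -, eab, eab', -, -, -, eda', ca, cb, cd, hP⟩ := h N
      obtain ⟨s, hs⟩ := (hP (n + 1)).2 (a' (n + 1) z)
      -- Injectivity in the current degree has just been established for every object, in particular
      -- for W.
      have : b (n + 1) s = 0 :=
        inj W (by rw [cb, hs, (eab' _).apply_apply_eq_zero, map_zero])
      obtain ⟨t, rfl⟩ := (eab _ s).1 this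
      have hz : a' (n + 1) (z - μ (n + 1) N t) = 0 := by rw [map_sub, ← ca, hs, sub_self]
      obtain ⟨y, hy⟩ := (eda' n _).1 hz
      obtain ⟨y, rfl⟩ := ihs W y
      exact ⟨δ n y + t, by rw [map_add, cd, hy, sub_add_cancel]⟩
  exact ⟨(key n).1 N, (key n).2 N⟩

end Comparison

/-! ## Exact functors and cocycles on projective resolutions -/

section ExtMk

universe w w' v v' u₁ u₂

open Localization CochainComplex HomComplex Limits

namespace CategoryTheory.ProjectiveResolution

variable {C : Type u₁} [Category.{v} C] [Abelian C] {D : Type u₂} [Category.{v'} D] [Abelian D]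

/-- Smallness of morphisms in the derived category is invariant under quasi-isomorphism. It passes
in this way from single complexes to resolutions and to their images under exact functors. -/
lemma hasSmallLocalizedShiftedHom_source {K L L' : CochainComplex C ℤ} (f : K ⟶ L) [QuasiIso f]
    [HasSmallLocalizedShiftedHom.{w} (HomologicalComplex.quasiIso C (.up ℤ)) ℤ L L'] :
    HasSmallLocalizedShiftedHom.{w} (HomologicalComplex.quasiIso C (.up ℤ)) ℤ K L' :=
  (hasSmallLocalizedShiftedHom_iff_source _ _ f
    (by rw [HomologicalComplex.mem_quasiIso_iff]; infer_instance) _).2 inferInstance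

lemma hasSmallLocalizedShiftedHom_target {K L L' : CochainComplex C ℤ} (f : K ⟶ L) [QuasiIso f]
    [HasSmallLocalizedShiftedHom.{w} (HomologicalComplex.quasiIso C (.up ℤ)) ℤ L' L] :
    HasSmallLocalizedShiftedHom.{w} (HomologicalComplex.quasiIso C (.up ℤ)) ℤ L' K :=
  (hasSmallLocalizedShiftedHom_iff_target _ _ _ f
    (by rw [HomologicalComplex.mem_quasiIso_iff]; infer_instance)).2 inferInstance

variable {X Y : C} (R : ProjectiveResolution X) {n : ℕ}

/-- The morphism of complexes defined by a cocycle on a projective resolution. -/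
noncomputable def extMkHom (f : R.complex.X n ⟶ Y) (m : ℕ) (hm : n + 1 = m)
    (hf : R.complex.d m n ≫ f = 0) :
    ShiftedHom R.cochainComplex ((singleFunctor C 0).obj Y) (n : ℤ) :=
  Cocycle.equivHomShift.symm (Cocycle.toSingleMk ((R.cochainComplexXIso (-n) n rfl).hom ≫ f)
     (by simp) (-m) (by lia) (by simpa [cochainComplex_d _ _ _ m n rfl rfl]))

/-- The target is concentrated in degree -n, so this one component, equal to f up to identifications
of objects, determines the whole morphism. -/
lemma extMkHom_f (f : R.complex.X n ⟶ Y) (m : ℕ) (hm : n + 1 = m)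
    (hf : R.complex.d m n ≫ f = 0) :
    HomologicalComplex.Hom.f (R.extMkHom f m hm hf) (-n : ℤ) ≫
      (HomologicalComplex.XIsoOfEq ((HomologicalComplex.single C (.up ℤ) 0).obj Y)
        (neg_add_cancel (n : ℤ))).hom =
      (R.cochainComplexXIso (-n) n rfl).hom ≫ f ≫
        (HomologicalComplex.singleObjXSelf (.up ℤ) 0 Y).inv := by
  let z : Cocycle R.cochainComplex ((singleFunctor C 0).obj Y) (n : ℤ) :=
    Cocycle.toSingleMk (p := -(n : ℤ)) (q := 0) ((R.cochainComplexXIso (-n) n rfl).hom ≫ f)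
     (by simp) (-m) (by lia) (by simpa [cochainComplex_d _ _ _ m n rfl rfl])
  have h : z.1.v (-n) 0 (by lia) = _ := Cochain.toSingleMk_v _ _
  change (Cochain.rightShift z.1 _ _ (zero_add _)).v (-n : ℤ) (-n : ℤ) (add_zero _) ≫ _ = _
  rw [Cochain.rightShift_v _ _ _ (zero_add _) _ _ _ 0 (by simp), h]
  refine (Category.assoc _ _ _).trans ?_
  refine .trans ?_ ((Category.comp_id _).trans (Category.assoc _ _ _))
  congr 1
  exact Iso.inv_hom_id _

-- A cancellation of identifications, kept to arbitrary objects so that it can be applied to the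
-- terms of the complexes up to definitional equality.
omit [Abelian C] [Abelian D] in
lemma map_comp_aux (F : C ⥤ D) {P P' T : D} {Q Q' U V : C} (e : P ⟶ P') (a : P' ⟶ F.obj Q')
    (i : Q ≅ Q') (r : Q' ⟶ U) (s : V ≅ U) (t : F.obj U ⟶ T) :
    (e ≫ a ≫ F.map i.inv) ≫ F.map (i.hom ≫ r ≫ s.inv) ≫ F.map s.hom ≫ t =
      e ≫ (a ≫ F.map r) ≫ t := by
  simp only [Category.assoc, ← F.map_comp_assoc, Iso.inv_hom_id, Category.comp_id,
    Iso.inv_hom_id_assoc]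

omit [Abelian D] in
lemma comp_inv_comp_aux {P P' Q Q' T V : D} (e : P ⟶ P') (r : P' ⟶ Q) (i : Q' ≅ Q) (g : Q ⟶ V)
    (t : V ⟶ T) : e ≫ (r ≫ g) ≫ t = (e ≫ r ≫ i.inv) ≫ i.hom ≫ g ≫ t := by
  simp

section map

variable (F : C ⥤ D) [F.Additive] {X' : D} {R' : ProjectiveResolution X'} {R}
  (φ : ∀ n, R'.complex.X n ⟶ F.obj (R.complex.X n))
  (hφ : ∀ i j, φ i ≫ F.map (R.complex.d i j) = R'.complex.d i j ≫ φ j)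

/-- The morphism of cochain complexes defined by a morphism of complexes. -/
noncomputable def cochainMap :
    R'.cochainComplex ⟶ (F.mapHomologicalComplex _).obj R.cochainComplex where
  f i := if h : i ≤ 0 then (R'.cochainComplexXIso i i.natAbs (by lia)).hom ≫ φ i.natAbs ≫
      F.map (R.cochainComplexXIso i i.natAbs (by lia)).inv else 0
  comm' := by
    rintro i j rfl
    by_cases h : i + 1 ≤ 0
    · have h' : i ≤ 0 := by lia
      have := hφ i.natAbs (i + 1).natAbs
      rw [dif_pos h, dif_pos h']
      change (_ ≫ _ ≫ _) ≫ F.map (R.cochainComplex.d i (i + 1)) = _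
      simp only [cochainComplex_d _ i (i + 1) i.natAbs (i + 1).natAbs (by lia) (by lia),
        Category.assoc, Iso.inv_hom_id_assoc, F.map_comp]
      rw [← F.map_comp_assoc (R.cochainComplexXIso _ _ _).inv, Iso.inv_hom_id, F.map_id,
        Category.id_comp, reassoc_of% this]
      rfl
    · exact (F.map_isZero
        (R.cochainComplex.isZero_of_isStrictlyLE 0 (i + 1) (by lia))).eq_of_tgt _ _

lemma cochainMap_f (i : ℤ) (k : ℕ) (h : -k = i) : (cochainMap F φ hφ).f i =
    (R'.cochainComplexXIso i k h).hom ≫ φ k ≫ F.map (R.cochainComplexXIso i k h).inv := by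
  obtain rfl : k = i.natAbs := by lia
  exact dif_pos (by lia)

/-- Only degree zero carries information, since the target is a single complex; there the claim is
the hypothesis that φ lies over g. -/
lemma cochainMap_comp_π' {g : X' ⟶ F.obj X}
    (hg : φ 0 ≫ F.map (R.π.f 0 ≫ (HomologicalComplex.singleObjXSelf (.down ℕ) 0 X).hom) =
      (R'.π.f 0 ≫ (HomologicalComplex.singleObjXSelf (.down ℕ) 0 X').hom) ≫ g) :
    cochainMap F φ hφ ≫ (F.mapHomologicalComplex _).map R.π' ≫
        (HomologicalComplex.singleMapHomologicalComplex F (.up ℤ) 0).hom.app X =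
      R'.π' ≫ (HomologicalComplex.single D (.up ℤ) 0).map g := by
  refine HomologicalComplex.to_single_hom_ext ?_
  have h₁ := cochainMap_f F φ hφ 0 0 rfl
  have h₂ := HomologicalComplex.singleMapHomologicalComplex_hom_app_self F (.up ℤ) 0 X
  have hg' : φ 0 ≫ F.map (show R.complex.X 0 ⟶ X from R.π.f 0) =
      (show _ ⟶ X' from R'.π.f 0) ≫ g :=
    (congrArg (fun a => φ 0 ≫ F.map a) (Category.comp_id _).symm).trans
      (hg.trans (congrArg (· ≫ g) (Category.comp_id _)))
  refine .trans (congrArg₂ (fun a b => a ≫ F.map (R.π'.f 0) ≫ b) h₁ h₂) ?_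
  refine .trans (congrArg (fun a => _ ≫ F.map a ≫ _) R.π'_f_zero) ?_
  refine .trans ?_ (congrArg₂ (fun a b => a ≫ b) R'.π'_f_zero
    (HomologicalComplex.single_map_f_self _ _ g)).symm
  refine .trans (map_comp_aux F _ _ _ _ _ _) ?_
  refine .trans (congrArg (fun a => _ ≫ a ≫ _) hg') ?_
  exact comp_inv_comp_aux _ _ _ _ _

/-- Again only degree -n matters, and there both sides are φ followed by F(f) up to identifications.
-/
lemma extMkHom_map (f : R.complex.X n ⟶ Y) (m : ℕ) (hm : n + 1 = m)
    (hf : R.complex.d m n ≫ f = 0) (hf' : R'.complex.d m n ≫ φ n ≫ F.map f = 0) :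
    cochainMap F φ hφ ≫ (ShiftedHom.map (R.extMkHom f m hm hf) (F.mapHomologicalComplex (.up ℤ)) :
        (F.mapHomologicalComplex (.up ℤ)).obj R.cochainComplex ⟶
          ((F.mapHomologicalComplex (.up ℤ)).obj ((singleFunctor C 0).obj Y))⟦(n : ℤ)⟧) ≫
        ((F.mapCochainComplexSingleFunctor 0).hom.app Y)⟦(n:ℤ)⟧' =
      R'.extMkHom (φ n ≫ F.map f) m hm hf' := by
  ext i
  by_cases h : i = -n
  · subst h
    let σ := (HomologicalComplex.singleMapHomologicalComplex F (.up ℤ) 0).hom.app Y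
    refine (cancel_mono (HomologicalComplex.XIsoOfEq
      ((HomologicalComplex.single D (.up ℤ) 0).obj (F.obj Y)) (neg_add_cancel (n : ℤ))).hom).1 ?_
    refine .trans ?_ (extMkHom_f _ _ _ _ _).symm
    have h₁ : σ.f (-n + n : ℤ) ≫ (HomologicalComplex.XIsoOfEq
        ((HomologicalComplex.single D (.up ℤ) 0).obj (F.obj Y)) (neg_add_cancel (n : ℤ))).hom =
        F.map (HomologicalComplex.XIsoOfEq ((HomologicalComplex.single C (.up ℤ) 0).obj Y)
        (neg_add_cancel (n : ℤ))).hom ≫ σ.f 0 := by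
      have (i : ℤ) (h : i = 0) : σ.f i ≫ (HomologicalComplex.XIsoOfEq
        ((HomologicalComplex.single D (.up ℤ) 0).obj (F.obj Y)) h).hom =
        F.map (HomologicalComplex.XIsoOfEq ((HomologicalComplex.single C (.up ℤ) 0).obj Y)
        h).hom ≫ σ.f 0 := by
        subst h
        refine (Category.comp_id _).trans (.trans ?_ (congrArg (· ≫ σ.f 0) (F.map_id _)).symm)
        exact (Category.id_comp _).symm
      exact this _ _
    have h₂ := extMkHom_f R f m hm hf
    have h₃ : σ.f 0 = _ :=
      HomologicalComplex.singleMapHomologicalComplex_hom_app_self F (.up ℤ) 0 Y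
    refine .trans ((Category.assoc _ _ _).trans (congrArg (_ ≫ ·) ((Category.assoc _ _ _).trans
      ((congrArg₂ (· ≫ ·) (Category.comp_id (F.map _)) h₁).trans
        ((F.map_comp_assoc _ _ _).symm.trans
          (congrArg₂ (fun a b => F.map a ≫ b) h₂ h₃)))))) ?_
    refine .trans (congrArg (· ≫ _) (cochainMap_f F φ hφ (-n) n rfl)) ?_
    exact map_comp_aux F _ _ _ _ _ _
  · exact (HomologicalComplex.isZero_single_obj_X (.up ℤ) 0 (F.obj Y) (i + n)
      (by lia)).eq_of_tgt _ _

end map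

section

variable {K L L' : CochainComplex C ℤ}
  [HasSmallLocalizedShiftedHom.{w} (HomologicalComplex.quasiIso C (.up ℤ)) ℤ K L]
  [HasSmallLocalizedShiftedHom.{w} (HomologicalComplex.quasiIso C (.up ℤ)) ℤ L L']
  [HasSmallLocalizedShiftedHom.{w} (HomologicalComplex.quasiIso C (.up ℤ)) ℤ K L']
  [HasSmallLocalizedShiftedHom.{w} (HomologicalComplex.quasiIso C (.up ℤ)) ℤ L' L']

lemma smallShiftedHom_mk₀_comp_mk {n : ℤ} (f : K ⟶ L) (g : ShiftedHom L L' n) :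
    (SmallShiftedHom.mk₀ (HomologicalComplex.quasiIso C (.up ℤ)) (0 : ℤ) rfl f).comp
      (SmallShiftedHom.mk _ g) (add_zero n) = SmallShiftedHom.mk _ (f ≫ g : _ ⟶ _) := by
  apply (SmallShiftedHom.equiv _ (HomologicalComplex.quasiIso C (.up ℤ)).Q).injective
  simp [SmallShiftedHom.equiv_comp, ShiftedHom.mk₀_comp, ShiftedHom.map]

lemma smallShiftedHom_mk₀_comp_mk₀ (f : K ⟶ L) (g : L ⟶ L') :
    (SmallShiftedHom.mk₀ (HomologicalComplex.quasiIso C (.up ℤ)) (0 : ℤ) rfl f).comp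
      (SmallShiftedHom.mk₀ _ (0 : ℤ) rfl g) (add_zero 0) =
      SmallShiftedHom.mk₀ _ (0 : ℤ) rfl (f ≫ g) := by
  apply (SmallShiftedHom.equiv _ (HomologicalComplex.quasiIso C (.up ℤ)).Q).injective
  simp [SmallShiftedHom.equiv_comp]

end

variable [HasExt.{w} C] [HasExt.{w'} D]

lemma extMk_eq (f : R.complex.X n ⟶ Y) (m : ℕ) (hm : n + 1 = m)
    (hf : R.complex.d m n ≫ f = 0) : R.extMk f m hm hf =
    SmallShiftedHom.comp
      (SmallShiftedHom.mk₀Inv (W := HomologicalComplex.quasiIso C (.up ℤ)) (0 : ℤ) rfl R.π'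
        (by rw [HomologicalComplex.mem_quasiIso_iff]; infer_instance))
      (SmallShiftedHom.mk _ (R.extMkHom f m hm hf)) (add_zero _) := rfl

/-- The class of a cocycle is the formal inverse of the augmentation followed by an honest morphism
of complexes; composing with the augmentation removes the inverse. -/
lemma mk₀_π'_comp_extMk (f : R.complex.X n ⟶ Y) (m : ℕ) (hm : n + 1 = m)
    (hf : R.complex.d m n ≫ f = 0) :
    SmallShiftedHom.comp (b := (n : ℤ))
        (SmallShiftedHom.mk₀ (HomologicalComplex.quasiIso C (.up ℤ)) (0 : ℤ) rfl R.π')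
      (show SmallShiftedHom _ ((singleFunctor C 0).obj X) ((singleFunctor C 0).obj Y) (n : ℤ)
        from R.extMk f m hm hf) (add_zero _) =
      SmallShiftedHom.mk _ (R.extMkHom f m hm hf) := by
  dsimp only
  rw [extMk_eq, ← SmallShiftedHom.comp_assoc, SmallShiftedHom.mk₀_comp_mk₀Inv,
    SmallShiftedHom.mk₀_id_comp]
  all_goals simp

/-- The image under an exact functor `F` of the class of a cocycle `f` on a projective resolution
`R`, restricted along a morphism `g`, is the class of the cocycle `φ ≫ F f`, for a morphism
of complexes `φ` to `F R` over `g`. -/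
lemma mk₀_comp_mapExactFunctor_extMk (F : C ⥤ D) [F.Additive] [PreservesFiniteLimits F]
    [PreservesFiniteColimits F] {X' : D} (R' : ProjectiveResolution X')
    (φ : ∀ n, R'.complex.X n ⟶ F.obj (R.complex.X n))
    (hφ : ∀ i j, φ i ≫ F.map (R.complex.d i j) = R'.complex.d i j ≫ φ j) (g : X' ⟶ F.obj X)
    (hg : φ 0 ≫ F.map (R.π.f 0 ≫ (HomologicalComplex.singleObjXSelf (.down ℕ) 0 X).hom) =
      (R'.π.f 0 ≫ (HomologicalComplex.singleObjXSelf (.down ℕ) 0 X').hom) ≫ g)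
    (f : R.complex.X n ⟶ Y) (m : ℕ) (hm : n + 1 = m) (hf : R.complex.d m n ≫ f = 0)
    (hf' : R'.complex.d m n ≫ φ n ≫ F.map f = 0) :
    (Ext.mk₀ g).comp ((R.extMk f m hm hf).mapExactFunctor F) (zero_add n) =
      R'.extMk (φ n ≫ F.map f) m hm hf' := by
  let K := (F.mapHomologicalComplex (.up ℤ)).obj R.cochainComplex
  let α : K ⟶ (singleFunctor D 0).obj (F.obj X) :=
    (F.mapHomologicalComplex (.up ℤ)).map R.π' ≫ (F.mapCochainComplexSingleFunctor 0).hom.app X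
  have : QuasiIso ((F.mapHomologicalComplex (.up ℤ)).map R.π') := inferInstance
  have : QuasiIso α := inferInstance
  have hsmall (Z : D) : HasSmallLocalizedShiftedHom.{w'} (HomologicalComplex.quasiIso D (.up ℤ)) ℤ
      K ((singleFunctor D 0).obj Z) :=
    hasSmallLocalizedShiftedHom_source α
  have hsmall' (Z : D) : HasSmallLocalizedShiftedHom.{w'} (HomologicalComplex.quasiIso D (.up ℤ)) ℤ
      R'.cochainComplex ((singleFunctor D 0).obj Z) := hasSmallLocalizedShiftedHom_source R'.π'
  have hsmall'' (Z : C) : HasSmallLocalizedShiftedHom.{w'} (HomologicalComplex.quasiIso D (.up ℤ)) ℤ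
      K ((F ⋙ singleFunctor D 0).obj Z) := hsmall (F.obj Z)
  have : HasSmallLocalizedShiftedHom.{w'} (HomologicalComplex.quasiIso D (.up ℤ)) ℤ K K :=
    hasSmallLocalizedShiftedHom_target α
  have : HasSmallLocalizedShiftedHom.{w'} (HomologicalComplex.quasiIso D (.up ℤ)) ℤ
    R'.cochainComplex K := hasSmallLocalizedShiftedHom_target α
  have : HasSmallLocalizedShiftedHom.{w'} (HomologicalComplex.quasiIso D (.up ℤ)) ℤ
    R'.cochainComplex R'.cochainComplex := hasSmallLocalizedShiftedHom_target R'.π'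
  have : HasSmallLocalizedShiftedHom.{w'} (HomologicalComplex.quasiIso D (.up ℤ)) ℤ
    ((singleFunctor D 0).obj X') R'.cochainComplex := hasSmallLocalizedShiftedHom_target R'.π'
  have hπ : HomologicalComplex.quasiIso D (.up ℤ) R'.π' := by
    rw [HomologicalComplex.mem_quasiIso_iff]; infer_instance
  -- Precomposition with a quasi-isomorphism is injective, so the two classes may be compared on the
  -- resolution R', where both come from morphisms of complexes.
  apply (SmallShiftedHom.precompEquiv R'.π' hπ).injective
  refine .trans ?_ (R'.mk₀_π'_comp_extMk _ m hm hf').symm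
  let Φ := F.mapHomologicalComplexUpToQuasiIsoLocalizerMorphism (.up ℤ)
  let E : SmallShiftedHom.{w'} (HomologicalComplex.quasiIso D (.up ℤ))
      ((singleFunctor D 0).obj (F.obj X)) ((singleFunctor D 0).obj (F.obj Y)) (n : ℤ) :=
    (R.extMk f m hm hf).mapExactFunctor F
  -- F is applied to the identity `mk₀_π'_comp_extMk` for R, which removes the inverse
  -- quasi-isomorphism from the image of the class.
  have h₁ : (SmallShiftedHom.mk₀ (HomologicalComplex.quasiIso D (.up ℤ)) (0 : ℤ) rfl α).comp E
      (add_zero _) = SmallShiftedHom.mk _ ((ShiftedHom.map (R.extMkHom f m hm hf)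
        (F.mapHomologicalComplex (.up ℤ)) : _ ⟶ _) ≫
        ((F.mapCochainComplexSingleFunctor 0).hom.app Y)⟦(n:ℤ)⟧') := by
    have h := Φ.smallShiftedHomMap_mk₀ (Iso.refl K) ((F.mapCochainComplexSingleFunctor 0).app X)
      (0 : ℤ) rfl R.π'
    have h' := Φ.smallShiftedHomMap_mk (Iso.refl K) ((F.mapCochainComplexSingleFunctor 0).app Y)
      (R.extMkHom f m hm hf)
    have h'' := Φ.smallShiftedHomMap_comp (Iso.refl K) ((F.mapCochainComplexSingleFunctor 0).app X)
      ((F.mapCochainComplexSingleFunctor 0).app Y)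
      (SmallShiftedHom.mk₀ (HomologicalComplex.quasiIso C (.up ℤ)) (0 : ℤ) rfl R.π')
      (show SmallShiftedHom _ ((singleFunctor C 0).obj X) ((singleFunctor C 0).obj Y) (n : ℤ)
        from R.extMk f m hm hf) (add_zero _)
    refine .trans ?_ (h''.symm.trans ((congrArg _ (R.mk₀_π'_comp_extMk f m hm hf)).trans
      (h'.trans ?_)))
    · refine (congrArg (fun a => SmallShiftedHom.comp a E (add_zero (n : ℤ))) ?_)
      refine .trans ?_ h.symm
      congr 1
      exact (Category.id_comp _).symm
    · congr 1
      rw [ShiftedHom.mk₀_comp]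
      refine .trans (Category.id_comp _) ?_
      rw [ShiftedHom.comp_mk₀]
      rfl
  rw [← extMkHom_map F φ hφ f m hm hf hf', ← smallShiftedHom_mk₀_comp_mk, ← h₁,
    ← SmallShiftedHom.comp_assoc _ _ _ _ (add_zero 0) (add_zero (n : ℤ)) (by simp),
    smallShiftedHom_mk₀_comp_mk₀]
  have h₃ : cochainMap F φ hφ ≫ α = R'.π' ≫ (singleFunctor D 0).map g :=
    cochainMap_comp_π' F φ hφ hg
  rw [h₃, ← smallShiftedHom_mk₀_comp_mk₀, SmallShiftedHom.comp_assoc _ _ _ _ (add_zero 0)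
    (add_zero (n : ℤ)) (by simp)]
  rfl

end CategoryTheory.ProjectiveResolution

end ExtMk

/-! ## Operators on `N ⊗ X` twisted by a coaction -/

section Twist

variable {k H B : Type*} [CommRing k] [Ring H] [Bialgebra k H] [Ring B] [Algebra k B]
  {N N' N'' : Type*} [AddCommGroup N] [Module k N] [AddCommGroup N'] [Module k N']
  [AddCommGroup N''] [Module k N'']

/-- The convolution `h ↦ ∑ ψ(h₂) ∘ φ(h₁)`. -/
noncomputable def convComp (φ : H →ₗ[k] N →ₗ[k] N') (ψ : H →ₗ[k] N' →ₗ[k] N'') :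
    H →ₗ[k] N →ₗ[k] N'' :=
  TensorProduct.lift ((LinearMap.llcomp k N N' N'').flip.compl₁₂ φ ψ) ∘ₗ Coalgebra.comul

lemma convComp_apply (φ : H →ₗ[k] N →ₗ[k] N') (ψ : H →ₗ[k] N' →ₗ[k] N'') (h : H)
    {ι : Type*} (R : Coalgebra.Repr k h ι) (n : N) :
    convComp φ ψ h n = ∑ i ∈ R.index, ψ (R.right i) (φ (R.left i) n) := by
  simp [convComp, ← R.eq]

variable {β : ComoduleAlgebra k H B} {X : Type*} [AddCommGroup X] [Module k X]
  [Module Bᵐᵒᵖ X] [IsScalarTower k Bᵐᵒᵖ X] (χ : HopfModule β X)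

/-- The operator `n ⊗ x ↦ ∑ φ(x₋₁) n ⊗ x₀`. -/
noncomputable def HopfModule.twist (φ : H →ₗ[k] N →ₗ[k] N') : N ⊗[k] X →ₗ[k] N' ⊗[k] X :=
  TensorProduct.lift (LinearMap.lcomp k _ χ.coact ∘ₗ LinearMap.rTensorHom X ∘ₗ φ.flip)

lemma HopfModule.twist_tmul (φ : H →ₗ[k] N →ₗ[k] N') (n : N) (x : X) :
    χ.twist φ (n ⊗ₜ x) = (φ.flip n).rTensor X (χ.coact x) := rfl

/-- Both sides are one map Λ evaluated on the two iterated coactions of x, which agree by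
coassociativity. Together with `HopfModule.twist_counit` this shows that a convolution inverse of φ
gives an inverse operator; all the twists below are inverted in this way. -/
lemma HopfModule.twist_comp (φ : H →ₗ[k] N →ₗ[k] N') (ψ : H →ₗ[k] N' →ₗ[k] N'') :
    χ.twist ψ ∘ₗ χ.twist φ = χ.twist (convComp φ ψ) := by
  ext n x
  let Λ : H ⊗[k] (H ⊗[k] X) →ₗ[k] N'' ⊗[k] X :=
    TensorProduct.lift (LinearMap.rTensorHom X ∘ₗ ψ.flip ∘ₗ φ.flip n)
  have h₁ : χ.twist ψ (χ.twist φ (n ⊗ₜ x)) = Λ (χ.coact.lTensor H (χ.coact x)) := by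
    rw [twist_tmul]
    induction χ.coact x using TensorProduct.induction_on with
    | zero => simp
    | add y z hy hz => simp only [map_add, hy, hz]
    | tmul h y => simp [twist_tmul, Λ]
  have h₂ : χ.twist (convComp φ ψ) (n ⊗ₜ x) = Λ (TensorProduct.assoc k H H X
      ((Coalgebra.comul (R := k) (A := H)).rTensor X (χ.coact x))) := by
    rw [twist_tmul]
    induction χ.coact x using TensorProduct.induction_on with
    | zero => simp
    | add y z hy hz => simp only [map_add, hy, hz]
    | tmul h y =>
      have R := Coalgebra.Repr.arbitrary k h
      simp [convComp_apply φ ψ h R, Λ, ← R.eq, TensorProduct.sum_tmul]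
  simp only [TensorProduct.AlgebraTensorModule.curry_apply, LinearMap.restrictScalars_self,
    TensorProduct.curry_apply, LinearMap.comp_apply]
  rw [h₁, h₂, χ.coassoc]

lemma HopfModule.twist_twist (φ : H →ₗ[k] N →ₗ[k] N') (ψ : H →ₗ[k] N' →ₗ[k] N'')
    (z : N ⊗[k] X) : χ.twist ψ (χ.twist φ z) = χ.twist (convComp φ ψ) z :=
  LinearMap.congr_fun (χ.twist_comp φ ψ) z

lemma HopfModule.twist_counit (φ : H →ₗ[k] N →ₗ[k] N)
    (hφ : ∀ h n, φ h n = Coalgebra.counit (R := k) h • n) (z : N ⊗[k] X) : χ.twist φ z = z := by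
  induction z using TensorProduct.induction_on with
  | zero => simp
  | add y z hy hz => simp only [map_add, hy, hz]
  | tmul n x =>
    rw [twist_tmul]
    have : φ.flip n = (LinearMap.toSpanSingleton k N n) ∘ₗ Coalgebra.counit := by
      ext h; simp [hφ]
    have hx := χ.counit x
    rw [← (TensorProduct.lid k X).eq_symm_apply] at hx
    rw [this, LinearMap.rTensor_comp, LinearMap.comp_apply, hx]
    simp

lemma HopfModule.rTensor_twist (f : N' →ₗ[k] N'') (φ : H →ₗ[k] N →ₗ[k] N') (z : N ⊗[k] X) :
    f.rTensor X (χ.twist φ z) = χ.twist (LinearMap.compRight k f ∘ₗ φ) z := by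
  induction z using TensorProduct.induction_on with
  | zero => simp
  | add y z hy hz => simp only [map_add, hy, hz]
  | tmul n x =>
    rw [twist_tmul, twist_tmul, ← LinearMap.comp_apply, ← LinearMap.rTensor_comp]
    rfl

lemma HopfModule.twist_rTensor (f : N →ₗ[k] N') (φ : H →ₗ[k] N' →ₗ[k] N'') (z : N ⊗[k] X) :
    χ.twist φ (f.rTensor X z) = χ.twist (LinearMap.lcomp k _ f ∘ₗ φ) z := by
  induction z using TensorProduct.induction_on with
  | zero => simp
  | add y z hy hz => simp only [map_add, hy, hz]
  | tmul n x =>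
    rw [LinearMap.rTensor_tmul, twist_tmul, twist_tmul]
    rfl

/-- Twisted operators commute with colinear maps. -/
lemma HopfModule.twist_lTensor {X' : Type*} [AddCommGroup X'] [Module k X']
    [Module Bᵐᵒᵖ X'] [IsScalarTower k Bᵐᵒᵖ X'] (χ' : HopfModule β X') (u : X →ₗ[k] X')
    (hu : ∀ x, χ'.coact (u x) = u.lTensor H (χ.coact x)) (φ : H →ₗ[k] N →ₗ[k] N')
    (z : N ⊗[k] X) : χ'.twist φ (u.lTensor N z) = u.lTensor N' (χ.twist φ z) := by
  induction z using TensorProduct.induction_on with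
  | zero => simp
  | add y z hy hz => simp only [map_add, hy, hz]
  | tmul n x =>
    rw [LinearMap.lTensor_tmul, twist_tmul, twist_tmul, hu]
    induction χ.coact x using TensorProduct.induction_on with
    | zero => simp
    | add y z hy hz => simp only [map_add, hy, hz]
    | tmul h y => simp

/-- Twisted operators and the action of `B`. -/
lemma HopfModule.twist_smul (φ : H →ₗ[k] N →ₗ[k] N') (b : B) (z : N ⊗[k] X) {ι : Type*}
    (s : Finset ι) (g : ι → H) (c : ι → B) (hb : β.coact b = ∑ i ∈ s, g i ⊗ₜ c i) :
    χ.twist φ (((rightAction k B X).flip b).lTensor N z) =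
      ∑ i ∈ s, ((rightAction k B X).flip (c i)).lTensor N'
        (χ.twist (φ ∘ₗ LinearMap.mulRight k (g i)) z) := by
  induction z using TensorProduct.induction_on with
  | zero => simp
  | add y z hy hz => simp only [map_add, hy, hz, Finset.sum_add_distrib]
  | tmul n x =>
    rw [LinearMap.lTensor_tmul, LinearMap.flip_apply, twist_tmul, rightAction_apply,
      χ.coact_smul, hb]
    simp only [twist_tmul]
    induction χ.coact x using TensorProduct.induction_on with
    | zero => simp
    | add y z hy hz =>
      simp only [map_add, LinearMap.add_apply, hy, hz, Finset.sum_add_distrib]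
    | tmul h y => simp

end Twist
/-! ## Diagonal modules -/

section Diag

variable {k R T B : Type*} [CommRing k] [Ring R] [Algebra k R] [Ring T] [Algebra k T]
  [Ring B] [Algebra k B] (f : R →ₐ[k] T ⊗[k] B)
  (N : Type*) [AddCommGroup N] [Module k N] (Y : Type*) [AddCommGroup Y] [Module k Y]

/-- The space `N ⊗ Y` as a right `R`-module through `f : R → T ⊗ B`. -/
@[nolint unusedArguments]
def DiagModule (_f : R →ₐ[k] T ⊗[k] B) (N : Type*) [AddCommGroup N] [Module k N]
    (Y : Type*) [AddCommGroup Y] [Module k Y] : Type _ := N ⊗[k] Y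

noncomputable instance : AddCommGroup (DiagModule f N Y) :=
  inferInstanceAs (AddCommGroup (N ⊗[k] Y))

noncomputable instance : Module k (DiagModule f N Y) := inferInstanceAs (Module k (N ⊗[k] Y))

variable [Module Tᵐᵒᵖ N] [IsScalarTower k Tᵐᵒᵖ N] [Module Bᵐᵒᵖ Y] [IsScalarTower k Bᵐᵒᵖ Y]

/-- The right action of `T ⊗ B` on `N ⊗ Y`. -/
noncomputable abbrev tensorAction : N ⊗[k] Y →ₗ[k] T ⊗[k] B →ₗ[k] N ⊗[k] Y :=
  TensorProduct.map₂ (rightAction k T N) (rightAction k B Y)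

lemma tensorAction_mul (z : N ⊗[k] Y) (u v : T ⊗[k] B) :
    tensorAction N Y z (u * v) = tensorAction N Y (tensorAction N Y z u) v := by
  induction z using TensorProduct.induction_on with
  | zero => simp
  | add y z hy hz => simp only [map_add, LinearMap.add_apply, hy, hz]
  | tmul n y =>
    induction u using TensorProduct.induction_on with
    | zero => simp
    | add y z hy hz => simp only [map_add, add_mul, LinearMap.add_apply, hy, hz]
    | tmul t b =>
      induction v using TensorProduct.induction_on with
      | zero => simp
      | add y z hy hz => simp only [map_add, mul_add, hy, hz]
      | tmul t' b' => simp [rightAction_apply, mul_smul]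

lemma tensorAction_one (z : N ⊗[k] Y) : tensorAction (T := T) (B := B) N Y z 1 = z := by
  induction z using TensorProduct.induction_on with
  | zero => simp
  | add y z hy hz => simp only [map_add, LinearMap.add_apply, hy, hz]
  | tmul n y => simp [Algebra.TensorProduct.one_def, rightAction_apply]

noncomputable instance : Module Rᵐᵒᵖ (DiagModule f N Y) where
  smul r z := tensorAction N Y z (f r.unop)
  one_smul z := (congrArg _ (map_one f)).trans (tensorAction_one N Y z)
  mul_smul r s z := (congrArg _ (map_mul f _ _)).trans (tensorAction_mul N Y z _ _)
  smul_zero r := LinearMap.map_zero₂ (tensorAction N Y) _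
  zero_smul z := (congrArg _ (map_zero f)).trans (map_zero (tensorAction N Y z))
  smul_add r v w := LinearMap.map_add₂ (tensorAction N Y) _ _ _
  add_smul r s z := (congrArg _ (map_add f _ _)).trans (map_add (tensorAction N Y z) _ _)

lemma DiagModule.smul_def (r : R) (z : DiagModule f N Y) :
    op r • z = tensorAction N Y z (f r) := rfl

instance : IsScalarTower k Rᵐᵒᵖ (DiagModule f N Y) where
  smul_assoc r s z := by
    change tensorAction N Y (show N ⊗[k] Y from z) (f (r • s.unop)) =
      r • tensorAction N Y (show N ⊗[k] Y from z) (f s.unop)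
    rw [map_smul, map_smul]

end Diag

/-! ## Smash products -/

section Smash

variable {k H A B : Type*} [CommRing k] [Ring H] [Bialgebra k H] [Ring A] [Algebra k A]
  [Ring B] [Algebra k B] (α : ModuleAlgebra k H A) (β : ComoduleAlgebra k H B)

lemma SmashProduct.induction {P : SmashProduct α β → Prop} (x : SmashProduct α β) (h₀ : P 0)
    (hadd : ∀ x y, P x → P y → P (x + y)) (ht : ∀ a b, P (SmashProduct.tmul α β a b)) : P x :=
  TensorProduct.induction_on (motive := P) x h₀ ht hadd

lemma SmashProduct.tmul_mul_one_tmul (a : A) (b b' : B) :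
    SmashProduct.tmul α β a b * SmashProduct.tmul α β 1 b' = SmashProduct.tmul α β a (b * b') := by
  refine (twistMul_tmul_tmul _ _ _ _ _).trans ?_
  rw [(smashTwist α β).one_right]
  simp
  rfl

lemma SmashProduct.tmul_one_mul_tmul (a a' : A) (b : B) :
    SmashProduct.tmul α β a 1 * SmashProduct.tmul α β a' b = SmashProduct.tmul α β (a * a') b := by
  refine (twistMul_tmul_tmul _ _ _ _ _).trans ?_
  rw [(smashTwist α β).one_left]
  simp
  rfl

/-- The map `a # b ↦ ∑ (a # b₋₁) ⊗ b₀`. -/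
noncomputable def smashDiagAux (a : A) : H ⊗[k] B →ₗ[k] SmashHopf α ⊗[k] B :=
  (show H →ₗ[k] SmashHopf α from TensorProduct.mk k A H a).rTensor B

lemma smashDiagAux_tmul (a : A) (h : H) (b : B) :
    smashDiagAux α a (h ⊗ₜ[k] b) = SmashHopf.tmul α a h ⊗ₜ b := rfl

/-- The map `a # b ↦ ∑ (a # b₋₁) ⊗ b₀`. -/
noncomputable def smashDiagLin : SmashProduct α β →ₗ[k] SmashHopf α ⊗[k] B :=
  show A ⊗[k] B →ₗ[k] _ from TensorProduct.lift (LinearMap.mk₂ k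
    (fun a b => smashDiagAux α a (β.coact b))
    (fun a a' b => by
      induction β.coact b using TensorProduct.induction_on with
      | zero => simp
      | add y z hy hz => simp only [map_add, hy, hz]; abel
      | tmul h c =>
        simp only [smashDiagAux_tmul, ← TensorProduct.add_tmul]
        exact congrArg (· ⊗ₜ c) (TensorProduct.add_tmul _ _ _))
    (fun r a b => by
      induction β.coact b using TensorProduct.induction_on with
      | zero => simp
      | add y z hy hz => simp only [map_add, hy, hz, smul_add]
      | tmul h c => rfl)
    (fun a b b' => by simp) (fun r a b => by simp))

lemma smashDiagLin_tmul (a : A) (b : B) :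
    smashDiagLin α β (SmashProduct.tmul α β a b) = smashDiagAux α a (β.coact b) := rfl

/-- The map `(g ⊗ c) ⊗ (h ⊗ h' ⊗ c') ↦ (a (h ⇀ a') # h' g) ⊗ c' c`. -/
noncomputable def smashDiagPairing (a a' : A) (u : H ⊗[k] B) :
    H ⊗[k] (H ⊗[k] B) →ₗ[k] SmashHopf α ⊗[k] B :=
  TensorProduct.lift (LinearMap.flip
    (LinearMap.flip (show A →ₗ[k] H ⊗[k] B →ₗ[k] SmashHopf α ⊗[k] B from
      LinearMap.rTensorHom B ∘ₗ TensorProduct.mk k A H) ∘ₗ LinearMap.mulRight k u) ∘ₗ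
    LinearMap.mulLeft k a ∘ₗ α.act.toLinearMap.flip a')

lemma smashDiagPairing_tmul (a a' : A) (u : H ⊗[k] B) (h : H) (v : H ⊗[k] B) :
    smashDiagPairing α a a' u (h ⊗ₜ v) = smashDiagAux α (a * α.act h a') (v * u) := rfl

/-- The two sides are the values of `smashDiagPairing` on (id ⊗ ρ)ρ(b) and (Δ ⊗ id)ρ(b): the left
side uses the product of A # B and multiplicativity of ρ, the right side the product of A # H. -/
lemma smashDiagLin_mul_tmul (a a' : A) (b b' : B) :
    smashDiagLin α β (SmashProduct.tmul α β a b * SmashProduct.tmul α β a' b') =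
    smashDiagLin α β (SmashProduct.tmul α β a b) *
      smashDiagLin α β (SmashProduct.tmul α β a' b') := by
  have h₁ : smashDiagLin α β (SmashProduct.tmul α β a b * SmashProduct.tmul α β a' b') =
      smashDiagPairing α a a' (β.coact b') (β.coact.toLinearMap.lTensor H (β.coact b)) := by
    refine (congrArg _ (twistMul_tmul_tmul (smashτ α β) a a' b b')).trans ?_
    rw [smashτ_apply]
    induction β.coact b using TensorProduct.induction_on with
    | zero =>
      rw [map_zero, mul_zero, zero_mul, map_zero, map_zero]
      exact map_zero (smashDiagLin α β)
    | add y z hy hz =>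
      rw [map_add, mul_add, add_mul, map_add, map_add, ← hy, ← hz]
      exact map_add (smashDiagLin α β) _ _
    | tmul h c =>
      simp only [LinearMap.rTensor_tmul, Algebra.TensorProduct.tmul_mul_tmul, one_mul, mul_one,
        LinearMap.lTensor_tmul, smashDiagPairing_tmul]
      refine (smashDiagLin_tmul α β _ _).trans ?_
      rw [map_mul]
      rfl
  have h₂ : smashDiagLin α β (SmashProduct.tmul α β a b) *
        smashDiagLin α β (SmashProduct.tmul α β a' b') =
      smashDiagPairing α a a' (β.coact b') (TensorProduct.assoc k H H B
        ((Coalgebra.comul (R := k) (A := H)).rTensor B (β.coact b))) := by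
    rw [smashDiagLin_tmul, smashDiagLin_tmul]
    induction β.coact b using TensorProduct.induction_on with
    | zero => simp
    | add y z hy hz => simp only [map_add, add_mul, hy, hz]
    | tmul h c =>
      have R := Coalgebra.Repr.arbitrary k h
      simp only [LinearMap.rTensor_tmul, ← R.eq, TensorProduct.sum_tmul, map_sum,
        TensorProduct.assoc_tmul, smashDiagPairing_tmul, smashDiagAux_tmul]
      induction β.coact b' using TensorProduct.induction_on with
      | zero => simp
      | add y z hy hz => simp only [map_add, mul_add, hy, hz, Finset.sum_add_distrib]
      | tmul g d =>
        rw [smashDiagAux_tmul, Algebra.TensorProduct.tmul_mul_tmul,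
          SmashProduct.tmul_mul_tmul α _ a a' h g R.index R.left R.right R.eq.symm]
        simp only [TensorProduct.sum_tmul, Algebra.TensorProduct.tmul_mul_tmul,
          smashDiagAux_tmul]
  rw [h₁, h₂, β.coassoc]

lemma smashDiagLin_mul (x y : SmashProduct α β) :
    smashDiagLin α β (x * y) = smashDiagLin α β x * smashDiagLin α β y := by
  induction x using SmashProduct.induction with
  | h₀ => rw [zero_mul, map_zero, zero_mul]
  | hadd x x' hx hy => rw [add_mul, map_add, map_add, add_mul, hx, hy]
  | ht a b =>
    induction y using SmashProduct.induction with
    | h₀ => rw [mul_zero, map_zero, mul_zero]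
    | hadd x x' hx hy => rw [mul_add, map_add, map_add, mul_add, hx, hy]
    | ht a' b' => exact smashDiagLin_mul_tmul α β a a' b b'

/-- The algebra map `A # B → (A # H) ⊗ B`, `a # b ↦ ∑ (a # b₋₁) ⊗ b₀`. -/
noncomputable def smashDiag : SmashProduct α β →ₐ[k] SmashHopf α ⊗[k] B :=
  AlgHom.ofLinearMap (smashDiagLin α β)
    (by
      refine (smashDiagLin_tmul α β 1 1).trans ?_
      rw [map_one]
      rfl)
    (smashDiagLin_mul α β)

end Smash

/-! ## Untwisting the smash product of modules -/

section Untwist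

variable {k H A B : Type*} [CommRing k] [Ring H] [HopfAlgebra k H] [Ring A] [Algebra k A]
  [Ring B] [Algebra k B] (α : ModuleAlgebra k H A) {β : ComoduleAlgebra k H B}

/-- The inclusion `h ↦ 1 # h`. -/
noncomputable def SmashHopf.ofHopf : H →ₐ[k] SmashHopf α :=
  AlgHom.ofLinearMap (show H →ₗ[k] SmashHopf α from TensorProduct.mk k A H 1) rfl
    (fun h h' => (SmashProduct.tmul_mul_one_tmul α _ 1 h h').symm)

lemma SmashHopf.ofHopf_apply (h : H) : SmashHopf.ofHopf α h = SmashHopf.tmul α 1 h := rfl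

lemma smashModuleA_eq_twist (N : Type*) [AddCommGroup N] [Module k N] [Module Aᵐᵒᵖ N]
    [IsScalarTower k Aᵐᵒᵖ N] {Y : Type*} [AddCommGroup Y] [Module k Y] [Module Bᵐᵒᵖ Y]
    [IsScalarTower k Bᵐᵒᵖ Y] (χ : HopfModule β Y) (a : A) (z : N ⊗[k] Y) :
    smashModuleA α N χ a z =
      χ.twist ((rightAction k A N).flip ∘ₗ α.act.toLinearMap.flip a) z := by
  induction z using TensorProduct.induction_on with
  | zero => simp
  | add y z hy hz => simp only [map_add, hy, hz]
  | tmul n y => 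
    rw [smashModuleA_tmul, HopfModule.twist_tmul]
    rfl

variable (N : Type*) [AddCommGroup N] [Module k N]
  [Module (SmashHopf α)ᵐᵒᵖ N] [IsScalarTower k (SmashHopf α)ᵐᵒᵖ N]

/-- The right action of `H` on a right `A # H`-module. -/
noncomputable def hopfRight : H →ₗ[k] N →ₗ[k] N :=
  (rightAction k (SmashHopf α) N).flip ∘ₗ (SmashHopf.ofHopf α).toLinearMap

variable {N}

lemma hopfRight_apply (h : H) (n : N) : hopfRight α N h n = op (SmashHopf.tmul α 1 h) • n := rfl

lemma hopfRight_mul (h h' : H) (n : N) :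
    hopfRight α N (h * h') n = hopfRight α N h' (hopfRight α N h n) := by
  rw [hopfRight_apply, hopfRight_apply, hopfRight_apply, smul_smul, ← op_mul,
    ← SmashHopf.ofHopf_apply, map_mul]
  rfl

lemma hopfRight_one (n : N) : hopfRight α N 1 n = n := one_smul _ n

lemma hopfRight_sum {ι : Type*} (s : Finset ι) (h : ι → H) (n : N) :
    hopfRight α N (∑ i ∈ s, h i) n = ∑ i ∈ s, hopfRight α N (h i) n := by
  rw [map_sum, LinearMap.sum_apply]

variable {Y : Type*} [AddCommGroup Y] [Module k Y] [Module Bᵐᵒᵖ Y] [IsScalarTower k Bᵐᵒᵖ Y]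
  (χ : HopfModule β Y)

/-- The map `n ⊗ y ↦ ∑ n y₋₁ ⊗ y₀`. -/
noncomputable def untwist : N ⊗[k] Y →ₗ[k] N ⊗[k] Y := χ.twist (hopfRight α N)

/-- The map `n ⊗ y ↦ ∑ n S(y₋₁) ⊗ y₀`. -/
noncomputable def retwist : N ⊗[k] Y →ₗ[k] N ⊗[k] Y :=
  χ.twist (hopfRight α N ∘ₗ HopfAlgebra.antipode k)

/-- The antipode is the convolution inverse of the identity, and the right action of H turns this
into inverse operators. -/
lemma retwist_untwist (z : N ⊗[k] Y) : retwist α χ (untwist α χ z) = z := by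
  rw [retwist, untwist, HopfModule.twist_twist]
  refine χ.twist_counit _ (fun h n => ?_) z
  have R := Coalgebra.Repr.arbitrary k h
  rw [convComp_apply _ _ h R]
  simp only [LinearMap.comp_apply, ← hopfRight_mul]
  rw [← hopfRight_sum, HopfAlgebra.sum_mul_antipode_eq_smul, map_smul, LinearMap.smul_apply,
    hopfRight_one]

lemma untwist_retwist (z : N ⊗[k] Y) : untwist α χ (retwist α χ z) = z := by
  rw [retwist, untwist, HopfModule.twist_twist]
  refine χ.twist_counit _ (fun h n => ?_) z
  have R := Coalgebra.Repr.arbitrary k h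
  rw [convComp_apply _ _ h R]
  simp only [LinearMap.comp_apply, ← hopfRight_mul]
  rw [← hopfRight_sum, HopfAlgebra.sum_antipode_mul_eq_smul, map_smul, LinearMap.smul_apply,
    hopfRight_one]


variable [Module Aᵐᵒᵖ N] [IsScalarTower k Aᵐᵒᵖ N]

/-- This is (1 # h)(a # g) = ∑ (h₁ ⇀ a) # h₂ g applied to n. The hypothesis that a # 1 acts as a
lets the first factor be read in the A-module N. -/
lemma hopfRight_smul (hN : ∀ (a : A) (n : N), op (SmashHopf.tmul α a 1) • n = op a • n)
    (h g : H) (a : A) (n : N) {ι : Type*} (R : Coalgebra.Repr k h ι) :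
    op (SmashHopf.tmul α a g) • hopfRight α N h n =
      ∑ i ∈ R.index, hopfRight α N (R.right i * g) (op (α.act (R.left i) a) • n) := by
  rw [hopfRight_apply, smul_smul, ← op_mul,
    SmashProduct.tmul_mul_tmul α _ 1 a h g R.index R.left R.right R.eq.symm, Finset.op_sum,
    Finset.sum_smul]
  refine Finset.sum_congr rfl fun i _ => ?_
  rw [hopfRight_apply, ← hN, smul_smul, ← op_mul, SmashProduct.tmul_one_mul_tmul, one_mul,
    mul_one]

lemma exists_sum_tmul {M₁ M₂ : Type*} [AddCommGroup M₁] [Module k M₁] [AddCommGroup M₂]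
    [Module k M₂] (z : M₁ ⊗[k] M₂) :
    ∃ (r : ℕ) (a : Fin r → M₁) (b : Fin r → M₂), z = ∑ i, a i ⊗ₜ b i := by
  obtain ⟨s, hs⟩ := TensorProduct.exists_finset z
  refine ⟨s.card, fun i => (s.equivFin.symm i).1.1, fun i => (s.equivFin.symm i).1.2, ?_⟩
  rw [hs, ← Finset.sum_coe_sort s, ← s.equivFin.symm.sum_comp]

/-- After untwisting, the coaction of Y no longer enters the action: A # B acts diagonally through
`smashDiag`. The point is that (n x₋₁)(a # b₋₁) already contains the twist n (x₋₂ ⇀ a) by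
`hopfRight_smul`. This makes N # Y functorial for all B-linear maps in Y. -/
lemma untwist_smul (hN : ∀ (a : A) (n : N), op (SmashHopf.tmul α a 1) • n = op a • n)
    (x : SmashProduct α β) (z : N ⊗[k] Y) :
    untwist α χ (smashModuleAct α N χ x z) =
      tensorAction N Y (untwist α χ z) (smashDiag α β x) := by
  induction x using SmashProduct.induction with
  | h₀ =>
    rw [map_zero, map_zero]
    exact (congrArg (untwist α χ) (LinearMap.map_zero₂ (smashModuleAct α N χ) z)).trans (map_zero _)
  | hadd x y hx hy =>
    rw [map_add, map_add, ← hx, ← hy, ← map_add]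
    exact congrArg (untwist α χ) (LinearMap.map_add₂ (smashModuleAct α N χ) x y z)
  | ht a b =>
    obtain ⟨r, g, c, hb⟩ := exists_sum_tmul (β.coact b)
    have h₁ : smashModuleAct α N χ (SmashProduct.tmul α β a b) z =
      ((rightAction k B Y).flip b).lTensor N (smashModuleA α N χ a z) :=
      LinearMap.congr_fun (smashModuleAct_tmul α N χ a b) z
    have h₂ : smashDiag α β (SmashProduct.tmul α β a b) =
      ∑ i, SmashHopf.tmul α a (g i) ⊗ₜ c i := by
      refine (smashDiagLin_tmul α β a b).trans ?_
      rw [hb, map_sum]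
      rfl
    rw [h₁, h₂, map_sum, smashModuleA_eq_twist, untwist, HopfModule.twist_smul χ _ b _ _ g c hb]
    refine Finset.sum_congr rfl fun i _ => ?_
    have h₃ (v : N ⊗[k] Y) : tensorAction N Y v (SmashHopf.tmul α a (g i) ⊗ₜ c i) =
        ((rightAction k B Y).flip (c i)).lTensor N
          (((rightAction k (SmashHopf α) N).flip (SmashHopf.tmul α a (g i))).rTensor Y v) := by
      induction v using TensorProduct.induction_on with
      | zero => simp
      | add y z hy hz => simp only [map_add, LinearMap.add_apply, hy, hz]
      | tmul n y => rfl
    rw [h₃, HopfModule.rTensor_twist, HopfModule.twist_twist]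
    refine congrArg (fun φ => ((rightAction k B Y).flip (c i)).lTensor N (χ.twist φ z))
      (LinearMap.ext fun h => LinearMap.ext fun n => ?_)
    have R := Coalgebra.Repr.arbitrary k h
    rw [convComp_apply _ _ h R]
    exact (hopfRight_smul α hN h (g i) a n R).symm

end Untwist

/-! ## The antipode and its inverse -/

section Antipode

open Coalgebra HopfAlgebra WithConv

variable {k H : Type*} [CommRing k] [Ring H] [HopfAlgebra k H]

/-- The antipode is an anti-morphism of coalgebras. -/
lemma HopfAlgebra.comul_antipode (h : H) {ι : Type*} (R : Coalgebra.Repr k h ι) :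
    comul (R := k) (antipode k h) =
      ∑ i ∈ R.index, antipode k (R.right i) ⊗ₜ[k] antipode k (R.left i) := by
  let l : H →ₐ[k] H ⊗[k] H := Algebra.TensorProduct.includeLeft
  let r : H →ₐ[k] H ⊗[k] H := Algebra.TensorProduct.includeRight
  let S : H →ₗ[k] H := antipode k
  have h₁ : toConv (l.toLinearMap ∘ₗ S) * toConv l.toLinearMap = 1 := by
    ext h
    rw [(Repr.arbitrary k h).convMul_apply]
    simp only [LinearMap.comp_apply, AlgHom.toLinearMap_apply, ← map_mul, ← map_sum, S]
    rw [sum_antipode_mul_eq_algebraMap_counit, AlgHom.commutes]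
    rfl
  have h₂ : toConv (r.toLinearMap ∘ₗ S) * toConv r.toLinearMap = 1 := by
    ext h
    rw [(Repr.arbitrary k h).convMul_apply]
    simp only [LinearMap.comp_apply, AlgHom.toLinearMap_apply, ← map_mul, ← map_sum, S]
    rw [sum_antipode_mul_eq_algebraMap_counit, AlgHom.commutes]
    rfl
  have h₃ : toConv (comul (R := k) (A := H)) = toConv l.toLinearMap * toConv r.toLinearMap := by
    ext h
    rw [(Repr.arbitrary k h).convMul_apply]
    simp [l, r, (Repr.arbitrary k h).eq]
  -- The coproduct is the convolution product of the two inclusions of H in H ⊗ H, so the product of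
  -- their inverses in reverse order is a left inverse of it. The coproduct composed with S is a
  -- right inverse, hence the two coincide.
  have h₄ : toConv (r.toLinearMap ∘ₗ S) * toConv (l.toLinearMap ∘ₗ S) *
      toConv (comul (R := k) (A := H)) = 1 := by
    rw [h₃, mul_assoc, ← mul_assoc (toConv (l.toLinearMap ∘ₗ S)), h₁, one_mul, h₂]
  have h₅ := left_inv_eq_right_inv h₄ LinearMap.comul_right_inv
  have h₆ := LinearMap.congr_fun (congrArg ofConv h₅) h
  refine h₆.symm.trans ?_
  rw [R.convMul_apply]
  simp [l, r, S]

/-- The inverse of the antipode. -/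
noncomputable def antipodeInv (hS : Function.Bijective (antipode k (A := H))) : H →ₗ[k] H :=
  (LinearEquiv.ofBijective (antipode k (A := H)) hS).symm.toLinearMap

variable (hS : Function.Bijective (antipode k (A := H)))

lemma antipode_antipodeInv (h : H) : antipode k (antipodeInv hS h) = h :=
  (LinearEquiv.ofBijective (antipode k (A := H)) hS).apply_symm_apply h

lemma antipodeInv_antipode (h : H) : antipodeInv hS (antipode k h) = h :=
  (LinearEquiv.ofBijective (antipode k (A := H)) hS).symm_apply_apply h

lemma antipodeInv_mul (h g : H) : antipodeInv hS (h * g) = antipodeInv hS g * antipodeInv hS h := by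
  apply hS.1
  rw [antipode_mul_antidistrib, antipode_antipodeInv, antipode_antipodeInv, antipode_antipodeInv]

/-- Applying the injective map S, which reverses products, turns this into the usual antipode
identity. Thus S⁻¹ is an antipode for the opposite coproduct. -/
lemma sum_mul_antipodeInv (h : H) {ι : Type*} (R : Coalgebra.Repr k h ι) :
    ∑ i ∈ R.index, R.right i * antipodeInv hS (R.left i) =
      algebraMap k H (counit (R := k) h) := by
  apply hS.1
  simp only [map_sum, antipode_mul_antidistrib, antipode_antipodeInv]
  rw [sum_mul_antipode_eq_algebraMap_counit, Algebra.algebraMap_eq_smul_one, map_smul,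
    antipode_one]

lemma sum_antipodeInv_mul (h : H) {ι : Type*} (R : Coalgebra.Repr k h ι) :
    ∑ i ∈ R.index, antipodeInv hS (R.right i) * R.left i =
      algebraMap k H (counit (R := k) h) := by
  apply hS.1
  simp only [map_sum, antipode_mul_antidistrib, antipode_antipodeInv]
  rw [sum_antipode_mul_eq_algebraMap_counit, Algebra.algebraMap_eq_smul_one, map_smul,
    antipode_one]

lemma comul_antipodeInv (h : H) {ι : Type*} (R : Coalgebra.Repr k h ι) :
    comul (R := k) (antipodeInv hS h) =
      ∑ i ∈ R.index, antipodeInv hS (R.right i) ⊗ₜ[k] antipodeInv hS (R.left i) := by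
  have h₁ := comul_antipode (k := k) (antipodeInv hS h)
    (Repr.arbitrary k (antipodeInv hS h))
  rw [antipode_antipodeInv] at h₁
  have h₂ : ∑ i ∈ R.index, antipodeInv hS (R.right i) ⊗ₜ[k] antipodeInv hS (R.left i) =
      TensorProduct.map (antipodeInv hS) (antipodeInv hS)
        (TensorProduct.comm k H H (comul (R := k) h)) := by
    simp [← R.eq]
  rw [h₂, h₁]
  simp [antipodeInv_antipode, (Repr.arbitrary k (antipodeInv hS h)).eq]

end Antipode

/-! ## The coaction on maps -/

section HomCoact

open HopfAlgebra

variable {k H B : Type*} [CommRing k] [Ring H] [HopfAlgebra k H] [Ring B] [Algebra k B]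
  (hS : Function.Bijective (antipode k (A := H))) {β : ComoduleAlgebra k H B}
  {X : Type*} [AddCommGroup X] [Module k X] [Module Bᵐᵒᵖ X] [IsScalarTower k Bᵐᵒᵖ X]
  (χ : HopfModule β X)

/-- The map `h ⊗ x ↦ ∑ x₋₁ S⁻¹(h) ⊗ x₀`. -/
noncomputable def leftTwist : H ⊗[k] X →ₗ[k] H ⊗[k] X :=
  χ.twist ((LinearMap.mul k H).compl₂ (antipodeInv hS))

lemma leftTwist_tmul (h : H) (x : X) : leftTwist hS χ (h ⊗ₜ x) =
    (LinearMap.mulRight k (antipodeInv hS h)).rTensor X (χ.coact x) := rfl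

/-- The map `h ⊗ x ↦ ∑ S(h) x₋₁ ⊗ x₀`. -/
noncomputable def leftUntwist : H ⊗[k] X →ₗ[k] H ⊗[k] X :=
  χ.twist ((LinearMap.mul k H).flip.compl₂ (antipode k))

lemma leftUntwist_tmul (h : H) (x : X) : leftUntwist χ (h ⊗ₜ x) =
    (LinearMap.mulLeft k (antipode k h)).rTensor X (χ.coact x) := rfl

lemma leftUntwist_leftTwist (z : H ⊗[k] X) : leftUntwist χ (leftTwist hS χ z) = z := by
  rw [leftTwist, leftUntwist, HopfModule.twist_twist]
  refine χ.twist_counit _ (fun h n => ?_) z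
  have R := Coalgebra.Repr.arbitrary k h
  rw [convComp_apply _ _ h R]
  simp only [LinearMap.compl₂_apply, LinearMap.flip_apply, LinearMap.mul_apply',
    antipode_mul_antidistrib, antipode_antipodeInv, mul_assoc, ← Finset.mul_sum]
  rw [sum_antipode_mul_eq_smul]
  simp

lemma leftTwist_leftUntwist (z : H ⊗[k] X) : leftTwist hS χ (leftUntwist χ z) = z := by
  rw [leftTwist, leftUntwist, HopfModule.twist_twist]
  refine χ.twist_counit _ (fun h n => ?_) z
  have R := Coalgebra.Repr.arbitrary k h
  rw [convComp_apply _ _ h R]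
  simp only [LinearMap.compl₂_apply, LinearMap.flip_apply, LinearMap.mul_apply',
    antipodeInv_mul, antipodeInv_antipode, ← mul_assoc, ← Finset.sum_mul]
  rw [sum_mul_antipodeInv, Algebra.algebraMap_eq_smul_one, smul_mul_assoc, one_mul]

/-- The action of `B` on `H ⊗ X` through `X`. -/
lemma tensorAction_one_tmul (z : H ⊗[k] X) (b : B) :
    tensorAction H X z ((1 : H) ⊗ₜ[k] b) = ((rightAction k B X).flip b).lTensor H z := by
  induction z using TensorProduct.induction_on with
  | zero => simp
  | add y z hy hz => simp only [map_add, LinearMap.add_apply, hy, hz]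
  | tmul n y => simp [rightAction_apply]

/-- Since ρ(xb) = ρ(x)ρ(b), the factor b₋₁ appears on the right of x₋₁, away from S(h). So the
action on X alone becomes the diagonal action. -/
lemma leftUntwist_smul (z : H ⊗[k] X) (b : B) :
    leftUntwist χ (tensorAction H X z ((1 : H) ⊗ₜ[k] b)) =
      tensorAction H X (leftUntwist χ z) (β.coact b) := by
  obtain ⟨r, g, c, hb⟩ := exists_sum_tmul (β.coact b)
  rw [tensorAction_one_tmul, leftUntwist, HopfModule.twist_smul χ _ b _ _ g c hb, hb, map_sum]
  refine Finset.sum_congr rfl fun i _ => ?_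
  have h₃ (v : H ⊗[k] X) : tensorAction H X v (g i ⊗ₜ c i) =
      ((rightAction k B X).flip (c i)).lTensor H ((LinearMap.mulRight k (g i)).rTensor X v) := by
    induction v using TensorProduct.induction_on with
    | zero => simp
    | add y z hy hz => simp only [map_add, LinearMap.add_apply, hy, hz]
    | tmul n y => rfl
  rw [h₃, HopfModule.rTensor_twist]
  refine congrArg (fun φ => ((rightAction k B X).flip (c i)).lTensor H (χ.twist φ z))
    (LinearMap.ext fun h => LinearMap.ext fun n => ?_)
  simp [mul_assoc]

lemma leftTwist_smul (z : H ⊗[k] X) (b : B) :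
    leftTwist hS χ (tensorAction H X z (β.coact b)) =
      tensorAction H X (leftTwist hS χ z) ((1 : H) ⊗ₜ[k] b) := by
  rw [← leftUntwist_leftTwist hS χ z, ← leftUntwist_smul, leftTwist_leftUntwist,
    leftUntwist_leftTwist]

/-- The inverse antipode reverses the coproduct, so Δ(x₋₁ S⁻¹(h)) has h₂ in its first factor and h₁
in its second. Coassociativity of X does the rest. -/
lemma leftTwist_coassoc (h : H) (x : X) {ι : Type*} (R : Coalgebra.Repr k h ι) :
    ∑ i ∈ R.index, (leftTwist hS χ ∘ₗ TensorProduct.mk k H X (R.left i)).lTensor H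
        (leftTwist hS χ (R.right i ⊗ₜ x)) =
      TensorProduct.assoc k H H X
        ((Coalgebra.comul (R := k) (A := H)).rTensor X (leftTwist hS χ (h ⊗ₜ x))) := by
  let Λ : H ⊗[k] (H ⊗[k] X) →ₗ[k] H ⊗[k] (H ⊗[k] X) := ∑ i ∈ R.index,
    TensorProduct.map (LinearMap.mulRight k (antipodeInv hS (R.right i)))
      ((LinearMap.mulRight k (antipodeInv hS (R.left i))).rTensor X)
  have h₁ : ∑ i ∈ R.index, (leftTwist hS χ ∘ₗ TensorProduct.mk k H X (R.left i)).lTensor H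
      (leftTwist hS χ (R.right i ⊗ₜ x)) = Λ (χ.coact.lTensor H (χ.coact x)) := by
    simp only [leftTwist_tmul, Λ, LinearMap.sum_apply]
    refine Finset.sum_congr rfl fun i _ => ?_
    induction χ.coact x using TensorProduct.induction_on with
    | zero => simp
    | add y z hy hz => simp only [map_add, hy, hz]
    | tmul g y => simp [leftTwist_tmul]
  have h₂ : TensorProduct.assoc k H H X
      ((Coalgebra.comul (R := k) (A := H)).rTensor X (leftTwist hS χ (h ⊗ₜ x))) =
      Λ (TensorProduct.assoc k H H X
        ((Coalgebra.comul (R := k) (A := H)).rTensor X (χ.coact x))) := by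
    rw [leftTwist_tmul]
    induction χ.coact x using TensorProduct.induction_on with
    | zero => simp
    | add y z hy hz => simp only [map_add, hy, hz]
    | tmul g y =>
      simp only [LinearMap.rTensor_tmul, LinearMap.mulRight_apply, Bialgebra.comul_mul,
        comul_antipodeInv hS h R]
      induction Coalgebra.comul (R := k) g using TensorProduct.induction_on with
      | zero => simp
      | add y z hy hz => simp only [map_add, add_mul, TensorProduct.add_tmul, hy, hz]
      | tmul g' g'' =>
        simp [Λ, Finset.mul_sum, TensorProduct.sum_tmul]
  rw [h₁, h₂, χ.coassoc]

/-- The map `x ↦ ∑ g(x₀)₋₁ S⁻¹(x₋₁) ⊗ g(x₀)₀`. -/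
noncomputable def mapCoact {Q : Type*} [AddCommGroup Q] [Module k Q] [Module Bᵐᵒᵖ Q]
    [IsScalarTower k Bᵐᵒᵖ Q] (θ : HopfModule β Q) (g : Q →ₗ[k] X) : Q →ₗ[k] H ⊗[k] X :=
  leftTwist hS χ ∘ₗ g.lTensor H ∘ₗ θ.coact

variable {Q : Type*} [AddCommGroup Q] [Module k Q] [Module Bᵐᵒᵖ Q]
    [IsScalarTower k Bᵐᵒᵖ Q] (θ : HopfModule β Q)

/-- A linear map Q → H ⊗ X need not be an element of H ⊗ Hom(Q, X), so coassociativity can be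
expressed only after a finite decomposition into maps g'ᵢ is given. -/
lemma mapCoact_coassoc (g : Q →ₗ[k] X) (x : Q) {r : ℕ} (h : Fin r → H) (g' : Fin r → Q →ₗ[k] X)
    (hg : ∀ x, mapCoact hS χ θ g x = ∑ i, h i ⊗ₜ g' i x) :
    ∑ i, h i ⊗ₜ mapCoact hS χ θ (g' i) x =
      TensorProduct.assoc k H H X
        ((Coalgebra.comul (R := k) (A := H)).rTensor X (mapCoact hS χ θ g x)) := by
  let Λ : H ⊗[k] (H ⊗[k] Q) →ₗ[k] H ⊗[k] (H ⊗[k] X) := TensorProduct.lift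
    (LinearMap.lcomp k _ (leftTwist hS χ ∘ₗ g.lTensor H) ∘ₗ LinearMap.lTensorHom H ∘ₗ
      LinearMap.compRight k (leftTwist hS χ) ∘ₗ TensorProduct.mk k H X)
  have hΛ (p : H) (z : H ⊗[k] Q) : Λ (p ⊗ₜ z) =
    (leftTwist hS χ ∘ₗ TensorProduct.mk k H X p).lTensor H (leftTwist hS χ (g.lTensor H z)) := rfl
  have h₁ : ∑ i, h i ⊗ₜ mapCoact hS χ θ (g' i) x = Λ (θ.coact.lTensor H (θ.coact x)) := by
    simp only [mapCoact, LinearMap.comp_apply]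
    induction θ.coact x using TensorProduct.induction_on with
    | zero => simp
    | add y z hy hz =>
      simp only [map_add, TensorProduct.tmul_add, Finset.sum_add_distrib, hy, hz]
    | tmul p y =>
      have hy := hg y
      simp only [mapCoact, LinearMap.comp_apply] at hy
      simp only [LinearMap.lTensor_tmul, hΛ, hy, map_sum]
      rfl
  have h₂ : TensorProduct.assoc k H H X
        ((Coalgebra.comul (R := k) (A := H)).rTensor X (mapCoact hS χ θ g x)) =
      Λ (TensorProduct.assoc k H H Q
        ((Coalgebra.comul (R := k) (A := H)).rTensor Q (θ.coact x))) := by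
    simp only [mapCoact, LinearMap.comp_apply]
    induction θ.coact x using TensorProduct.induction_on with
    | zero => simp
    | add y z hy hz => simp only [map_add, hy, hz]
    | tmul p y =>
      have R := Coalgebra.Repr.arbitrary k p
      rw [LinearMap.lTensor_tmul, ← leftTwist_coassoc hS χ p (g y) R, LinearMap.rTensor_tmul,
        ← R.eq, TensorProduct.sum_tmul, map_sum, map_sum]
      simp [hΛ]
  rw [h₁, h₂, θ.coassoc]

variable {A : Type*} [Ring A] [Algebra k A] (α : ModuleAlgebra k H A)
  {N : Type*} [AddCommGroup N] [Module k N]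
  [Module (SmashHopf α)ᵐᵒᵖ N] [IsScalarTower k (SmashHopf α)ᵐᵒᵖ N]

/-- Conjugating `id ⊗ g` by the untwisting. -/
lemma retwist_lTensor_untwist (g : Q →ₗ[k] X) (n : N) (x : Q) :
    retwist α χ (g.lTensor N (untwist α θ (n ⊗ₜ[k] x))) =
      ((hopfRight α N ∘ₗ antipode k).flip n).rTensor X (mapCoact hS χ θ g x) := by
  simp only [mapCoact, LinearMap.comp_apply, untwist, HopfModule.twist_tmul]
  induction θ.coact x using TensorProduct.induction_on with
  | zero => simp
  | add y z hy hz => simp only [map_add, hy, hz]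
  | tmul p y =>
    simp only [LinearMap.rTensor_tmul, LinearMap.lTensor_tmul, leftTwist_tmul, retwist,
      HopfModule.twist_tmul]
    rw [← LinearMap.rTensor_comp_apply]
    refine congrArg (fun f : H →ₗ[k] N => f.rTensor X (χ.coact (g y)))
      (LinearMap.ext fun q => ?_)
    simp [antipode_mul_antidistrib, antipode_antipodeInv, hopfRight_mul]

end HomCoact

/-! ## Exact functors between categories of modules -/

section ExactFunctor

open Limits

variable {R R' : Type u} [Ring R] [Ring R']

lemma ModuleCat.exact_of_shortExact {S : ShortComplex (ModuleCat.{u} R)} (hS : S.ShortExact) :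
    Function.Exact S.f S.g :=
  (ShortComplex.ShortExact.moduleCat_exact_iff_function_exact _).1 hS.exact

lemma ModuleCat.preservesFinite_of_exact (F : ModuleCat.{u} R ⥤ ModuleCat.{u} R') [F.Additive]
    (h : ∀ S : ShortComplex (ModuleCat.{u} R), S.ShortExact →
      Function.Exact (F.map S.f) (F.map S.g) ∧ Function.Injective (F.map S.f) ∧
        Function.Surjective (F.map S.g)) :
    PreservesFiniteLimits F ∧ PreservesFiniteColimits F :=
  ((Functor.exact_tfae F).out 0 3).1 fun S hS =>
    ModuleCat.shortComplex_shortExact (S.map F) (h S hS).1 (h S hS).2.1 (h S hS).2.2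

end ExactFunctor

/-! ### The exact functor N ⊗ - with a diagonal action. -/

section DiagFunctor

open Limits
open scoped ModuleCat

variable {k : Type u} [Field k] {R T B : Type u} [Ring R] [Algebra k R] [Ring T] [Algebra k T]
  [Ring B] [Algebra k B]

lemma tensorAction_map {N N' Y Y' : Type*} [AddCommGroup N] [Module k N] [Module Tᵐᵒᵖ N]
    [IsScalarTower k Tᵐᵒᵖ N] [AddCommGroup N'] [Module k N'] [Module Tᵐᵒᵖ N']
    [IsScalarTower k Tᵐᵒᵖ N'] [AddCommGroup Y] [Module k Y] [Module Bᵐᵒᵖ Y]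
    [IsScalarTower k Bᵐᵒᵖ Y] [AddCommGroup Y'] [Module k Y'] [Module Bᵐᵒᵖ Y']
    [IsScalarTower k Bᵐᵒᵖ Y'] (u : N →ₗ[Tᵐᵒᵖ] N') (v : Y →ₗ[Bᵐᵒᵖ] Y') (z : N ⊗[k] Y)
    (t : T ⊗[k] B) :
    TensorProduct.map (u.restrictScalars k) (v.restrictScalars k) (tensorAction N Y z t) =
      tensorAction N' Y' (TensorProduct.map (u.restrictScalars k) (v.restrictScalars k) z) t := by
  induction z using TensorProduct.induction_on with
  | zero => simp
  | add y z hy hz => simp only [map_add, LinearMap.add_apply, hy, hz]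
  | tmul n y =>
    induction t using TensorProduct.induction_on with
    | zero => simp
    | add y z hy hz => simp only [map_add, hy, hz]
    | tmul t b => simp [rightAction_apply]

variable (f : R →ₐ[k] T ⊗[k] B)
  (N : Type u) [AddCommGroup N] [Module k N] [Module Tᵐᵒᵖ N] [IsScalarTower k Tᵐᵒᵖ N]

/-- The linear map of diagonal modules given by a pair of linear maps. -/
noncomputable def DiagModule.map {N N' Y Y' : Type*} [AddCommGroup N] [Module k N] [Module Tᵐᵒᵖ N]
    [IsScalarTower k Tᵐᵒᵖ N] [AddCommGroup N'] [Module k N'] [Module Tᵐᵒᵖ N']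
    [IsScalarTower k Tᵐᵒᵖ N'] [AddCommGroup Y] [Module k Y] [Module Bᵐᵒᵖ Y]
    [IsScalarTower k Bᵐᵒᵖ Y] [AddCommGroup Y'] [Module k Y'] [Module Bᵐᵒᵖ Y']
    [IsScalarTower k Bᵐᵒᵖ Y'] (u : N →ₗ[Tᵐᵒᵖ] N') (v : Y →ₗ[Bᵐᵒᵖ] Y') :
    DiagModule f N Y →ₗ[Rᵐᵒᵖ] DiagModule f N' Y' where
  toFun := TensorProduct.map (u.restrictScalars k) (v.restrictScalars k)
  map_add' := map_add (TensorProduct.map (u.restrictScalars k) (v.restrictScalars k))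
  map_smul' r z := tensorAction_map u v z (f r.unop)

/-- The functor `Y ↦ N ⊗ Y` from right `B`-modules to right `R`-modules. -/
noncomputable def diagFunctor : ModuleCat.{u} Bᵐᵒᵖ ⥤ ModuleCat.{u} Rᵐᵒᵖ where
  obj Y := ModuleCat.of Rᵐᵒᵖ (DiagModule f N Y)
  map {Y Y'} g := ModuleCat.ofHom (X := DiagModule f N Y) (Y := DiagModule f N Y')
    (DiagModule.map f (LinearMap.id : N →ₗ[Tᵐᵒᵖ] N) g.hom)
  map_id Y := ModuleCat.hom_ext (LinearMap.ext fun z => LinearMap.congr_fun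
    (TensorProduct.map_id (R := k) (M := N) (N := Y)) z)
  map_comp g g' := ModuleCat.hom_ext (LinearMap.ext fun z => LinearMap.congr_fun
    (LinearMap.lTensor_comp N (g'.hom.restrictScalars k) (g.hom.restrictScalars k)) z)

instance : (diagFunctor f N).Additive where
  map_add {Y Y'} {g g'} := by
    ext z
    exact LinearMap.congr_fun (LinearMap.lTensor_add N (g.hom.restrictScalars k)
      (g'.hom.restrictScalars k)) z

lemma diagFunctor_exact :
    PreservesFiniteLimits (diagFunctor f N) ∧ PreservesFiniteColimits (diagFunctor f N) := by
  refine ModuleCat.preservesFinite_of_exact _ fun S hS => ⟨?_, ?_, ?_⟩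
  · exact lTensor_exact N (f := S.f.hom.restrictScalars k) (g := S.g.hom.restrictScalars k)
      (ModuleCat.exact_of_shortExact hS) hS.moduleCat_surjective_g
  · exact Module.Flat.lTensor_preserves_injective_linearMap (S.f.hom.restrictScalars k)
      hS.moduleCat_injective_f
  · exact LinearMap.lTensor_surjective N (g := S.g.hom.restrictScalars k)
      hS.moduleCat_surjective_g

instance : PreservesFiniteLimits (diagFunctor f N) := (diagFunctor_exact f N).1

instance : PreservesFiniteColimits (diagFunctor f N) := (diagFunctor_exact f N).2

lemma DiagModule.algebraMap_smul (Y : Type*) [AddCommGroup Y] [Module k Y] [Module Bᵐᵒᵖ Y]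
    [IsScalarTower k Bᵐᵒᵖ Y] (r : k) (z : DiagModule f N Y) :
    algebraMap k Rᵐᵒᵖ r • z = r • z := _root_.algebraMap_smul _ _ _

instance : (diagFunctor f N).Linear k where
  map_smul {Y Y'} g r := by
    ext z
    refine (LinearMap.congr_fun (LinearMap.lTensor_smul N r (g.hom.restrictScalars k)) z).trans ?_
    exact (DiagModule.algebraMap_smul f N Y' r ((diagFunctor f N).map g z)).symm

variable {N} {N' : Type u} [AddCommGroup N'] [Module k N'] [Module Tᵐᵒᵖ N']
  [IsScalarTower k Tᵐᵒᵖ N']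

/-- The natural transformation given by a `T`-linear map. -/
noncomputable def diagNatTrans (u : N →ₗ[Tᵐᵒᵖ] N') : diagFunctor f N ⟶ diagFunctor f N' where
  app Y := ModuleCat.ofHom (DiagModule.map f u LinearMap.id)
  naturality Y Y' g := by
    ext z
    exact (LinearMap.congr_fun (LinearMap.rTensor_comp_lTensor (f := u.restrictScalars k)
      (g := g.hom.restrictScalars k)) z).trans (LinearMap.congr_fun (LinearMap.lTensor_comp_rTensor
        (f := u.restrictScalars k) (g := g.hom.restrictScalars k)) z).symm

end DiagFunctor

/-! ### The exact functor N ↦ N # Y. -/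

section SmashFunctor

open Limits
open scoped ModuleCat

variable {k : Type u} [Field k] {H A B : Type u} [Ring H] [Bialgebra k H] [Ring A] [Algebra k A]
  [Ring B] [Algebra k B] (α : ModuleAlgebra k H A) {β : ComoduleAlgebra k H B}
  {Y : Type u} [AddCommGroup Y] [Module k Y] [Module Bᵐᵒᵖ Y] [IsScalarTower k Bᵐᵒᵖ Y]
  (χ : HopfModule β Y)
  {Y' : Type u} [AddCommGroup Y'] [Module k Y'] [Module Bᵐᵒᵖ Y'] [IsScalarTower k Bᵐᵒᵖ Y']
  (χ' : HopfModule β Y')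

lemma smashModuleAct_smashTmul (N : Type*) [AddCommGroup N] [Module k N] [Module Aᵐᵒᵖ N]
    [IsScalarTower k Aᵐᵒᵖ N] (a : A) (b : B) (z : N ⊗[k] Y) :
    smashModuleAct α N χ (SmashProduct.tmul α β a b) z =
      ((rightAction k B Y).flip b).lTensor N (smashModuleA α N χ a z) :=
  LinearMap.congr_fun (smashModuleAct_tmul α N χ a b) z

lemma smashModuleAct_map {N N' : Type*} [AddCommGroup N] [Module k N] [Module Aᵐᵒᵖ N]
    [IsScalarTower k Aᵐᵒᵖ N] [AddCommGroup N'] [Module k N'] [Module Aᵐᵒᵖ N']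
    [IsScalarTower k Aᵐᵒᵖ N'] (u : N →ₗ[Aᵐᵒᵖ] N') (v : Y →ₗ[Bᵐᵒᵖ] Y')
    (hv : ∀ y, χ'.coact (v y) = (v.restrictScalars k).lTensor H (χ.coact y)) (z : N ⊗[k] Y)
    (x : SmashProduct α β) :
    TensorProduct.map (u.restrictScalars k) (v.restrictScalars k) (smashModuleAct α N χ x z) =
      smashModuleAct α N' χ' x
        (TensorProduct.map (u.restrictScalars k) (v.restrictScalars k) z) := by
  induction x using SmashProduct.induction with
  | h₀ =>
    refine (congrArg _ (LinearMap.map_zero₂ (smashModuleAct α N χ) z)).trans ?_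
    rw [map_zero]
    exact (LinearMap.map_zero₂ (smashModuleAct α N' χ') _).symm
  | hadd x y hx hy =>
    refine (congrArg _ (LinearMap.map_add₂ (smashModuleAct α N χ) x y z)).trans ?_
    rw [map_add, hx, hy]
    exact (LinearMap.map_add₂ (smashModuleAct α N' χ') x y _).symm
  | ht a b =>
    rw [smashModuleAct_smashTmul, smashModuleAct_smashTmul]
    induction z using TensorProduct.induction_on with
    | zero => simp
    | add y z hy hz => simp only [map_add, hy, hz]
    | tmul n y =>
      rw [TensorProduct.map_tmul, smashModuleA_tmul, smashModuleA_tmul,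
        LinearMap.restrictScalars_apply, LinearMap.restrictScalars_apply, hv]
      induction χ.coact y using TensorProduct.induction_on with
      | zero => simp
      | add y z hy hz => simp only [map_add, hy, hz]
      | tmul h y => simp [rightAction_apply]

/-- The linear map `N # Y → N' # Y'` given by a linear map and a map of Hopf modules. -/
noncomputable def SmashModule.map {N N' : Type*} [AddCommGroup N] [Module k N] [Module Aᵐᵒᵖ N]
    [IsScalarTower k Aᵐᵒᵖ N] [AddCommGroup N'] [Module k N'] [Module Aᵐᵒᵖ N']
    [IsScalarTower k Aᵐᵒᵖ N'] (u : N →ₗ[Aᵐᵒᵖ] N') (v : Y →ₗ[Bᵐᵒᵖ] Y')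
    (hv : ∀ y, χ'.coact (v y) = (v.restrictScalars k).lTensor H (χ.coact y)) :
    SmashModule α N χ →ₗ[(SmashProduct α β)ᵐᵒᵖ] SmashModule α N' χ' where
  toFun := TensorProduct.map (u.restrictScalars k) (v.restrictScalars k)
  map_add' := map_add (TensorProduct.map (u.restrictScalars k) (v.restrictScalars k))
  map_smul' r z := smashModuleAct_map α χ χ' u v hv z r.unop

/-- The functor `N ↦ N # Y`. -/
noncomputable def smashFunctor : ModuleCat.{u} Aᵐᵒᵖ ⥤ ModuleCat.{u} (SmashProduct α β)ᵐᵒᵖ where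
  obj N := ModuleCat.of (SmashProduct α β)ᵐᵒᵖ (SmashModule α N χ)
  map {N N'} g := ModuleCat.ofHom (X := SmashModule α N χ) (Y := SmashModule α N' χ)
    (SmashModule.map α χ χ g.hom (LinearMap.id : Y →ₗ[Bᵐᵒᵖ] Y)
    (fun y => (LinearMap.congr_fun (LinearMap.lTensor_id H Y) (χ.coact y)).symm))
  map_id N := ModuleCat.hom_ext (LinearMap.ext fun z => LinearMap.congr_fun
    (TensorProduct.map_id (R := k) (M := N) (N := Y)) z)
  map_comp g g' := ModuleCat.hom_ext (LinearMap.ext fun z => LinearMap.congr_fun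
    (LinearMap.rTensor_comp Y (g'.hom.restrictScalars k) (g.hom.restrictScalars k)) z)

instance : (smashFunctor α χ).Additive where
  map_add {N N'} {g g'} := by
    ext z
    exact LinearMap.congr_fun (LinearMap.rTensor_add Y (g.hom.restrictScalars k)
      (g'.hom.restrictScalars k)) z

lemma smashFunctor_exact :
    PreservesFiniteLimits (smashFunctor α χ) ∧ PreservesFiniteColimits (smashFunctor α χ) := by
  refine ModuleCat.preservesFinite_of_exact _ fun S hS => ⟨?_, ?_, ?_⟩
  · exact rTensor_exact Y (f := S.f.hom.restrictScalars k) (g := S.g.hom.restrictScalars k)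
      (ModuleCat.exact_of_shortExact hS) hS.moduleCat_surjective_g
  · exact Module.Flat.rTensor_preserves_injective_linearMap (S.f.hom.restrictScalars k)
      hS.moduleCat_injective_f
  · exact LinearMap.rTensor_surjective Y (g := S.g.hom.restrictScalars k)
      hS.moduleCat_surjective_g

instance : PreservesFiniteLimits (smashFunctor α χ) := (smashFunctor_exact α χ).1

instance : PreservesFiniteColimits (smashFunctor α χ) := (smashFunctor_exact α χ).2

lemma SmashModule.algebraMap_smul (N : Type*) [AddCommGroup N] [Module k N] [Module Aᵐᵒᵖ N]
    [IsScalarTower k Aᵐᵒᵖ N] (r : k) (z : SmashModule α N χ) :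
    algebraMap k (SmashProduct α β)ᵐᵒᵖ r • z = r • z := _root_.algebraMap_smul _ _ _

instance : (smashFunctor α χ).Linear k where
  map_smul {N N'} g r := by
    ext z
    refine (LinearMap.congr_fun (LinearMap.rTensor_smul Y r (g.hom.restrictScalars k)) z).trans ?_
    exact (SmashModule.algebraMap_smul α χ N' r ((smashFunctor α χ).map g z)).symm

variable {χ χ'} in
/-- The natural transformation given by a map of Hopf modules. -/
noncomputable def smashNatTrans (v : Y →ₗ[Bᵐᵒᵖ] Y')
    (hv : ∀ y, χ'.coact (v y) = (v.restrictScalars k).lTensor H (χ.coact y)) :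
    smashFunctor α χ ⟶ smashFunctor α χ' where
  app N := ModuleCat.ofHom (SmashModule.map α χ χ' LinearMap.id v hv)
  naturality N N' g := by
    ext z
    exact (LinearMap.congr_fun (LinearMap.lTensor_comp_rTensor
      (f := g.hom.restrictScalars k) (g := v.restrictScalars k))
        z).trans (LinearMap.congr_fun (LinearMap.rTensor_comp_lTensor
        (f := g.hom.restrictScalars k) (g := v.restrictScalars k)) z).symm

end SmashFunctor

/-! ## Restriction to `A` -/

section SmashRestrict

open Limits
open scoped ModuleCat

/-- A projective S-module is a direct summand of a direct sum of copies of S, and this splitting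
survives restriction to R. -/
lemma ModuleCat.projective_restrictScalars {R S : Type u} [Ring R] [Ring S] (f : R →+* S)
    (h : Module.Projective R ((ModuleCat.restrictScalars f).obj (ModuleCat.of S S)))
    (P : ModuleCat.{u} S) [Projective P] : Projective ((ModuleCat.restrictScalars f).obj P) := by
  have : Module.Projective S P := P.projective_of_module_projective
  obtain ⟨s, hs⟩ := Module.projective_def'.1 this
  classical
  have e : (P →₀ (ModuleCat.restrictScalars f).obj (ModuleCat.of S S)) ≃ₗ[R]
    Π₀ _ : P, (ModuleCat.restrictScalars f).obj (ModuleCat.of S S) := finsuppLequivDFinsupp R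
  have : Module.Projective R (P →₀ (ModuleCat.restrictScalars f).obj (ModuleCat.of S S)) :=
    Module.Projective.of_equiv e.symm
  let i : (ModuleCat.restrictScalars f).obj P →ₗ[R]
      (P →₀ (ModuleCat.restrictScalars f).obj (ModuleCat.of S S)) :=
    { toFun := s
      map_add' := s.map_add
      map_smul' r x := s.map_smul (f r) x }
  let t : (P →₀ (ModuleCat.restrictScalars f).obj (ModuleCat.of S S)) →ₗ[R]
      (ModuleCat.restrictScalars f).obj P :=
    { toFun := Finsupp.linearCombination S (id : P → P)
      map_add' := (Finsupp.linearCombination S (id : P → P)).map_add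
      map_smul' r x := (Finsupp.linearCombination S (id : P → P)).map_smul (f r) x }
  have : Module.Projective R ((ModuleCat.restrictScalars f).obj P) :=
    Module.Projective.of_split i t (LinearMap.ext fun x => LinearMap.congr_fun hs x)
  exact ((ModuleCat.restrictScalars f).obj P).projective_of_categoryTheory_projective

variable {k : Type u} [Field k] {H A B : Type u} [Ring H] [HopfAlgebra k H] [Ring A] [Algebra k A]
  [Ring B] [Algebra k B] (α : ModuleAlgebra k H A) {β : ComoduleAlgebra k H B}

/-- The inclusion `a ↦ a # 1`. -/
noncomputable def SmashHopf.ofA : A →ₐ[k] SmashHopf α :=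
  AlgHom.ofLinearMap (show A →ₗ[k] SmashHopf α from (TensorProduct.mk k A H).flip 1) rfl
    (fun a a' => (SmashProduct.tmul_one_mul_tmul α _ a a' 1).symm)

/-- The restriction of right `A # H`-modules to `A`. -/
noncomputable def smashRes : ModuleCat.{u} (SmashHopf α)ᵐᵒᵖ ⥤ ModuleCat.{u} Aᵐᵒᵖ :=
  ModuleCat.restrictScalars (AlgHom.op (SmashHopf.ofA α)).toRingHom

noncomputable instance (N : ModuleCat.{u} (SmashHopf α)ᵐᵒᵖ) :
    Module (SmashHopf α)ᵐᵒᵖ ((smashRes α).obj N) :=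
  N.isModule

lemma smashRes_smul (N : ModuleCat.{u} (SmashHopf α)ᵐᵒᵖ) (a : A) (n : (smashRes α).obj N) :
    op (SmashHopf.tmul α a 1) • n = op a • n := rfl

lemma smashRes_smul_eq (N : ModuleCat.{u} (SmashHopf α)ᵐᵒᵖ) (r : k) (n : (smashRes α).obj N) :
    r • n = algebraMap k (SmashHopf α)ᵐᵒᵖ r • n := by
  have : algebraMap k (SmashHopf α)ᵐᵒᵖ r = op (SmashHopf.ofA α (algebraMap k A r)) := by
    rw [AlgHom.commutes]
    rfl
  rw [this]
  rfl

instance (N : ModuleCat.{u} (SmashHopf α)ᵐᵒᵖ) :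
    IsScalarTower k (SmashHopf α)ᵐᵒᵖ ((smashRes α).obj N) where
  smul_assoc r s n := by
    rw [smashRes_smul_eq, smul_smul, Algebra.smul_def]

instance : (smashRes α).Additive :=
  inferInstanceAs (ModuleCat.restrictScalars _).Additive

lemma smashRes_exact :
    PreservesFiniteLimits (smashRes α) ∧ PreservesFiniteColimits (smashRes α) :=
  ModuleCat.preservesFinite_of_exact _ fun _ hS =>
    ⟨ModuleCat.exact_of_shortExact hS, hS.moduleCat_injective_f, hS.moduleCat_surjective_g⟩

instance : PreservesFiniteLimits (smashRes α) := (smashRes_exact α).1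

instance : PreservesFiniteColimits (smashRes α) := (smashRes_exact α).2

variable {Y : Type u} [AddCommGroup Y] [Module k Y] [Module Bᵐᵒᵖ Y] [IsScalarTower k Bᵐᵒᵖ Y]
  (χ : HopfModule β Y) (hS : Function.Bijective (HopfAlgebra.antipode k (A := H)))

/-- The map `a ⊗ y ↦ ∑ (y₋₁ ⇀ a) ⊗ y₀`, that is, `a ⊗ y ↦ (1 # y) (a # 1)`, as an equivalence. -/
noncomputable def actTwist : A ⊗[k] Y ≃ₗ[k] A ⊗[k] Y :=
  have h₁ (h : H) (a : A) : convComp (α.act.toLinearMap ∘ₗ antipodeInv hS) α.act.toLinearMap h a =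
      Coalgebra.counit (R := k) h • a := by
    have R := Coalgebra.Repr.arbitrary k h
    rw [convComp_apply _ _ h R]
    simp only [LinearMap.comp_apply, AlgHom.toLinearMap_apply, ← Module.End.mul_apply, ← map_mul]
    rw [← LinearMap.sum_apply, ← map_sum, sum_mul_antipodeInv, AlgHom.commutes]
    rfl
  have h₂ (h : H) (a : A) : convComp α.act.toLinearMap (α.act.toLinearMap ∘ₗ antipodeInv hS) h a =
      Coalgebra.counit (R := k) h • a := by
    have R := Coalgebra.Repr.arbitrary k h
    rw [convComp_apply _ _ h R]
    simp only [LinearMap.comp_apply, AlgHom.toLinearMap_apply, ← Module.End.mul_apply, ← map_mul]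
    rw [← LinearMap.sum_apply, ← map_sum, sum_antipodeInv_mul, AlgHom.commutes]
    rfl
  LinearEquiv.ofLinearMap (χ.twist α.act.toLinearMap)
    (χ.twist (α.act.toLinearMap ∘ₗ antipodeInv hS))
    (LinearMap.ext fun z => (χ.twist_twist _ _ z).trans (χ.twist_counit _ h₁ z))
    (LinearMap.ext fun z => (χ.twist_twist _ _ z).trans (χ.twist_counit _ h₂ z))

lemma actTwist_tmul (a : A) (y : Y) :
    actTwist α χ hS (a ⊗ₜ y) = (α.act.toLinearMap.flip a).rTensor Y (χ.coact y) := rfl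

variable (β) in
/-- `B` as a Hopf module over itself. -/
noncomputable def HopfModule.regular : HopfModule β B where
  coact := β.coact.toLinearMap
  coassoc := β.coassoc
  counit := β.counit
  coact_smul x b := by
    change β.coact (x * b) = _
    rw [map_mul, AlgHom.toLinearMap_apply]
    induction β.coact x using TensorProduct.induction_on with
    | zero => simp
    | add y z hy hz => simp only [map_add, LinearMap.add_apply, add_mul, hy, hz]
    | tmul g g' =>
      induction β.coact b using TensorProduct.induction_on with
      | zero => simp
      | add y z hy hz => simp only [map_add, mul_add, hy, hz]
      | tmul h h' => simp [rightAction_apply]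

/-- Bijectivity of `actTwist` thus means that A # B is also B ⊗ A with the factors multiplied in the
opposite order. This gives freeness over A on the right and a convenient spanning set. -/
lemma actTwist_regular (a : A) (b : B) :
    actTwist α (HopfModule.regular β) hS (a ⊗ₜ b) =
      SmashProduct.tmul α β 1 b * SmashProduct.tmul α β a 1 := by
  obtain ⟨r, g, c, hb⟩ := exists_sum_tmul (β.coact b)
  rw [SmashProduct.tmul_mul_tmul α _ 1 a b 1 Finset.univ g c hb, actTwist_tmul]
  change (α.act.toLinearMap.flip a).rTensor B (β.coact b) = _
  simp only [hb, map_sum, LinearMap.rTensor_tmul, one_mul, mul_one]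
  rfl

/-- `A # B` is spanned by the elements `(1 # b) (a # 1)`. -/
lemma SmashProduct.induction_mul (hS : Function.Bijective (HopfAlgebra.antipode k (A := H)))
    {P : SmashProduct α β → Prop} (x : SmashProduct α β) (h₀ : P 0)
    (hadd : ∀ x y, P x → P y → P (x + y))
    (ht : ∀ a b, P (SmashProduct.tmul α β 1 b * SmashProduct.tmul α β a 1)) : P x := by
  obtain ⟨z, rfl⟩ := (actTwist α (HopfModule.regular β) hS).surjective x
  induction z using TensorProduct.induction_on with
  | zero => rw [map_zero]; exact h₀
  | add y z hy hz => rw [map_add]; exact hadd _ _ hy hz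
  | tmul a b => rw [actTwist_regular]; exact ht a b

variable (β) in
/-- The inclusion `a ↦ a # 1`. -/
noncomputable def SmashProduct.includeA : A →ₗ[k] SmashProduct α β :=
  show A →ₗ[k] A ⊗[k] B from (TensorProduct.mk k A B).flip 1

/-- `A # H` is free as a right `A`-module. -/
noncomputable def smashHopfEquiv :
    Aᵐᵒᵖ ⊗[k] H ≃ₗ[Aᵐᵒᵖ] (smashRes α).obj (ModuleCat.of (SmashHopf α)ᵐᵒᵖ (SmashHopf α)ᵐᵒᵖ) :=
  let e : Aᵐᵒᵖ ⊗[k] H ≃+ (smashRes α).obj (ModuleCat.of (SmashHopf α)ᵐᵒᵖ (SmashHopf α)ᵐᵒᵖ) :=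
    (TensorProduct.congr (MulOpposite.opLinearEquiv k).symm (LinearEquiv.refl k H)).toAddEquiv.trans
      ((actTwist α (HopfModule.regular (ComoduleAlgebra.self k H)) hS).toAddEquiv.trans
        (opAddEquiv (α := SmashHopf α)))
  { e with
    map_smul' a z := by
      induction z using TensorProduct.induction_on with
      | zero => rw [smul_zero]; exact (map_zero e).trans (smul_zero _).symm
      | add y z hy hz =>
        rw [smul_add]
        refine (map_add e _ _).trans ?_
        refine (congrArg₂ (· + ·) hy hz).trans ?_
        refine .trans ?_ (congrArg _ (map_add e _ _).symm)
        exact (smul_add _ _ _).symm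
      | tmul b h =>
        change op (show SmashHopf α from
          actTwist α (HopfModule.regular (ComoduleAlgebra.self k H)) hS ((a • b).unop ⊗ₜ h)) =
          op (SmashHopf.tmul α a.unop 1) *
            op (show SmashHopf α from actTwist α (HopfModule.regular (ComoduleAlgebra.self k H))
              hS (b.unop ⊗ₜ h))
        rw [actTwist_regular, actTwist_regular, smul_eq_mul, unop_mul]
        change op (SmashHopf.tmul α 1 h * SmashHopf.tmul α (b.unop * a.unop) 1) =
          op ((SmashHopf.tmul α 1 h * SmashHopf.tmul α b.unop 1) * SmashHopf.tmul α a.unop 1)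
        rw [mul_assoc, SmashProduct.tmul_one_mul_tmul] }


/-- By `smashHopfEquiv`, A # H is free as a right A-module. Consequently resolutions and dimension
shifting over A # H compute Ext over A. -/
lemma smashRes_preservesProjectiveObjects
    (hS : Function.Bijective (HopfAlgebra.antipode k (A := H))) :
    (smashRes α).PreservesProjectiveObjects where
  projective_obj {P} _ := ModuleCat.projective_restrictScalars _
    (Module.Projective.of_equiv (smashHopfEquiv α hS)) P

variable {N : Type u} [AddCommGroup N] [Module k N] [Module Aᵐᵒᵖ N] [IsScalarTower k Aᵐᵒᵖ N]
  (e : A ≃ₗ[k] N) (he : ∀ a, e a = op a • e 1)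

/-- The equivalence `a ⊗ y ↦ (n₀ # y) (a # 1)` for a free `A`-module with basis `n₀`. -/
noncomputable def smashFreeEquiv : A ⊗[k] Y ≃ₗ[k] SmashModule α N χ :=
  (actTwist α χ hS).trans (TensorProduct.congr e (LinearEquiv.refl k Y))

include he in
lemma smashFreeEquiv_tmul (a : A) (y : Y) : smashFreeEquiv α χ hS e (a ⊗ₜ y) =
    op (SmashProduct.tmul α β a 1) • SmashModule.tmul α χ (e 1) y := by
  refine (congrArg (TensorProduct.congr e (LinearEquiv.refl k Y))
    (actTwist_tmul α χ hS a y)).trans ?_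
  refine .trans ?_ (smashModuleAct_smashTmul α χ N a 1 (e 1 ⊗ₜ y)).symm
  rw [smashModuleA_tmul]
  induction χ.coact y using TensorProduct.induction_on with
  | zero => simp
  | add y z hy hz => simp only [map_add, hy, hz]
  | tmul h y => simp [rightAction_apply, ← he]

/-- The operators of `B` on `N # Y`. -/
lemma SmashModule.one_smul_tmul (n : N) (y : Y) (b : B) :
    op (SmashProduct.tmul α β 1 b) • SmashModule.tmul α χ n y =
      SmashModule.tmul α χ n (op b • y) := by
  have h : op (SmashProduct.tmul α β 1 (1 : B)) • SmashModule.tmul α χ n y =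
    SmashModule.tmul α χ n y := one_smul _ _
  have h' : SmashProduct.tmul α β 1 b =
    SmashProduct.tmul α β 1 1 * SmashProduct.tmul α β 1 b := (one_mul _).symm
  have h₁ : smashModuleA α N χ 1 (n ⊗ₜ y) = n ⊗ₜ y := by
    refine .trans ?_ h
    refine .trans ?_ (smashModuleAct_smashTmul α χ N 1 1 (n ⊗ₜ y)).symm
    have : (rightAction k B Y).flip 1 = LinearMap.id := by
      ext y; simp [rightAction_apply]
    rw [this, LinearMap.lTensor_id, LinearMap.id_apply]
  refine (smashModuleAct_smashTmul α χ N 1 b (n ⊗ₜ y)).trans ?_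
  rw [h₁]
  rfl

variable {Z : Type u} [AddCommGroup Z] [Module k Z] [Module (SmashProduct α β)ᵐᵒᵖ Z]
  [IsScalarTower k (SmashProduct α β)ᵐᵒᵖ Z]

-- Together with `exists_smashModule_hom` this is the universal property of N # Y, for N free on n₀
-- = e 1: it is the module induced from Y along B → A # B, so its maps to Z are the B-linear maps Y
-- → Z.
include hS he in
lemma smashModule_hom_ext {f g : SmashModule α N χ →ₗ[(SmashProduct α β)ᵐᵒᵖ] Z}
    (h : ∀ y, f (SmashModule.tmul α χ (e 1) y) = g (SmashModule.tmul α χ (e 1) y)) : f = g := by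
  ext z
  obtain ⟨z, rfl⟩ := (smashFreeEquiv α χ hS e).surjective z
  induction z using TensorProduct.induction_on with
  | zero => simp
  | add y z hy hz => simp only [map_add, hy, hz]
  | tmul a y => rw [smashFreeEquiv_tmul α χ hS e he, map_smul, map_smul, h]

include hS he in
lemma exists_smashModule_hom (g : Y →ₗ[k] Z)
    (hg : ∀ y b, g (op b • y) = op (SmashProduct.tmul α β 1 b) • g y) :
    ∃ f : SmashModule α N χ →ₗ[(SmashProduct α β)ᵐᵒᵖ] Z,
      ∀ y, f (SmashModule.tmul α χ (e 1) y) = g y := by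
  let F : A ⊗[k] Y →ₗ[k] Z := TensorProduct.lift (LinearMap.flip
    (LinearMap.lcomp k Z (SmashProduct.includeA α β) ∘ₗ rightAction k (SmashProduct α β) Z ∘ₗ g))
  have hF (a : A) (y : Y) : F (a ⊗ₜ y) = op (SmashProduct.tmul α β a 1) • g y := rfl
  let f : SmashModule α N χ →ₗ[k] Z := F ∘ₗ (smashFreeEquiv α χ hS e).symm.toLinearMap
  have hf (a : A) (y : Y) : f (op (SmashProduct.tmul α β a 1) • SmashModule.tmul α χ (e 1) y) =
      op (SmashProduct.tmul α β a 1) • g y := by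
    rw [← smashFreeEquiv_tmul α χ hS e he]
    exact (congrArg F ((smashFreeEquiv α χ hS e).symm_apply_apply _)).trans (hF a y)
  -- Every x is a sum of products (1 # b)(a # 1), and on n₀ # y the first factor acts inside Y. So
  -- B-linearity of g and the definition of f on (n₀ # y)(a # 1) cover all of A # B.
  have h₁ (x : SmashProduct α β) (y : Y) :
      f (op x • SmashModule.tmul α χ (e 1) y) = op x • g y := by
    induction x using SmashProduct.induction_mul α hS with
    | h₀ => rw [MulOpposite.op_zero, zero_smul, zero_smul, map_zero]
    | hadd x x' hx hx' => rw [MulOpposite.op_add, add_smul, add_smul, map_add, hx, hx']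
    | ht a b => rw [op_mul, mul_smul, mul_smul, SmashModule.one_smul_tmul, hf, hg]
  refine ⟨{ f with map_smul' := fun x z => ?_ }, fun y => ?_⟩
  · change f (x • z) = x • f z
    obtain ⟨z, rfl⟩ := (smashFreeEquiv α χ hS e).surjective z
    induction z using TensorProduct.induction_on with
    | zero => rw [map_zero, smul_zero, map_zero, smul_zero]
    | add y z hy hz => rw [map_add, smul_add, map_add, map_add, hy, hz, smul_add]
    | tmul a y =>
      rw [smashFreeEquiv_tmul α χ hS e he, smul_smul, hf, smul_smul]
      exact h₁ (SmashProduct.tmul α β a 1 * x.unop) y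
  · refine .trans ?_ (one_smul (SmashProduct α β)ᵐᵒᵖ (g y))
    refine .trans ?_ (h₁ 1 y)
    rw [op_one, one_smul]
    rfl

-- Induction is left adjoint to the exact restriction to B, so it preserves projectives: a section
-- is found by lifting y ↦ n₀ # y over B and extending it by the universal property.
include hS he in
lemma projective_smashModule [Module.Projective Bᵐᵒᵖ Y] :
    Module.Projective (SmashProduct α β)ᵐᵒᵖ (SmashModule α N χ) := by
  refine Module.Projective.of_lifting_property'' fun p hp => ?_
  let P := SmashModule α N χ →₀ (SmashProduct α β)ᵐᵒᵖ
  let i : Bᵐᵒᵖ →+* (SmashProduct α β)ᵐᵒᵖ :=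
    (show B →+* SmashProduct α β from
      { toFun := SmashProduct.tmul α β 1
        map_one' := rfl
        map_mul' b b' := (SmashProduct.tmul_mul_one_tmul α β 1 b b').symm
        map_zero' := TensorProduct.tmul_zero _ _
        map_add' b b' := TensorProduct.tmul_add _ _ _ }).op
  let _ : Module Bᵐᵒᵖ P := Module.compHom P i
  let _ : Module Bᵐᵒᵖ (SmashModule α N χ) := Module.compHom (SmashModule α N χ) i
  let p' : P →ₗ[Bᵐᵒᵖ] SmashModule α N χ :=
    { toFun := p
      map_add' := p.map_add
      map_smul' b x := p.map_smul (i b) x }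
  let g : Y →ₗ[Bᵐᵒᵖ] SmashModule α N χ :=
    { toFun := SmashModule.tmul α χ (e 1)
      map_add' y y' := TensorProduct.tmul_add _ _ _
      map_smul' b y := (SmashModule.one_smul_tmul α χ (e 1) y b.unop).symm }
  obtain ⟨g', hg'⟩ := Module.projective_lifting_property p' g hp
  have : IsScalarTower k Bᵐᵒᵖ P := ⟨fun r b x => by
    have h : i (r • b) = r • i b := congrArg op (TensorProduct.tmul_smul r (1 : A) b.unop)
    change i (r • b) • x = r • i b • x
    rw [h, smul_assoc]⟩
  obtain ⟨f, hf⟩ := exists_smashModule_hom α χ hS e he (g'.restrictScalars k)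
    fun y b => g'.map_smul (op b) y
  refine ⟨f, smashModule_hom_ext α χ hS e he fun y => ?_⟩
  rw [LinearMap.comp_apply, hf]
  exact LinearMap.congr_fun hg' y

end SmashRestrict

/-! ## Natural transformations -/

section Natural

open Limits HopfAlgebra
open scoped ModuleCat

lemma DiagModule.hom_ext {k R T B : Type*} [CommRing k] [Ring R] [Algebra k R] [Ring T]
    [Algebra k T] [Ring B] [Algebra k B] {f : R →ₐ[k] T ⊗[k] B} {N Y P : Type*} [AddCommGroup N]
    [Module k N] [AddCommGroup Y] [Module k Y] [AddCommGroup P]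
    {F : Type*} [FunLike F (DiagModule f N Y) P] [AddMonoidHomClass F (DiagModule f N Y) P]
      {p q : F}
    (h : ∀ (n : N) (y : Y), p (n ⊗ₜ[k] y : N ⊗[k] Y) = q (n ⊗ₜ[k] y : N ⊗[k] Y)) : p = q := by
  refine DFunLike.ext _ _ fun z => ?_
  refine TensorProduct.induction_on (motive := fun z : N ⊗[k] Y => p z = q z) z
    ((map_zero p).trans (map_zero q).symm) h fun y z hy hz => ?_
  exact (map_add p y z).trans ((congrArg₂ (· + ·) hy hz).trans (map_add q y z).symm)

section

variable {k H B X : Type*} [CommRing k] [Ring H] [Bialgebra k H] [Ring B] [Algebra k B]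
  [AddCommGroup X] [Module k X] [Module Bᵐᵒᵖ X] [IsScalarTower k Bᵐᵒᵖ X]

variable (k H X) in
/-- The map `h ⊗ x ↦ ε(h) x`. -/
noncomputable def counitTensor : H ⊗[k] X →ₗ[k] X :=
  TensorProduct.lid k X ∘ₗ (Coalgebra.counit (R := k) (A := H)).rTensor X

lemma counitTensor_tmul (h : H) (x : X) :
    counitTensor k H X (h ⊗ₜ x) = Coalgebra.counit (R := k) h • x := by
  simp [counitTensor]

lemma counitTensor_lTensor {X' : Type*} [AddCommGroup X'] [Module k X'] (f : X →ₗ[k] X')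
    (z : H ⊗[k] X) : counitTensor k H X' (f.lTensor H z) = f (counitTensor k H X z) := by
  induction z using TensorProduct.induction_on with
  | zero => simp
  | add y z hy hz => simp only [map_add, hy, hz]
  | tmul g x => simp [counitTensor_tmul]

lemma counitTensor_tensorAction (z : H ⊗[k] X) (t : H ⊗[k] B) :
    counitTensor k H X (tensorAction H X z t) =
      op (counitTensor k H B t) • counitTensor k H X z := by
  induction z using TensorProduct.induction_on with
  | zero => simp
  | add y z hy hz => simp only [map_add, LinearMap.add_apply, hy, hz, smul_add]
  | tmul g x =>
    induction t using TensorProduct.induction_on with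
    | zero => simp
    | add y z hy hz => simp only [map_add, hy, hz, MulOpposite.op_add, add_smul]
    | tmul h c =>
      rw [TensorProduct.map₂_apply_tmul, TensorProduct.map_tmul, counitTensor_tmul,
        counitTensor_tmul, counitTensor_tmul,
        rightAction_apply, rightAction_apply, op_smul_eq_mul, Bialgebra.counit_mul,
        MulOpposite.op_smul, smul_assoc, smul_comm (op c), smul_smul, mul_comm]

end

variable {k : Type u} [Field k] {H A B : Type u} [Ring H] [HopfAlgebra k H] [Ring A] [Algebra k A]
  [Ring B] [Algebra k B] (α : ModuleAlgebra k H A) (β : ComoduleAlgebra k H B)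

/-- The functor `Y ↦ H ⊗ Y` with the diagonal action of `B`. -/
noncomputable abbrev coactFunctor : ModuleCat.{u} Bᵐᵒᵖ ⥤ ModuleCat.{u} Bᵐᵒᵖ :=
  diagFunctor β.coact H

variable (k H B) in
/-- The functor `Y ↦ H ⊗ Y` with the action of `B` on `Y`. -/
noncomputable abbrev freeFunctor : ModuleCat.{u} Bᵐᵒᵖ ⥤ ModuleCat.{u} Bᵐᵒᵖ :=
  diagFunctor (Algebra.TensorProduct.includeRight : B →ₐ[k] H ⊗[k] B) H

/-- The functor `Y ↦ N ⊗ Y` from right `B`-modules to right `A # B`-modules, for a right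
`A # H`-module `N`. -/
noncomputable abbrev smashDiagFunctor (N : ModuleCat.{u} (SmashHopf α)ᵐᵒᵖ) :
    ModuleCat.{u} Bᵐᵒᵖ ⥤ ModuleCat.{u} (SmashProduct α β)ᵐᵒᵖ :=
  diagFunctor (smashDiag α β) ((smashRes α).obj N)

/-- The natural transformation of `smashDiagFunctor` given by a map of `A # H`-modules. -/
noncomputable def smashDiagNatTrans {N N' : ModuleCat.{u} (SmashHopf α)ᵐᵒᵖ} (u : N ⟶ N') :
    smashDiagFunctor α β N ⟶ smashDiagFunctor α β N' :=
  diagNatTrans (smashDiag α β) (N := (smashRes α).obj N) (N' := (smashRes α).obj N')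
    (show (smashRes α).obj N →ₗ[(SmashHopf α)ᵐᵒᵖ] (smashRes α).obj N' from u.hom)

variable {β} {X X' : ModuleCat.{u} Bᵐᵒᵖ} (χ : HopfModule β X) (χ' : HopfModule β X')

/-- The coaction as a morphism of `B`-modules. -/
noncomputable def coactHom : X ⟶ (coactFunctor β).obj X :=
  ModuleCat.ofHom (Y := DiagModule β.coact H X)
    { toFun := χ.coact
      map_add' := χ.coact.map_add
      map_smul' b x := χ.coact_smul x b.unop }

variable (hS : Function.Bijective (antipode k (A := H)))

/-- `h ⊗ x ↦ ∑ x₋₁ S⁻¹(h) ⊗ x₀` as a morphism of `B`-modules. -/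
noncomputable def leftTwistHom : (coactFunctor β).obj X ⟶ (freeFunctor k H B).obj X :=
  ModuleCat.ofHom (X := DiagModule β.coact H X)
    (Y := DiagModule (Algebra.TensorProduct.includeRight : B →ₐ[k] H ⊗[k] B) H X)
    { toFun := leftTwist hS χ
      map_add' := (leftTwist hS χ).map_add
      map_smul' b z := leftTwist_smul hS χ z b.unop }

/-- `h ⊗ x ↦ ∑ S(h) x₋₁ ⊗ x₀` as a morphism of `B`-modules. -/
noncomputable def leftUntwistHom : (freeFunctor k H B).obj X ⟶ (coactFunctor β).obj X :=
  ModuleCat.ofHom (Y := DiagModule β.coact H X)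
    (X := DiagModule (Algebra.TensorProduct.includeRight : B →ₐ[k] H ⊗[k] B) H X)
    { toFun := leftUntwist χ
      map_add' := (leftUntwist χ).map_add
      map_smul' b z := leftUntwist_smul χ z b.unop }

lemma leftTwistHom_comp : leftTwistHom χ hS ≫ leftUntwistHom χ = 𝟙 _ :=
  ModuleCat.hom_ext (LinearMap.ext fun z => leftUntwist_leftTwist hS χ z)

lemma leftUntwistHom_comp : leftUntwistHom χ ≫ leftTwistHom χ hS = 𝟙 _ :=
  ModuleCat.hom_ext (LinearMap.ext fun z => leftTwist_leftUntwist hS χ z)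

variable (k B) in
/-- The natural transformation `x ↦ h ⊗ x`. -/
noncomputable def freeInsert (h : H) : 𝟭 (ModuleCat.{u} Bᵐᵒᵖ) ⟶ freeFunctor k H B where
  app X := ModuleCat.ofHom (X := X)
    (Y := DiagModule (Algebra.TensorProduct.includeRight : B →ₐ[k] H ⊗[k] B) H X)
    { toFun := TensorProduct.mk k H X h
      map_add' := (TensorProduct.mk k H X h).map_add
      map_smul' b x := (tensorAction_one_tmul (h ⊗ₜ x) b.unop).symm }
  naturality _ _ _ := rfl

variable (k B) in
/-- The natural transformation `g ⊗ x ↦ g h ⊗ x`. -/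
noncomputable def freeMulRight (h : H) : freeFunctor k H B ⟶ freeFunctor k H B where
  app X := ModuleCat.ofHom
    (X := DiagModule (Algebra.TensorProduct.includeRight : B →ₐ[k] H ⊗[k] B) H X)
    (Y := DiagModule (Algebra.TensorProduct.includeRight : B →ₐ[k] H ⊗[k] B) H X)
    { toFun := (LinearMap.mulRight k h).rTensor X
      map_add' := ((LinearMap.mulRight k h).rTensor X).map_add
      map_smul' b z := by
        refine (congrArg _ (tensorAction_one_tmul z b.unop)).trans
          (.trans ?_ (tensorAction_one_tmul _ b.unop).symm)
        exact (LinearMap.congr_fun (LinearMap.rTensor_comp_lTensor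
          (f := LinearMap.mulRight k h) (g := (rightAction k B X).flip b.unop)) z).trans
          (LinearMap.congr_fun (LinearMap.lTensor_comp_rTensor
            (f := LinearMap.mulRight k h) (g := (rightAction k B X).flip b.unop)) z).symm }
  naturality Y Y' g := by
    ext z
    exact (LinearMap.congr_fun (LinearMap.rTensor_comp_lTensor
      (f := LinearMap.mulRight k h) (g := g.hom.restrictScalars k)) z).trans
      (LinearMap.congr_fun (LinearMap.lTensor_comp_rTensor
        (f := LinearMap.mulRight k h) (g := g.hom.restrictScalars k)) z).symm

variable (k H B) in
/-- The natural transformation `h ⊗ x ↦ ε(h) x`. -/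
noncomputable def freeCounit : freeFunctor k H B ⟶ 𝟭 (ModuleCat.{u} Bᵐᵒᵖ) where
  app X := ModuleCat.ofHom (Y := X)
    (X := DiagModule (Algebra.TensorProduct.includeRight : B →ₐ[k] H ⊗[k] B) H X)
    { toFun := counitTensor k H X
      map_add' := (counitTensor k H X).map_add
      map_smul' b z := by
        refine (counitTensor_tensorAction z _).trans ?_
        rw [Algebra.TensorProduct.includeRight_apply, counitTensor_tmul, Bialgebra.counit_one,
          one_smul]
        rfl }
  naturality Y Y' g := by
    ext z
    exact counitTensor_lTensor (g.hom.restrictScalars k) z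

variable (β) in
/-- The natural transformation `h ⊗ x ↦ ε(h) x`. -/
noncomputable def coactCounit : coactFunctor β ⟶ 𝟭 (ModuleCat.{u} Bᵐᵒᵖ) where
  app X := ModuleCat.ofHom (Y := X) (X := DiagModule β.coact H X)
    { toFun := counitTensor k H X
      map_add' := (counitTensor k H X).map_add
      map_smul' b z := by
        refine (counitTensor_tensorAction z _).trans ?_
        rw [show counitTensor k H B (β.coact b.unop) = b.unop from β.counit b.unop]
        rfl }
  naturality Y Y' g := by
    ext z
    exact counitTensor_lTensor (g.hom.restrictScalars k) z

variable (k) in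
/-- Left multiplication as a map of right modules. -/
def mulLeftHom (h : H) : H →ₗ[Hᵐᵒᵖ] H where
  toFun g := h * g
  map_add' := mul_add h
  map_smul' a g := (mul_assoc h g a.unop).symm

variable (β) in
/-- The natural transformation `g ⊗ x ↦ h g ⊗ x`. -/
noncomputable def coactMulLeft (h : H) : coactFunctor β ⟶ coactFunctor β :=
  diagNatTrans β.coact (mulLeftHom h)

/-! ## Relations between them -/

lemma freeInsert_one_comp_leftUntwistHom :
    (freeInsert k B (1 : H)).app X ≫ leftUntwistHom χ = coactHom χ := by
  ext x
  refine (leftUntwist_tmul χ 1 x).trans ?_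
  rw [antipode_one, LinearMap.mulLeft_one, LinearMap.rTensor_id]
  rfl

lemma coactHom_comp_leftTwistHom :
    coactHom χ ≫ leftTwistHom χ hS = (freeInsert k B (1 : H)).app X := by
  rw [← freeInsert_one_comp_leftUntwistHom, Category.assoc, leftUntwistHom_comp, Category.comp_id]

/-- Because S(gh) = S(h)S(g), right multiplication by h becomes left multiplication by S(h), which
is a natural transformation of the diagonal functor. This is the source of H-linearity in
`extConj_comp_freeMulRight`. -/
lemma freeMulRight_comp_leftUntwistHom (h : H) :
    (freeMulRight k B h).app X ≫ leftUntwistHom χ =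
      leftUntwistHom χ ≫ (coactMulLeft β (antipode k h)).app X := by
  refine ModuleCat.hom_ext (DiagModule.hom_ext fun g x => ?_)
  change leftUntwist χ ((g * h) ⊗ₜ x) =
    (LinearMap.mulLeft k (antipode k h)).rTensor X (leftUntwist χ (g ⊗ₜ x))
  rw [leftUntwist_tmul, leftUntwist_tmul, ← LinearMap.rTensor_comp_apply,
    antipode_mul_antidistrib, LinearMap.mulLeft_mul]

lemma leftUntwistHom_comp_coactCounit :
    leftUntwistHom χ ≫ (coactCounit β).app X = (freeCounit k H B).app X := by
  refine ModuleCat.hom_ext (DiagModule.hom_ext fun g x => ?_)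
  change counitTensor k H X (leftUntwist χ (g ⊗ₜ x)) = counitTensor k H X (g ⊗ₜ x)
  rw [leftUntwist_tmul, counitTensor_tmul]
  refine .trans ?_ (congrArg (Coalgebra.counit (R := k) g • ·) (χ.counit x))
  change _ = Coalgebra.counit (R := k) g • counitTensor k H X (χ.coact x)
  induction χ.coact x using TensorProduct.induction_on with
  | zero => simp
  | add y z hy hz => simp only [map_add, hy, hz, smul_add]
  | tmul g' x => simp [counitTensor_tmul, mul_smul]

lemma leftTwistHom_comp_freeCounit :
    leftTwistHom χ hS ≫ (freeCounit k H B).app X = (coactCounit β).app X := by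
  rw [← leftUntwistHom_comp_coactCounit χ, ← Category.assoc, leftTwistHom_comp, Category.id_comp]

lemma coactHom_comp_coactCounit : coactHom χ ≫ (coactCounit β).app X = 𝟙 X :=
  ModuleCat.hom_ext (LinearMap.ext fun x => χ.counit x)

lemma freeInsert_comp_freeMulRight (g h : H) :
    (freeInsert k B g).app X ≫ (freeMulRight k B h).app X = (freeInsert k B (g * h)).app X := rfl

lemma freeInsert_comp_freeCounit (h : H) :
    (freeInsert k B h).app X ≫ (freeCounit k H B).app X = Coalgebra.counit (R := k) h • 𝟙 X := by
  ext x
  refine (counitTensor_tmul (k := k) (X := X) h x).trans ?_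
  rfl

/-- A restatement of colinearity as a commuting square of B-modules, the form needed for morphisms
of extensions and of complexes. -/
lemma leftTwistHom_naturality (f : X ⟶ X')
    (hf : ∀ x, χ'.coact (f x) = (f.hom.restrictScalars k).lTensor H (χ.coact x)) :
    coactHom χ ≫ (coactFunctor β).map f = f ≫ coactHom χ' :=
  ModuleCat.hom_ext (LinearMap.ext fun x => (hf x).symm)

/-- `n ⊗ x ↦ ∑ n x₋₁ ⊗ x₀` as an isomorphism of `A # B`-modules. -/
noncomputable def untwistIso (N : ModuleCat.{u} (SmashHopf α)ᵐᵒᵖ) :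
    (smashFunctor α χ).obj ((smashRes α).obj N) ≅ (smashDiagFunctor α β N).obj X :=
  LinearEquiv.toModuleIso (X₁ := SmashModule α ((smashRes α).obj N) χ)
    (X₂ := DiagModule (smashDiag α β) ((smashRes α).obj N) X)
    { toFun := untwist α χ
      invFun := retwist α χ
      left_inv := retwist_untwist α χ
      right_inv := untwist_retwist α χ
      map_add' := (untwist α χ).map_add
      map_smul' x z := untwist_smul α χ (smashRes_smul α N) x.unop z }

lemma untwistIso_naturality_left {N N' : ModuleCat.{u} (SmashHopf α)ᵐᵒᵖ} (u : N ⟶ N') :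
    (smashFunctor α χ).map ((smashRes α).map u) ≫ (untwistIso α χ N').hom =
      (untwistIso α χ N).hom ≫ (smashDiagNatTrans α β u).app X := by
  ext z
  let u' : (smashRes α).obj N →ₗ[(SmashHopf α)ᵐᵒᵖ] (smashRes α).obj N' := u.hom
  refine (HopfModule.twist_rTensor χ (u'.restrictScalars k) _ z).trans
    (.trans ?_ (HopfModule.rTensor_twist χ (u'.restrictScalars k) _ z).symm)
  refine congrArg (fun φ => χ.twist φ z) (LinearMap.ext fun h => LinearMap.ext fun n => ?_)
  exact (u'.map_smul _ n).symm

lemma untwistIso_naturality_right (N : ModuleCat.{u} (SmashHopf α)ᵐᵒᵖ) (f : X ⟶ X')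
    (hf : ∀ x, χ'.coact (f x) = (f.hom.restrictScalars k).lTensor H (χ.coact x)) :
    (smashNatTrans α f.hom hf).app ((smashRes α).obj N) ≫ (untwistIso α χ' N).hom =
      (untwistIso α χ N).hom ≫ (smashDiagFunctor α β N).map f := by
  ext z
  exact HopfModule.twist_lTensor χ χ' (f.hom.restrictScalars k) hf _ z

end Natural

/-! ## Pseudo-coherent modules -/

section PseudoCoherent

variable {R : Type u} [Ring R]

/-- A property of modules for which each module with this property is covered by a finitely
generated projective module with a kernel that has this property. -/
def ModuleCat.CoverClosed (Φ : ModuleCat.{u} R → Prop) : Prop :=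
  ∀ N, Φ N → ∃ (K P : ModuleCat.{u} R) (i : K →ₗ[R] P) (p : P →ₗ[R] N), Function.Injective i ∧
    Function.Exact i p ∧ Function.Surjective p ∧ Module.Finite R P ∧ Module.Projective R P ∧ Φ K

/-- The modules of type `FP_∞`: the largest class of modules that is closed under kernels of
suitable finitely generated projective covers. -/
def ModuleCat.IsFPInfinity (N : ModuleCat.{u} R) : Prop :=
  ∃ Φ : ModuleCat.{u} R → Prop, ModuleCat.CoverClosed Φ ∧ Φ N

namespace ModuleCat.IsFPInfinity

variable {N : ModuleCat.{u} R}

lemma exists_cover (h : N.IsFPInfinity) :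
    ∃ (K P : ModuleCat.{u} R) (i : K →ₗ[R] P) (p : P →ₗ[R] N), Function.Injective i ∧
      Function.Exact i p ∧ Function.Surjective p ∧ Module.Finite R P ∧ Module.Projective R P ∧
      K.IsFPInfinity := by
  obtain ⟨Φ, hΦ, hN⟩ := h
  obtain ⟨K, P, i, p, hi, he, hp, hf, hP, hK⟩ := hΦ N hN
  exact ⟨K, P, i, p, hi, he, hp, hf, hP, Φ, hΦ, hK⟩

lemma finite (h : N.IsFPInfinity) : Module.Finite R N := by
  obtain ⟨K, P, i, p, -, -, hp, hf, -⟩ := h.exists_cover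
  exact Module.Finite.of_surjective p hp

/-- The modules that become isomorphic to a module of a class after addition of finitely generated
projective modules. -/
def Stable (Φ : ModuleCat.{u} R → Prop) (K' : ModuleCat.{u} R) : Prop :=
  ∃ (E K P Q : ModuleCat.{u} R) (i : K →ₗ[R] E) (p : E →ₗ[R] Q) (i' : K' →ₗ[R] E)
    (p' : E →ₗ[R] P), Function.Injective i ∧ Function.Exact i p ∧ Function.Surjective p ∧
    Function.Injective i' ∧ Function.Exact i' p' ∧ Function.Surjective p' ∧
    Module.Finite R P ∧ Module.Projective R P ∧ Module.Finite R Q ∧ Module.Projective R Q ∧ Φ K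

/-- Here E is both K ⊕ Q and K' ⊕ P. A cover P₁ of K with kernel K₁ gives a surjection ψ : P₁ × Q →
E with kernel K₁. Composing it with a retraction r of E onto K' gives a cover of K', whose kernel is
an extension of P by K₁ and hence again stably equivalent to a member of Φ. -/
lemma coverClosed_stable {Φ : ModuleCat.{u} R → Prop} (hΦ : ModuleCat.CoverClosed Φ) :
    ModuleCat.CoverClosed (Stable Φ) := by
  rintro K' ⟨E, K, P, Q, i, p, i', p', hi, hip, hp, hi', hip', hp', _, _, _, _, hK⟩
  obtain ⟨K₁, P₁, j, q, hj, hjq, hq, _, _, hK₁⟩ := hΦ K hK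
  obtain ⟨s, hs⟩ := Module.projective_lifting_property p LinearMap.id hp
  obtain ⟨t, ht⟩ := Module.projective_lifting_property p' LinearMap.id hp'
  have hs' (y) : p (s y) = y := LinearMap.congr_fun hs y
  have ht' (y) : p' (t y) = y := LinearMap.congr_fun ht y
  have hpi (x) : p (i x) = 0 := (hip _).2 ⟨x, rfl⟩
  have hpi' (x) : p' (i' x) = 0 := (hip' _).2 ⟨x, rfl⟩
  let ψ : P₁ × Q →ₗ[R] E := (i ∘ₗ q).coprod s
  have hψ (w) : ψ w = i (q w.1) + s w.2 := rfl
  have hψs : Function.Surjective ψ := by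
    intro e
    obtain ⟨x, hx⟩ := (hip (e - s (p e))).1 (by simp [hs'])
    obtain ⟨y, rfl⟩ := hq x
    exact ⟨(y, p e), by simp [hψ, hx]⟩
  have hr (e : E) : (LinearMap.id - t ∘ₗ p' : E →ₗ[R] E) e ∈ LinearMap.range i' :=
    (hip' _).1 (by simp [ht'])
  let r : E →ₗ[R] K' := (LinearEquiv.ofInjective i' hi').symm.toLinearMap ∘ₗ
    (LinearMap.id - t ∘ₗ p' : E →ₗ[R] E).codRestrict _ hr
  have hr' (e : E) : i' (r e) = e - t (p' e) :=
    congrArg Subtype.val ((LinearEquiv.ofInjective i' hi').apply_symm_apply _)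
  have hri (x) : r (i' x) = x := hi' (by simp [hr', hpi'])
  have hfin : Module.Finite R (P₁ × Q) := inferInstance
  have hproj : Module.Projective R (P₁ × Q) := inferInstance
  refine ⟨ModuleCat.of R (LinearMap.ker (r ∘ₗ ψ)), ModuleCat.of R (P₁ × Q),
    (LinearMap.ker (r ∘ₗ ψ)).subtype, r ∘ₗ ψ, Subtype.val_injective,
    LinearMap.exact_subtype_ker_map _, fun x => ?_, hfin, hproj, ?_⟩
  · obtain ⟨w, hw⟩ := hψs (i' x)
    exact ⟨w, by simp [hw, hri]⟩
  have hker (w : P₁ × Q) (hw : ψ w = 0) : ∃ x, (j x, 0) = w := by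
    have h2 : w.2 = 0 := by
      have := congrArg p hw
      simpa [hψ, hpi, hs'] using this
    have h1 : q w.1 = 0 := hi (by simpa [hψ, h2] using hw)
    obtain ⟨x, hx⟩ := (hjq _).1 h1
    exact ⟨x, Prod.ext hx h2.symm⟩
  have hψj (x) : ψ (j x, 0) = 0 := by simp [hψ, (hjq _).2 ⟨x, rfl⟩]
  have hfin' : Module.Finite R PUnit.{u + 1} := inferInstance
  have hproj' : Module.Projective R PUnit.{u + 1} := inferInstance
  -- The kernel itself serves as the common module E, with zero as the complement on its own side
  -- and P as the complement of K₁.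
  refine ⟨ModuleCat.of R (LinearMap.ker (r ∘ₗ ψ)), K₁, ModuleCat.of R PUnit.{u + 1}, P,
    (LinearMap.inl R P₁ Q ∘ₗ j).codRestrict _ fun x => ?_,
    p' ∘ₗ ψ ∘ₗ (LinearMap.ker (r ∘ₗ ψ)).subtype, LinearMap.id, 0, fun x y h => ?_,
      fun w => ⟨fun h => ?_, ?_⟩,
    fun y => ?_, Function.injective_id, fun x => ⟨fun _ => ⟨x, rfl⟩, fun _ => rfl⟩,
    fun x => ⟨0, Subsingleton.elim _ _⟩, hfin', hproj',
    ‹Module.Finite R P›, ‹Module.Projective R P›, hK₁⟩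
  · change r (ψ (j x, 0)) = 0
    rw [hψj, map_zero]
  · exact hj (congrArg Prod.fst (congrArg Subtype.val h))
  · obtain ⟨w, hw⟩ := w
    have hw' : r (ψ w) = 0 := hw
    have h' : p' (ψ w) = 0 := h
    have : ψ w = 0 := by
      have := hr' (ψ w)
      rw [hw', h', map_zero, map_zero, sub_zero] at this
      exact this.symm
    obtain ⟨x, hx⟩ := hker w this
    exact ⟨x, Subtype.ext hx⟩
  · rintro ⟨x, rfl⟩
    change p' (ψ (j x, 0)) = 0
    rw [hψj, map_zero]
  · obtain ⟨w, hw⟩ := hψs (t y)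
    refine ⟨⟨w, ?_⟩, ?_⟩
    · change r (ψ w) = 0
      exact hi' (by rw [hr', hw, ht', sub_self, map_zero])
    · change p' (ψ w) = y
      rw [hw, ht']

/-- The kernel of a finitely generated projective cover of a module of type `FP_∞` is of type
`FP_∞`. -/
lemma of_exact (h : N.IsFPInfinity) {K Q : ModuleCat.{u} R} (i : K →ₗ[R] Q) (p : Q →ₗ[R] N)
    (hi : Function.Injective i) (hip : Function.Exact i p) (hp : Function.Surjective p)
    [Module.Finite R Q] [Module.Projective R Q] : K.IsFPInfinity := by
  obtain ⟨Φ, hΦ, hN⟩ := h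
  obtain ⟨K', P, i', p', hi', hip', hp', _, _, hK'⟩ := hΦ N hN
  -- Schanuel's argument: the fibre product of the two covers of N contains both kernels, with
  -- quotients Q and P.
  refine ⟨_, coverClosed_stable hΦ, ModuleCat.of R (LinearMap.ker
    (p'.coprod (-p))), K', P, Q,
    ((LinearMap.inl R P Q) ∘ₗ i').codRestrict _ fun x => ?_,
    LinearMap.snd R P Q ∘ₗ Submodule.subtype _,
    ((LinearMap.inr R P Q) ∘ₗ i).codRestrict _ fun x => ?_,
    LinearMap.fst R P Q ∘ₗ Submodule.subtype _,
    fun x y h => hi' (congrArg Prod.fst (congrArg Subtype.val h)), ?_, ?_,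
    fun x y h => hi (congrArg Prod.snd (congrArg Subtype.val h)), ?_, ?_,
    inferInstance, inferInstance, inferInstance, inferInstance, hK'⟩
  · simp [(hip' _).2 ⟨x, rfl⟩]
  · simp [(hip _).2 ⟨x, rfl⟩]
  · rintro ⟨⟨x, y⟩, hw⟩
    have hw' : p' x + -p y = 0 := hw
    refine ⟨fun h => ?_, ?_⟩
    · obtain rfl : y = 0 := h
      obtain ⟨z, rfl⟩ := (hip' x).1 (by simpa using hw')
      exact ⟨z, rfl⟩
    · rintro ⟨z, hz⟩
      exact (congrArg Prod.snd (congrArg Subtype.val hz)).symm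
  · intro y
    obtain ⟨x, hx⟩ := hp' (p y)
    exact ⟨⟨(x, y), by simp [hx]⟩, rfl⟩
  · rintro ⟨⟨x, y⟩, hw⟩
    have hw' : p' x + -p y = 0 := hw
    refine ⟨fun h => ?_, ?_⟩
    · obtain rfl : x = 0 := h
      obtain ⟨z, rfl⟩ := (hip y).1 (by simpa using hw')
      exact ⟨z, rfl⟩
    · rintro ⟨z, hz⟩
      exact (congrArg Prod.fst (congrArg Subtype.val hz)).symm
  · intro x
    obtain ⟨y, hy⟩ := hp (p' x)
    exact ⟨⟨(x, y), by simp [hy]⟩, rfl⟩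

end ModuleCat.IsFPInfinity

lemma resolutionAug_surjective {M : Type u} [AddCommGroup M] [Module R M]
    (P : ProjectiveResolution (ModuleCat.of R M)) : Function.Surjective (resolutionAug P) := by
  have : Epi (resolutionAug P) := by
    unfold resolutionAug
    infer_instance
  exact (ModuleCat.epi_iff_surjective _).1 this

lemma resolutionAug_exact {M : Type u} [AddCommGroup M] [Module R M]
    (P : ProjectiveResolution (ModuleCat.of R M)) :
    Function.Exact (P.complex.d 1 0) (resolutionAug P) := by
  have h := (ShortComplex.ShortExact.moduleCat_exact_iff_function_exact _).1 P.exact₀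
  have hi := (ModuleCat.mono_iff_injective
    (HomologicalComplex.singleObjXSelf (ComplexShape.down ℕ) 0 (ModuleCat.of R M)).hom).1
    inferInstance
  intro x
  refine Iff.trans ⟨fun hx => hi ?_, fun hx => ?_⟩ (h x)
  · exact .trans hx (map_zero _).symm
  · exact .trans (congrArg (HomologicalComplex.singleObjXSelf (ComplexShape.down ℕ) 0
      (ModuleCat.of R M)).hom hx) (map_zero _)

/-- The class consisting of M and the images of the differentials of the resolution is closed under
the covers that the resolution provides. -/
lemma ModuleCat.isFPInfinity_of_isPseudoCoherent {M : Type u} [AddCommGroup M] [Module R M]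
    (h : IsPseudoCoherent R M) : (ModuleCat.of R M).IsFPInfinity := by
  obtain ⟨P, hP⟩ := h
  have hpr (n) : Module.Projective R (P.complex.X n) :=
    (P.complex.X n).projective_of_module_projective
  refine ⟨fun N => N = ModuleCat.of R M ∨
    ∃ n, N = ModuleCat.of R (LinearMap.range (P.complex.d (n + 1) n).hom), ?_, .inl rfl⟩
  rintro N (rfl | ⟨n, rfl⟩)
  · exact ⟨ModuleCat.of R (LinearMap.range (P.complex.d (0 + 1) 0).hom), P.complex.X 0,
      (LinearMap.range (P.complex.d (0 + 1) 0).hom).subtype, (resolutionAug P).hom,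
        Subtype.val_injective,
      fun x => (resolutionAug_exact P x).trans
        ⟨fun ⟨y, hy⟩ => ⟨⟨x, y, hy⟩, rfl⟩, fun ⟨⟨_, y, hy⟩, h⟩ => ⟨y, hy.trans h⟩⟩,
      resolutionAug_surjective P, hP 0, hpr 0, .inr ⟨0, rfl⟩⟩
  · have he := (ShortComplex.ShortExact.moduleCat_exact_iff_function_exact _).1 (P.exact_succ n)
    exact ⟨ModuleCat.of R (LinearMap.range (P.complex.d (n + 1 + 1) (n + 1)).hom),
      P.complex.X (n + 1), (LinearMap.range (P.complex.d (n + 1 + 1) (n + 1)).hom).subtype,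
        LinearMap.rangeRestrict _,
      Subtype.val_injective,
      fun x => (Subtype.ext_iff.trans (he x)).trans
        ⟨fun ⟨y, hy⟩ => ⟨⟨x, y, hy⟩, rfl⟩, fun ⟨⟨_, y, hy⟩, h⟩ => ⟨y, hy.trans h⟩⟩,
      LinearMap.surjective_rangeRestrict _, hP _, hpr _, .inr ⟨n + 1, rfl⟩⟩

end PseudoCoherent

/-! ## Covers of Hopf modules -/

section HopfCover

variable {k H B : Type u} [Field k] [Ring H] [HopfAlgebra k H] [Ring B] [Algebra k B]
  {β : ComoduleAlgebra k H B} {X : Type u} [AddCommGroup X] [Module k X] [Module Bᵐᵒᵖ X]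
  [IsScalarTower k Bᵐᵒᵖ X] (χ : HopfModule β X)

lemma LinearMap.lTensor_map₂ {K : Type u} [AddCommGroup K] [Module k K] [Module Bᵐᵒᵖ K]
    [IsScalarTower k Bᵐᵒᵖ K] (f : K →ₗ[Bᵐᵒᵖ] X) (u : H ⊗[k] K) (t : H ⊗[k] B) :
    (f.restrictScalars k).lTensor H
      (TensorProduct.map₂ (LinearMap.mul k H) (rightAction k B K) u t) =
    TensorProduct.map₂ (LinearMap.mul k H) (rightAction k B X)
      ((f.restrictScalars k).lTensor H u) t := by
  induction u using TensorProduct.induction_on with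
  | zero => simp
  | add y z hy hz => simp only [map_add, LinearMap.add_apply, hy, hz]
  | tmul g x =>
    induction t using TensorProduct.induction_on with
    | zero => simp
    | add y z hy hz => simp only [map_add, hy, hz]
    | tmul h c => simp [rightAction_apply]

/-- The Hopf module structure on a submodule that is stable under the coaction. -/
noncomputable def HopfModule.ofInjective {K : Type u} [AddCommGroup K] [Module k K]
    [Module Bᵐᵒᵖ K] [IsScalarTower k Bᵐᵒᵖ K] (i : K →ₗ[Bᵐᵒᵖ] X) (hi : Function.Injective i)
    (h : ∀ y, χ.coact (i y) ∈ LinearMap.range ((i.restrictScalars k).lTensor H)) :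
    {κ : HopfModule β K // ∀ y, χ.coact (i y) = (i.restrictScalars k).lTensor H (κ.coact y)} := by
  have hj : Function.Injective ((i.restrictScalars k).lTensor H) :=
    Module.Flat.lTensor_preserves_injective_linearMap (i.restrictScalars k) hi
  have hjj : Function.Injective (((i.restrictScalars k).lTensor H).lTensor H) :=
    Module.Flat.lTensor_preserves_injective_linearMap _ hj
  let c : K →ₗ[k] H ⊗[k] K := (LinearEquiv.ofInjective _ hj).symm.toLinearMap ∘ₗ
    (χ.coact ∘ₗ i.restrictScalars k).codRestrict _ h
  have hc (y) : χ.coact (i y) = (i.restrictScalars k).lTensor H (c y) :=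
    (congrArg Subtype.val ((LinearEquiv.ofInjective _ hj).apply_symm_apply ⟨_, h y⟩)).symm
  refine ⟨⟨c, fun x => hjj ?_, fun x => hi ?_, fun x b => hj ?_⟩, hc⟩
  · have h1 : (i.restrictScalars k).lTensor H ∘ₗ c = χ.coact ∘ₗ i.restrictScalars k :=
      LinearMap.ext fun y => (hc y).symm
    have h2 : ∀ u : (H ⊗[k] H) ⊗[k] K, ((i.restrictScalars k).lTensor H).lTensor H
        (TensorProduct.assoc k H H K u) =
        TensorProduct.assoc k H H X ((i.restrictScalars k).lTensor (H ⊗[k] H) u) := by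
      intro u
      induction u using TensorProduct.induction_on with
      | zero => simp
      | add y z hy hz => simp only [map_add, hy, hz]
      | tmul g x =>
        induction g using TensorProduct.induction_on with
        | zero => simp
        | add y z hy hz => simp only [map_add, TensorProduct.add_tmul, hy, hz]
        | tmul g h => simp
    rw [h2, ← LinearMap.lTensor_comp_apply, h1, LinearMap.lTensor_comp_apply, ← hc, ← χ.coassoc,
      hc]
    exact congrArg (TensorProduct.assoc k H H X) ((LinearMap.congr_fun
      (LinearMap.lTensor_comp_rTensor (f := Coalgebra.comul (R := k) (A := H))
        (g := i.restrictScalars k)) (c x)).trans (LinearMap.congr_fun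
      (LinearMap.rTensor_comp_lTensor (f := Coalgebra.comul (R := k) (A := H))
        (g := i.restrictScalars k)) (c x)).symm)
  · rw [← χ.counit (i x), hc]
    generalize c x = u
    induction u using TensorProduct.induction_on with
    | zero => simp
    | add y z hy hz => simp only [map_add, hy, hz]
    | tmul g x => simp
  · rw [LinearMap.lTensor_map₂, ← hc, ← hc, map_smul, χ.coact_smul]

/-- Over a field H ⊗ - preserves exactness, so the kernel of a colinear map is stable under the
coaction. -/
lemma HopfModule.coact_mem_range_of_exact {Y : Type u} [AddCommGroup Y] [Module k Y]
    [Module Bᵐᵒᵖ Y] [IsScalarTower k Bᵐᵒᵖ Y] (χ' : HopfModule β Y) {K : Type u} [AddCommGroup K]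
    [Module k K] [Module Bᵐᵒᵖ K] [IsScalarTower k Bᵐᵒᵖ K] (i : K →ₗ[Bᵐᵒᵖ] X) (p : X →ₗ[Bᵐᵒᵖ] Y)
    (hip : Function.Exact i p)
    (hp : ∀ x, χ'.coact (p x) = (p.restrictScalars k).lTensor H (χ.coact x)) (y : K) :
    χ.coact (i y) ∈ LinearMap.range ((i.restrictScalars k).lTensor H) :=
  (Module.Flat.lTensor_exact H (f := i.restrictScalars k) (g := p.restrictScalars k) hip _).1
    (by rw [← hp, (hip _).2 ⟨y, rfl⟩, map_zero])

/-- The map `h ⊗ b, h' ⊗ x ↦ h' h ⊗ (b ⊗ x)`. -/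
noncomputable def tensorCoactAux (B X : Type u) [AddCommGroup B] [Module k B] [AddCommGroup X]
    [Module k X] : H ⊗[k] B →ₗ[k] H ⊗[k] X →ₗ[k] H ⊗[k] (B ⊗[k] X) :=
  TensorProduct.map₂ (LinearMap.mul k H).flip (TensorProduct.mk k B X)

/-- The Hopf module `B ⊗ X` for a comodule `X`. -/
noncomputable def HopfModule.tensor (χ : HopfModule β X) : HopfModule β (B ⊗[k] X) where
  -- The comodule X comes first in the product x₋₁ b₋₁ although B is written on the left: B ⊗ X
  -- stands for X ⊗ B, on which B acts by right multiplication.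
  coact := TensorProduct.lift ((tensorCoactAux B X).compl₁₂ β.coact.toLinearMap χ.coact)
  coassoc z := by
    induction z using TensorProduct.induction_on with
    | zero => simp
    | add y z hy hz => simp only [map_add, hy, hz]
    | tmul b x =>
      let F : H ⊗[k] (H ⊗[k] B) →ₗ[k] H ⊗[k] (H ⊗[k] X) →ₗ[k] H ⊗[k] (H ⊗[k] (B ⊗[k] X)) :=
        TensorProduct.map₂ (LinearMap.mul k H).flip (tensorCoactAux B X)
      have h1 (u : H ⊗[k] B) (v : H ⊗[k] X) :
          TensorProduct.assoc k H H (B ⊗[k] X)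
            ((Coalgebra.comul (R := k) (A := H)).rTensor (B ⊗[k] X) (tensorCoactAux B X u v)) =
          F (TensorProduct.assoc k H H B ((Coalgebra.comul (R := k) (A := H)).rTensor B u))
            (TensorProduct.assoc k H H X ((Coalgebra.comul (R := k) (A := H)).rTensor X v)) := by
        induction u using TensorProduct.induction_on with
        | zero => simp
        | add y z hy hz => simp only [map_add, LinearMap.add_apply, hy, hz]
        | tmul g c =>
        induction v using TensorProduct.induction_on with
        | zero => simp
        | add y z hy hz => simp only [map_add, hy, hz]
        | tmul h x =>
          simp only [tensorCoactAux, TensorProduct.map₂_apply_tmul, TensorProduct.map_tmul,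
            LinearMap.rTensor_tmul,
            LinearMap.flip_apply, LinearMap.mul_apply', Bialgebra.comul_mul,
            TensorProduct.mk_apply]
          generalize Coalgebra.comul (R := k) g = g'
          generalize Coalgebra.comul (R := k) h = h'
          induction g' using TensorProduct.induction_on with
          | zero => simp
          | add y z hy hz => simp only [map_add, mul_add, TensorProduct.add_tmul, hy, hz,
            LinearMap.add_apply]
          | tmul g₁ g₂ =>
          induction h' using TensorProduct.induction_on with
          | zero => simp
          | add y z hy hz => simp only [map_add, add_mul, TensorProduct.add_tmul, hy, hz]
          | tmul h₁ h₂ => simp [F, tensorCoactAux]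
      have h2 (u : H ⊗[k] B) (v : H ⊗[k] X) :
          (TensorProduct.lift ((tensorCoactAux B X).compl₁₂ β.coact.toLinearMap χ.coact)).lTensor H
            (tensorCoactAux B X u v) =
          F (β.coact.toLinearMap.lTensor H u) (χ.coact.lTensor H v) := by
        induction u using TensorProduct.induction_on with
        | zero => simp
        | add y z hy hz => simp only [map_add, LinearMap.add_apply, hy, hz]
        | tmul g c =>
        induction v using TensorProduct.induction_on with
        | zero => simp
        | add y z hy hz => simp only [map_add, hy, hz]
        | tmul h x => simp [F, tensorCoactAux]
      have h3 : TensorProduct.lift ((tensorCoactAux B X).compl₁₂ β.coact.toLinearMap χ.coact)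
          (b ⊗ₜ[k] x) = tensorCoactAux B X (β.coact b) (χ.coact x) := by simp
      rw [h3, h1, h2, β.coassoc, χ.coassoc]
  counit z := by
    induction z using TensorProduct.induction_on with
    | zero => simp
    | add y z hy hz => simp only [map_add, hy, hz]
    | tmul b x =>
      have h1 (u : H ⊗[k] B) (v : H ⊗[k] X) : TensorProduct.lid k (B ⊗[k] X)
          ((Coalgebra.counit (R := k) (A := H)).rTensor (B ⊗[k] X) (tensorCoactAux B X u v)) =
          TensorProduct.lid k B ((Coalgebra.counit (R := k) (A := H)).rTensor B u) ⊗ₜ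
          TensorProduct.lid k X ((Coalgebra.counit (R := k) (A := H)).rTensor X v) := by
        induction u using TensorProduct.induction_on with
        | zero => simp
        | add y z hy hz => simp only [map_add, LinearMap.add_apply, TensorProduct.add_tmul, hy, hz]
        | tmul g c =>
        induction v using TensorProduct.induction_on with
        | zero => simp
        | add y z hy hz => simp only [map_add, TensorProduct.tmul_add, hy, hz]
        | tmul h x =>
          simp [tensorCoactAux, TensorProduct.smul_tmul', TensorProduct.tmul_smul, mul_smul]
      refine (h1 _ _).trans ?_
      rw [χ.counit]
      exact congrArg (· ⊗ₜ[k] x) (β.counit b)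
  coact_smul z b := by
    induction z using TensorProduct.induction_on with
    | zero => simp
    | add y z hy hz => simp only [smul_add, map_add, LinearMap.add_apply, hy, hz]
    | tmul c x =>
      have h1 (u w : H ⊗[k] B) (v : H ⊗[k] X) : tensorCoactAux B X (u * w) v =
          TensorProduct.map₂ (LinearMap.mul k H) (rightAction k B (B ⊗[k] X))
            (tensorCoactAux B X u v) w := by
        induction u using TensorProduct.induction_on with
        | zero => simp
        | add y z hy hz => simp only [add_mul, map_add, LinearMap.add_apply, hy, hz]
        | tmul g c =>
        induction v using TensorProduct.induction_on with
        | zero => simp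
        | add y z hy hz => simp only [map_add, LinearMap.add_apply, hy, hz]
        | tmul h x =>
        induction w using TensorProduct.induction_on with
        | zero => simp
        | add y z hy hz => simp only [mul_add, map_add, LinearMap.add_apply, hy, hz]
        | tmul g' c' =>
          simp [tensorCoactAux, rightAction_apply, TensorProduct.smul_tmul', mul_assoc]
      refine .trans ?_ (h1 _ _ _)
      exact congrArg (fun t => tensorCoactAux B X t (χ.coact x)) (map_mul β.coact c b)

lemma HopfModule.tensor_coact_tmul (b : B) (x : X) :
    χ.tensor.coact (b ⊗ₜ x) = tensorCoactAux B X (β.coact b) (χ.coact x) := rfl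

end HopfCover
-- Finitely generated projective covers of Hopf modules.
section HopfCover

variable {k H B : Type u} [Field k] [Ring H] [HopfAlgebra k H] [Ring B] [Algebra k B]
  {β : ComoduleAlgebra k H B} {X : Type u} [AddCommGroup X] [Module k X] [Module Bᵐᵒᵖ X]
  [IsScalarTower k Bᵐᵒᵖ X] (χ : HopfModule β X)

/-- Each element of a comodule lies in a finite-dimensional subcomodule. -/
lemma HopfModule.exists_finite_subcomodule (x : X) :
    ∃ V : Submodule k X, x ∈ V ∧ Module.Finite k V ∧
      ∀ v ∈ V, χ.coact v ∈ LinearMap.range (V.subtype.lTensor H) := by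
  classical
  let b := Module.Basis.ofVectorSpace k H
  obtain ⟨c, hc⟩ := TensorProduct.eq_repr_basis_left b (χ.coact x)
  -- V is spanned by the coefficients of ρ(x) with respect to a basis of H. It contains x by
  -- counitality.
  let V : Submodule k X := Submodule.span k (c '' c.support)
  have hV i : c i ∈ V := by
    by_cases hi : c i = 0
    · rw [hi]; exact zero_mem _
    · exact Submodule.subset_span ⟨i, by simpa using hi, rfl⟩
  refine ⟨V, ?_, Module.Finite.span_of_finite k (c.support.finite_toSet.image c), ?_⟩
  · rw [← χ.counit x, ← hc]
    simp only [Finsupp.sum, map_sum, LinearMap.rTensor_tmul, TensorProduct.lid_tmul]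
    exact sum_mem fun i _ => V.smul_mem _ (hV i)
  have hg (f : H →ₗ[k] k) (t : H ⊗[k] H) (v : X) (hv : v ∈ V) :
      TensorProduct.lid k (H ⊗[k] X) (f.rTensor (H ⊗[k] X) (TensorProduct.assoc k H H X (t ⊗ₜ v))) ∈
        LinearMap.range (V.subtype.lTensor H) := by
    induction t using TensorProduct.induction_on with
    | zero => simp
    | add y z hy hz => simpa only [map_add, TensorProduct.add_tmul] using add_mem hy hz
    | tmul g h => exact ⟨f g • (h ⊗ₜ ⟨v, hv⟩), by simp⟩
  have hf (f : H →ₗ[k] k) (u : H ⊗[k] X) :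
      χ.coact (TensorProduct.lid k X (f.rTensor X u)) =
        TensorProduct.lid k (H ⊗[k] X) (f.rTensor (H ⊗[k] X) (χ.coact.lTensor H u)) := by
    induction u using TensorProduct.induction_on with
    | zero => simp
    | add y z hy hz => simp only [map_add, hy, hz]
    | tmul g x => simp
  suffices V ≤ (LinearMap.range (V.subtype.lTensor H)).comap χ.coact from fun v hv => this hv
  refine Submodule.span_le.2 ?_
  rintro _ ⟨i, -, rfl⟩
  -- Each coefficient is ρ(x) contracted with a coordinate functional on H. By coassociativity its
  -- coaction is the contraction of (Δ ⊗ id)ρ(x), whose X-components still lie in V.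
  have hi : c i = TensorProduct.lid k X ((b.coord i).rTensor X (χ.coact x)) := by
    rw [← TensorProduct.equivFinsuppOfBasisLeft_apply, ← hc,
      ← TensorProduct.equivFinsuppOfBasisLeft_symm_apply, LinearEquiv.apply_symm_apply]
  change χ.coact (c i) ∈ LinearMap.range (V.subtype.lTensor H)
  rw [hi, hf, ← χ.coassoc, ← hc]
  simp only [Finsupp.sum, map_sum, LinearMap.rTensor_tmul]
  exact sum_mem fun j _ => hg _ _ _ (hV j)

lemma HopfModule.exists_finite_subcomodule_finset (s : Finset X) :
    ∃ V : Submodule k X, ↑s ⊆ (V : Set X) ∧ Module.Finite k V ∧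
      ∀ v ∈ V, χ.coact v ∈ LinearMap.range (V.subtype.lTensor H) := by
  classical
  induction s using Finset.induction_on with
  | empty =>
    refine ⟨⊥, by simp, inferInstance, fun v hv => ?_⟩
    rw [(Submodule.mem_bot k).1 hv, map_zero]
    exact zero_mem _
  | insert x s _ ih =>
    obtain ⟨V, hsV, _, hV⟩ := ih
    obtain ⟨W, hxW, _, hW⟩ := χ.exists_finite_subcomodule x
    have hmono {U U' : Submodule k X} (h : U ≤ U') : LinearMap.range (U.subtype.lTensor H) ≤
        LinearMap.range (U'.subtype.lTensor H) := by
      rintro _ ⟨z, rfl⟩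
      exact ⟨(Submodule.inclusion h).lTensor H z, by
        rw [← LinearMap.lTensor_comp_apply, Submodule.subtype_comp_inclusion]⟩
    refine ⟨V ⊔ W, ?_, inferInstance, fun v hv => ?_⟩
    · rw [Finset.coe_insert, Set.insert_subset_iff]
      exact ⟨(le_sup_right : W ≤ V ⊔ W) hxW, hsV.trans (le_sup_left : V ≤ V ⊔ W)⟩
    · obtain ⟨y, hy, z, hz, rfl⟩ := Submodule.mem_sup.1 hv
      rw [map_add]
      exact add_mem (hmono le_sup_left (hV y hy)) (hmono le_sup_right (hW z hz))

instance : Module.Projective Bᵐᵒᵖ B :=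
  Module.Projective.of_equiv (R := Bᵐᵒᵖ) (M := Bᵐᵒᵖ) (σ := RingHom.id _) (N := B)
    { opAddEquiv.symm with map_smul' := fun _ _ => rfl }

instance : Module.Finite Bᵐᵒᵖ B :=
  ⟨⟨{1}, by
    rw [Finset.coe_singleton, eq_top_iff]
    exact fun b _ => Submodule.mem_span_singleton.2 ⟨op b, by simp⟩⟩⟩

lemma finite_tensorProduct_right (V : Type u) [AddCommGroup V] [Module k V] [Module.Finite k V] :
    Module.Finite Bᵐᵒᵖ (B ⊗[k] V) := by
  classical
  obtain ⟨s, hs⟩ := Module.Finite.fg_top (R := k) (M := V)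
  refine ⟨⟨s.image (TensorProduct.mk k B V 1), eq_top_iff.2 fun z _ => ?_⟩⟩
  clear * - hs
  induction z using TensorProduct.induction_on with
  | zero => exact zero_mem _
  | add y z hy hz => exact add_mem hy hz
  | tmul b v =>
    have hv : v ∈ Submodule.span k (s : Set V) := hs ▸ Submodule.mem_top
    induction hv using Submodule.span_induction with
    | mem v hv =>
      have : (b ⊗ₜ[k] v : B ⊗[k] V) = op b • ((1 : B) ⊗ₜ[k] v) := by
        simp [TensorProduct.smul_tmul']
      rw [this]
      exact Submodule.smul_mem _ _ (Submodule.subset_span (by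
        simpa using ⟨v, hv, rfl⟩))
    | zero => rw [TensorProduct.tmul_zero]; exact zero_mem _
    | add v w _ _ hv hw => rw [TensorProduct.tmul_add]; exact add_mem hv hw
    | smul r v _ hv =>
      rw [TensorProduct.tmul_smul, ← algebraMap_smul Bᵐᵒᵖ r]
      exact Submodule.smul_mem _ _ hv

variable (k B X) in
/-- The map `b ⊗ x ↦ x b`. -/
noncomputable def rightActionHom : B ⊗[k] X →ₗ[Bᵐᵒᵖ] X where
  __ := TensorProduct.lift (rightAction k B X).flip
  map_smul' b z := by
    change TensorProduct.lift (rightAction k B X).flip (b • z) =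
      b • TensorProduct.lift (rightAction k B X).flip z
    induction z using TensorProduct.induction_on with
    | zero => simp
    | add y z hy hz => simp only [smul_add, map_add, hy, hz]
    | tmul c x => simp [TensorProduct.smul_tmul', rightAction_apply, mul_smul]

lemma rightActionHom_tmul (b : B) (x : X) : rightActionHom k B X (b ⊗ₜ x) = op b • x := rfl

lemma coact_rightActionHom (z : B ⊗[k] X) : χ.coact (rightActionHom k B X z) =
    ((rightActionHom k B X).restrictScalars k).lTensor H (χ.tensor.coact z) := by
  induction z using TensorProduct.induction_on with
  | zero => simp
  | add y z hy hz => simp only [map_add, hy, hz]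
  | tmul b x =>
    rw [rightActionHom_tmul, χ.coact_smul, χ.tensor_coact_tmul]
    generalize β.coact b = u
    generalize χ.coact x = v
    induction u using TensorProduct.induction_on with
    | zero => simp
    | add y z hy hz => simp only [map_add, LinearMap.add_apply, hy, hz]
    | tmul g c =>
    induction v using TensorProduct.induction_on with
    | zero => simp
    | add y z hy hz => simp only [map_add, LinearMap.add_apply, hy, hz]
    | tmul h x => simp [tensorCoactAux, rightAction_apply, rightActionHom_tmul]

/-- A finite set of generators lies in a finite-dimensional subcomodule V. The free module B ⊗ V
with the tensor coaction maps onto X by the action, which is colinear. -/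
lemma HopfModule.exists_cover [Module.Finite Bᵐᵒᵖ X] :
    ∃ (Q : Type u) (_ : AddCommGroup Q) (_ : Module k Q) (_ : Module Bᵐᵒᵖ Q)
      (_ : IsScalarTower k Bᵐᵒᵖ Q) (θ : HopfModule β Q) (p : Q →ₗ[Bᵐᵒᵖ] X),
      Module.Finite Bᵐᵒᵖ Q ∧ Module.Projective Bᵐᵒᵖ Q ∧ Function.Surjective p ∧
      ∀ z, χ.coact (p z) = (p.restrictScalars k).lTensor H (θ.coact z) := by
  obtain ⟨s, hs⟩ := Module.Finite.fg_top (R := Bᵐᵒᵖ) (M := X)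
  obtain ⟨V, hsV, _, hV⟩ := χ.exists_finite_subcomodule_finset s
  let i : B ⊗[k] V →ₗ[Bᵐᵒᵖ] B ⊗[k] X :=
    TensorProduct.AlgebraTensorModule.lTensor Bᵐᵒᵖ B V.subtype
  have hi : Function.Injective i :=
    Module.Flat.lTensor_preserves_injective_linearMap V.subtype V.injective_subtype
  have hr (z : B ⊗[k] V) :
      χ.tensor.coact (i z) ∈ LinearMap.range ((i.restrictScalars k).lTensor H) := by
    induction z using TensorProduct.induction_on with
    | zero => simp
    | add y z hy hz => simpa only [map_add] using add_mem hy hz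
    | tmul b v =>
      obtain ⟨w, hw⟩ := hV v v.2
      change χ.tensor.coact (b ⊗ₜ v.1) ∈ _
      rw [HopfModule.tensor_coact_tmul, ← hw]
      refine ⟨tensorCoactAux B V (β.coact b) w, ?_⟩
      clear hw
      generalize β.coact b = u
      induction u using TensorProduct.induction_on with
      | zero => simp
      | add y z hy hz => simp only [map_add, LinearMap.add_apply, hy, hz]
      | tmul g c =>
      induction w using TensorProduct.induction_on with
      | zero => simp
      | add y z hy hz => simp only [map_add, hy, hz]
      | tmul h x => simp [tensorCoactAux, i]
  obtain ⟨θ, hθ⟩ := χ.tensor.ofInjective i hi hr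
  refine ⟨B ⊗[k] V, inferInstance, inferInstance, inferInstance, inferInstance, θ,
    rightActionHom k B X ∘ₗ i, finite_tensorProduct_right V, inferInstance, ?_, fun z => ?_⟩
  · rw [← LinearMap.range_eq_top, eq_top_iff, ← hs, Submodule.span_le]
    exact fun x hx => ⟨1 ⊗ₜ ⟨x, hsV hx⟩, by simp [i, rightActionHom_tmul]⟩
  · refine (coact_rightActionHom χ (i z)).trans ?_
    rw [hθ, ← LinearMap.lTensor_comp_apply]
    rfl

lemma HopfModule.exists_shortExact [Module.Finite Bᵐᵒᵖ X] :
    ∃ (K Q : Type u) (_ : AddCommGroup K) (_ : Module k K) (_ : Module Bᵐᵒᵖ K)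
      (_ : IsScalarTower k Bᵐᵒᵖ K) (_ : AddCommGroup Q) (_ : Module k Q) (_ : Module Bᵐᵒᵖ Q)
      (_ : IsScalarTower k Bᵐᵒᵖ Q) (κ : HopfModule β K) (θ : HopfModule β Q)
      (i : K →ₗ[Bᵐᵒᵖ] Q) (p : Q →ₗ[Bᵐᵒᵖ] X),
      Function.Injective i ∧ Function.Exact i p ∧ Function.Surjective p ∧
      Module.Finite Bᵐᵒᵖ Q ∧ Module.Projective Bᵐᵒᵖ Q ∧
      (∀ y, θ.coact (i y) = (i.restrictScalars k).lTensor H (κ.coact y)) ∧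
      ∀ z, χ.coact (p z) = (p.restrictScalars k).lTensor H (θ.coact z) := by
  obtain ⟨Q, _, _, _, _, θ, p, hf, hp, hs, hθ⟩ := χ.exists_cover
  obtain ⟨κ, hκ⟩ := θ.ofInjective (LinearMap.ker p).subtype Subtype.val_injective
    (θ.coact_mem_range_of_exact χ _ p (LinearMap.exact_subtype_ker_map p) hθ)
  exact ⟨LinearMap.ker p, Q, inferInstance, inferInstance, inferInstance, inferInstance,
    inferInstance, inferInstance, inferInstance, inferInstance, κ, θ, _, p,
    Subtype.val_injective, LinearMap.exact_subtype_ker_map p, hs, hf, hp, hκ, hθ⟩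

-- The sequence of `HopfModule.exists_shortExact` as one in the category of B-modules. This is the
-- tool for dimension shifting in the Hopf module variable.
open scoped ModuleCat in
lemma ModuleCat.exists_hopf_cover {X : ModuleCat.{u} Bᵐᵒᵖ} (χ : HopfModule β X)
    [Module.Finite Bᵐᵒᵖ X] :
    ∃ (K Q : ModuleCat.{u} Bᵐᵒᵖ) (κ : HopfModule β K) (θ : HopfModule β Q) (i : K ⟶ Q)
      (p : Q ⟶ X) (w : i ≫ p = 0), (ShortComplex.mk i p w).ShortExact ∧
      Module.Finite Bᵐᵒᵖ Q ∧ Module.Projective Bᵐᵒᵖ Q ∧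
      (∀ y, θ.coact (i y) = (i.hom.restrictScalars k).lTensor H (κ.coact y)) ∧
      (∀ y, χ.coact (p y) = (p.hom.restrictScalars k).lTensor H (θ.coact y)) := by
  obtain ⟨K, Q, _, iK, _, _, _, iQ, _, _, κ, θ, i, p, hi, hip, hs, hf, hp, hκ, hθ⟩ :=
    χ.exists_shortExact
  -- The scalar action of k is forced by the B-action, so it may be replaced by the one that the
  -- category supplies.
  have : iQ = ModuleCat.moduleOfAlgebraModule (ModuleCat.of Bᵐᵒᵖ Q) :=
    Module.ext' _ _ fun r x => (algebraMap_smul Bᵐᵒᵖ r x).symm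
  subst this
  have : iK = ModuleCat.moduleOfAlgebraModule (ModuleCat.of Bᵐᵒᵖ K) :=
    Module.ext' _ _ fun r x => (algebraMap_smul Bᵐᵒᵖ r x).symm
  subst this
  exact ⟨ModuleCat.of Bᵐᵒᵖ K, ModuleCat.of Bᵐᵒᵖ Q, κ, θ, ModuleCat.ofHom i, ModuleCat.ofHom p,
    ModuleCat.hom_ext (LinearMap.ext fun x => (hip _).2 ⟨x, rfl⟩),
    ModuleCat.shortComplex_shortExact _ hip hi hs, hf, hp, hκ, hθ⟩

end HopfCover

/-! ## Resolutions from short exact sequences -/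

section Splice

open Limits

variable {C : Type*} [Category* C] [Abelian C]

/-- A projective resolution spliced from short exact sequences. -/
noncomputable def CategoryTheory.ProjectiveResolution.splice (Z Q : ℕ → C)
    (i : ∀ n, Z (n + 1) ⟶ Q n)
    (p : ∀ n, Q n ⟶ Z n) (w : ∀ n, i n ≫ p n = 0)
    (hS : ∀ n, (ShortComplex.mk (i n) (p n) (w n)).ShortExact) (hQ : ∀ n, Projective (Q n)) :
    ProjectiveResolution (Z 0) where
  complex := ChainComplex.of Q (fun n => p (n + 1) ≫ i n) (fun n => by
    rw [Category.assoc, reassoc_of% (w (n + 1)), zero_comp, comp_zero])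
  projective := hQ
  π := (ChainComplex.toSingle₀Equiv _ _).symm ⟨p 0,
    (congrArg (· ≫ p 0) (ChainComplex.of_d Q (fun n => p (n + 1) ≫ i n) 0)).trans
      (by rw [Category.assoc, w, comp_zero])⟩
  quasiIso := ⟨fun n => by
    have hi (n) : Mono (i n) := (hS n).mono_f
    have hp (n) : Epi (p n) := (hS n).epi_g
    have he (n) (h : (p (n + 1) ≫ i n) ≫ p n = 0) :
        (ShortComplex.mk (p (n + 1) ≫ i n) (p n) h).Exact :=
      (ShortComplex.exact_iff_of_epi_of_isIso_of_mono
        (S₁ := ShortComplex.mk (p (n + 1) ≫ i n) (p n) h) (S₂ := ShortComplex.mk (i n) (p n) (w n))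
        { τ₁ := p (n + 1), τ₂ := 𝟙 _, τ₃ := 𝟙 _ }).2 (hS n).exact
    cases n with
    | zero =>
      rw [ChainComplex.quasiIsoAt₀_iff, ShortComplex.quasiIso_iff_of_zeros']
      · refine (ShortComplex.exact_and_epi_g_iff_of_iso ?_).2
          ⟨he 0 (by rw [Category.assoc, w, comp_zero]), hp 0⟩
        refine ShortComplex.isoMk (Iso.refl _) (Iso.refl _) (Iso.refl _) ?_ ?_
        · refine (Category.id_comp _).trans (.trans ?_ (Category.comp_id _).symm)
          exact (ChainComplex.of_d Q (fun n => p (n + 1) ≫ i n) 0).symm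
        · refine (Category.id_comp _).trans (.trans ?_ (Category.comp_id _).symm)
          exact (ChainComplex.toSingle₀Equiv_symm_apply_f_zero
            (C := ChainComplex.of Q (fun n => p (n + 1) ≫ i n) _) (p 0) _).symm
      all_goals rfl
    | succ n =>
      rw [quasiIsoAt_iff_exactAt']
      · rw [HomologicalComplex.exactAt_iff' _ (n + 1 + 1) (n + 1) n (by simp) (by simp)]
        have h : (p (n + 2) ≫ i (n + 1)) ≫ p (n + 1) = 0 := by
          rw [Category.assoc, w, comp_zero]
        have h2 := (ShortComplex.exact_iff_of_epi_of_isIso_of_mono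
          (S₁ := ShortComplex.mk (p (n + 2) ≫ i (n + 1)) (p (n + 1)) h)
          (S₂ := ShortComplex.mk (p (n + 2) ≫ i (n + 1)) (p (n + 1) ≫ i n)
            (by rw [← Category.assoc, h, zero_comp]))
          { τ₁ := 𝟙 _, τ₂ := 𝟙 _, τ₃ := i n }).1 (he (n + 1) h)
        refine ShortComplex.exact_of_iso (S₁ := ShortComplex.mk (p (n + 2) ≫ i (n + 1)) (p (n + 1)
          ≫ i n)
            (by rw [← Category.assoc, h, zero_comp])) ?_ h2
        refine ShortComplex.isoMk (Iso.refl _) (Iso.refl _) (Iso.refl _) ?_ ?_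
        · refine (Category.id_comp _).trans (.trans ?_ (Category.comp_id _).symm)
          exact ChainComplex.of_d Q (fun n => p (n + 1) ≫ i n) (n + 1)
        · refine (Category.id_comp _).trans (.trans ?_ (Category.comp_id _).symm)
          exact ChainComplex.of_d Q (fun n => p (n + 1) ≫ i n) n
      · apply ChainComplex.exactAt_succ_single_obj⟩

lemma resolutionAug_splice {R : Type u} [Ring R] (Z Q : ℕ → ModuleCat.{u} R)
    (i : ∀ n, Z (n + 1) ⟶ Q n) (p : ∀ n, Q n ⟶ Z n) (w : ∀ n, i n ≫ p n = 0)
    (hS : ∀ n, (ShortComplex.mk (i n) (p n) (w n)).ShortExact) (hQ : ∀ n, Projective (Q n)) :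
    resolutionAug (M := Z 0) (ProjectiveResolution.splice Z Q i p w hS hQ) = p 0 :=
  (Category.comp_id _).trans (ChainComplex.toSingle₀Equiv_symm_apply_f_zero
    (C := ChainComplex.of Q (fun n => p (n + 1) ≫ i n) _) (p 0) _)

lemma splice_d (Z Q : ℕ → C) (i : ∀ n, Z (n + 1) ⟶ Q n)
    (p : ∀ n, Q n ⟶ Z n) (w : ∀ n, i n ≫ p n = 0)
    (hS : ∀ n, (ShortComplex.mk (i n) (p n) (w n)).ShortExact) (hQ : ∀ n, Projective (Q n))
    (n : ℕ) :
    (ProjectiveResolution.splice Z Q i p w hS hQ).complex.d (n + 1) n = p (n + 1) ≫ i n :=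
  ChainComplex.of_d Q (fun n => p (n + 1) ≫ i n) n

end Splice

/-! ### Existence of the Hopf and the equivariant resolutions. -/

section Resolutions

variable {k H A B : Type u} [Field k] [Ring H] [HopfAlgebra k H] [Ring A] [Algebra k A]
  [Ring B] [Algebra k B]

open scoped ModuleCat

/-- The Hopf resolution spliced from short exact sequences of Hopf modules. -/
noncomputable def HopfResolution.splice {β : ComoduleAlgebra k H B} (Z Q : ℕ → ModuleCat.{u} Bᵐᵒᵖ)
    (κ : ∀ n, HopfModule β (Z n)) (θ : ∀ n, HopfModule β (Q n))
    (i : ∀ n, Z (n + 1) ⟶ Q n) (p : ∀ n, Q n ⟶ Z n) (w : ∀ n, i n ≫ p n = 0)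
    (hS : ∀ n, (ShortComplex.mk (i n) (p n) (w n)).ShortExact)
    (hf : ∀ n, Module.Finite Bᵐᵒᵖ (Q n)) (hQ : ∀ n, Projective (Q n))
    (hi : ∀ n y, (θ n).coact (i n y) =
      ((i n).hom.restrictScalars k).lTensor H ((κ (n + 1)).coact y))
    (hp : ∀ n y, (κ n).coact (p n y) =
      ((p n).hom.restrictScalars k).lTensor H ((θ n).coact y)) :
    HopfResolution (κ 0) where
  res := ProjectiveResolution.splice Z Q i p w hS hQ
  finite := hf
  mod n := ModuleCat.moduleOfAlgebraModule (Q n)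
  tower n := ModuleCat.isScalarTower_of_algebra_moduleCat (Q n)
  hopf := θ
  d_coact n x := by
    rw [splice_d Z Q i p w hS hQ n]
    refine (hi n _).trans ((congrArg _ (hp (n + 1) x)).trans ?_)
    exact (LinearMap.lTensor_comp_apply _ _ _ _).symm
  aug_coact x := by
    rw [resolutionAug_splice Z Q i p w hS hQ]
    exact hp 0 x

/-- The covers can be iterated because the kernel is again of type FP_∞ by
`ModuleCat.IsFPInfinity.of_exact`, in particular finitely generated. The pseudo-coherent resolution
of X itself carries no coaction. -/
lemma exists_hopfResolution {β : ComoduleAlgebra k H B} {X : ModuleCat.{u} Bᵐᵒᵖ}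
    (χ : HopfModule β X) (hX : X.IsFPInfinity) : Nonempty (HopfResolution χ) := by
  let Obj := {Y : Σ Y : ModuleCat.{u} Bᵐᵒᵖ, HopfModule β Y // Y.1.IsFPInfinity}
  have step (Y : Obj) : ∃ (K : Obj) (Q : ModuleCat.{u} Bᵐᵒᵖ) (θ : HopfModule β Q)
      (i : K.1.1 ⟶ Q) (p : Q ⟶ Y.1.1) (w : i ≫ p = 0), (ShortComplex.mk i p w).ShortExact ∧
      Module.Finite Bᵐᵒᵖ Q ∧ Projective Q ∧
      (∀ y, θ.coact (i y) = (i.hom.restrictScalars k).lTensor H (K.1.2.coact y)) ∧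
      (∀ y, Y.1.2.coact (p y) = (p.hom.restrictScalars k).lTensor H (θ.coact y)) := by
    have := Y.2.finite
    obtain ⟨K, Q, κ, θ, i, p, w, hS, hf, hQ, hi, hp⟩ := ModuleCat.exists_hopf_cover Y.1.2
    exact ⟨⟨⟨K, κ⟩, Y.2.of_exact i.hom p.hom hS.moduleCat_injective_f
      ((ShortComplex.ShortExact.moduleCat_exact_iff_function_exact _).1 hS.exact)
      hS.moduleCat_surjective_g⟩, Q, θ, i, p, w, hS, hf,
      Q.projective_of_categoryTheory_projective, hi, hp⟩
  choose K Q θ i p w hS hf hQ hi hp using step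
  let Z (n : ℕ) : Obj := Nat.rec ⟨⟨X, χ⟩, hX⟩ (fun _ Y => K Y) n
  exact ⟨HopfResolution.splice (fun n => (Z n).1.1) (fun n => Q (Z n)) (fun n => (Z n).1.2)
    (fun n => θ (Z n)) (fun n => i (Z n)) (fun n => p (Z n)) (fun n => w (Z n))
    (fun n => hS (Z n)) (fun n => hf (Z n)) (fun n => hQ (Z n)) (fun n => hi (Z n))
    (fun n => hp (Z n))⟩

/-- The equivariant resolution spliced from short exact sequences of `A # H`-modules. -/
noncomputable def EquivariantResolution.splice (α : ModuleAlgebra k H A)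
    (Z Q : ℕ → ModuleCat.{u} (SmashHopf α)ᵐᵒᵖ)
    (i : ∀ n, Z (n + 1) ⟶ Q n) (p : ∀ n, Q n ⟶ Z n)
    (w : ∀ n, (smashRes α).map (i n) ≫ (smashRes α).map (p n) = 0)
    (hS : ∀ n, (ShortComplex.mk ((smashRes α).map (i n)) ((smashRes α).map (p n))
      (w n)).ShortExact)
    (hQ : ∀ n, Projective ((smashRes α).obj (Q n))) :
    EquivariantResolution α ((smashRes α).obj (Z 0)) where
  res := ProjectiveResolution.splice (fun n => (smashRes α).obj (Z n))
    (fun n => (smashRes α).obj (Q n)) (fun n => (smashRes α).map (i n))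
    (fun n => (smashRes α).map (p n)) w hS hQ
  mod n := (Q n).isModule
  smul_eq _ _ _ := rfl
  d_smul n s x := by
    rw [splice_d (fun n => (smashRes α).obj (Z n))
      (fun n => (smashRes α).obj (Q n)) (fun n => (smashRes α).map (i n))
      (fun n => (smashRes α).map (p n)) w hS hQ n]
    exact (congrArg (i n) ((p (n + 1)).hom.map_smul s x)).trans ((i n).hom.map_smul s _)
  aug_smul s x := by
    rw [resolutionAug_splice (fun n => (smashRes α).obj (Z n))
      (fun n => (smashRes α).obj (Q n)) (fun n => (smashRes α).map (i n))
      (fun n => (smashRes α).map (p n)) w hS hQ]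
    exact (p 0).hom.map_smul s x

/-- Projective covers over A # H are iterated and then restricted to A, where they remain
projective. -/
lemma exists_equivariantResolution (α : ModuleAlgebra k H A)
    (hS : Function.Bijective (HopfAlgebra.antipode k (A := H)))
    (N : ModuleCat.{u} (SmashHopf α)ᵐᵒᵖ) :
    Nonempty (EquivariantResolution α ((smashRes α).obj N)) := by
  have step (Y : ModuleCat.{u} (SmashHopf α)ᵐᵒᵖ) : ∃ (K Q : ModuleCat.{u} (SmashHopf α)ᵐᵒᵖ)
      (i : K ⟶ Q) (p : Q ⟶ Y) (w : i ≫ p = 0), (ShortComplex.mk i p w).ShortExact ∧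
      Projective Q :=
    let P : ProjectivePresentation Y := Classical.arbitrary _
    ⟨_, P.p, _, P.f, Limits.kernel.condition P.f, { exact := ShortComplex.exact_kernel P.f },
      P.projective⟩
  choose K Q i p w hS' hQ using step
  have hR := smashRes_preservesProjectiveObjects α hS
  let Z (n : ℕ) : ModuleCat.{u} (SmashHopf α)ᵐᵒᵖ := Nat.rec N (fun _ Y => K Y) n
  exact ⟨EquivariantResolution.splice α Z (fun n => Q (Z n)) (fun n => i (Z n))
    (fun n => p (Z n)) (fun n => by rw [← Functor.map_comp, w, Functor.map_zero])
    (fun n => (hS' (Z n)).map_of_exact (smashRes α))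
    (fun n => (smashRes α).projective_obj_of_projective (hQ _))⟩

end Resolutions

/-! ## Tensor products and spaces of homomorphisms -/

section TensorHom

open scoped ModuleCat

variable {k B : Type u} [Field k] [Ring B] [Algebra k B] (V : Type u) [AddCommGroup V] [Module k V]
  (Q X : ModuleCat.{u} Bᵐᵒᵖ)

variable (k) in
/-- The map `v ⊗ g ↦ (q ↦ v ⊗ g q)`. -/
noncomputable def tensorHom : V ⊗[k] (Q ⟶ X) →ₗ[k] Q →ₗ[k] V ⊗[k] X :=
  TensorProduct.lift (LinearMap.mk₂ k
    (fun v (g : Q ⟶ X) => TensorProduct.mk k V X v ∘ₗ g.hom.restrictScalars k)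
    (fun _ _ _ => LinearMap.ext fun _ => TensorProduct.add_tmul _ _ _)
    (fun _ _ _ => LinearMap.ext fun _ => TensorProduct.smul_tmul' _ _ _)
    (fun _ _ _ => LinearMap.ext fun _ => TensorProduct.tmul_add _ _ _)
    (fun r v g => LinearMap.ext fun q => (congrArg (v ⊗ₜ[k] ·)
      (show (r • g : Q ⟶ X) q = r • g q from rfl)).trans (TensorProduct.tmul_smul _ _ _)))

variable {V Q X}

lemma tensorHom_injective : Function.Injective (tensorHom k V Q X) := by
  classical
  rw [injective_iff_map_eq_zero]
  intro z hz
  let b := Module.Basis.ofVectorSpace k V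
  obtain ⟨c, rfl⟩ := TensorProduct.eq_repr_basis_left b z
  suffices c = 0 by simp [this]
  ext i q
  have h : (c.mapRange (fun g : Q ⟶ X => g q) rfl).sum (fun i x => b i ⊗ₜ[k] x) = 0 := by
    rw [Finsupp.sum_mapRange_index (fun _ => TensorProduct.tmul_zero _ _)]
    refine .trans ?_ (LinearMap.congr_fun hz q)
    simp only [Finsupp.sum, map_sum, LinearMap.sum_apply]
    rfl
  have := DFunLike.congr_fun (TensorProduct.sum_tmul_basis_left_eq_zero b _ h) i
  exact this

/-- The coordinates of φ in a basis of V are B-linear maps Q → X, and on a finite set of generators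
all but finitely many of them vanish. So finite generation of Q makes V ⊗ Hom(Q, X) → Hom(Q, V ⊗ X)
surjective; `tensorHom_injective` holds in general. -/
lemma exists_tensorHom_eq [Module.Finite Bᵐᵒᵖ Q] (φ : Q →ₗ[k] V ⊗[k] X)
    (hφ : ∀ q b, φ (op b • q) = ((rightAction k B X).flip b).lTensor V (φ q)) :
    ∃ z, tensorHom k V Q X z = φ := by
  classical
  let b := Module.Basis.ofVectorSpace k V
  let c (z : V ⊗[k] X) := TensorProduct.equivFinsuppOfBasisLeft b z
  have hc (z : V ⊗[k] X) : (c z).sum (fun i x => b i ⊗ₜ[k] x) = z := by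
    rw [← TensorProduct.equivFinsuppOfBasisLeft_symm_apply, LinearEquiv.symm_apply_apply]
  have hcl (z i) : c z i = TensorProduct.lid k X ((b.coord i).rTensor X z) :=
    TensorProduct.equivFinsuppOfBasisLeft_apply b z i
  have hcs (i) (x : B) (z : V ⊗[k] X) :
      c (((rightAction k B X).flip x).lTensor V z) i = op x • c z i := by
    rw [hcl, hcl]
    induction z using TensorProduct.induction_on with
    | zero => simp
    | add y z hy hz => simp only [map_add, smul_add, hy, hz]
    | tmul v y =>
      simp only [LinearMap.lTensor_tmul, LinearMap.rTensor_tmul, TensorProduct.lid_tmul,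
        LinearMap.flip_apply, rightAction_apply]
      exact (smul_comm _ _ _)
  let g (i) : Q ⟶ X := ModuleCat.ofHom
    { toFun := fun q => c (φ q) i
      map_add' := fun x y => by simp only [map_add, c, Finsupp.add_apply]
      map_smul' := fun x q => (congrArg (fun z => c z i) (hφ q x.unop)).trans (hcs i x.unop _) }
  obtain ⟨s, hs⟩ := Module.Finite.fg_top (R := Bᵐᵒᵖ) (M := Q)
  let I := s.biUnion fun q => (c (φ q)).support
  have hg (i) (hi : i ∉ I) : (g i).hom = 0 := by
    refine LinearMap.ext_on (s := (s : Set Q)) hs fun q hq => ?_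
    by_contra h
    exact hi (Finset.mem_biUnion.2 ⟨q, hq, Finsupp.mem_support_iff.2 h⟩)
  refine ⟨∑ i ∈ I, b i ⊗ₜ g i, LinearMap.ext fun q => ?_⟩
  rw [map_sum, LinearMap.sum_apply, ← hc (φ q)]
  refine (Finset.sum_subset_zero_on_sdiff (f := fun i => b i ⊗ₜ[k] c (φ q) i)
    (s₁ := (c (φ q)).support) (fun i hi => ?_) (fun i hi => ?_) fun i _ => rfl).symm
  · by_contra h
    exact Finsupp.mem_support_iff.1 hi (LinearMap.congr_fun (hg i h) q)
  · rw [Finsupp.notMem_support_iff.1 (Finset.mem_sdiff.1 hi).2, TensorProduct.tmul_zero]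

end TensorHom

lemma ModuleCat.isFPInfinity_of_projective {R : Type u} [Ring R] (P : ModuleCat.{u} R)
    [Module.Finite R P] [Module.Projective R P] : P.IsFPInfinity := by
  refine ⟨fun P => Module.Finite R P ∧ Module.Projective R P, fun N hN => ?_,
    ‹Module.Finite R P›, ‹Module.Projective R P›⟩
  have : Subsingleton (ModuleCat.of R PUnit.{u + 1}) :=
    inferInstanceAs (Subsingleton PUnit.{u + 1})
  refine ⟨ModuleCat.of R PUnit.{u + 1}, N, 0, LinearMap.id, fun _ _ _ => Subsingleton.elim _ _,
    fun x => ⟨fun h => ⟨0, h.symm⟩, fun ⟨_, h⟩ => h.symm⟩, Function.surjective_id, hN.1, hN.2,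
    ?_, ?_⟩
  · exact (Module.Finite.of_surjective (0 : R →ₗ[R] PUnit.{u + 1}) fun _ => ⟨0, rfl⟩ :)
  · exact (⟨⟨0, fun _ => Subsingleton.elim (α := PUnit.{u + 1}) _ _⟩⟩ :
      Module.Projective R PUnit.{u + 1})

/-! ### Comparison of V ⊗ Ext(X, Y) with Ext(X, Y'). -/

section TensorExt

universe v w

variable {k : Type u} [Field k] {C : Type v} [Category.{w} C] [Abelian C] [Linear k C]
  [HasExt.{w} C]
  {V : Type*} [AddCommGroup V] [Module k V] {Y Y' : C} (s : V →ₗ[k] (Y ⟶ Y'))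

/-- The map `v ⊗ γ ↦ γ s(v)`. -/
noncomputable def tensorExt (X : C) (n : ℕ) : V ⊗[k] Ext X Y n →ₗ[k] Ext X Y' n :=
  TensorProduct.lift ((Ext.bilinearCompOfLinear k X Y Y' n 0 n (add_zero n)).flip ∘ₗ
    (Ext.linearEquiv₀ (R := k)).symm.toLinearMap ∘ₗ s)

lemma tensorExt_tmul (X : C) (n : ℕ) (v : V) (γ : Ext X Y n) :
    tensorExt s X n (v ⊗ₜ γ) = γ.comp (Ext.mk₀ (s v)) (add_zero n) := rfl

/-- Precomposition with `x`. -/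
noncomputable def extPrecomp {X X' : C} {a : ℕ} (x : Ext X' X a) (Z : C) {n m : ℕ} (h : a + n = m) :
    Ext X Z n →ₗ[k] Ext X' Z m :=
  Ext.bilinearCompOfLinear k X' X Z a n m h x

lemma extPrecomp_apply {X X' : C} {a : ℕ} (x : Ext X' X a) (Z : C) {n m : ℕ} (h : a + n = m)
    (y : Ext X Z n) : extPrecomp (k := k) x Z h y = x.comp y h := rfl

lemma tensorExt_precomp {X X' : C} {a n m : ℕ} (x : Ext X' X a) (h : a + n = m)
    (z : V ⊗[k] Ext X Y n) :
    tensorExt s X' m ((extPrecomp x Y h).lTensor V z) = x.comp (tensorExt s X n z) h := by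
  induction z using TensorProduct.induction_on with
  | zero => simp
  | add y z hy hz => simp only [map_add, Ext.comp_add, hy, hz]
  | tmul v γ =>
    rw [LinearMap.lTensor_tmul, tensorExt_tmul, tensorExt_tmul, extPrecomp_apply,
      Ext.comp_assoc x γ _ h (add_zero n) (by omega)]

lemma tensorExt_bijective_of_projective (X : C) [Projective X]
    (h : Function.Bijective (tensorExt s X 0)) (n : ℕ) :
    Function.Bijective (tensorExt s X n) := by
  obtain rfl | n := n
  · exact h
  · have h₁ (y : Ext X Y (n + 1)) : y = 0 := y.eq_zero_of_projective
    refine ⟨fun a b _ => ?_, fun y => ⟨0, by rw [map_zero, y.eq_zero_of_projective]⟩⟩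
    have (a : V ⊗[k] Ext X Y (n + 1)) : a = 0 := by
      induction a using TensorProduct.induction_on with
      | zero => rfl
      | add y z hy hz => rw [hy, hz, add_zero]
      | tmul v γ => rw [h₁ γ, TensorProduct.tmul_zero]
    rw [this a, this b]

/-- Both sides have long exact sequences in X, the left one because V ⊗ - is exact. So
`bijective_of_coverings` reduces the claim to projective members of O, where only degree zero is
nontrivial. -/
lemma tensorExt_bijective {O : C → Prop} (hO : ∀ X, O X → ∃ (K P : C) (i : K ⟶ P) (p : P ⟶ X)
      (w : i ≫ p = 0), (ShortComplex.mk i p w).ShortExact ∧ Projective P ∧ O K ∧ O P ∧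
        Function.Bijective (tensorExt s P 0)) (X : C) (hX : O X) (n : ℕ) :
    Function.Bijective (tensorExt s X n) := by
  refine bijective_of_coverings (O := {X // O X}) (T := fun n X => V ⊗[k] Ext X.1 Y n)
    (T' := fun n X => Ext X.1 Y' n) (fun n X => (tensorExt s X.1 n).toAddMonoidHom) ?_ n ⟨X, hX⟩
  rintro ⟨X, hX⟩
  obtain ⟨K, P, i, p, w, hS, hP, hK, hP', hb⟩ := hO X hX
  have e₁ (Z : C) (n : ℕ) : Function.Exact (extPrecomp (k := k) (Ext.mk₀ p) Z (zero_add n))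
      (extPrecomp (k := k) (Ext.mk₀ i) Z (zero_add n)) := by
    refine fun y => ⟨fun h => Ext.contravariant_sequence_exact₂ hS Z y h, ?_⟩
    rintro ⟨y, rfl⟩
    rw [extPrecomp_apply, extPrecomp_apply, ← Ext.comp_assoc _ _ _ (zero_add 0) (zero_add n)
      (by omega), Ext.mk₀_comp_mk₀, w,
      Ext.mk₀_zero, Ext.zero_comp]
  have e₂ (Z : C) (n : ℕ) : Function.Exact (extPrecomp (k := k) (Ext.mk₀ i) Z (zero_add n))
      (extPrecomp (k := k) hS.extClass Z (add_comm 1 n)) := by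
    refine fun y => ⟨fun h => Ext.contravariant_sequence_exact₁ hS Z y (add_comm 1 n) h, ?_⟩
    rintro ⟨y, rfl⟩
    rw [extPrecomp_apply, extPrecomp_apply, ← Ext.comp_assoc _ _ _ (add_zero 1) (zero_add n)
      (by omega),
      hS.extClass_comp, Ext.zero_comp]
  have e₃ (Z : C) (n : ℕ) : Function.Exact (extPrecomp (k := k) hS.extClass Z (add_comm 1 n))
      (extPrecomp (k := k) (Ext.mk₀ p) Z (zero_add (n + 1))) := by
    refine fun y => ⟨fun h => Ext.contravariant_sequence_exact₃ hS Z y h (add_comm 1 n), ?_⟩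
    rintro ⟨y, rfl⟩
    rw [extPrecomp_apply, extPrecomp_apply, ← Ext.comp_assoc _ _ _ (zero_add 1) (add_comm 1 n)
      (by omega),
      hS.comp_extClass, Ext.zero_comp]
  have e₀ (Z : C) : Function.Injective (extPrecomp (k := k) (Ext.mk₀ p) Z (zero_add 0)) :=
    have := hS.epi_g
    Ext.precomp_mk₀_injective_of_epi Z p
  refine ⟨⟨P, hP'⟩, ⟨K, hK⟩,
    fun n => ((extPrecomp (Ext.mk₀ p) Y (zero_add n)).lTensor V).toAddMonoidHom,
    fun n => ((extPrecomp (Ext.mk₀ i) Y (zero_add n)).lTensor V).toAddMonoidHom,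
    fun n => ((extPrecomp hS.extClass Y (add_comm 1 n)).lTensor V).toAddMonoidHom,
    fun n => (extPrecomp (k := k) (Ext.mk₀ p) Y' (zero_add n)).toAddMonoidHom,
    fun n => (extPrecomp (k := k) (Ext.mk₀ i) Y' (zero_add n)).toAddMonoidHom,
    fun n => (extPrecomp (k := k) hS.extClass Y' (add_comm 1 n)).toAddMonoidHom,
    Module.Flat.lTensor_preserves_injective_linearMap _ (e₀ Y), e₀ Y',
    fun n => Module.Flat.lTensor_exact V (e₁ Y n), e₁ Y',
    fun n => Module.Flat.lTensor_exact V (e₂ Y n), e₂ Y',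
    fun n => Module.Flat.lTensor_exact V (e₃ Y n), e₃ Y',
    fun n => tensorExt_precomp s _ _, fun n => tensorExt_precomp s _ _,
    fun n => tensorExt_precomp s _ _, fun n => tensorExt_bijective_of_projective s P hb n⟩

end TensorExt

/-! ## The coaction on Ext -/

section ExtCoact

open Limits HopfAlgebra
open scoped ModuleCat

variable {k : Type u} [Field k] {H B : Type u} [Ring H] [HopfAlgebra k H]
  [Ring B] [Algebra k B] {β : ComoduleAlgebra k H B}

variable (k H) in
/-- The maps `x ↦ h ⊗ x`, for varying `h`. -/
noncomputable def freeInsertLin (X : ModuleCat.{u} Bᵐᵒᵖ) :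
    H →ₗ[k] (X ⟶ (freeFunctor k H B).obj X) where
  toFun h := (freeInsert k B h).app X
  map_add' h h' := ModuleCat.hom_ext (LinearMap.ext fun x => TensorProduct.add_tmul h h' x)
  map_smul' r h := by
    ext x
    refine .trans ?_ (algebraMap_smul (M := DiagModule
      (Algebra.TensorProduct.includeRight : B →ₐ[k] H ⊗[k] B) H X) Bᵐᵒᵖ r
      (h ⊗ₜ[k] x : H ⊗[k] X)).symm
    rfl

lemma freeInsertLin_apply (X : ModuleCat.{u} Bᵐᵒᵖ) (h : H) :
    freeInsertLin k H X h = (freeInsert k B h).app X := rfl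

lemma tensorExt_freeInsertLin_zero (X X' : ModuleCat.{u} Bᵐᵒᵖ) (z : H ⊗[k] (X ⟶ X')) (x : X) :
    (Ext.linearEquiv₀ (R := k) (tensorExt (freeInsertLin k H X') X 0
      ((Ext.linearEquiv₀ (R := k)).symm.toLinearMap.lTensor H z)) :
        X ⟶ (freeFunctor k H B).obj X') x = tensorHom k H X X' z x := by
  induction z using TensorProduct.induction_on with
  | zero => simp; rfl
  | add y z hy hz => simp only [map_add, LinearMap.add_apply, ← hy, ← hz]; rfl
  | tmul h g =>
    rw [LinearMap.lTensor_tmul, tensorExt_tmul]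
    refine (congrArg (fun y => (Ext.linearEquiv₀ (R := k) y : X ⟶ (freeFunctor k H B).obj X') x)
      (Ext.mk₀_comp_mk₀ g (freeInsertLin k H X' h))).trans ?_
    refine (congrArg (fun f : X ⟶ (freeFunctor k H B).obj X' => f x)
      ((Ext.linearEquiv₀ (R := k)).apply_symm_apply (g ≫ freeInsertLin k H X' h))).trans ?_
    rfl

/-- Ext out of a module of type FP_∞ commutes with H ⊗ - for H of any dimension. On a finitely
generated projective module this is injectivity and surjectivity of `tensorHom`. -/
lemma tensorExt_freeInsertLin_bijective (X X' : ModuleCat.{u} Bᵐᵒᵖ) (hX : X.IsFPInfinity)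
    (n : ℕ) : Function.Bijective (tensorExt (freeInsertLin k H X') X n) := by
  refine tensorExt_bijective _ (O := ModuleCat.IsFPInfinity) (fun X hX => ?_) X hX n
  obtain ⟨K, P, i, p, hi, hip, hp, _, _, hK⟩ := hX.exists_cover
  refine ⟨K, P, ModuleCat.ofHom i, ModuleCat.ofHom p,
    ModuleCat.hom_ext (LinearMap.ext fun x => (hip _).2 ⟨x, rfl⟩),
    ModuleCat.shortComplex_shortExact _ hip hi hp, P.projective_of_categoryTheory_projective,
    hK, P.isFPInfinity_of_projective, ?_⟩
  let e := LinearEquiv.lTensor H (Ext.linearEquiv₀ (R := k) (X := P) (Y := X')).symm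
  constructor
  · refine Function.Injective.of_comp_right (g := e) (fun z z' h => ?_) e.surjective
    refine tensorHom_injective (LinearMap.ext fun x => ?_)
    rw [← tensorExt_freeInsertLin_zero, ← tensorExt_freeInsertLin_zero]
    exact congrArg (fun y => (Ext.linearEquiv₀ (R := k) y :
      P ⟶ (freeFunctor k H B).obj X') x) h
  · intro y
    obtain ⟨g, rfl⟩ := (Ext.linearEquiv₀ (R := k)).symm.surjective y
    let g' : P →ₗ[k] H ⊗[k] X' :=
      { toFun := g.hom
        map_add' := g.hom.map_add
        map_smul' := fun r x => (g.hom.map_smul (algebraMap k Bᵐᵒᵖ r) x).trans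
          (algebraMap_smul (M := DiagModule
            (Algebra.TensorProduct.includeRight : B →ₐ[k] H ⊗[k] B) H X') Bᵐᵒᵖ r _) }
    obtain ⟨z, hz⟩ := exists_tensorHom_eq (k := k) (V := H) (Q := P) (X := X')
      g' fun q b => (g.hom.map_smul (op b) q).trans (tensorAction_one_tmul (g' q) b)
    refine ⟨e z, (Ext.linearEquiv₀ (R := k)).injective ?_⟩
    ext x
    refine (tensorExt_freeInsertLin_zero P X' z x).trans ?_
    rw [hz, LinearEquiv.apply_symm_apply]
    rfl

variable (hS : Function.Bijective (antipode k (A := H)))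
  {X X' X'' : ModuleCat.{u} Bᵐᵒᵖ} (χ : HopfModule β X) (χ' : HopfModule β X')
  (χ'' : HopfModule β X'')

/-- The image of a class under the functor `H ⊗ -`, as a class on `X` with values in the free
module `H ⊗ X'`. -/
noncomputable def extTwist (n : ℕ) : Ext X X' n →ₗ[k] Ext X ((freeFunctor k H B).obj X') n :=
  extPrecomp (Ext.mk₀ (coactHom χ)) _ (zero_add n) ∘ₗ
    (Ext.bilinearCompOfLinear k _ _ _ n 0 n (add_zero n)).flip (Ext.mk₀ (leftTwistHom χ' hS)) ∘ₗ
    (coactFunctor β).mapExtLinearMap k X X' n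

lemma extTwist_apply {n : ℕ} (γ : Ext X X' n) : extTwist hS χ χ' n γ =
    (Ext.mk₀ (coactHom χ)).comp ((γ.mapExactFunctor (coactFunctor β)).comp
      (Ext.mk₀ (leftTwistHom χ' hS)) (add_zero n)) (zero_add n) := rfl

variable (hX : X.IsFPInfinity) (hX' : X'.IsFPInfinity)

/-- The coaction of `H` on Ext groups of Hopf modules. -/
noncomputable def extCoact (n : ℕ) : Ext X X' n →ₗ[k] H ⊗[k] Ext X X' n :=
  (LinearEquiv.ofBijective _ (tensorExt_freeInsertLin_bijective X X' hX n)).symm.toLinearMap ∘ₗ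
    extTwist hS χ χ' n

lemma tensorExt_extCoact {n : ℕ} (γ : Ext X X' n) :
    tensorExt (freeInsertLin k H X') X n (extCoact hS χ χ' hX n γ) = extTwist hS χ χ' n γ :=
  (LinearEquiv.ofBijective _ (tensorExt_freeInsertLin_bijective X X' hX n)).apply_symm_apply _

lemma extCoact_eq_iff {n : ℕ} (γ : Ext X X' n) (z : H ⊗[k] Ext X X' n) :
    extCoact hS χ χ' hX n γ = z ↔
      extTwist hS χ χ' n γ = tensorExt (freeInsertLin k H X') X n z := by
  rw [← tensorExt_extCoact hS χ χ' hX,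
    (tensorExt_freeInsertLin_bijective X X' hX n).1.eq_iff]

lemma Ext.mapExactFunctor_id {C : Type*} [Category* C] [Abelian C] [HasExt C]
    [EnoughProjectives C] {X Y : C} {n : ℕ} (x : Ext X Y n) :
    x.mapExactFunctor (𝟭 C) = x := by
  refine ext_induction (Y := Y) (p := fun X n x => x.mapExactFunctor (𝟭 C) = x) ?_ ?_ X n x
  · intro X f
    exact Ext.mapExactFunctor_mk₀ (𝟭 C) f
  · intro S hS n x hx
    rw [Ext.mapExactFunctor_comp, hx, Ext.mapExactFunctor_extClass]
    rfl

/-- The coaction on Ext is counital. -/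
lemma extCoact_counit {n : ℕ} (γ : Ext X X' n) :
    counitTensor k H (Ext X X' n) (extCoact hS χ χ' hX n γ) = γ := by
  have h (z : H ⊗[k] Ext X X' n) : counitTensor k H (Ext X X' n) z =
      (tensorExt (freeInsertLin k H X') X n z).comp
        (Ext.mk₀ ((freeCounit k H B).app X')) (add_zero n) := by
    induction z using TensorProduct.induction_on with
    | zero => simp
    | add y z hy hz => simp only [map_add, Ext.add_comp, hy, hz]
    | tmul h γ =>
      rw [counitTensor_tmul, tensorExt_tmul, freeInsertLin_apply,
        Ext.comp_assoc_of_third_deg_zero, Ext.mk₀_comp_mk₀, freeInsert_comp_freeCounit,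
        Ext.mk₀_smul, Ext.comp_smul]
      exact congrArg _ (Ext.comp_mk₀_id γ).symm
  rw [h, tensorExt_extCoact, extTwist_apply, Ext.comp_assoc_of_third_deg_zero,
    Ext.comp_assoc_of_third_deg_zero, Ext.mk₀_comp_mk₀, leftTwistHom_comp_freeCounit,
    mapExactFunctor_comp_natTrans (coactFunctor β) (𝟭 _) (coactCounit β) γ,
    Ext.mapExactFunctor_id]
  refine (Ext.mk₀_comp_mk₀_assoc _ _ _).trans ?_
  rw [coactHom_comp_coactCounit]
  exact Ext.mk₀_id_comp γ


/-- The map `γ' ↦ T(γ')` on the twisted free modules. -/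
noncomputable def extConj {n : ℕ} (γ : Ext X X' n) :
    Ext ((freeFunctor k H B).obj X) ((freeFunctor k H B).obj X') n :=
  (Ext.mk₀ (leftUntwistHom χ)).comp ((γ.mapExactFunctor (coactFunctor β)).comp
    (Ext.mk₀ (leftTwistHom χ' hS)) (add_zero n)) (zero_add n)

/-- Write T(γ) for `extConj`, the diagonal image of γ conjugated by the twists. It is linear for
right multiplication by H, which under the twists corresponds to left multiplication by S(h),
natural in the B-module. -/
lemma extConj_comp_freeMulRight {n : ℕ} (γ : Ext X X' n) (h : H) :
    (extConj hS χ χ' γ).comp (Ext.mk₀ ((freeMulRight k B h).app X')) (add_zero n) =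
      (Ext.mk₀ ((freeMulRight k B h).app X)).comp (extConj hS χ χ' γ) (zero_add n) := by
  have h₁ : leftTwistHom χ' hS ≫ (freeMulRight k B h).app X' =
      (coactMulLeft β (antipode k h)).app X' ≫ leftTwistHom χ' hS := by
    rw [← Category.comp_id ((freeMulRight k B h).app X'), ← leftUntwistHom_comp χ' hS,
      ← Category.assoc ((freeMulRight k B h).app X'), freeMulRight_comp_leftUntwistHom,
      ← Category.assoc, ← Category.assoc, leftTwistHom_comp, Category.id_comp]
  have h₂ := mapExactFunctor_comp_natTrans (coactFunctor β) (coactFunctor β)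
    (coactMulLeft β (antipode k h)) γ
  have h₃ : (γ.mapExactFunctor (coactFunctor β)).comp (Ext.mk₀
      ((coactMulLeft β (antipode k h)).app X' ≫ leftTwistHom χ' hS)) (add_zero n) =
      (Ext.mk₀ ((coactMulLeft β (antipode k h)).app X)).comp
        ((γ.mapExactFunctor (coactFunctor β)).comp (Ext.mk₀ (leftTwistHom χ' hS)) (add_zero n))
        (zero_add n) := by
    rw [← Ext.mk₀_comp_mk₀, ← Ext.comp_assoc_of_third_deg_zero, h₂,
      Ext.comp_assoc_of_third_deg_zero]
  rw [extConj, Ext.comp_assoc_of_third_deg_zero, Ext.comp_assoc_of_third_deg_zero,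
    Ext.mk₀_comp_mk₀, h₁, h₃, Ext.mk₀_comp_mk₀_assoc, Ext.mk₀_comp_mk₀_assoc,
    freeMulRight_comp_leftUntwistHom]

lemma freeInsert_one_comp_extConj {n : ℕ} (γ : Ext X X' n) :
    (Ext.mk₀ ((freeInsert k B (1 : H)).app X)).comp (extConj hS χ χ' γ) (zero_add n) =
      extTwist hS χ χ' n γ := by
  rw [extConj, Ext.mk₀_comp_mk₀_assoc, freeInsert_one_comp_leftUntwistHom]
  rfl

/-- By H-linearity T(γ) is determined by its value on 1 ⊗ X, which is `extTwist`. -/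
lemma freeInsert_comp_extConj {n : ℕ} (γ : Ext X X' n) (h : H) :
    (Ext.mk₀ ((freeInsert k B h).app X)).comp (extConj hS χ χ' γ) (zero_add n) =
      (extTwist hS χ χ' n γ).comp (Ext.mk₀ ((freeMulRight k B h).app X')) (add_zero n) := by
  rw [← freeInsert_one_comp_extConj, Ext.comp_assoc_of_third_deg_zero,
    extConj_comp_freeMulRight, Ext.mk₀_comp_mk₀_assoc, freeInsert_comp_freeMulRight, one_mul]

/-- The diagonal functor is multiplicative, and the twist ending the first factor cancels against
the untwist beginning T(γ'). -/
lemma extTwist_comp {n m l : ℕ} (γ : Ext X X' n) (γ' : Ext X' X'' m) (h : n + m = l) :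
    extTwist hS χ χ'' l (γ.comp γ' h) =
      (extTwist hS χ χ' n γ).comp (extConj hS χ' χ'' γ') h := by
  rw [extTwist_apply, extTwist_apply, extConj, Ext.mapExactFunctor_comp,
    Ext.comp_assoc (Ext.mk₀ (coactHom χ)) _ _ (zero_add n) h (by omega),
    Ext.comp_assoc_of_second_deg_zero, Ext.mk₀_comp_mk₀_assoc, leftTwistHom_comp,
    Ext.mk₀_id_comp, Ext.comp_assoc_of_third_deg_zero]

/-- The coaction on Ext is multiplicative. -/
lemma extCoact_comp {n m l : ℕ} (γ : Ext X X' n) (γ' : Ext X' X'' m) (h : n + m = l) :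
    extCoact hS χ χ'' hX l (γ.comp γ' h) =
      TensorProduct.map₂ (LinearMap.mul k H).flip (Ext.bilinearCompOfLinear k X X' X'' n m l h)
        (extCoact hS χ χ' hX n γ) (extCoact hS χ' χ'' hX' m γ') := by
  -- The H-component g of γ is inserted first and then multiplied from the left by the component g'
  -- of γ'. This gives g' g, in accordance with the order of the Yoneda product.
  rw [extCoact_eq_iff, extTwist_comp hS χ χ' χ'', ← tensorExt_extCoact hS χ χ' hX]
  induction extCoact hS χ χ' hX n γ using TensorProduct.induction_on with
  | zero => simp
  | add y z hy hz => simp only [map_add, LinearMap.add_apply, Ext.add_comp, hy, hz]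
  | tmul g γ =>
    rw [tensorExt_tmul, Ext.comp_assoc_of_second_deg_zero, freeInsertLin_apply,
      freeInsert_comp_extConj, ← tensorExt_extCoact hS χ' χ'' hX']
    induction extCoact hS χ' χ'' hX' m γ' using TensorProduct.induction_on with
    | zero => simp
    | add y z hy hz => simp only [map_add, Ext.add_comp, Ext.comp_add, hy, hz]
    | tmul g' γ' =>
      rw [TensorProduct.map₂_apply_tmul, TensorProduct.map_tmul, tensorExt_tmul, tensorExt_tmul,
        freeInsertLin_apply, Ext.comp_assoc_of_third_deg_zero, Ext.mk₀_comp_mk₀,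
        freeInsert_comp_freeMulRight]
      exact (Ext.comp_assoc_of_third_deg_zero γ γ' _ h).symm

/-- The coactions form a morphism from the extension to its image under H ⊗ -, and naturality of
connecting classes makes the class coinvariant. -/
lemma extCoact_extClass {S : ShortComplex (ModuleCat.{u} Bᵐᵒᵖ)} (hSe : S.ShortExact)
    (κ : HopfModule β S.X₁) (θ : HopfModule β S.X₂) (χ : HopfModule β S.X₃)
    (hX : S.X₃.IsFPInfinity)
    (hi : ∀ y, θ.coact (S.f y) = (S.f.hom.restrictScalars k).lTensor H (κ.coact y))
    (hp : ∀ y, χ.coact (S.g y) = (S.g.hom.restrictScalars k).lTensor H (θ.coact y)) :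
    extCoact hS χ κ hX 1 hSe.extClass = 1 ⊗ₜ hSe.extClass := by
  have h := mapExactFunctor_extClass_naturality (𝟭 _) (coactFunctor β) hSe hSe (coactHom κ)
    (coactHom θ) (coactHom χ) (leftTwistHom_naturality κ θ S.f hi)
    (leftTwistHom_naturality θ χ S.g hp)
  rw [Ext.mapExactFunctor_id] at h
  rw [extCoact_eq_iff, extTwist_apply, ← Ext.comp_assoc_of_third_deg_zero, ← h,
    Ext.comp_assoc_of_third_deg_zero, Ext.mk₀_comp_mk₀, coactHom_comp_leftTwistHom]
  rfl

/-- The connecting class has H-component 1, so the coaction commutes with dimension shifting along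
sequences of Hopf modules. -/
lemma extCoact_extClass_comp {S : ShortComplex (ModuleCat.{u} Bᵐᵒᵖ)} (hSe : S.ShortExact)
    (κ : HopfModule β S.X₁) (θ : HopfModule β S.X₂) (χ : HopfModule β S.X₃)
    (hX : S.X₃.IsFPInfinity) (hK : S.X₁.IsFPInfinity)
    (hi : ∀ y, θ.coact (S.f y) = (S.f.hom.restrictScalars k).lTensor H (κ.coact y))
    (hp : ∀ y, χ.coact (S.g y) = (S.g.hom.restrictScalars k).lTensor H (θ.coact y))
    {n : ℕ} (γ : Ext S.X₁ X' n) :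
    extCoact hS χ χ' hX (n + 1) (hSe.extClass.comp γ (add_comm 1 n)) =
      (extPrecomp hSe.extClass X' (add_comm 1 n)).lTensor H (extCoact hS κ χ' hK n γ) := by
  rw [extCoact_comp hS χ κ χ' hX hK, extCoact_extClass hS hSe κ θ χ hX hi hp]
  refine congrArg (fun f : H →ₗ[k] H => TensorProduct.map f _ (extCoact hS κ χ' hK n γ))
    (show (LinearMap.mul k H).flip 1 = LinearMap.id from ?_)
  ext; simp


end ExtCoact

/-! ### Coassociativity and the comodule algebra structure on Ext. -/

section ExtCoassoc

open Limits HopfAlgebra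
open scoped ModuleCat

variable {k : Type u} [Field k] {H B : Type u} [Ring H] [HopfAlgebra k H]
  [Ring B] [Algebra k B] {β : ComoduleAlgebra k H B}
  (hS : Function.Bijective (antipode k (A := H)))

lemma homCoact_eq_mapCoact {Q X : Type u} [AddCommGroup Q] [Module k Q]
    [Module Bᵐᵒᵖ Q] [IsScalarTower k Bᵐᵒᵖ Q] [AddCommGroup X] [Module k X]
    [Module Bᵐᵒᵖ X] [IsScalarTower k Bᵐᵒᵖ X] (θ : HopfModule β Q) (χ : HopfModule β X)
    (g : Q →ₗ[Bᵐᵒᵖ] X) : homCoact hS θ χ g = mapCoact hS χ θ (g.restrictScalars k) := by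
  ext x
  simp only [homCoact, mapCoact, LinearMap.comp_apply]
  induction θ.coact x using TensorProduct.induction_on with
  | zero => simp
  | add y z hy hz => simp only [map_add, hy, hz]
  | tmul h y =>
    rw [LinearMap.lTensor_tmul, leftTwist_tmul]
    rfl

variable {X X' : ModuleCat.{u} Bᵐᵒᵖ}

variable (X') in
/-- The evaluation at an element of the morphisms that represent classes of degree zero. -/
noncomputable def extEval (x : X) : Ext X X' 0 →ₗ[k] X' where
  toFun γ := (Ext.linearEquiv₀ (R := k) γ : X ⟶ X') x
  map_add' γ γ' := by rw [map_add]; rfl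
  map_smul' r γ := by rw [map_smul]; rfl

lemma extEval_mk₀ (x : X) (g : X ⟶ X') : extEval (k := k) X' x (Ext.mk₀ g) = g x :=
  congrArg (fun f : X ⟶ X' => f x) ((Ext.linearEquiv₀ (R := k)).apply_symm_apply g)

/-- Injectivity of `tensorHom`: elements of V ⊗ Hom(X, X') are separated by evaluation at the points
of X. This turns identities in degree zero into identities between elements. -/
lemma extEval_lTensor_ext {V : Type u} [AddCommGroup V] [Module k V] {w w' : V ⊗[k] Ext X X' 0}
    (h : ∀ x, (extEval X' x).lTensor V w = (extEval X' x).lTensor V w') : w = w' := by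
  have key (z : V ⊗[k] Ext X X' 0) (x : X) : tensorHom k V X X'
      ((Ext.linearEquiv₀ (R := k)).toLinearMap.lTensor V z) x = (extEval X' x).lTensor V z := by
    induction z using TensorProduct.induction_on with
    | zero => simp
    | add y z hy hz => simp only [map_add, LinearMap.add_apply, hy, hz]
    | tmul v γ => rfl
  refine (LinearEquiv.lTensor V (Ext.linearEquiv₀ (R := k) (X := X) (Y := X'))).injective
    (tensorHom_injective (LinearMap.ext fun x => ?_))
  exact (key w x).trans ((h x).trans (key w' x).symm)

variable (χ : HopfModule β X) (χ' : HopfModule β X') (hX : X.IsFPInfinity)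

lemma extEval_tensorExt (x : X) (z : H ⊗[k] Ext X X' 0) :
    extEval (k := k) ((freeFunctor k H B).obj X') x (tensorExt (freeInsertLin k H X') X 0 z) =
      (extEval X' x).lTensor H z := by
  induction z using TensorProduct.induction_on with
  | zero => simp; rfl
  | add y z hy hz => rw [map_add, map_add, map_add, hy, hz]; rfl
  | tmul v γ =>
    obtain ⟨g, rfl⟩ := (Ext.mk₀_bijective _ _).2 γ
    rw [tensorExt_tmul, Ext.mk₀_comp_mk₀, extEval_mk₀, LinearMap.lTensor_tmul, extEval_mk₀]
    rfl

lemma extEval_extTwist (g : X ⟶ X') (x : X) :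
    extEval (k := k) ((freeFunctor k H B).obj X') x (extTwist hS χ χ' 0 (Ext.mk₀ g)) =
      mapCoact hS χ' χ (g.hom.restrictScalars k) x := by
  rw [extTwist_apply, Ext.mapExactFunctor_mk₀, Ext.mk₀_comp_mk₀, Ext.mk₀_comp_mk₀, extEval_mk₀]
  rfl

/-- In degree zero the abstract coaction is the explicit one x ↦ ∑ g(x₀)₋₁ S⁻¹(x₋₁) ⊗ g(x₀)₀. -/
lemma extEval_extCoact (g : X ⟶ X') (x : X) :
    (extEval X' x).lTensor H (extCoact hS χ χ' hX 0 (Ext.mk₀ g)) =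
      mapCoact hS χ' χ (g.hom.restrictScalars k) x := by
  rw [← extEval_tensorExt, tensorExt_extCoact, extEval_extTwist]

lemma exists_extCoact_mk₀ (g : X ⟶ X') : ∃ (r : ℕ) (h : Fin r → H) (g' : Fin r → (X ⟶ X')),
    extCoact hS χ χ' hX 0 (Ext.mk₀ g) = ∑ i, h i ⊗ₜ Ext.mk₀ (g' i) ∧
    ∀ x, mapCoact hS χ' χ (g.hom.restrictScalars k) x = ∑ i, h i ⊗ₜ g' i x := by
  obtain ⟨r, h, γ, hγ⟩ := exists_sum_tmul (extCoact hS χ χ' hX 0 (Ext.mk₀ g))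
  choose g' hg' using fun i => (Ext.mk₀_bijective _ _).2 (γ i)
  refine ⟨r, h, g', by simp only [hγ, hg'], fun x => ?_⟩
  rw [← extEval_extCoact hS χ χ' hX, hγ, map_sum]
  simp only [LinearMap.lTensor_tmul, ← hg', extEval_mk₀]

lemma lTensor_lTensor_assoc {V W : Type*} [AddCommGroup V] [Module k V] [AddCommGroup W]
    [Module k W] (f : V →ₗ[k] W) (z : (H ⊗[k] H) ⊗[k] V) :
    (f.lTensor H).lTensor H (TensorProduct.assoc k H H V z) =
      TensorProduct.assoc k H H W (f.lTensor (H ⊗[k] H) z) := by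
  rw [LinearMap.lTensor_tensor]
  simp

lemma rTensor_lTensor_apply {V W : Type*} [AddCommGroup V] [Module k V] [AddCommGroup W]
    [Module k W] (f : V →ₗ[k] W) {P Q : Type*} [AddCommGroup P] [Module k P] [AddCommGroup Q]
    [Module k Q] (g : P →ₗ[k] Q) (z : P ⊗[k] V) :
    g.rTensor W (f.lTensor P z) = f.lTensor Q (g.rTensor V z) :=
  (LinearMap.congr_fun (LinearMap.rTensor_comp_lTensor (f := g) (g := f)) z).trans
    (LinearMap.congr_fun (LinearMap.lTensor_comp_rTensor (f := g) (g := f)) z).symm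

/-- The coaction on Ext is coassociative. -/
lemma extCoact_coassoc (n : ℕ) (γ : Ext X X' n) :
    TensorProduct.assoc k H H (Ext X X' n) ((Coalgebra.comul (R := k) (A := H)).rTensor _
      (extCoact hS χ χ' hX n γ)) =
      (extCoact hS χ χ' hX n).lTensor H (extCoact hS χ χ' hX n γ) := by
  induction n generalizing X with
  | zero =>
    obtain ⟨g, rfl⟩ := (Ext.mk₀_bijective _ _).2 γ
    obtain ⟨r, h, g', hg, hg'⟩ := exists_extCoact_mk₀ hS χ χ' hX g
    -- In degree zero it suffices to evaluate at each x, where the claim is `mapCoact_coassoc`.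
    refine (TensorProduct.assoc k H H (Ext X X' 0)).symm.injective
      (extEval_lTensor_ext fun x => (TensorProduct.assoc k H H X').injective ?_)
    rw [← lTensor_lTensor_assoc, ← lTensor_lTensor_assoc, LinearEquiv.apply_symm_apply,
      LinearEquiv.apply_symm_apply, lTensor_lTensor_assoc]
    have h₁ := mapCoact_coassoc hS χ' χ (g.hom.restrictScalars k) x h
      (fun i => (g' i).hom.restrictScalars k) hg'
    refine .trans ?_ (h₁.symm.trans ?_)
    · rw [← extEval_extCoact hS χ χ' hX, rTensor_lTensor_apply]
    · rw [hg, map_sum, map_sum]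
      exact Finset.sum_congr rfl fun i _ => congrArg (h i ⊗ₜ[k] ·)
        (extEval_extCoact hS χ χ' hX (g' i) x).symm
  | succ n ih =>
    have := hX.finite
    obtain ⟨K, Q, κ, θ, i, p, w, hSe, hf, hQ, hi, hp⟩ := ModuleCat.exists_hopf_cover χ
    have hK : K.IsFPInfinity := hX.of_exact i.hom p.hom hSe.moduleCat_injective_f
      ((ShortComplex.ShortExact.moduleCat_exact_iff_function_exact _).1 hSe.exact)
      hSe.moduleCat_surjective_g
    have := Q.projective_of_categoryTheory_projective
    obtain ⟨γ, rfl⟩ := Ext.contravariant_sequence_exact₃ hSe X' γ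
      (Ext.eq_zero_of_projective (P := Q) _) (add_comm 1 n)
    -- Every class of degree n + 1 is a connecting class of Hopf modules times a class of degree n.
    -- The coaction passes through the connecting class, so the identity is inherited.
    have hc := extCoact_extClass_comp hS χ' hSe κ θ χ hX hK hi hp (n := n)
    refine (congrArg (fun z => TensorProduct.assoc k H H (Ext X X' (n + 1))
      ((Coalgebra.comul (R := k) (A := H)).rTensor _ z)) (hc γ)).trans ?_
    refine .trans ?_ (congrArg ((extCoact hS χ χ' hX (n + 1)).lTensor H) (hc γ)).symm
    have h₁ : (extCoact hS χ χ' hX (n + 1)) ∘ₗ extPrecomp hSe.extClass X' (add_comm 1 n) =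
      (extPrecomp hSe.extClass X' (add_comm 1 n)).lTensor H ∘ₗ extCoact hS κ χ' hK n :=
      LinearMap.ext hc
    rw [← LinearMap.lTensor_comp_apply, h₁, LinearMap.lTensor_comp_apply, ← ih κ hK γ,
      lTensor_lTensor_assoc]
    exact congrArg _ (rTensor_lTensor_apply _ _ _)

variable (χ : HopfModule β X) in
/-- The coaction on the Yoneda algebra of a Hopf module, as a morphism of algebras. -/
noncomputable def extCoactHom : (⨁ n, Ext X X n) →ₐ[k] H ⊗[k] ⨁ n, Ext X X n :=
  DirectSum.toAlgebra k (Ext X X)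
    (fun n => (DirectSum.lof k ℕ (Ext X X) n).lTensor H ∘ₗ extCoact hS χ χ hX n)
    (by
      have h : extCoact hS χ χ hX 0 (Ext.mk₀ (𝟙 X)) = 1 ⊗ₜ Ext.mk₀ (𝟙 X) := by
        rw [extCoact_eq_iff, extTwist_apply, Ext.mapExactFunctor_mk₀, Ext.mk₀_comp_mk₀,
          Ext.mk₀_comp_mk₀, CategoryTheory.Functor.map_id, Category.id_comp,
          coactHom_comp_leftTwistHom, tensorExt_tmul, Ext.mk₀_id_comp]
        rfl
      exact congrArg ((DirectSum.lof k ℕ (Ext X X) 0).lTensor H) h)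
    (by
      intro a b x y
      have h := extCoact_comp hS χ χ χ hX hX y x (add_comm b a)
      refine (congrArg ((DirectSum.lof k ℕ (Ext X X) (a + b)).lTensor H) h).trans ?_
      simp only [LinearMap.comp_apply]
      generalize extCoact hS χ χ hX b y = v
      generalize extCoact hS χ χ hX a x = w
      induction v using TensorProduct.induction_on with
      | zero => simp
      | add y z hy hz => simp only [map_add, LinearMap.add_apply, mul_add, hy, hz]
      | tmul g y =>
      induction w using TensorProduct.induction_on with
      | zero => simp
      | add y z hy hz => simp only [map_add, add_mul, hy, hz]
      | tmul h x =>
        simp only [TensorProduct.map₂_apply_tmul, TensorProduct.map_tmul, LinearMap.lTensor_tmul,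
          Algebra.TensorProduct.tmul_mul_tmul]
        exact congrArg ((h * g) ⊗ₜ[k] ·) (DirectSum.of_mul_of x y).symm)

lemma extCoactHom_lof (n : ℕ) (γ : Ext X X n) :
    extCoactHom hS hX χ (DirectSum.lof k ℕ (Ext X X) n γ) =
      (DirectSum.lof k ℕ (Ext X X) n).lTensor H (extCoact hS χ χ hX n γ) :=
  DirectSum.toModule_lof k (φ := fun n => (DirectSum.lof k ℕ (Ext X X) n).lTensor H ∘ₗ
    extCoact hS χ χ hX n) n γ

variable (χ : HopfModule β X) in
/-- The comodule algebra structure on the Yoneda algebra of a Hopf module. -/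
noncomputable def extComodule : GradedComoduleAlgebra k H (Ext X X) where
  coact := extCoactHom hS hX χ
  coassoc b := by
    induction b using DirectSum.induction_on with
    | zero => simp
    | add x y hx hy => simp only [map_add, hx, hy]
    | of n γ =>
      have hc : (extCoactHom hS hX χ).toLinearMap ∘ₗ DirectSum.lof k ℕ (Ext X X) n =
        (DirectSum.lof k ℕ (Ext X X) n).lTensor H ∘ₗ extCoact hS χ χ hX n :=
        LinearMap.ext fun γ => extCoactHom_lof hS χ hX n γ
      change TensorProduct.assoc k H H _ (LinearMap.rTensor _ _
        (extCoactHom hS hX χ (DirectSum.lof k ℕ (Ext X X) n γ))) =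
        (extCoactHom hS hX χ).toLinearMap.lTensor H
          (extCoactHom hS hX χ (DirectSum.lof k ℕ (Ext X X) n γ))
      rw [extCoactHom_lof, rTensor_lTensor_apply, ← lTensor_lTensor_assoc, extCoact_coassoc,
        ← LinearMap.lTensor_comp_apply, ← LinearMap.lTensor_comp_apply, hc]
  counit b := by
    induction b using DirectSum.induction_on with
    | zero => simp
    | add x y hx hy => simp only [map_add, hx, hy]
    | of n γ =>
      change TensorProduct.lid k _ (LinearMap.rTensor _ _
        (extCoactHom hS hX χ (DirectSum.lof k ℕ (Ext X X) n γ))) =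
          DirectSum.lof k ℕ (Ext X X) n γ
      rw [extCoactHom_lof]
      refine .trans ?_ (congrArg (DirectSum.lof k ℕ (Ext X X) n)
        (extCoact_counit hS χ χ hX γ))
      generalize extCoact hS χ χ hX n γ = z
      induction z using TensorProduct.induction_on with
      | zero => simp
      | add x y hx hy => simp only [map_add, hx, hy]
      | tmul h x => simp [counitTensor_tmul]
  coact_lof n y := ⟨_, (extCoactHom_lof hS χ hX n y).symm⟩

end ExtCoassoc

/-! ### The coaction computed on Hopf resolutions. -/

section InducedCoaction

open Limits HopfAlgebra
open scoped ModuleCat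

lemma CategoryTheory.ProjectiveResolution.sum_extMk {C : Type*} [Category* C] [Abelian C]
    [HasExt C] {X Y : C} (R : ProjectiveResolution X) {n : ℕ} {ι : Type*} (s : Finset ι)
    (f : ι → (R.complex.X n ⟶ Y)) (m : ℕ) (hm : n + 1 = m)
    (hf : ∀ i, R.complex.d m n ≫ f i = 0) (hf' : R.complex.d m n ≫ ∑ i ∈ s, f i = 0) :
    R.extMk (∑ i ∈ s, f i) m hm hf' = ∑ i ∈ s, R.extMk (f i) m hm (hf i) := by
  classical
  induction s using Finset.induction_on with
  | empty => exact R.extMk_zero m hm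
  | insert a s ha ih =>
    have h : R.complex.d m n ≫ ∑ i ∈ s, f i = 0 := by simp [Preadditive.comp_sum, hf]
    simp only [Finset.sum_insert ha]
    rw [← ih h, R.add_extMk]

variable {k : Type u} [Field k] {H B : Type u} [Ring H] [HopfAlgebra k H]
  [Ring B] [Algebra k B] {β : ComoduleAlgebra k H B}
  (hS : Function.Bijective (antipode k (A := H)))

variable {Q Q' X : ModuleCat.{u} Bᵐᵒᵖ} (θ : HopfModule β Q) (θ' : HopfModule β Q')
  (χ : HopfModule β X)

lemma exists_tensorHom_eq_mapCoact [Module.Finite Bᵐᵒᵖ Q] (g : Q ⟶ X) :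
    ∃ z, tensorHom k H Q X z = mapCoact hS χ θ (g.hom.restrictScalars k) := by
  refine exists_tensorHom_eq _ fun q b => ?_
  have h := (coactHom θ ≫ (coactFunctor β).map g ≫ leftTwistHom χ hS).hom.map_smul (op b) q
  exact h.trans (tensorAction_one_tmul (H := H) (X := X) _ b)

/-- Since d is colinear, the coaction of a cocycle is killed by H ⊗ d*. By flatness it then lies in
H ⊗ ker d*, so its components can be chosen to be cocycles. -/
lemma exists_cocycles_mapCoact [Module.Finite Bᵐᵒᵖ Q] (d : Q' ⟶ Q)
    (hd : ∀ x, θ.coact (d x) = (d.hom.restrictScalars k).lTensor H (θ'.coact x)) (g : Q ⟶ X)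
    (hg : d ≫ g = 0) : ∃ (r : ℕ) (h : Fin r → H) (g' : Fin r → (Q ⟶ X)),
      (∀ i, d ≫ g' i = 0) ∧
      ∀ x, mapCoact hS χ θ (g.hom.restrictScalars k) x = ∑ i, h i ⊗ₜ g' i x := by
  obtain ⟨z, hz⟩ := exists_tensorHom_eq_mapCoact hS θ χ g
  let D : (Q ⟶ X) →ₗ[k] (Q' ⟶ X) := Linear.leftComp k X d
  have h₁ : D.lTensor H z = 0 := by
    apply tensorHom_injective
    rw [map_zero]
    have h₂ (z : H ⊗[k] (Q ⟶ X)) : tensorHom k H Q' X (D.lTensor H z) =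
        tensorHom k H Q X z ∘ₗ d.hom.restrictScalars k := by
      induction z using TensorProduct.induction_on with
      | zero => simp
      | add y z hy hz => rw [map_add, map_add, map_add, hy, hz]; rfl
      | tmul v g => rfl
    rw [h₂, hz]
    ext x
    have h₃ : (g.hom.restrictScalars k) ∘ₗ (d.hom.restrictScalars k) = 0 :=
      LinearMap.ext fun x => ConcreteCategory.congr_hom hg x
    simp only [mapCoact, LinearMap.comp_apply]
    refine (congrArg (fun y => leftTwist hS χ ((g.hom.restrictScalars k).lTensor H y))
      (hd x)).trans ?_
    rw [← LinearMap.lTensor_comp_apply, h₃]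
    simp
  have h₄ := Module.Flat.lTensor_exact H (LinearMap.exact_subtype_ker_map D)
  obtain ⟨y, rfl⟩ := (h₄ z).1 h₁
  obtain ⟨r, h, c, rfl⟩ := exists_sum_tmul y
  refine ⟨r, h, fun i => (c i).1, fun i => (c i).2, fun x => ?_⟩
  rw [← hz, map_sum, map_sum, LinearMap.sum_apply]
  rfl

variable {χ} in
-- The coactions on the terms of R form a morphism of complexes from R to H ⊗ R over the coaction of
-- X. The formula for exact functors on cocycles therefore represents the twisted class by the
-- coaction of g.
lemma extCoact_extMk (hX : X.IsFPInfinity) (R : ProjectiveResolution X)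
    (θ : ∀ n, HopfModule β (R.complex.X n))
    (hd : ∀ i j, coactHom (θ i) ≫ (coactFunctor β).map (R.complex.d i j) =
      R.complex.d i j ≫ coactHom (θ j))
    (haug : coactHom (θ 0) ≫ (coactFunctor β).map (resolutionAug R) =
      resolutionAug R ≫ coactHom χ)
    {n : ℕ} (g : R.complex.X n ⟶ X) (hg : R.complex.d (n + 1) n ≫ g = 0)
    {r : ℕ} (h : Fin r → H) (g' : Fin r → (R.complex.X n ⟶ X))
    (hg' : ∀ i, R.complex.d (n + 1) n ≫ g' i = 0)
    (hgg : ∀ x, mapCoact hS χ (θ n) (g.hom.restrictScalars k) x = ∑ i, h i ⊗ₜ g' i x) :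
    extCoact hS χ χ hX n (R.extMk g (n + 1) rfl hg) =
      ∑ i, h i ⊗ₜ R.extMk (g' i) (n + 1) rfl (hg' i) := by
  have hf' : R.complex.d (n + 1) n ≫ coactHom (θ n) ≫ (coactFunctor β).map g = 0 := by
    rw [← Category.assoc, ← hd, Category.assoc, ← Functor.map_comp, hg]
    simp
  have h₁ := R.mk₀_comp_mapExactFunctor_extMk (coactFunctor β) R (fun n => coactHom (θ n)) hd
    (coactHom χ) haug g (n + 1) rfl hg hf'
  have hsum : (coactHom (θ n) ≫ (coactFunctor β).map g) ≫ leftTwistHom χ hS =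
      ∑ i, g' i ≫ (freeInsert k B (h i)).app X := by
    refine ModuleCat.hom_ext (LinearMap.ext fun x => (hgg x).trans ?_)
    let ev : (R.complex.X n ⟶ (freeFunctor k H B).obj X) →+ H ⊗[k] X :=
      { toFun f := f x, map_zero' := rfl, map_add' _ _ := rfl }
    exact (map_sum ev (fun i => g' i ≫ (freeInsert k B (h i)).app X) Finset.univ).symm
  rw [extCoact_eq_iff, extTwist_apply, ← Ext.comp_assoc_of_third_deg_zero, h₁,
    R.extMk_comp_mk₀, map_sum]
  simp only [tensorExt_tmul, R.extMk_comp_mk₀, freeInsertLin_apply]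
  rw [← R.sum_extMk]
  · congr 1
  · rw [Preadditive.comp_sum]
    exact Finset.sum_eq_zero fun i _ => by rw [← Category.assoc, hg' i, zero_comp]

/-- The coaction on the Yoneda algebra is induced by the coaction on the cochain complex of each
resolution by finitely generated projective Hopf modules. -/
lemma isInducedCoaction_extComodule (hX : X.IsFPInfinity) (Q : HopfResolution χ) :
    IsInducedCoaction hS Q (extComodule hS hX χ) := by
  obtain @⟨R, hfin, mod, tower, θ, hd, haug⟩ := Q
  -- The k-structures recorded in Q are determined by the B-structures, so they are the canonical
  -- ones.
  have : mod = fun n => ModuleCat.moduleOfAlgebraModule (R.complex.X n) :=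
    funext fun n => Module.ext' _ _ fun r x => (algebraMap_smul Bᵐᵒᵖ r x).symm
  subst this
  intro n g hg
  obtain ⟨r, h, g', hg', hgg⟩ := exists_cocycles_mapCoact hS (Q := R.complex.X n)
    (Q' := R.complex.X (n + 1)) (θ n) (θ (n + 1)) χ (R.complex.d (n + 1) n) (hd n) g hg
  refine ⟨r, h, g', hg', fun x => ?_, ?_⟩
  · exact (LinearMap.congr_fun (homCoact_eq_mapCoact hS (θ n) χ g.hom) x).trans (hgg x)
  have hd' : ∀ i j, coactHom (θ i) ≫ (coactFunctor β).map (R.complex.d i j) =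
      R.complex.d i j ≫ coactHom (θ j) := by
    intro i j
    by_cases hij : j + 1 = i
    · subst hij
      exact leftTwistHom_naturality (θ (j + 1)) (θ j) _ (hd j)
    · have h₀ : R.complex.d i j = 0 := R.complex.shape i j hij
      rw [h₀, zero_comp, Functor.map_zero, comp_zero]
  have key := extCoact_extMk hS (χ := χ) hX R θ hd' (leftTwistHom_naturality (θ 0) χ _ haug)
    g hg h g' hg' hgg
  have h₁ := extCoactHom_lof hS χ hX n (R.extMk g (n + 1) rfl hg)
  rw [key, map_sum] at h₁
  exact h₁

end InducedCoaction

/-! ## The action of `H` on linear maps -/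

section HopfConj

open Coalgebra HopfAlgebra

variable {k H A : Type u} [Field k] [Ring H] [HopfAlgebra k H] [Ring A] [Algebra k A]
  (α : ModuleAlgebra k H A)
  {N N' : Type*} [AddCommGroup N] [Module k N] [Module (SmashHopf α)ᵐᵒᵖ N]
  [IsScalarTower k (SmashHopf α)ᵐᵒᵖ N] [AddCommGroup N'] [Module k N']
  [Module (SmashHopf α)ᵐᵒᵖ N'] [IsScalarTower k (SmashHopf α)ᵐᵒᵖ N']

/-- The coproduct of `S(h)`. -/
noncomputable def antipodeRepr {h : H} {ι : Type*} (R : Repr k h ι) :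
    Repr k (antipode k h) ι where
  index := R.index
  left i := antipode k (R.right i)
  right i := antipode k (R.left i)
  eq := (comul_antipode h R).symm

/-- The coproduct of `h h'`. -/
noncomputable def mulRepr {h h' : H} {ι ι' : Type*} (R : Repr k h ι) (R' : Repr k h' ι') :
    Repr k (h * h') (ι × ι') where
  index := R.index ×ˢ R'.index
  left i := R.left i.1 * R'.left i.2
  right i := R.right i.1 * R'.right i.2
  eq := by
    rw [Bialgebra.comul_mul, ← R.eq, ← R'.eq, Finset.sum_mul_sum, Finset.sum_product]
    simp only [Algebra.TensorProduct.tmul_mul_tmul]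

/-- `H` as a Hopf module over itself. -/
noncomputable abbrev HopfModule.self (k H : Type u) [Field k] [Ring H] [HopfAlgebra k H] :
    HopfModule (ComoduleAlgebra.self k H) H :=
  HopfModule.regular (ComoduleAlgebra.self k H)

variable (N) in
/-- The map `n ↦ ∑ n S(y₁) ⊗ y₂` for `y = S(h)`. -/
noncomputable def conjUnit : H →ₗ[k] N →ₗ[k] N ⊗[k] H :=
  ((TensorProduct.mk k N H).compr₂ (retwist α (HopfModule.self k H))).flip ∘ₗ antipode k

variable (N) in
/-- The map `n ⊗ y ↦ n y`. -/
noncomputable def conjCounit : N ⊗[k] H →ₗ[k] N :=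
  (TensorProduct.rid k N).toLinearMap ∘ₗ (counit (R := k) (A := H)).lTensor N ∘ₗ
    untwist α (HopfModule.self k H)

lemma conjUnit_apply (h : H) (n : N) :
    conjUnit α N h n = retwist α (HopfModule.self k H) (n ⊗ₜ antipode k h) := rfl

lemma conjUnit_eq_sum (h : H) (n : N) {ι : Type*} (R : Repr k h ι) :
    conjUnit α N h n = ∑ i ∈ R.index,
      hopfRight α N (antipode k (antipode k (R.right i))) n ⊗ₜ antipode k (R.left i) := by
  refine (HopfModule.twist_tmul _ _ _ _).trans ?_
  refine (congrArg (LinearMap.rTensor H _) (comul_antipode h R)).trans ?_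
  rw [map_sum]
  rfl

lemma untwist_self_tmul (n : N) (y : H) {ι : Type*} (R : Repr k y ι) :
    untwist α (HopfModule.self k H) (n ⊗ₜ y) =
      ∑ i ∈ R.index, hopfRight α N (R.left i) n ⊗ₜ R.right i := by
  refine (HopfModule.twist_tmul _ _ _ _).trans ?_
  refine (congrArg (LinearMap.rTensor H _) R.eq.symm).trans ?_
  rw [map_sum]
  rfl

lemma conjCounit_tmul (n : N) (y : H) :
    conjCounit α N (n ⊗ₜ y) = hopfRight α N y n := by
  have R := Repr.arbitrary k y
  rw [conjCounit, LinearMap.comp_apply, LinearMap.comp_apply, untwist_self_tmul α n y R]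
  simp only [map_sum, LinearMap.lTensor_tmul, LinearEquiv.coe_coe, TensorProduct.rid_tmul]
  have h₁ := congrArg (TensorProduct.rid k H) (sum_tmul_counit_eq R)
  simp only [map_sum, TensorProduct.rid_tmul, one_smul] at h₁
  conv_rhs => rw [← h₁]
  simp

/-- The map `n ↦ ∑ h₁ ⇀ f (S(h₂) ⇀ n)`, where `h ⇀ n = n S(h)`. -/
noncomputable def hopfConj : H →ₗ[k] (N →ₗ[k] N') →ₗ[k] N →ₗ[k] N' :=
  LinearMap.mk₂ k (fun h f => conjCounit α N' ∘ₗ f.rTensor H ∘ₗ conjUnit α N h)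
    (by intros; ext; simp) (by intros; ext; simp)
    (by intros; ext; simp [LinearMap.rTensor_add]) (by intros; ext; simp [LinearMap.rTensor_smul])

lemma hopfConj_def (h : H) (f : N →ₗ[k] N') :
    hopfConj α h f = conjCounit α N' ∘ₗ f.rTensor H ∘ₗ conjUnit α N h := rfl

lemma hopfConj_apply (h : H) (f : N →ₗ[k] N') (n : N) {ι : Type*} (R : Repr k h ι) :
    hopfConj α h f n = ∑ i ∈ R.index, hopfRight α N' (antipode k (R.left i))
      (f (hopfRight α N (antipode k (antipode k (R.right i))) n)) := by
  rw [hopfConj_def, LinearMap.comp_apply, LinearMap.comp_apply, conjUnit_eq_sum α h n R]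
  simp only [map_sum, LinearMap.rTensor_tmul, conjCounit_tmul]

/-- The trilinear map `a ⊗ b ⊗ c ↦ f (n S(S(c))) S(b) ⊗ S(a)`. -/
noncomputable def hopfConjAux (f : N →ₗ[k] N') (n : N) : H ⊗[k] (H ⊗[k] H) →ₗ[k] N' ⊗[k] H :=
  (TensorProduct.comm k H N').toLinearMap ∘ₗ TensorProduct.map (antipode k)
    (TensorProduct.lift ((hopfRight α N' ∘ₗ antipode k).compl₂
      (f ∘ₗ (hopfRight α N).flip n ∘ₗ antipode k ∘ₗ antipode k)))

/-- The unit of h moves past f # H at the price of h₂ acting on f and h₁ staying behind. After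
untwisting, both sides are one trilinear expression in the iterated coproduct of h. This is what
makes the action on Ext compatible with products. -/
lemma rTensor_conjUnit (h : H) (f : N →ₗ[k] N') (n : N) {ι : Type*} (R : Repr k h ι) :
    f.rTensor H (conjUnit α N h n) =
      ∑ i ∈ R.index, conjUnit α N' (R.left i) (hopfConj α (R.right i) f n) := by
  have hu : Function.Injective (untwist α (N := N') (HopfModule.self k H)) :=
    Function.LeftInverse.injective (retwist_untwist α (HopfModule.self k H))
  apply hu
  have a₁ (i : ι) := Repr.arbitrary k (R.left i)
  have a₂ (i : ι) := Repr.arbitrary k (R.right i)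
  have h₁ := congrArg (hopfConjAux α f n) (sum_tmul_tmul_eq R a₁ a₂)
  rw [map_sum, map_sum] at h₁
  rw [conjUnit_eq_sum α h n R, map_sum, map_sum, map_sum]
  refine .trans (Finset.sum_congr rfl fun i _ => ?_) (h₁.trans (Finset.sum_congr rfl fun i _ => ?_))
  · rw [LinearMap.rTensor_tmul, untwist_self_tmul α _ _ (antipodeRepr (a₁ i)), map_sum]
    rfl
  · rw [conjUnit_apply, untwist_retwist, hopfConj_apply α _ f n (a₂ i), TensorProduct.sum_tmul,
      map_sum]
    rfl

/-- The evaluation map is H-linear: ∑ (h₁ ⇀ f)(h₂ ⇀ n) = h ⇀ f(n), because S(h₂)h₃ cancels inside f.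
It drives the commutation rule in degree zero. -/
lemma sum_hopfConj (h : H) (f : N →ₗ[k] N') (n : N) {ι : Type*} (R : Repr k h ι) :
    ∑ i ∈ R.index, hopfConj α (R.left i) f (hopfRight α N (antipode k (R.right i)) n) =
      hopfRight α N' (antipode k h) (f n) := by
  have a₁ (i : ι) := Repr.arbitrary k (R.left i)
  have a₂ (i : ι) := Repr.arbitrary k (R.right i)
  let T : H ⊗[k] (H ⊗[k] H) →ₗ[k] N' := TensorProduct.lift ((hopfRight α N' ∘ₗ antipode k).compl₂
    (f ∘ₗ (hopfRight α N).flip n ∘ₗ antipode k ∘ₗ LinearMap.mul' k H ∘ₗ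
      (antipode k).rTensor H))
  have hT (a b c : H) : T (a ⊗ₜ (b ⊗ₜ c)) = hopfRight α N' (antipode k a)
    (f (hopfRight α N (antipode k (antipode k b * c)) n)) := rfl
  have h₁ := congrArg T (sum_tmul_tmul_eq R a₁ a₂)
  rw [map_sum, map_sum] at h₁
  refine .trans (Finset.sum_congr rfl fun i _ => ?_) (h₁.trans ?_)
  · rw [hopfConj_apply α _ f _ (a₁ i), map_sum]
    refine Finset.sum_congr rfl fun j _ => ?_
    rw [hT, antipode_mul_antidistrib, hopfRight_mul]
  · have h₂ (i : ι) : T (∑ j ∈ (a₂ i).index, R.left i ⊗ₜ ((a₂ i).left j ⊗ₜ (a₂ i).right j)) =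
        hopfRight α N' (antipode k (counit (R := k) (R.right i) • R.left i)) (f n) := by
      simp only [map_sum, hT]
      rw [← map_sum, ← map_sum, ← LinearMap.sum_apply, ← map_sum, ← map_sum,
        sum_antipode_mul_eq_smul, map_smul, antipode_one, map_smul, map_smul]
      simp [hopfRight_one]
    have h₃ := congrArg (TensorProduct.rid k H) (sum_tmul_counit_eq R)
    simp only [map_sum, TensorProduct.rid_tmul, one_smul] at h₃
    simp only [h₂]
    rw [← LinearMap.sum_apply, ← map_sum, ← map_sum, h₃]

lemma hopfConj_mul (h h' : H) (f : N →ₗ[k] N') :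
    hopfConj α (h * h') f = hopfConj α h (hopfConj α h' f) := by
  ext n
  have R := Repr.arbitrary k h
  have R' := Repr.arbitrary k h'
  rw [hopfConj_apply α _ f n (mulRepr R R'), hopfConj_apply α h _ n R]
  simp only [mulRepr, Finset.sum_product]
  refine Finset.sum_congr rfl fun i _ => ?_
  rw [hopfConj_apply α _ f _ R', map_sum]
  refine Finset.sum_congr rfl fun j _ => ?_
  rw [antipode_mul_antidistrib, antipode_mul_antidistrib, antipode_mul_antidistrib,
    hopfRight_mul, hopfRight_mul]

lemma hopfConj_one (f : N →ₗ[k] N') : hopfConj α 1 f = f := by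
  ext n
  let R : Repr k (1 : H) Unit :=
    ⟨{()}, fun _ => 1, fun _ => 1, by simp [Algebra.TensorProduct.one_def]⟩
  rw [hopfConj_apply α _ f n R]
  simp [R, hopfRight_one]

lemma hopfConj_id (h : H) :
    hopfConj α h (LinearMap.id : N →ₗ[k] N) = counit (R := k) h • LinearMap.id := by
  ext n
  have R := Repr.arbitrary k h
  rw [hopfConj_apply α _ _ n R]
  simp only [LinearMap.id_apply, ← hopfRight_mul, ← antipode_mul_antidistrib]
  rw [← LinearMap.sum_apply, ← map_sum, ← map_sum, sum_mul_antipode_eq_smul, map_smul,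
    antipode_one, map_smul]
  simp [hopfRight_one]

variable [Module Aᵐᵒᵖ N] [IsScalarTower k Aᵐᵒᵖ N]

/-- The image of a # 1 under `smashDiag` is (a # 1) ⊗ 1, so on the untwisted side A acts on N alone.
-/
lemma untwist_self_smul (hN : ∀ (a : A) (n : N), op (SmashHopf.tmul α a 1) • n = op a • n)
    (a : A) (z : N ⊗[k] H) : untwist α (HopfModule.self k H)
      (smashModuleAct α N (HopfModule.self k H) (SmashHopf.tmul α a 1) z) =
    ((rightAction k A N).flip a).rTensor H (untwist α (HopfModule.self k H) z) := by
  rw [untwist_smul α _ hN]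
  have h₁ : smashDiag α (ComoduleAlgebra.self k H) (SmashHopf.tmul α a 1) =
      SmashHopf.tmul α a 1 ⊗ₜ 1 := by
    refine (smashDiagLin_tmul α _ a 1).trans ?_
    rw [map_one]
    rfl
  rw [h₁]
  induction untwist α (HopfModule.self k H) z using TensorProduct.induction_on with
  | zero => simp
  | add y z hy hz => simp only [map_add, LinearMap.add_apply, hy, hz]
  | tmul n y => simp [rightAction_apply, hN]

/-- After untwisting, the unit is n ↦ n ⊗ S(h), which is visibly A-linear. -/
lemma conjUnit_smul (hN : ∀ (a : A) (n : N), op (SmashHopf.tmul α a 1) • n = op a • n)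
    (h : H) (a : A) (n : N) : conjUnit α N h (op a • n) =
      smashModuleAct α N (HopfModule.self k H) (SmashHopf.tmul α a 1) (conjUnit α N h n) := by
  apply Function.LeftInverse.injective (retwist_untwist α (N := N) (HopfModule.self k H))
  rw [untwist_self_smul α hN, conjUnit_apply, conjUnit_apply, untwist_retwist, untwist_retwist]
  rfl

lemma conjCounit_smul (hN : ∀ (a : A) (n : N), op (SmashHopf.tmul α a 1) • n = op a • n)
    (a : A) (z : N ⊗[k] H) :
    conjCounit α N (smashModuleAct α N (HopfModule.self k H) (SmashHopf.tmul α a 1) z) =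
      op a • conjCounit α N z := by
  rw [conjCounit, LinearMap.comp_apply, LinearMap.comp_apply, untwist_self_smul α hN,
    LinearMap.comp_apply, LinearMap.comp_apply]
  induction untwist α (HopfModule.self k H) z using TensorProduct.induction_on with
  | zero => simp
  | add y z hy hz => simp only [map_add, smul_add, hy, hz]
  | tmul n y => simp [rightAction_apply, smul_comm (op a)]

end HopfConj
/-! ## The action of `H` on Ext groups -/

section HopfExt

open Limits Coalgebra HopfAlgebra
open scoped ModuleCat

variable {k : Type u} [Field k] {H A : Type u} [Ring H] [HopfAlgebra k H] [Ring A] [Algebra k A]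
  (α : ModuleAlgebra k H A)

instance : (smashRes α).Linear k where
  map_smul {N N'} g r := by
    ext n
    exact (smashRes_smul_eq α N' r (g n)).symm

/-- The functor `N ↦ N # H` from right `A`-modules to right `A`-modules. -/
noncomputable abbrev conjFunctor : ModuleCat.{u} Aᵐᵒᵖ ⥤ ModuleCat.{u} Aᵐᵒᵖ :=
  smashFunctor α (HopfModule.self k H) ⋙ smashRes α

/-- `conjUnit` as a morphism of right `A`-modules. -/
noncomputable def conjUnitHom (h : H) (N : ModuleCat.{u} (SmashHopf α)ᵐᵒᵖ) :
    (smashRes α).obj N ⟶ (conjFunctor α).obj ((smashRes α).obj N) :=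
  ModuleCat.ofHom (X := (smashRes α).obj N)
    (Y := (conjFunctor α).obj ((smashRes α).obj N))
    { toFun n := conjUnit α ((smashRes α).obj N) h n
      map_add' := map_add (conjUnit α ((smashRes α).obj N) h)
      map_smul' a n := conjUnit_smul α (smashRes_smul α N) h a.unop n }

/-- `conjCounit` as a morphism of right `A`-modules. -/
noncomputable def conjCounitHom (N : ModuleCat.{u} (SmashHopf α)ᵐᵒᵖ) :
    (conjFunctor α).obj ((smashRes α).obj N) ⟶ (smashRes α).obj N :=
  ModuleCat.ofHom (X := (conjFunctor α).obj ((smashRes α).obj N))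
    (Y := (smashRes α).obj N)
    { toFun z := conjCounit α ((smashRes α).obj N) z
      map_add' := map_add (conjCounit α ((smashRes α).obj N))
      map_smul' a z := conjCounit_smul α (smashRes_smul α N) a.unop z }

lemma conjUnitHom_naturality (h : H) {N N' : ModuleCat.{u} (SmashHopf α)ᵐᵒᵖ} (g : N ⟶ N') :
    conjUnitHom α h N ≫ (conjFunctor α).map ((smashRes α).map g) =
      (smashRes α).map g ≫ conjUnitHom α h N' := by
  ext n
  have R := Repr.arbitrary k h
  refine (congrArg (LinearMap.rTensor H (((smashRes α).map g).hom.restrictScalars k))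
    (conjUnit_eq_sum α h n R)).trans (.trans ?_ (conjUnit_eq_sum α h
      (show (smashRes α).obj N' from g n) R).symm)
  rw [map_sum]
  exact Finset.sum_congr rfl fun i _ => congrArg (· ⊗ₜ[k] _) (map_smul g.hom _ n)

variable {N N' N'' : ModuleCat.{u} (SmashHopf α)ᵐᵒᵖ}

/-- The action of `H` on Ext groups over `A` between modules over `A # H`. -/
noncomputable def hopfExt (h : H) (n : ℕ) : Ext ((smashRes α).obj N) ((smashRes α).obj N') n →ₗ[k]
    Ext ((smashRes α).obj N) ((smashRes α).obj N') n :=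
  ((Ext.bilinearCompOfLinear k _ _ _ 0 n n (zero_add n)) (Ext.mk₀ (conjUnitHom α h N))) ∘ₗ
    ((Ext.bilinearCompOfLinear k _ _ _ n 0 n (add_zero n)).flip
      (Ext.mk₀ (conjCounitHom α N'))) ∘ₗ
      Functor.mapExtLinearMap (conjFunctor α) k _ _ n

lemma hopfExt_apply (h : H) {n : ℕ} (x : Ext ((smashRes α).obj N) ((smashRes α).obj N') n) :
    hopfExt α h n x = (Ext.mk₀ (conjUnitHom α h N)).comp ((x.mapExactFunctor (conjFunctor α)).comp
      (Ext.mk₀ (conjCounitHom α N')) (add_zero n)) (zero_add n) := rfl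

/-- `hopfConj` for morphisms of right `A`-modules. -/
noncomputable def conjHom (h : H) (f : (smashRes α).obj N ⟶ (smashRes α).obj N') :
    (smashRes α).obj N ⟶ (smashRes α).obj N' :=
  conjUnitHom α h N ≫ (conjFunctor α).map f ≫ conjCounitHom α N'

lemma hopfExt_mk₀ (h : H) (f : (smashRes α).obj N ⟶ (smashRes α).obj N') :
    hopfExt α h 0 (Ext.mk₀ f) = Ext.mk₀ (conjHom α h f) := by
  rw [hopfExt_apply, Ext.mapExactFunctor_mk₀, Ext.mk₀_comp_mk₀, Ext.mk₀_comp_mk₀]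
  rfl

/-- An exact functor `G` and a family of morphisms `R(N) → G(R(N))`, natural in `N`, are compatible
with the classes of short exact sequences. -/
lemma mk₀_comp_mapExactFunctor_mapExactFunctor_extClass {C D E : Type*} [Category* C] [Abelian C]
    [HasExt C]
    [Category* D] [Abelian D] [HasExt D] [Category* E] [Abelian E] [HasExt E]
    {S : ShortComplex C} (hS : S.ShortExact) (R : C ⥤ D) [R.Additive] [PreservesFiniteLimits R]
    [PreservesFiniteColimits R] (F G : D ⥤ E) [F.Additive] [PreservesFiniteLimits F]
    [PreservesFiniteColimits F] [G.Additive] [PreservesFiniteLimits G]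
    [PreservesFiniteColimits G] (τ : ∀ N, F.obj (R.obj N) ⟶ G.obj (R.obj N))
    (hτ : ∀ {N N' : C} (f : N ⟶ N'), τ N ≫ G.map (R.map f) = F.map (R.map f) ≫ τ N') :
    (Ext.mk₀ (τ S.X₃)).comp ((hS.extClass.mapExactFunctor R).mapExactFunctor G) (zero_add 1) =
      ((hS.extClass.mapExactFunctor R).mapExactFunctor F).comp (Ext.mk₀ (τ S.X₁)) (add_zero 1) := by
  have h := mapExactFunctor_extClass_naturality F G (hS.map_of_exact R) (hS.map_of_exact R)
    (τ S.X₁) (τ S.X₂) (τ S.X₃) (hτ S.f) (hτ S.g)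
  have h' : (hS.map_of_exact R).extClass = hS.extClass.mapExactFunctor R :=
    (Ext.mapExactFunctor_extClass ..).symm
  rw [h'] at h
  exact h.symm

/-- The units N → N # H are natural for A # H-linear maps, so they commute with connecting classes
of sequences over A # H. By `ext_induction_restrict`, the laws of the action then follow from degree
zero. -/
lemma hopfExt_extClass_comp (h : H) {S : ShortComplex (ModuleCat.{u} (SmashHopf α)ᵐᵒᵖ)}
    (hS : S.ShortExact) {n : ℕ} (x : Ext ((smashRes α).obj S.X₁) ((smashRes α).obj N') n) :
    hopfExt α h (n + 1) ((hS.extClass.mapExactFunctor (smashRes α)).comp x (add_comm 1 n)) =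
      (hS.extClass.mapExactFunctor (smashRes α)).comp (hopfExt α h n x) (add_comm 1 n) := by
  have h₁ := mk₀_comp_mapExactFunctor_mapExactFunctor_extClass hS (smashRes α) (𝟭 _)
    (conjFunctor α) (conjUnitHom α h) (conjUnitHom_naturality α h)
  rw [Ext.mapExactFunctor_id] at h₁
  rw [hopfExt_apply, hopfExt_apply, Ext.mapExactFunctor_comp,
    Ext.comp_assoc_of_third_deg_zero, ← Ext.comp_assoc _ _ _ (zero_add 1) _ (by omega), h₁,
    Ext.comp_assoc_of_second_deg_zero]

variable (hS : Function.Bijective (antipode k (A := H)))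

lemma Ext.finset_sum_comp {C : Type*} [Category* C] [Abelian C] [HasExt C] {X Y Z : C} {ι : Type*}
    (s : Finset ι) {n m l : ℕ} (x : ι → Ext X Y n) (y : Ext Y Z m) (e : n + m = l) :
    (∑ i ∈ s, x i).comp y e = ∑ i ∈ s, (x i).comp y e :=
  map_sum ((Ext.bilinearComp X Y Z n m l e).flip y) x s

lemma Ext.comp_finset_sum {C : Type*} [Category* C] [Abelian C] [HasExt C] {X Y Z : C} {ι : Type*}
    (s : Finset ι) {n m l : ℕ} (x : Ext X Y n) (y : ι → Ext Y Z m) (e : n + m = l) :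
    x.comp (∑ i ∈ s, y i) e = ∑ i ∈ s, x.comp (y i) e :=
  map_sum (Ext.bilinearComp X Y Z n m l e x) y s

include hS in
lemma hopfExt_mul (h h' : H) {n : ℕ} (x : Ext ((smashRes α).obj N) ((smashRes α).obj N') n) :
    hopfExt α (h * h') n x = hopfExt α h n (hopfExt α h' n x) := by
  have := smashRes_preservesProjectiveObjects α hS
  refine ext_induction_restrict (smashRes α)
    (p := fun N n x => hopfExt α (h * h') n x = hopfExt α h n (hopfExt α h' n x))
    (fun N f => ?_) (fun S hS n x ih => ?_) N n x
  · rw [hopfExt_mk₀, hopfExt_mk₀, hopfExt_mk₀]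
    congr 1
    ext n
    exact LinearMap.congr_fun (hopfConj_mul α h h' (f.hom.restrictScalars k)) n
  · rw [hopfExt_extClass_comp, hopfExt_extClass_comp, hopfExt_extClass_comp, ih]

include hS in
lemma hopfExt_one {n : ℕ} (x : Ext ((smashRes α).obj N) ((smashRes α).obj N') n) :
    hopfExt α 1 n x = x := by
  have := smashRes_preservesProjectiveObjects α hS
  refine ext_induction_restrict (smashRes α) (p := fun N n x => hopfExt α 1 n x = x)
    (fun N f => ?_) (fun S hS n x ih => ?_) N n x
  · rw [hopfExt_mk₀]
    congr 1
    ext n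
    exact LinearMap.congr_fun (hopfConj_one α (f.hom.restrictScalars k)) n
  · rw [hopfExt_extClass_comp, ih]

lemma conjUnitHom_comp_map (h : H) {ι : Type*} (R : Repr k h ι)
    (f : (smashRes α).obj N ⟶ (smashRes α).obj N') :
    conjUnitHom α h N ≫ (conjFunctor α).map f =
      ∑ i ∈ R.index, conjHom α (R.right i) f ≫ conjUnitHom α (R.left i) N' := by
  refine ModuleCat.hom_ext (LinearMap.ext fun n =>
    (rTensor_conjUnit α h (f.hom.restrictScalars k) n R).trans ?_)
  let ev : ((smashRes α).obj N ⟶ (conjFunctor α).obj ((smashRes α).obj N')) →+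
      (smashRes α).obj N' ⊗[k] H :=
    { toFun f := f n, map_zero' := rfl, map_add' _ _ := rfl }
  exact (map_sum ev (fun i => conjHom α (R.right i) f ≫ conjUnitHom α (R.left i) N') R.index).symm

lemma Ext.mk₀_finset_sum {C : Type*} [Category* C] [Abelian C] [HasExt C] {X Y : C} {ι : Type*}
    (s : Finset ι) (f : ι → (X ⟶ Y)) : Ext.mk₀ (∑ i ∈ s, f i) = ∑ i ∈ s, Ext.mk₀ (f i) :=
  map_sum (Ext.addEquiv₀ (X := X) (Y := Y)).symm f s

-- The version of `rTensor_conjUnit` in all degrees, by dimension shifting over A # H.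
include hS in
lemma mk₀_conjUnitHom_comp (h : H) {ι : Type*} (R : Repr k h ι) {n : ℕ}
    (x : Ext ((smashRes α).obj N) ((smashRes α).obj N') n) :
    (Ext.mk₀ (conjUnitHom α h N)).comp (x.mapExactFunctor (conjFunctor α)) (zero_add n) =
      ∑ i ∈ R.index, (hopfExt α (R.right i) n x).comp
        (Ext.mk₀ (conjUnitHom α (R.left i) N')) (add_zero n) := by
  have := smashRes_preservesProjectiveObjects α hS
  refine ext_induction_restrict (smashRes α) (p := fun N n x =>
    (Ext.mk₀ (conjUnitHom α h N)).comp (x.mapExactFunctor (conjFunctor α)) (zero_add n) =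
      ∑ i ∈ R.index, (hopfExt α (R.right i) n x).comp
        (Ext.mk₀ (conjUnitHom α (R.left i) N')) (add_zero n))
    (fun N f => ?_) (fun S hS n x ih => ?_) N n x
  · simp only [hopfExt_mk₀, Ext.mapExactFunctor_mk₀, Ext.mk₀_comp_mk₀]
    rw [conjUnitHom_comp_map α h R, Ext.mk₀_finset_sum]
  · have h₁ := mk₀_comp_mapExactFunctor_mapExactFunctor_extClass hS (smashRes α) (𝟭 _)
      (conjFunctor α) (conjUnitHom α h) (conjUnitHom_naturality α h)
    rw [Ext.mapExactFunctor_id] at h₁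
    simp only [hopfExt_extClass_comp, Ext.comp_assoc_of_third_deg_zero]
    rw [← Ext.comp_finset_sum, ← ih, Ext.mapExactFunctor_comp,
      ← Ext.comp_assoc _ _ _ (zero_add 1) _ (by omega), h₁, Ext.comp_assoc_of_second_deg_zero]

-- The unit moves past x # H and leaves h₂ acting on x and h₁ on y. As the Yoneda product of these
-- classes is y times x, this is the usual order for a module algebra.
include hS in
lemma hopfExt_comp (h : H) {ι : Type*} (R : Repr k h ι) {n m l : ℕ}
    (x : Ext ((smashRes α).obj N) ((smashRes α).obj N') n)
    (y : Ext ((smashRes α).obj N') ((smashRes α).obj N'') m) (e : n + m = l) :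
    hopfExt α h l (x.comp y e) =
      ∑ i ∈ R.index, (hopfExt α (R.right i) n x).comp (hopfExt α (R.left i) m y) e := by
  rw [hopfExt_apply, Ext.mapExactFunctor_comp, Ext.comp_assoc_of_third_deg_zero,
    ← Ext.comp_assoc _ _ _ (zero_add n) _ (by omega), mk₀_conjUnitHom_comp α hS h R,
    Ext.finset_sum_comp]
  simp only [Ext.comp_assoc_of_second_deg_zero, hopfExt_apply]

lemma hopfExt_mk₀_id (h : H) : hopfExt α h 0 (Ext.mk₀ (𝟙 ((smashRes α).obj N))) =
    counit (R := k) h • Ext.mk₀ (𝟙 _) := by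
  rw [hopfExt_mk₀, ← Ext.mk₀_smul]
  congr 1
  ext n
  exact LinearMap.congr_fun (hopfConj_id α h) n

end HopfExt

/-! ## The module algebra structure on the Yoneda algebra -/

section HopfExtAlgebra

open Limits Coalgebra HopfAlgebra
open scoped ModuleCat

variable {k : Type u} [Field k] {H A : Type u} [Ring H] [HopfAlgebra k H] [Ring A] [Algebra k A]
  (α : ModuleAlgebra k H A)

lemma conjUnitHom_add (h h' : H) (N : ModuleCat.{u} (SmashHopf α)ᵐᵒᵖ) :
    conjUnitHom α (h + h') N = conjUnitHom α h N + conjUnitHom α h' N := by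
  ext n
  exact LinearMap.congr_fun ((conjUnit α ((smashRes α).obj N)).map_add h h') n

lemma conjUnitHom_smul (r : k) (h : H) (N : ModuleCat.{u} (SmashHopf α)ᵐᵒᵖ) :
    conjUnitHom α (r • h) N = r • conjUnitHom α h N := by
  ext n
  refine (LinearMap.congr_fun ((conjUnit α ((smashRes α).obj N)).map_smul r h) n).trans ?_
  refine .trans ?_ (smashRes_smul_eq α _ r (conjUnitHom α h N n)).symm
  exact (SmashModule.algebraMap_smul α (HopfModule.self k H) ((smashRes α).obj N) r _).symm

variable {N N' : ModuleCat.{u} (SmashHopf α)ᵐᵒᵖ}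

/-- `hopfExt`, as a linear map. -/
noncomputable def hopfExtLin (n : ℕ) : H →ₗ[k]
    Module.End k (Ext ((smashRes α).obj N) ((smashRes α).obj N') n) where
  toFun h := hopfExt α h n
  map_add' h h' := LinearMap.ext fun x => by
    rw [LinearMap.add_apply, hopfExt_apply, conjUnitHom_add, Ext.mk₀_add, Ext.add_comp]
    rfl
  map_smul' r h := LinearMap.ext fun x => by
    rw [LinearMap.smul_apply, hopfExt_apply, conjUnitHom_smul, Ext.mk₀_smul, Ext.smul_comp]
    rfl

variable (hS : Function.Bijective (antipode k (A := H))) (N)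

/-- The operator on the Yoneda algebra given by an element of `H`. -/
noncomputable def hopfExtAct : H →ₗ[k]
    Module.End k (⨁ n, Ext ((smashRes α).obj N) ((smashRes α).obj N) n) where
  toFun h := DirectSum.lmap fun n => hopfExt α h n
  map_add' h h' := DirectSum.linearMap_ext k fun n => LinearMap.ext fun x => by
    rw [LinearMap.add_comp, LinearMap.add_apply]
    simp only [LinearMap.comp_apply, DirectSum.lmap_lof]
    rw [← map_add]
    exact congrArg (DirectSum.lof k ℕ _ n)
      (LinearMap.congr_fun ((hopfExtLin α n).map_add h h') x)
  map_smul' r h := DirectSum.linearMap_ext k fun n => LinearMap.ext fun x => by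
    rw [RingHom.id_apply, LinearMap.smul_comp, LinearMap.smul_apply]
    simp only [LinearMap.comp_apply, DirectSum.lmap_lof]
    rw [← map_smul]
    exact congrArg (DirectSum.lof k ℕ _ n)
      (LinearMap.congr_fun ((hopfExtLin α n).map_smul r h) x)

lemma hopfExtAct_lof (h : H) (n : ℕ) (x : Ext ((smashRes α).obj N) ((smashRes α).obj N) n) :
    hopfExtAct α N h (DirectSum.lof k ℕ _ n x) = DirectSum.lof k ℕ _ n (hopfExt α h n x) :=
  DirectSum.lmap_lof (fun n => hopfExt α h n) n x

include hS in
lemma hopfExtAct_mul (h : H) {ι : Type*} (R : Repr k h ι)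
    (a a' : ⨁ n, Ext ((smashRes α).obj N) ((smashRes α).obj N) n) :
    hopfExtAct α N h (a * a') =
      ∑ i ∈ R.index, hopfExtAct α N (R.left i) a * hopfExtAct α N (R.right i) a' := by
  induction a using DirectSum.induction_on with
  | zero => simp
  | add x y hx hy => simp only [add_mul, map_add, Finset.sum_add_distrib, hx, hy]
  | of n x =>
  induction a' using DirectSum.induction_on with
  | zero => simp
  | add x y hx hy => simp only [mul_add, map_add, Finset.sum_add_distrib, hx, hy]
  | of m y =>
    refine (congrArg (hopfExtAct α N h) (DirectSum.of_mul_of x y)).trans ?_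
    refine (hopfExtAct_lof α N h (n + m) (y.comp x (add_comm m n))).trans ?_
    rw [hopfExt_comp α hS h R, map_sum]
    refine Finset.sum_congr rfl fun i _ => ?_
    have h₁ : hopfExtAct α N (R.left i) (DirectSum.of _ n x) = DirectSum.of _ n _ :=
      hopfExtAct_lof α N (R.left i) n x
    have h₂ : hopfExtAct α N (R.right i) (DirectSum.of _ m y) = DirectSum.of _ m _ :=
      hopfExtAct_lof α N (R.right i) m y
    rw [h₁, h₂]
    exact (DirectSum.of_mul_of (hopfExt α (R.left i) n x) (hopfExt α (R.right i) m y)).symm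

/-- The module algebra structure on the Yoneda algebra of a module over `A # H`. -/
noncomputable def hopfModuleAlgebra : GradedModuleAlgebra k H
    (Ext ((smashRes α).obj N) ((smashRes α).obj N)) where
  act := AlgHom.ofLinearMap (hopfExtAct α N)
    (DirectSum.linearMap_ext k fun n => LinearMap.ext fun x =>
      (hopfExtAct_lof α N 1 n x).trans
        (congrArg (DirectSum.lof k ℕ _ n) (hopfExt_one α hS x)))
    (fun h h' => DirectSum.linearMap_ext k fun n => LinearMap.ext fun x => by
      refine (hopfExtAct_lof α N (h * h') n x).trans
        ((congrArg (DirectSum.lof k ℕ _ n) (hopfExt_mul α hS h h' x)).trans ?_)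
      rw [LinearMap.comp_apply, Module.End.mul_apply, hopfExtAct_lof, hopfExtAct_lof])
  act_mul h a a' := by
    have R := Repr.arbitrary k h
    refine (hopfExtAct_mul α N hS h R a a').trans ?_
    refine .trans ?_ (congrArg (TensorProduct.lift _) R.eq)
    rw [map_sum]
    rfl
  act_one h := by
    refine (hopfExtAct_lof α N h 0 (Ext.mk₀ (𝟙 _))).trans ?_
    rw [hopfExt_mk₀_id, map_smul, Algebra.algebraMap_eq_smul_one]
    rfl
  act_lof h n x := ⟨_, (hopfExtAct_lof α N h n x).symm⟩

end HopfExtAlgebra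

/-! ### The action computed on equivariant resolutions. -/

section InducedAction

open Limits Coalgebra HopfAlgebra
open scoped ModuleCat

variable {k : Type u} [Field k] {H A : Type u} [Ring H] [HopfAlgebra k H] [Ring A] [Algebra k A]
  {α : ModuleAlgebra k H A}

/-- A module over `A` with a compatible structure of a module over `A # H`, as the restriction
of a module over `A # H`. -/
noncomputable def smashResIso (P : ModuleCat.{u} Aᵐᵒᵖ) [Module (SmashHopf α)ᵐᵒᵖ P]
    (hP : ∀ (a : A) (x : P), op (SmashHopf.tmul α a 1) • x = op a • x) :
    P ≅ (smashRes α).obj (ModuleCat.of (SmashHopf α)ᵐᵒᵖ P) where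
  hom := ModuleCat.ofHom (X := P) (Y := (smashRes α).obj (ModuleCat.of (SmashHopf α)ᵐᵒᵖ P))
    { toFun x := x
      map_add' _ _ := rfl
      map_smul' a x := (hP a.unop x).symm }
  inv := ModuleCat.ofHom (X := (smashRes α).obj (ModuleCat.of (SmashHopf α)ᵐᵒᵖ P)) (Y := P)
    { toFun x := x
      map_add' _ _ := rfl
      map_smul' a x := hP a.unop x }

variable (hS : Function.Bijective (antipode k (A := H))) (N : ModuleCat.{u} (SmashHopf α)ᵐᵒᵖ)

/-- The action of `H` on the Yoneda algebra is induced by the action on the cochain complex of each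
resolution by modules over `A # H` that are projective over `A`. -/
lemma isInducedAction_hopfModuleAlgebra (P : EquivariantResolution α ((smashRes α).obj N)) :
    IsInducedAction P (hopfModuleAlgebra α N hS) := by
  obtain @⟨R, mod, hP, hd, haug⟩ := P
  intro n f hf h
  let T (n : ℕ) : ModuleCat.{u} (SmashHopf α)ᵐᵒᵖ := ModuleCat.of (SmashHopf α)ᵐᵒᵖ (R.complex.X n)
  let ι (n : ℕ) : R.complex.X n ≅ (smashRes α).obj (T n) := smashResIso (R.complex.X n) (hP n)
  -- The units of the terms, transported along the identity isomorphisms ι, form a morphism of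
  -- complexes from R to R # H over the unit of N, because differentials and augmentation are A #
  -- H-linear.
  let φ (n : ℕ) : R.complex.X n ⟶ (conjFunctor α).obj (R.complex.X n) :=
    (ι n).hom ≫ conjUnitHom α h (T n) ≫ (conjFunctor α).map (ι n).inv
  have hφ (i j : ℕ) : φ i ≫ (conjFunctor α).map (R.complex.d i j) = R.complex.d i j ≫ φ j := by
    by_cases hij : j + 1 = i
    · subst hij
      let d : T (j + 1) ⟶ T j := ModuleCat.ofHom (X := R.complex.X (j + 1)) (Y := R.complex.X j)
        { toFun x := R.complex.d (j + 1) j x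
          map_add' := map_add (R.complex.d (j + 1) j).hom
          map_smul' := hd j }
      have h₁ : (ι (j + 1)).inv ≫ R.complex.d (j + 1) j = (smashRes α).map d ≫ (ι j).inv := rfl
      have h₂ : R.complex.d (j + 1) j ≫ (ι j).hom = (ι (j + 1)).hom ≫ (smashRes α).map d := rfl
      simp only [φ, Category.assoc, ← Functor.map_comp]
      rw [h₁, reassoc_of% h₂, Functor.map_comp, ← Category.assoc (conjUnitHom α h _),
        conjUnitHom_naturality]
      simp
    · have h₀ : R.complex.d i j = 0 := R.complex.shape i j hij
      rw [h₀, zero_comp, Functor.map_zero, comp_zero]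
  have haug' : φ 0 ≫ (conjFunctor α).map (resolutionAug R) =
      resolutionAug R ≫ conjUnitHom α h N := by
    let d : T 0 ⟶ N := ModuleCat.ofHom (X := R.complex.X 0) (Y := N)
      { toFun x := resolutionAug R x
        map_add' := map_add (resolutionAug R).hom
        map_smul' := haug }
    have h₁ : (ι 0).inv ≫ resolutionAug R = (smashRes α).map d := rfl
    have h₂ : resolutionAug R = (ι 0).hom ≫ (smashRes α).map d := rfl
    simp only [φ, Category.assoc, ← Functor.map_comp]
    rw [h₁, conjUnitHom_naturality]
    rfl
  have hf' : R.complex.d (n + 1) n ≫ φ n ≫ (conjFunctor α).map f = 0 := by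
    rw [← Category.assoc, ← hφ, Category.assoc, ← Functor.map_comp, hf, Functor.map_zero,
      comp_zero]
  have h₁ := R.mk₀_comp_mapExactFunctor_extMk (conjFunctor α) R φ hφ (conjUnitHom α h N) haug' f
    (n + 1) rfl hf hf'
  -- The representing cocycle is the unit, then f # H, then the counit, which is the conjugation
  -- formula for h ⇀ f.
  refine ⟨(φ n ≫ (conjFunctor α).map f) ≫ conjCounitHom α N, ?_, fun x => ?_, ?_⟩
  · rw [← Category.assoc, hf', zero_comp]
  · have h₂ : φ n ≫ (conjFunctor α).map f =
        (ι n).hom ≫ conjUnitHom α h (T n) ≫ (conjFunctor α).map ((ι n).inv ≫ f) := by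
      simp only [φ, Category.assoc, Functor.map_comp]
    have h₃ : (φ n ≫ (conjFunctor α).map f) ≫ conjCounitHom α N =
        (ι n).hom ≫ conjHom α h ((ι n).inv ≫ f) := by
      rw [h₂]
      simp only [conjHom, Category.assoc]
    refine (ConcreteCategory.congr_hom h₃ x).trans ?_
    refine (hopfConj_apply (N := (smashRes α).obj (T n)) (N' := (smashRes α).obj N) α h
      (((ι n).inv ≫ f).hom.restrictScalars k) x (Repr.arbitrary k h)).trans ?_
    rfl
  · refine (hopfExtAct_lof α N h n _).trans (congrArg (DirectSum.lof k ℕ _ n) ?_)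
    rw [hopfExt_apply, ← Ext.comp_assoc_of_third_deg_zero]
    refine (congrArg (fun z => Ext.comp z (Ext.mk₀ (conjCounitHom α N)) (add_zero n)) h₁).trans ?_
    rw [R.extMk_comp_mk₀]

end InducedAction

/-! ## The map on Ext groups given by `N # -` -/

section RightExt

open Limits Coalgebra HopfAlgebra
open scoped ModuleCat

variable {k : Type u} [Field k] {H A B : Type u} [Ring H] [HopfAlgebra k H] [Ring A] [Algebra k A]
  [Ring B] [Algebra k B] (α : ModuleAlgebra k H A) {β : ComoduleAlgebra k H B}
  {X X' X'' : ModuleCat.{u} Bᵐᵒᵖ} (χ : HopfModule β X) (χ' : HopfModule β X')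
  (χ'' : HopfModule β X'')

lemma SmashModule.hom_ext {N : ModuleCat.{u} Aᵐᵒᵖ} {Z : ModuleCat.{u} (SmashProduct α β)ᵐᵒᵖ}
    {f g : (smashFunctor α χ).obj N ⟶ Z}
    (h : ∀ (n : N) (x : X), f (SmashModule.tmul α χ n x) = g (SmashModule.tmul α χ n x)) :
    f = g := by
  refine ModuleCat.hom_ext (LinearMap.ext fun z => ?_)
  induction z using TensorProduct.induction_on with
  | zero => exact (map_zero f.hom).trans (map_zero g.hom).symm
  | tmul n x => exact h n x
  | add y z hy hz =>
    exact (map_add f.hom y z).trans ((congrArg₂ (· + ·) hy hz).trans (map_add g.hom y z).symm)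

/-- The map `N # X → N # X'` given by a map `X → X'` of `B`-modules, for a module `N`
over `A # H`. -/
noncomputable def rightHom (N : ModuleCat.{u} (SmashHopf α)ᵐᵒᵖ) (g : X ⟶ X') :
    (smashFunctor α χ).obj ((smashRes α).obj N) ⟶ (smashFunctor α χ').obj ((smashRes α).obj N) :=
  (untwistIso α χ N).hom ≫ (smashDiagFunctor α β N).map g ≫ (untwistIso α χ' N).inv

/-- In terms of the coaction on maps, this is n ⊗ x ↦ ∑ n S(g₋₁) ⊗ g₀(x), that is, ∑ (g₋₁ ⇀ n) ⊗
g₀(x). -/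
lemma rightHom_tmul (hS : Function.Bijective (antipode k (A := H)))
    (N : ModuleCat.{u} (SmashHopf α)ᵐᵒᵖ) (g : X ⟶ X') (n : (smashRes α).obj N)
    (x : X) : rightHom α χ χ' N g (SmashModule.tmul α χ n x) =
      ((hopfRight α ((smashRes α).obj N) ∘ₗ antipode k).flip n).rTensor X'
        (mapCoact hS χ' χ (g.hom.restrictScalars k) x) :=
  retwist_lTensor_untwist hS χ' χ α (g.hom.restrictScalars k) n x

lemma rightHom_naturality {N N' : ModuleCat.{u} (SmashHopf α)ᵐᵒᵖ} (u : N ⟶ N') (g : X ⟶ X') :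
    rightHom α χ χ' N g ≫ (smashFunctor α χ').map ((smashRes α).map u) =
      (smashFunctor α χ).map ((smashRes α).map u) ≫ rightHom α χ χ' N' g := by
  rw [rightHom, rightHom, ← Category.assoc ((smashFunctor α χ).map _), untwistIso_naturality_left,
    Category.assoc, Category.assoc, Category.assoc, ← NatTrans.naturality_assoc]
  congr 2
  rw [Iso.inv_comp_eq, ← Category.assoc, ← untwistIso_naturality_left, Category.assoc,
    Iso.hom_inv_id, Category.comp_id]

/-- The map on Ext groups given by `X ↦ N # X`, for a module `N` over `A # H`. -/
noncomputable def rightExt (N : ModuleCat.{u} (SmashHopf α)ᵐᵒᵖ) (n : ℕ) : Ext X X' n →ₗ[k]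
    Ext ((smashFunctor α χ).obj ((smashRes α).obj N))
      ((smashFunctor α χ').obj ((smashRes α).obj N)) n :=
  ((Ext.bilinearCompOfLinear k _ _ _ 0 n n (zero_add n)) (Ext.mk₀ (untwistIso α χ N).hom)) ∘ₗ
    ((Ext.bilinearCompOfLinear k _ _ _ n 0 n (add_zero n)).flip
      (Ext.mk₀ (untwistIso α χ' N).inv)) ∘ₗ
      Functor.mapExtLinearMap (smashDiagFunctor α β N) k _ _ n

lemma rightExt_apply (N : ModuleCat.{u} (SmashHopf α)ᵐᵒᵖ) {n : ℕ} (γ : Ext X X' n) :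
    rightExt α χ χ' N n γ = (Ext.mk₀ (untwistIso α χ N).hom).comp
      ((γ.mapExactFunctor (smashDiagFunctor α β N)).comp
        (Ext.mk₀ (untwistIso α χ' N).inv) (add_zero n)) (zero_add n) := rfl

lemma rightExt_mk₀ (N : ModuleCat.{u} (SmashHopf α)ᵐᵒᵖ) (g : X ⟶ X') :
    rightExt α χ χ' N 0 (Ext.mk₀ g) = Ext.mk₀ (rightHom α χ χ' N g) := by
  rw [rightExt_apply, Ext.mapExactFunctor_mk₀, Ext.mk₀_comp_mk₀, Ext.mk₀_comp_mk₀]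
  rfl

lemma rightExt_comp (N : ModuleCat.{u} (SmashHopf α)ᵐᵒᵖ) {n m l : ℕ} (γ : Ext X X' n)
    (γ' : Ext X' X'' m) (e : n + m = l) : rightExt α χ χ'' N l (γ.comp γ' e) =
      (rightExt α χ χ' N n γ).comp (rightExt α χ' χ'' N m γ') e := by
  rw [rightExt_apply, rightExt_apply, rightExt_apply, Ext.mapExactFunctor_comp,
    Ext.comp_assoc_of_third_deg_zero, Ext.comp_assoc _ _ _ (zero_add n) _ (by omega),
    Ext.comp_assoc_of_second_deg_zero, Ext.mk₀_comp_mk₀_assoc, Iso.inv_hom_id, Ext.mk₀_id_comp]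

lemma rightExt_mk₀_id (N : ModuleCat.{u} (SmashHopf α)ᵐᵒᵖ) :
    rightExt α χ χ N 0 (Ext.mk₀ (𝟙 X)) = Ext.mk₀ (𝟙 _) := by
  rw [rightExt_mk₀, rightHom, CategoryTheory.Functor.map_id, Category.id_comp, Iso.hom_inv_id]

lemma smashNatTrans_comp_zero {S : ShortComplex (ModuleCat.{u} Bᵐᵒᵖ)}
    {κ : HopfModule β S.X₁} {θ : HopfModule β S.X₂} {χ : HopfModule β S.X₃}
    (hi : ∀ y, θ.coact (S.f y) = (S.f.hom.restrictScalars k).lTensor H (κ.coact y))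
    (hp : ∀ y, χ.coact (S.g y) = (S.g.hom.restrictScalars k).lTensor H (θ.coact y))
    (N : ModuleCat.{u} Aᵐᵒᵖ) :
    (smashNatTrans α S.f.hom hi).app N ≫ (smashNatTrans α S.g.hom hp).app N = 0 := by
  ext z
  have h₀ : (S.g.hom.restrictScalars k) ∘ₗ (S.f.hom.restrictScalars k) = 0 :=
    LinearMap.ext fun x => ConcreteCategory.congr_hom S.zero x
  refine (LinearMap.lTensor_comp_apply N _ _ z).symm.trans ?_
  rw [h₀]
  exact LinearMap.congr_fun (LinearMap.lTensor_zero N) z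

lemma smash_shortExact {S : ShortComplex (ModuleCat.{u} Bᵐᵒᵖ)} (hSe : S.ShortExact)
    (κ : HopfModule β S.X₁) (θ : HopfModule β S.X₂) (χ : HopfModule β S.X₃)
    (hi : ∀ y, θ.coact (S.f y) = (S.f.hom.restrictScalars k).lTensor H (κ.coact y))
    (hp : ∀ y, χ.coact (S.g y) = (S.g.hom.restrictScalars k).lTensor H (θ.coact y))
    (N : ModuleCat.{u} Aᵐᵒᵖ) :
    (ShortComplex.mk ((smashNatTrans α S.f.hom hi).app N)
      ((smashNatTrans α S.g.hom hp).app N) (smashNatTrans_comp_zero α hi hp N)).ShortExact := by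
  refine ModuleCat.shortComplex_shortExact _ ?_ ?_ ?_
  · exact lTensor_exact N (f := S.f.hom.restrictScalars k) (g := S.g.hom.restrictScalars k)
      (ModuleCat.exact_of_shortExact hSe) hSe.moduleCat_surjective_g
  · exact Module.Flat.lTensor_preserves_injective_linearMap (S.f.hom.restrictScalars k)
      hSe.moduleCat_injective_f
  · exact LinearMap.lTensor_surjective N (g := S.g.hom.restrictScalars k) hSe.moduleCat_surjective_g

/-- For colinear maps, untwisting identifies N # - with the diagonal functor, so both produce the
same extension. It lets the sign rule for short exact sequences of functors be applied to N # γ. -/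
lemma rightExt_extClass {S : ShortComplex (ModuleCat.{u} Bᵐᵒᵖ)} (hSe : S.ShortExact)
    (κ : HopfModule β S.X₁) (θ : HopfModule β S.X₂) (χ : HopfModule β S.X₃)
    (hi : ∀ y, θ.coact (S.f y) = (S.f.hom.restrictScalars k).lTensor H (κ.coact y))
    (hp : ∀ y, χ.coact (S.g y) = (S.g.hom.restrictScalars k).lTensor H (θ.coact y))
    (N : ModuleCat.{u} (SmashHopf α)ᵐᵒᵖ) :
    rightExt α χ κ N 1 hSe.extClass = (smash_shortExact α hSe κ θ χ hi hp
      ((smashRes α).obj N)).extClass := by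
  let E := smash_shortExact α hSe κ θ χ hi hp
    ((smashRes α).obj N)
  have h := mapExactFunctor_extClass_naturality (𝟭 _) (smashDiagFunctor α β N) E hSe
    (untwistIso α κ N).hom (untwistIso α θ N).hom (untwistIso α χ N).hom
    (untwistIso_naturality_right α κ θ N S.f hi).symm
    (untwistIso_naturality_right α θ χ N S.g hp).symm
  rw [Ext.mapExactFunctor_id] at h
  rw [rightExt_apply, ← Ext.comp_assoc_of_third_deg_zero]
  refine (congrArg (fun z => Ext.comp z (Ext.mk₀ (untwistIso α κ N).inv) (add_zero 1))
    h.symm).trans ?_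
  rw [Ext.comp_assoc_of_third_deg_zero, Ext.mk₀_comp_mk₀]
  exact (congrArg (fun f => E.extClass.comp (Ext.mk₀ f) (add_zero 1)) (Iso.hom_inv_id _)).trans
    (Ext.comp_mk₀_id _)

variable {N N' : ModuleCat.{u} (SmashHopf α)ᵐᵒᵖ}

/-- The compatibility of `rightHom` with a map of `A`-modules. -/
lemma smashFunctor_map_comp_rightHom (hS : Function.Bijective (antipode k (A := H)))
    (f : (smashRes α).obj N ⟶ (smashRes α).obj N') (g : X ⟶ X') {r : ℕ} (h : Fin r → H)
    (g' : Fin r → (X ⟶ X'))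
    (hg : ∀ x, mapCoact hS χ' χ (g.hom.restrictScalars k) x = ∑ i, h i ⊗ₜ g' i x) :
    (smashFunctor α χ).map f ≫ rightHom α χ χ' N' g =
      ∑ i, rightHom α χ χ' N (g' i) ≫ (smashFunctor α χ').map (conjHom α (h i) f) := by
  let φ : (smashRes α).obj N →ₗ[k] (smashRes α).obj N' := f.hom.restrictScalars k
  let ev (n : (smashRes α).obj N) (x : X) : ((smashFunctor α χ).obj ((smashRes α).obj N) ⟶
      (smashFunctor α χ').obj ((smashRes α).obj N')) →+ (smashRes α).obj N' ⊗[k] X' :=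
    { toFun f := f.hom (SmashModule.tmul α χ n x)
      map_zero' := rfl, map_add' _ _ := rfl }
  have h₁ (n : (smashRes α).obj N) (x : X) : ((hopfRight α ((smashRes α).obj N') ∘ₗ
      antipode k).flip (φ n)).rTensor X' (mapCoact hS χ' χ (g.hom.restrictScalars k) x) =
      ∑ i, (hopfConj α (h i) φ).rTensor X' (((hopfRight α ((smashRes α).obj N) ∘ₗ
        antipode k).flip n).rTensor X' (mapCoact hS χ' χ ((g' i).hom.restrictScalars k) x)) := by
    -- L sends h ⊗ h' to (h ⇀ φ)(h' ⇀ n), so on a coproduct it collapses to a single action by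
    -- `sum_hopfConj`. Applied to coassociativity of the coaction of g, it gives the commutation
    -- rule on elements.
    let L : H ⊗[k] H →ₗ[k] (smashRes α).obj N' := TensorProduct.lift
      (((hopfConj α).flip φ).compl₂ ((hopfRight α ((smashRes α).obj N) ∘ₗ antipode k).flip n))
    have hL (y : H) : L (comul (R := k) y) = hopfRight α ((smashRes α).obj N') (antipode k y)
        (φ n) := by
      have R := Repr.arbitrary k y
      rw [← sum_hopfConj α y φ n R, ← R.eq, map_sum]
      rfl
    have h₂ := congrArg (fun z => L.rTensor X' ((TensorProduct.assoc k H H X').symm z))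
      (mapCoact_coassoc hS χ' χ (g.hom.restrictScalars k) x h
        (fun i => (g' i).hom.restrictScalars k) hg)
    simp only [LinearEquiv.symm_apply_apply, map_sum] at h₂
    rw [← LinearMap.rTensor_comp_apply] at h₂
    have h₃ : L ∘ₗ comul (R := k) = (hopfRight α ((smashRes α).obj N') ∘ₗ
      antipode k).flip (φ n) := LinearMap.ext hL
    rw [h₃] at h₂
    rw [← h₂]
    refine Finset.sum_congr rfl fun i _ => ?_
    generalize mapCoact hS χ' χ ((g' i).hom.restrictScalars k) x = z
    induction z using TensorProduct.induction_on with
    | zero => simp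
    | add y z hy hz => simp only [TensorProduct.tmul_add, map_add, hy, hz]
    | tmul y z => rfl
  refine SmashModule.hom_ext α χ fun n x => ?_
  refine .trans ?_ (map_sum (ev n x) (fun i => rightHom α χ χ' N (g' i) ≫
    (smashFunctor α χ').map (conjHom α (h i) f)) Finset.univ).symm
  refine (rightHom_tmul α χ χ' hS N' g (f n) x).trans ((h₁ n x).trans ?_)
  exact Finset.sum_congr rfl fun i _ => congrArg ((hopfConj α (h i) φ).rTensor X')
    (rightHom_tmul α χ χ' hS N (g' i) n x).symm

/-- For γ of degree zero the rule holds for x of every degree: connecting classes over A # H commute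
with `rightHom` by naturality, and with the action by `hopfExt_extClass_comp`. -/
lemma mapExactFunctor_comp_rightHom (hS : Function.Bijective (antipode k (A := H)))
    {n : ℕ} (x : Ext ((smashRes α).obj N) ((smashRes α).obj N') n)
    (g : X ⟶ X') {r : ℕ} (h : Fin r → H) (g' : Fin r → (X ⟶ X'))
    (hg : ∀ x, mapCoact hS χ' χ (g.hom.restrictScalars k) x = ∑ i, h i ⊗ₜ g' i x) :
    (x.mapExactFunctor (smashFunctor α χ)).comp (Ext.mk₀ (rightHom α χ χ' N' g)) (add_zero n) =
      ∑ i, (Ext.mk₀ (rightHom α χ χ' N (g' i))).comp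
        ((hopfExt α (h i) n x).mapExactFunctor (smashFunctor α χ')) (zero_add n) := by
  have := smashRes_preservesProjectiveObjects α hS
  refine ext_induction_restrict (smashRes α) (p := fun N n x =>
    (x.mapExactFunctor (smashFunctor α χ)).comp (Ext.mk₀ (rightHom α χ χ' N' g)) (add_zero n) =
      ∑ i, (Ext.mk₀ (rightHom α χ χ' N (g' i))).comp
        ((hopfExt α (h i) n x).mapExactFunctor (smashFunctor α χ')) (zero_add n))
    (fun N f => ?_) (fun S hS n x ih => ?_) N n x
  · simp only [hopfExt_mk₀, Ext.mapExactFunctor_mk₀, Ext.mk₀_comp_mk₀]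
    rw [smashFunctor_map_comp_rightHom α χ χ' hS f g h g' hg, Ext.mk₀_finset_sum]
  · have h₁ (i : Fin r) := mk₀_comp_mapExactFunctor_mapExactFunctor_extClass hS (smashRes α)
      (smashFunctor α χ) (smashFunctor α χ') (fun N => rightHom α χ χ' N (g' i))
      (fun u => rightHom_naturality α χ χ' u (g' i))
    simp only [hopfExt_extClass_comp, Ext.mapExactFunctor_comp, Ext.comp_assoc_of_third_deg_zero]
    rw [ih, Ext.comp_finset_sum]
    refine Finset.sum_congr rfl fun i _ => ?_
    rw [← Ext.comp_assoc _ _ _ (zero_add 1) _ (by omega), h₁, Ext.comp_assoc_of_second_deg_zero]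

end RightExt

/-! ### The graded commutation rule. -/

section Commutation

open Limits Coalgebra HopfAlgebra
open scoped ModuleCat

variable {k : Type u} [Field k] {H A B : Type u} [Ring H] [HopfAlgebra k H] [Ring A] [Algebra k A]
  [Ring B] [Algebra k B] (α : ModuleAlgebra k H A) {β : ComoduleAlgebra k H B}
  {X X' : ModuleCat.{u} Bᵐᵒᵖ} (χ : HopfModule β X) (χ' : HopfModule β X')
  {N N' : ModuleCat.{u} (SmashHopf α)ᵐᵒᵖ}

/-- The map `h ⊗ γ ↦ (N # γ) ((h ⇀ x) # X')`. -/
noncomputable def twistPairing {p : ℕ} (x : Ext ((smashRes α).obj N) ((smashRes α).obj N') p)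
    (q l : ℕ) (e : q + p = l) : H ⊗[k] Ext X X' q →ₗ[k]
      Ext ((smashFunctor α χ).obj ((smashRes α).obj N))
        ((smashFunctor α χ').obj ((smashRes α).obj N')) l :=
  TensorProduct.lift (((Ext.bilinearCompOfLinear k _ _ _ q p l e).flip ∘ₗ
    Functor.mapExtLinearMap (smashFunctor α χ') k _ _ p ∘ₗ (hopfExtLin α p).flip x).compl₂
      (rightExt α χ χ' N q))

lemma twistPairing_tmul {p : ℕ} (x : Ext ((smashRes α).obj N) ((smashRes α).obj N') p)
    {q l : ℕ} (e : q + p = l) (h : H) (γ : Ext X X' q) : twistPairing α χ χ' x q l e (h ⊗ₜ γ) =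
      (rightExt α χ χ' N q γ).comp ((hopfExt α h p x).mapExactFunctor (smashFunctor α χ')) e :=
  rfl

lemma twistPairing_lTensor_extPrecomp {X'' : ModuleCat.{u} Bᵐᵒᵖ} (χ'' : HopfModule β X'') {p : ℕ}
    (x : Ext ((smashRes α).obj N) ((smashRes α).obj N') p) {n q m l s : ℕ} (e : q + p = l)
    (γ : Ext X'' X n) (e' : n + q = m) (e'' : m + p = s) (z : H ⊗[k] Ext X X' q) :
    twistPairing α χ'' χ' x m s e'' ((extPrecomp γ X' e').lTensor H z) =
      (rightExt α χ'' χ N n γ).comp (twistPairing α χ χ' x q l e z) (by omega) := by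
  induction z using TensorProduct.induction_on with
  | zero => simp
  | add y z hy hz => simp only [map_add, Ext.comp_add, hy, hz]
  | tmul h γ' =>
    rw [LinearMap.lTensor_tmul, extPrecomp_apply, twistPairing_tmul, twistPairing_tmul,
      rightExt_comp α χ'' χ χ', Ext.comp_assoc _ _ _ e' e (by omega)]

variable (hS : Function.Bijective (antipode k (A := H)))

/-- The commutation of the classes that come from `A` with those that come from `B`. -/
lemma mapExactFunctor_comp_rightExt {p : ℕ}
    (x : Ext ((smashRes α).obj N) ((smashRes α).obj N') p) (hX : X.IsFPInfinity)
    {q l : ℕ} (γ : Ext X X' q) (e : p + q = l) :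
    (x.mapExactFunctor (smashFunctor α χ)).comp (rightExt α χ χ' N' q γ) e =
      (-1 : ℤ) ^ (p * q) • twistPairing α χ χ' x q l ((add_comm q p).trans e)
        (extCoact hS χ χ' hX q γ) := by
  induction q generalizing X l with
  | zero =>
    obtain ⟨g, rfl⟩ := (Ext.mk₀_bijective _ _).2 γ
    obtain ⟨r, h, g', hg, hg'⟩ := exists_extCoact_mk₀ hS χ χ' hX g
    obtain rfl : p = l := e
    rw [hg, rightExt_mk₀, mapExactFunctor_comp_rightHom α χ χ' hS x g h g' hg', map_sum,
      mul_zero, pow_zero, one_smul]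
    simp only [twistPairing_tmul, rightExt_mk₀]
  | succ q ih =>
    have := hX.finite
    obtain ⟨K, Q, κ, θ, i, f, w, hSe, hf, hQ, hi, hp⟩ := ModuleCat.exists_hopf_cover χ
    have hK : K.IsFPInfinity := hX.of_exact i.hom f.hom hSe.moduleCat_injective_f
      ((ShortComplex.ShortExact.moduleCat_exact_iff_function_exact _).1 hSe.exact)
      hSe.moduleCat_surjective_g
    have := Q.projective_of_categoryTheory_projective
    obtain ⟨γ, rfl⟩ := Ext.contravariant_sequence_exact₃ hSe X' γ
      (Ext.eq_zero_of_projective (P := Q) _) (add_comm 1 q)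
    have hc := extCoact_extClass_comp hS χ' hSe κ θ χ hX hK hi hp γ
    -- Passing x, of degree p, across the connecting class of the sequence of functors - # K, - # Q,
    -- - # X costs (-1)^p. This is the step from exponent p q to p (q + 1).
    have h₁ := mapExactFunctor_comp_extClass (smashFunctor α κ) (smashFunctor α θ)
      (smashFunctor α χ) (smashNatTrans α i.hom hi) (smashNatTrans α f.hom hp)
      (smashNatTrans_comp_zero (S := ShortComplex.mk i f w) α hi hp)
      (smash_shortExact (S := ShortComplex.mk i f w) α hSe κ θ χ hi hp) x
    have h₂ (N) := rightExt_extClass (S := ShortComplex.mk i f w) α hSe κ θ χ hi hp N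
    rw [← h₂, ← h₂] at h₁
    obtain rfl : p + (q + 1) = l := e
    have h₃ := twistPairing_lTensor_extPrecomp α κ χ' χ x (rfl : q + p = q + p) hSe.extClass
      (add_comm 1 q) (add_comm (q + 1) p) (extCoact hS κ χ' hK q γ)
    refine .trans ?_ (congrArg (fun z => (-1 : ℤ) ^ (p * (q + 1)) •
      twistPairing α χ χ' x (q + 1) (p + (q + 1)) (add_comm (q + 1) p) z) hc).symm
    refine .trans ?_ (congrArg (fun z => (-1 : ℤ) ^ (p * (q + 1)) • z) h₃).symm
    have h₄ := ih κ hK γ (l := q + p) (add_comm p q)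
    -- The sign is its own inverse, so the induction hypothesis can be solved for the twisted
    -- pairing.
    have h₅ : (-1 : ℤ) ^ (p * q) * (-1 : ℤ) ^ (p * q) = 1 := by
      rw [← mul_pow]; simp
    have h₆ : twistPairing α κ χ' x q (q + p) rfl (extCoact hS κ χ' hK q γ) =
        (-1 : ℤ) ^ (p * q) • (x.mapExactFunctor (smashFunctor α κ)).comp
          (rightExt α κ χ' N' q γ) (add_comm p q) := by
      rw [h₄, smul_smul, h₅, one_smul]
    rw [h₆, rightExt_comp α χ κ χ' N' hSe.extClass γ (add_comm 1 q)]
    refine (Ext.comp_assoc _ _ _ (rfl : p + 1 = p + 1) (add_comm 1 q) (by omega)).symm.trans ?_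
    refine (congrArg (fun z => Ext.comp z (rightExt α κ χ' N' q γ)
      (show p + 1 + q = p + (q + 1) by omega)) h₁).trans ?_
    have h₇ := fun (z : Ext ((smashFunctor α κ).obj ((smashRes α).obj N))
        ((smashFunctor α χ').obj ((smashRes α).obj N')) (q + p)) (r : ℤ) => map_zsmul
      (Ext.bilinearComp _ _ _ _ _ _ (show 1 + (q + p) = p + (q + 1) by omega)
        (rightExt α χ κ N 1 hSe.extClass)) r z
    refine .trans ?_ (congrArg (fun z => (-1 : ℤ) ^ (p * (q + 1)) • z) (h₇ _ _)).symm
    rw [smul_smul, mul_add, mul_one, pow_add, mul_assoc, mul_comm ((-1 : ℤ) ^ p), ← mul_assoc,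
      h₅, one_mul]
    refine (map_zsmul ((Ext.bilinearComp _ _ _ _ _ _ (show p + 1 + q = p + (q + 1) by omega)).flip
      (rightExt α κ χ' N' q γ)) _ _).trans (congrArg (fun z => (-1 : ℤ) ^ p • z) ?_)
    exact Ext.comp_assoc _ _ _ (add_comm 1 p) (add_comm p q) (by omega)

end Commutation

/-! ## Exactness of precomposition -/

section PrecompExact

universe v w

variable {k : Type u} [Field k] {C : Type v} [Category.{w} C] [Abelian C] [Linear k C]
  [HasExt.{w} C] {S : ShortComplex C} (hS : S.ShortExact) (Z : C) (n : ℕ)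

include hS

lemma extPrecomp_exact₂ : Function.Exact (extPrecomp (k := k) (Ext.mk₀ S.g) Z (zero_add n))
    (extPrecomp (k := k) (Ext.mk₀ S.f) Z (zero_add n)) := by
  refine fun y => ⟨fun h => Ext.contravariant_sequence_exact₂ hS Z y h, ?_⟩
  rintro ⟨y, rfl⟩
  rw [extPrecomp_apply, extPrecomp_apply,
    ← Ext.comp_assoc _ _ _ (zero_add 0) (zero_add n) (by omega), Ext.mk₀_comp_mk₀, S.zero,
    Ext.mk₀_zero, Ext.zero_comp]

lemma extPrecomp_exact₁ : Function.Exact (extPrecomp (k := k) (Ext.mk₀ S.f) Z (zero_add n))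
    (extPrecomp (k := k) hS.extClass Z (add_comm 1 n)) := by
  refine fun y => ⟨fun h => Ext.contravariant_sequence_exact₁ hS Z y (add_comm 1 n) h, ?_⟩
  rintro ⟨y, rfl⟩
  rw [extPrecomp_apply, extPrecomp_apply,
    ← Ext.comp_assoc _ _ _ (add_zero 1) (zero_add n) (by omega), hS.extClass_comp, Ext.zero_comp]

lemma extPrecomp_exact₃ : Function.Exact (extPrecomp (k := k) hS.extClass Z (add_comm 1 n))
    (extPrecomp (k := k) (Ext.mk₀ S.g) Z (zero_add (n + 1))) := by
  refine fun y => ⟨fun h => Ext.contravariant_sequence_exact₃ hS Z y h (add_comm 1 n), ?_⟩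
  rintro ⟨y, rfl⟩
  rw [extPrecomp_apply, extPrecomp_apply,
    ← Ext.comp_assoc _ _ _ (zero_add 1) (add_comm 1 n) (by omega), hS.comp_extClass, Ext.zero_comp]

lemma extPrecomp_injective :
    Function.Injective (extPrecomp (k := k) (Ext.mk₀ S.g) Z (zero_add 0)) :=
  have := hS.epi_g
  Ext.precomp_mk₀_injective_of_epi Z S.g

end PrecompExact

/-! ## The comparison map -/

section SmashExt

open Limits HopfAlgebra
open scoped ModuleCat

variable {k : Type u} [Field k] {H A B : Type u} [Ring H] [HopfAlgebra k H] [Ring A] [Algebra k A]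
  [Ring B] [Algebra k B] (α : ModuleAlgebra k H A) {β : ComoduleAlgebra k H B}
  {X X' : ModuleCat.{u} Bᵐᵒᵖ} (χ : HopfModule β X) (χ' : HopfModule β X')
  (N N' : ModuleCat.{u} Aᵐᵒᵖ) (M : ModuleCat.{u} (SmashHopf α)ᵐᵒᵖ)

/-- The map `(x, γ) ↦ (x # X) (M # γ)`. -/
noncomputable def smashExt {p q l : ℕ} (e : p + q = l) :
    Ext N ((smashRes α).obj M) p →ₗ[k] Ext X X' q →ₗ[k]
      Ext ((smashFunctor α χ).obj N) ((smashFunctor α χ').obj ((smashRes α).obj M)) l :=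
  (Ext.bilinearCompOfLinear k _ _ _ p q l e).compl₁₂
    (Functor.mapExtLinearMap (smashFunctor α χ) k _ _ p) (rightExt α χ χ' M q)

variable {N N' M}

lemma smashExt_apply {p q l : ℕ} (e : p + q = l) (x : Ext N ((smashRes α).obj M) p)
    (γ : Ext X X' q) : smashExt α χ χ' N M e x γ =
      (x.mapExactFunctor (smashFunctor α χ)).comp (rightExt α χ χ' M q γ) e := rfl

lemma smashExt_comp_left {p q l r s t : ℕ} (e : p + q = l) (y : Ext N N' r)
    (x : Ext N' ((smashRes α).obj M) p) (γ : Ext X X' q) (e' : r + p = s) (e'' : s + q = t) :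
    smashExt α χ χ' N M e'' (y.comp x e') γ =
      (y.mapExactFunctor (smashFunctor α χ)).comp (smashExt α χ χ' N' M e x γ) (by omega) := by
  rw [smashExt_apply, smashExt_apply, Ext.mapExactFunctor_comp,
    Ext.comp_assoc _ _ _ e' e (by omega)]

variable {X'' : ModuleCat.{u} Bᵐᵒᵖ} (χ'' : HopfModule β X'')

/-- For a colinear map the twists on the two sides cancel, and M # f is simply id ⊗ f. -/
lemma rightHom_eq_smashNatTrans (f : X ⟶ X')
    (hf : ∀ x, χ'.coact (f x) = (f.hom.restrictScalars k).lTensor H (χ.coact x)) :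
    rightHom α χ χ' M f = (smashNatTrans α f.hom hf).app ((smashRes α).obj M) := by
  rw [rightHom, ← Category.assoc, Iso.comp_inv_eq, untwistIso_naturality_right α χ χ' M f hf]

lemma smashExt_mk₀_comp (f : X'' ⟶ X)
    (hf : ∀ x, χ.coact (f x) = (f.hom.restrictScalars k).lTensor H (χ''.coact x)) {p q l : ℕ}
    (e : p + q = l) (x : Ext N ((smashRes α).obj M) p) (γ : Ext X X' q) :
    smashExt α χ'' χ' N M e x ((Ext.mk₀ f).comp γ (zero_add q)) =
      (Ext.mk₀ ((smashNatTrans α f.hom hf).app N)).comp (smashExt α χ χ' N M e x γ)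
        (zero_add l) := by
  rw [smashExt_apply, rightExt_comp α χ'' χ χ', rightExt_mk₀,
    rightHom_eq_smashNatTrans α χ'' χ f hf, ← Ext.comp_assoc_of_second_deg_zero,
    mapExactFunctor_comp_natTrans, smashExt_apply, Ext.comp_assoc _ _ _ (zero_add p) e (by omega)]

/-- Since x has degree zero here, no sign appears when the connecting class moves across it. This
case suffices for comparing sequences in X over a projective N. -/
lemma smashExt_extClass_comp {S : ShortComplex (ModuleCat.{u} Bᵐᵒᵖ)} (hSe : S.ShortExact)
    (κ : HopfModule β S.X₁) (θ : HopfModule β S.X₂) (χ : HopfModule β S.X₃)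
    (hi : ∀ y, θ.coact (S.f y) = (S.f.hom.restrictScalars k).lTensor H (κ.coact y))
    (hp : ∀ y, χ.coact (S.g y) = (S.g.hom.restrictScalars k).lTensor H (θ.coact y)) {q : ℕ}
    (x : Ext N ((smashRes α).obj M) 0) (γ : Ext S.X₁ X' q) :
    smashExt α χ χ' N M (zero_add (q + 1)) x (hSe.extClass.comp γ (add_comm 1 q)) =
      (smash_shortExact α hSe κ θ χ hi hp N).extClass.comp
        (smashExt α κ χ' N M (zero_add q) x γ) (add_comm 1 q) := by
  have h₁ := mapExactFunctor_comp_extClass (smashFunctor α κ) (smashFunctor α θ)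
    (smashFunctor α χ) (smashNatTrans α S.f.hom hi) (smashNatTrans α S.g.hom hp)
    (smashNatTrans_comp_zero α hi hp) (smash_shortExact α hSe κ θ χ hi hp) x
  rw [← rightExt_extClass α hSe κ θ χ hi hp M, pow_zero, one_smul] at h₁
  rw [smashExt_apply, smashExt_apply, rightExt_comp α χ κ χ']
  refine (Ext.comp_assoc _ _ _ (zero_add 1) (add_comm 1 q) (by omega)).symm.trans ?_
  refine (congrArg (fun z => Ext.comp z (rightExt α κ χ' M q γ) (add_comm 1 q)) h₁).trans ?_
  exact Ext.comp_assoc_of_second_deg_zero _ _ _ _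

end SmashExt

/-! ## The comparison map in degree zero -/

section CoactTwist

open HopfAlgebra

variable {k H A : Type*} [CommRing k] [Ring H] [HopfAlgebra k H] [Ring A] [Algebra k A]
  (α : ModuleAlgebra k H A) (N : Type*) [AddCommGroup N] [Module k N]
  [Module (SmashHopf α)ᵐᵒᵖ N] [IsScalarTower k (SmashHopf α)ᵐᵒᵖ N]

/-- For a comodule `Γ`, the map `n ⊗ γ ↦ ∑ n S(γ₋₁) ⊗ γ₀` is bijective. -/
lemma exists_retwist_equiv {Γ : Type*} [AddCommGroup Γ] [Module k Γ] (ρ : Γ →ₗ[k] H ⊗[k] Γ)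
    (h₁ : ∀ γ, TensorProduct.assoc k H H Γ
      ((Coalgebra.comul (R := k) (A := H)).rTensor Γ (ρ γ)) = ρ.lTensor H (ρ γ))
    (h₂ : ∀ γ, TensorProduct.lid k Γ
      ((Coalgebra.counit (R := k) (A := H)).rTensor Γ (ρ γ)) = γ) :
    ∃ D : N ⊗[k] Γ ≃ₗ[k] N ⊗[k] Γ, ∀ n γ, D (n ⊗ₜ γ) =
      ((hopfRight α N ∘ₗ antipode k).flip n).rTensor Γ (ρ γ) := by
  -- A comodule is a Hopf module over k with the trivial coaction, so the untwisting of Hopf modules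
  -- applies to it.
  let _ : Module kᵐᵒᵖ Γ := Module.compHom Γ (RingEquiv.toOpposite k).symm.toRingHom
  let β : ComoduleAlgebra k H k :=
    { coact := Algebra.ofId k (H ⊗[k] k)
      coassoc := fun b => by
        simp [Algebra.ofId_apply, Algebra.algebraMap_eq_smul_one, Algebra.TensorProduct.one_def]
      counit := fun b => by
        simp [Algebra.ofId_apply, Algebra.algebraMap_eq_smul_one, Algebra.TensorProduct.one_def] }
  have hs (r : k) (γ : Γ) : op r • γ = r • γ := rfl
  have : IsScalarTower k kᵐᵒᵖ Γ := ⟨fun r s γ => by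
    obtain ⟨s, rfl⟩ := op_surjective s
    rw [← MulOpposite.op_smul, hs, hs, smul_assoc]⟩
  let χ : HopfModule β Γ :=
    { coact := ρ
      coassoc := h₁
      counit := h₂
      coact_smul := fun γ r => by
        rw [hs, map_smul]
        generalize ρ γ = z
        induction z using TensorProduct.induction_on with
        | zero => simp
        | add x y hx hy => simp only [map_add, LinearMap.add_apply, smul_add, hx, hy]
        | tmul h γ =>
          simp [β, Algebra.ofId_apply, Algebra.algebraMap_eq_smul_one,
            Algebra.TensorProduct.one_def, rightAction_apply] }
  exact ⟨LinearEquiv.ofLinearMap (retwist α χ) (untwist α χ)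
    (LinearMap.ext (retwist_untwist α χ)) (LinearMap.ext (untwist_retwist α χ)),
    fun n γ => χ.twist_tmul _ n γ⟩

end CoactTwist

/-! ### Degree zero, for a free A-module of rank one. -/

section SmashExtZero

open Limits HopfAlgebra
open scoped ModuleCat

variable {k : Type u} [Field k] {H A B : Type u} [Ring H] [HopfAlgebra k H] [Ring A] [Algebra k A]
  [Ring B] [Algebra k B]

lemma extEval_bijective {N N' : ModuleCat.{u} Aᵐᵒᵖ} (e : A ≃ₗ[k] N)
    (he : ∀ a, e a = op a • e 1) : Function.Bijective (extEval (k := k) (X := N) N' (e 1)) := by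
  have hl (f g : N ⟶ N') (h : f (e 1) = g (e 1)) : f = g := by
    refine ModuleCat.hom_ext (LinearMap.ext fun n => ?_)
    obtain ⟨a, rfl⟩ := e.surjective n
    rw [he]
    exact (f.hom.map_smul _ _).trans ((congrArg (fun n' : N' => op a • n') h).trans
      (g.hom.map_smul _ _).symm)
  refine ⟨fun x y h => ?_, fun n' => ?_⟩
  · obtain ⟨f, rfl⟩ := (Ext.mk₀_bijective _ _).2 x
    obtain ⟨g, rfl⟩ := (Ext.mk₀_bijective _ _).2 y
    rw [extEval_mk₀, extEval_mk₀] at h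
    rw [hl f g h]
  · have he' (a a' : A) : e (a * a') = op a' • e a := by
      rw [he, he a, smul_smul, ← op_mul]
    let f : N →ₗ[Aᵐᵒᵖ] N' :=
      { toFun := fun n => op (e.symm n) • n'
        map_add' := fun x y => by rw [map_add, MulOpposite.op_add, add_smul]
        map_smul' := fun a n => by
          obtain ⟨a, rfl⟩ := op_surjective a
          obtain ⟨a', rfl⟩ := e.surjective n
          rw [← he', e.symm_apply_apply, e.symm_apply_apply, op_mul, mul_smul, RingHom.id_apply] }
    refine ⟨Ext.mk₀ (ModuleCat.ofHom f), (extEval_mk₀ _ _).trans ?_⟩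
    change op (e.symm (e 1)) • n' = n'
    rw [e.symm_apply_apply, op_one, one_smul]

variable (α : ModuleAlgebra k H A) {β : ComoduleAlgebra k H B}
  (hS : Function.Bijective (antipode k (A := H)))
  {X X' : ModuleCat.{u} Bᵐᵒᵖ} (χ : HopfModule β X) (χ' : HopfModule β X')
  (N : ModuleCat.{u} Aᵐᵒᵖ) (M : ModuleCat.{u} (SmashHopf α)ᵐᵒᵖ)

/-- The map `x ⊗ γ ↦ (x # X) (M # γ)`. -/
noncomputable def smashExtTensor {p q l : ℕ} (e : p + q = l) :
    Ext N ((smashRes α).obj M) p ⊗[k] Ext X X' q →ₗ[k]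
      Ext ((smashFunctor α χ).obj N) ((smashFunctor α χ').obj ((smashRes α).obj M)) l :=
  TensorProduct.lift (smashExt α χ χ' N M e)

lemma smashExtTensor_tmul {p q l : ℕ} (e : p + q = l) (x : Ext N ((smashRes α).obj M) p)
    (γ : Ext X X' q) : smashExtTensor α χ χ' N M e (x ⊗ₜ γ) = smashExt α χ χ' N M e x γ := rfl

/-- On n # x, the product of f and g is f(n) twisted against the coaction of g. So evaluation
factors through the twist D on M ⊗ Hom(X, X'), which is bijective. -/
lemma extEval_smashExtTensor (hX : X.IsFPInfinity)
    (D : (smashRes α).obj M ⊗[k] Ext X X' 0 ≃ₗ[k] (smashRes α).obj M ⊗[k] Ext X X' 0)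
    (hD : ∀ m γ, D (m ⊗ₜ γ) = ((hopfRight α ((smashRes α).obj M) ∘ₗ antipode k).flip m).rTensor _
      (extCoact hS χ χ' hX 0 γ)) (n : N) (x : X)
    (z : Ext N ((smashRes α).obj M) 0 ⊗[k] Ext X X' 0) :
    extEval (k := k) ((smashFunctor α χ').obj ((smashRes α).obj M)) (SmashModule.tmul α χ n x)
      (smashExtTensor α χ χ' N M (zero_add 0) z) =
      (extEval (k := k) X' x).lTensor ((smashRes α).obj M)
        (D ((extEval (k := k) ((smashRes α).obj M) n).rTensor _ z)) := by
  induction z using TensorProduct.induction_on with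
  | zero => simp; rfl
  | add y z hy hz => 
    simp only [map_add]
    exact (congrArg₂ (· + ·) hy hz)
  | tmul f γ =>
    obtain ⟨f, rfl⟩ := (Ext.mk₀_bijective _ _).2 f
    obtain ⟨g, rfl⟩ := (Ext.mk₀_bijective _ _).2 γ
    rw [LinearMap.rTensor_tmul, hD, ← rTensor_lTensor_apply, extEval_extCoact,
      smashExtTensor_tmul, smashExt_apply, rightExt_mk₀, Ext.mapExactFunctor_mk₀,
      Ext.mk₀_comp_mk₀, extEval_mk₀]
    exact (extEval_mk₀ (X := (smashFunctor α χ).obj N) (SmashModule.tmul α χ n x) _).trans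
      (rightHom_tmul α χ χ' hS M g (f n) x)

lemma smashModuleA_one {N Y : Type u} [AddCommGroup N] [Module k N] [Module Aᵐᵒᵖ N]
    [IsScalarTower k Aᵐᵒᵖ N] [AddCommGroup Y] [Module k Y] [Module Bᵐᵒᵖ Y]
    [IsScalarTower k Bᵐᵒᵖ Y] (χ : HopfModule β Y) (z : N ⊗[k] Y) :
    smashModuleA α N χ 1 z = z := by
  have h := smashModuleAct_one α N χ z
  have h₁ : (rightAction k B Y).flip 1 = LinearMap.id := by
    ext y; simp [rightAction_apply]
  rwa [smashModuleAct_tmul, LinearMap.comp_apply, h₁, LinearMap.lTensor_id,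
    LinearMap.id_apply] at h

lemma SmashModule.one_smul {N Y : Type u} [AddCommGroup N] [Module k N] [Module Aᵐᵒᵖ N]
    [IsScalarTower k Aᵐᵒᵖ N] [AddCommGroup Y] [Module k Y] [Module Bᵐᵒᵖ Y]
    [IsScalarTower k Bᵐᵒᵖ Y] (χ : HopfModule β Y) (z : SmashModule α N χ) (b : B) :
    op (SmashProduct.tmul α β 1 b) • z = ((rightAction k B Y).flip b).lTensor N z :=
  (smashModuleAct_smashTmul α χ N 1 b z).trans
    (congrArg (((rightAction k B Y).flip b).lTensor N) (smashModuleA_one α χ z))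

-- The map is a composite of bijections: Hom_A(N, M) = M by evaluation at the basis element, the
-- twist D, M ⊗ Hom_B(X, X') = Hom_B(X, M ⊗ X') for X finitely generated, and the universal property
-- of N # X.
include hS in
variable {N} in
lemma smashExtTensor_bijective_zero (e : A ≃ₗ[k] N) (he : ∀ a, e a = op a • e 1)
    [Module.Finite Bᵐᵒᵖ X] [Module.Projective Bᵐᵒᵖ X] :
    Function.Bijective (smashExtTensor α χ χ' N M (zero_add 0)) := by
  have hX := X.isFPInfinity_of_projective
  obtain ⟨D, hD⟩ := exists_retwist_equiv α ((smashRes α).obj M) (extCoact hS χ χ' hX 0)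
    (extCoact_coassoc hS χ χ' hX 0) (extCoact_counit hS χ χ' hX)
  let E := LinearEquiv.ofBijective _ (extEval_bijective (N' := (smashRes α).obj M) e he)
  have key := extEval_smashExtTensor α hS χ χ' N M hX D hD (e 1)
  refine ⟨(injective_iff_map_eq_zero _).2 fun z hz => ?_, fun y => ?_⟩
  · have h₁ : D ((LinearEquiv.rTensor (Ext X X' 0) E) z) = 0 := by
      refine extEval_lTensor_ext fun x => (key x z).symm.trans ?_
      rw [hz, map_zero, map_zero]
      rfl
    exact (LinearEquiv.map_eq_zero_iff _).1 ((LinearEquiv.map_eq_zero_iff _).1 h₁)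
  · obtain ⟨F, rfl⟩ := (Ext.mk₀_bijective _ _).2 y
    let φ : X →ₗ[k] (smashRes α).obj M ⊗[k] X' :=
      { toFun := fun x => F (SmashModule.tmul α χ (e 1) x)
        map_add' := fun x y => (congrArg F (TensorProduct.tmul_add _ _ _)).trans
          (F.hom.map_add _ _)
        map_smul' := fun r x => (congrArg F ((TensorProduct.tmul_smul r _ _).trans
          (algebraMap_smul (SmashProduct α β)ᵐᵒᵖ r (SmashModule.tmul α χ (e 1) x)).symm)).trans
            ((F.hom.map_smul _ _).trans (algebraMap_smul (SmashProduct α β)ᵐᵒᵖ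
              (M := SmashModule α ((smashRes α).obj M) χ') r _)) }
    obtain ⟨w, hw⟩ := exists_tensorHom_eq φ fun x b => by
      refine (congrArg F (SmashModule.one_smul_tmul α χ (e 1) x b).symm).trans ?_
      exact (F.hom.map_smul _ _).trans (SmashModule.one_smul α χ' _ b)
    refine ⟨(LinearEquiv.rTensor (Ext X X' 0) E).symm (D.symm
      ((Ext.linearEquiv₀ (R := k)).symm.toLinearMap.lTensor _ w)), ?_⟩
    obtain ⟨G, hG⟩ := (Ext.mk₀_bijective _ _).2 (smashExtTensor α χ χ' N M (zero_add 0)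
      ((LinearEquiv.rTensor (Ext X X' 0) E).symm (D.symm
        ((Ext.linearEquiv₀ (R := k)).symm.toLinearMap.lTensor _ w))))
    rw [← hG]
    refine congrArg Ext.mk₀ (ModuleCat.hom_ext (smashModule_hom_ext α χ hS e he fun x => ?_))
    refine (extEval_mk₀ (k := k) (X := (smashFunctor α χ).obj N)
      (SmashModule.tmul α χ (e 1) x) G).symm.trans ?_
    rw [hG]
    refine (key x _).trans ?_
    refine Eq.trans ?_ (LinearMap.congr_fun hw x)
    have h₁ (w) : tensorHom k ((smashRes α).obj M) X X' w x =
        (extEval (k := k) X' x).lTensor ((smashRes α).obj M)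
          ((Ext.linearEquiv₀ (R := k)).symm.toLinearMap.lTensor _ w) := by
      induction w using TensorProduct.induction_on with
      | zero => simp
      | add y z hy hz => simp only [map_add, LinearMap.add_apply, hy, hz]
      | tmul m g => exact congrArg (m ⊗ₜ[k] ·) (extEval_mk₀ x g).symm
    rw [h₁]
    refine congrArg ((extEval (k := k) X' x).lTensor ((smashRes α).obj M)) ?_
    exact (congrArg D ((LinearEquiv.rTensor (Ext X X' 0) E).apply_symm_apply _)).trans
      (D.apply_symm_apply _)

end SmashExtZero

/-! ### From free to finitely generated projective A-modules. -/

/-! ## The comparison map on projective modules -/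

section SmashExtProjective

open Limits HopfAlgebra
open scoped ModuleCat

variable {k : Type u} [Field k] {H A B : Type u} [Ring H] [HopfAlgebra k H] [Ring A] [Algebra k A]
  [Ring B] [Algebra k B] (α : ModuleAlgebra k H A) {β : ComoduleAlgebra k H B}
  (hS : Function.Bijective (antipode k (A := H)))
  {X X' : ModuleCat.{u} Bᵐᵒᵖ} (χ : HopfModule β X) (χ' : HopfModule β X')
  {N N' : ModuleCat.{u} Aᵐᵒᵖ} (M : ModuleCat.{u} (SmashHopf α)ᵐᵒᵖ)

lemma smashExtTensor_precomp_left {p q l r s t : ℕ} (e : p + q = l) (y : Ext N N' r)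
    (e' : r + p = s) (e'' : s + q = t) (e₃ : r + l = t)
    (z : Ext N' ((smashRes α).obj M) p ⊗[k] Ext X X' q) :
    smashExtTensor α χ χ' N M e'' ((extPrecomp y _ e').rTensor _ z) =
      (y.mapExactFunctor (smashFunctor α χ)).comp (smashExtTensor α χ χ' N' M e z) e₃ := by
  induction z using TensorProduct.induction_on with
  | zero => simp
  | add y z hy hz => simp only [map_add, Ext.comp_add, hy, hz]
  | tmul x γ => exact smashExt_comp_left α χ χ' e y x γ e' e''

lemma smashExtTensor_precomp_mk₀ {X'' : ModuleCat.{u} Bᵐᵒᵖ} (χ'' : HopfModule β X'') (f : X'' ⟶ X)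
    (hf : ∀ x, χ.coact (f x) = (f.hom.restrictScalars k).lTensor H (χ''.coact x)) {p q l : ℕ}
    (e : p + q = l) (z : Ext N ((smashRes α).obj M) p ⊗[k] Ext X X' q) :
    smashExtTensor α χ'' χ' N M e ((extPrecomp (Ext.mk₀ f) X' (zero_add q)).lTensor _ z) =
      (Ext.mk₀ ((smashNatTrans α f.hom hf).app N)).comp (smashExtTensor α χ χ' N M e z)
        (zero_add l) := by
  induction z using TensorProduct.induction_on with
  | zero => simp
  | add y z hy hz => simp only [map_add, Ext.comp_add, hy, hz]
  | tmul x γ => exact smashExt_mk₀_comp α χ χ' χ'' f hf e x γ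

lemma smashExtTensor_precomp_extClass {S : ShortComplex (ModuleCat.{u} Bᵐᵒᵖ)} (hSe : S.ShortExact)
    (κ : HopfModule β S.X₁) (θ : HopfModule β S.X₂) (χ : HopfModule β S.X₃)
    (hi : ∀ y, θ.coact (S.f y) = (S.f.hom.restrictScalars k).lTensor H (κ.coact y))
    (hp : ∀ y, χ.coact (S.g y) = (S.g.hom.restrictScalars k).lTensor H (θ.coact y)) {q : ℕ}
    (z : Ext N ((smashRes α).obj M) 0 ⊗[k] Ext S.X₁ X' q) :
    smashExtTensor α χ χ' N M (zero_add (q + 1))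
        ((extPrecomp hSe.extClass X' (add_comm 1 q)).lTensor _ z) =
      (smash_shortExact α hSe κ θ χ hi hp N).extClass.comp
        (smashExtTensor α κ χ' N M (zero_add q) z) (add_comm 1 q) := by
  induction z using TensorProduct.induction_on with
  | zero => simp
  | add y z hy hz => simp only [map_add, Ext.comp_add, hy, hz]
  | tmul x γ => exact smashExt_extClass_comp α χ' hSe κ θ χ hi hp x γ

lemma Ext.subsingleton_of_projective {C : Type*} [Category C] [Abelian C] [HasExt.{u} C]
    (P Y : C) [Projective P] (n : ℕ) : Subsingleton (Ext P Y (n + 1)) :=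
  ⟨fun x y => x.eq_zero_of_projective.trans y.eq_zero_of_projective.symm⟩

-- Both sides are cohomological in the Hopf module X. Covers by finitely generated projective Hopf
-- modules Q reduce to degree zero, as Q and N # Q are projective and both sides vanish on them in
-- positive degrees.
include hS in
lemma smashExtTensor_bijective_of_free (e : A ≃ₗ[k] N) (he : ∀ a, e a = op a • e 1)
    (hX : X.IsFPInfinity) (n : ℕ) :
    Function.Bijective (smashExtTensor α χ χ' N M (zero_add n)) := by
  refine bijective_of_coverings (O := Σ X : {X : ModuleCat.{u} Bᵐᵒᵖ // X.IsFPInfinity},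
      HopfModule β X.1)
    (T := fun n X => Ext N ((smashRes α).obj M) 0 ⊗[k] Ext X.1.1 X' n)
    (T' := fun n X => Ext ((smashFunctor α X.2).obj N)
      ((smashFunctor α χ').obj ((smashRes α).obj M)) n)
    (fun n X => (smashExtTensor α X.2 χ' N M (zero_add n)).toAddMonoidHom) ?_ n ⟨⟨X, hX⟩, χ⟩
  rintro ⟨⟨X, hX⟩, χ⟩
  have := hX.finite
  obtain ⟨K, Q, κ, θ, i, p, w, hSe, hQf, hQp, hi, hp⟩ := ModuleCat.exists_hopf_cover χ
  have hK : K.IsFPInfinity := hX.of_exact i.hom p.hom hSe.moduleCat_injective_f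
    (ModuleCat.exact_of_shortExact hSe) hSe.moduleCat_surjective_g
  have hSe' := smash_shortExact α hSe κ θ χ hi hp N
  let V := Ext N ((smashRes α).obj M) 0
  let Z := (smashFunctor α χ').obj ((smashRes α).obj M)
  refine ⟨⟨⟨Q, Q.isFPInfinity_of_projective⟩, θ⟩, ⟨⟨K, hK⟩, κ⟩,
    fun n => ((extPrecomp (Ext.mk₀ p) X' (zero_add n)).lTensor V).toAddMonoidHom,
    fun n => ((extPrecomp (Ext.mk₀ i) X' (zero_add n)).lTensor V).toAddMonoidHom,
    fun n => ((extPrecomp hSe.extClass X' (add_comm 1 n)).lTensor V).toAddMonoidHom,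
    fun n => (extPrecomp (k := k) (Ext.mk₀ ((smashNatTrans α p.hom hp).app N)) Z
      (zero_add n)).toAddMonoidHom,
    fun n => (extPrecomp (k := k) (Ext.mk₀ ((smashNatTrans α i.hom hi).app N)) Z
      (zero_add n)).toAddMonoidHom,
    fun n => (extPrecomp (k := k) hSe'.extClass Z (add_comm 1 n)).toAddMonoidHom,
    Module.Flat.lTensor_preserves_injective_linearMap _ (extPrecomp_injective hSe X'),
    extPrecomp_injective (k := k) hSe' Z,
    fun n => Module.Flat.lTensor_exact V (extPrecomp_exact₂ hSe X' n), extPrecomp_exact₂ (k := k)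
      hSe' Z,
    fun n => Module.Flat.lTensor_exact V (extPrecomp_exact₁ hSe X' n), extPrecomp_exact₁ (k := k)
      hSe' Z,
    fun n => Module.Flat.lTensor_exact V (extPrecomp_exact₃ hSe X' n), extPrecomp_exact₃ (k := k)
      hSe' Z,
    fun n => smashExtTensor_precomp_mk₀ α χ χ' M θ p hp (zero_add n),
    fun n => smashExtTensor_precomp_mk₀ α θ χ' M κ i hi (zero_add n),
    fun n => smashExtTensor_precomp_extClass α χ' M hSe κ θ χ hi hp, fun n => ?_⟩
  obtain _ | n := n
  · exact smashExtTensor_bijective_zero α hS θ χ' M e he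
  · have : Projective ((smashFunctor α θ).obj N) :=
      have : Module.Projective (SmashProduct α β)ᵐᵒᵖ ((smashFunctor α θ).obj N) :=
        projective_smashModule α θ hS e he
      ModuleCat.projective_of_categoryTheory_projective _
    have : Projective Q := Q.projective_of_categoryTheory_projective
    have := Ext.subsingleton_of_projective ((smashFunctor α θ).obj N) Z n
    have := Ext.subsingleton_of_projective Q X' n
    exact ⟨fun x y _ => Subsingleton.elim x y,
      fun y => ⟨0, Subsingleton.elim (α := Ext ((smashFunctor α θ).obj N) Z (n + 1)) _ _⟩⟩

lemma Ext.eq_sum_mk₀_comp {C : Type*} [Category C] [Abelian C] [HasExt.{u} C] {P Q Y : C} {n : ℕ}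
    (π ι : Fin n → _) (h : ∑ i, π i ≫ ι i = 𝟙 P) {q : ℕ} (y : Ext P Y q) :
    y = ∑ i, (Ext.mk₀ (π i : P ⟶ Q)).comp ((Ext.mk₀ (ι i : Q ⟶ P)).comp y (zero_add q))
      (zero_add q) := by
  conv_lhs => rw [← Ext.mk₀_id_comp y, ← h, Ext.mk₀_sum, Ext.sum_comp]
  exact Finset.sum_congr rfl fun i _ => (Ext.mk₀_comp_mk₀_assoc _ _ _).symm

lemma exists_linearEquiv_of_opEquiv (i : Aᵐᵒᵖ ≃ₗ[Aᵐᵒᵖ] N) :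
    ∃ e : A ≃ₗ[k] N, ∀ a, e a = op a • e 1 := by
  refine ⟨{ toFun := fun a => i (op a)
            invFun := fun n => unop (i.symm n)
            left_inv := fun a => congrArg unop (i.symm_apply_apply (op a))
            right_inv := i.apply_symm_apply
            map_add' := fun a a' => i.map_add (op a) (op a')
            map_smul' := fun r a => ?_ }, fun a => ?_⟩
  · refine .trans (congrArg i (Algebra.smul_def r (op a))) ?_
    exact (i.map_smul _ _).trans (algebraMap_smul Aᵐᵒᵖ r (i (op a)))
  · exact (congrArg i (mul_one (op a)).symm).trans (i.map_smul _ _)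

-- A finite dual basis writes the identity of N as a sum of maps through A, and naturality of the
-- comparison in N transfers bijectivity from A to N.
include hS in
lemma smashExtTensor_bijective_of_projective [Module.Finite Aᵐᵒᵖ N] [Module.Projective Aᵐᵒᵖ N]
    (hX : X.IsFPInfinity) (q : ℕ) :
    Function.Bijective (smashExtTensor α χ χ' N M (zero_add q)) := by
  let A₀ := ModuleCat.of Aᵐᵒᵖ Aᵐᵒᵖ
  obtain ⟨e, he⟩ := exists_linearEquiv_of_opEquiv (k := k) (N := A₀) (LinearEquiv.refl Aᵐᵒᵖ Aᵐᵒᵖ)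
  have hb := smashExtTensor_bijective_of_free (N := A₀) α hS χ χ' M e he hX q
  obtain ⟨n, π, ι, h⟩ : ∃ (n : ℕ) (π : Fin n → (N ⟶ A₀)) (ι : Fin n → (A₀ ⟶ N)),
      ∑ i, π i ≫ ι i = 𝟙 N := by
    obtain ⟨n, f, hf⟩ := Module.Finite.exists_fin' Aᵐᵒᵖ N
    obtain ⟨s, hs⟩ := Module.projective_lifting_property f LinearMap.id hf
    refine ⟨n, fun i => ModuleCat.ofHom (LinearMap.proj i ∘ₗ s),
      fun i => ModuleCat.ofHom (f ∘ₗ LinearMap.single Aᵐᵒᵖ (fun _ => Aᵐᵒᵖ) i), ?_⟩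
    refine ModuleCat.hom_ext (LinearMap.ext fun x => ?_)
    let ev : (N ⟶ N) →+ N := { toFun f := f x, map_zero' := rfl, map_add' _ _ := rfl }
    refine (map_sum ev _ _).trans ?_
    refine Eq.trans ?_ (LinearMap.congr_fun hs x)
    refine .trans (map_sum f (fun i => LinearMap.single Aᵐᵒᵖ (fun _ : Fin n => Aᵐᵒᵖ) i (s x i))
      Finset.univ).symm ?_
    exact congrArg f (Finset.univ_sum_single (s x))
  have key (f : N ⟶ A₀) (z) := smashExtTensor_precomp_left α χ χ' M (zero_add q) (Ext.mk₀ f)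
    (zero_add 0) (zero_add q) (zero_add q) z
  have key' (f : A₀ ⟶ N) (z) := smashExtTensor_precomp_left α χ χ' M (zero_add q) (Ext.mk₀ f)
    (zero_add 0) (zero_add q) (zero_add q) z
  have h' : ∑ i, (smashFunctor α χ).map (π i) ≫ (smashFunctor α χ).map (ι i) =
      𝟙 ((smashFunctor α χ).obj N) := by
    simp only [← Functor.map_comp]
    rw [← Functor.map_sum, h, CategoryTheory.Functor.map_id]
  refine ⟨(injective_iff_map_eq_zero _).2 fun z hz => ?_, fun y => ?_⟩
  · have hz' (i) : (extPrecomp (Ext.mk₀ (ι i)) _ (zero_add 0)).rTensor _ z = 0 := by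
      refine (injective_iff_map_eq_zero _).1 hb.1 _ ((key' (ι i) z).trans ?_)
      rw [hz, Ext.comp_zero]
    have hs : ∑ i, (extPrecomp (k := k) (Ext.mk₀ (π i)) ((smashRes α).obj M) (zero_add 0)) ∘ₗ
        (extPrecomp (Ext.mk₀ (ι i)) _ (zero_add 0)) = LinearMap.id := by
      refine LinearMap.ext fun x => ?_
      rw [LinearMap.sum_apply]
      exact (Ext.eq_sum_mk₀_comp π ι h x).symm
    rw [← LinearMap.id_apply (R := k) z, ← LinearMap.rTensor_id, ← hs, ← LinearMap.coe_rTensorHom,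
      map_sum, LinearMap.sum_apply]
    refine Finset.sum_eq_zero fun i _ => ?_
    rw [LinearMap.coe_rTensorHom, LinearMap.rTensor_comp, LinearMap.comp_apply, hz', map_zero]
  · choose z hz using fun i => hb.2
      ((Ext.mk₀ ((smashFunctor α χ).map (ι i))).comp y (zero_add q))
    refine ⟨∑ i, (extPrecomp (Ext.mk₀ (π i)) _ (zero_add 0)).rTensor _ (z i), ?_⟩
    rw [map_sum]
    refine Eq.trans (Finset.sum_congr rfl fun i _ => ?_) (Ext.eq_sum_mk₀_comp _ _ h' y).symm
    rw [key, hz, Ext.mapExactFunctor_mk₀]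

end SmashExtProjective

/-! ## The comparison map is bijective -/

section SmashExtBijective

open Limits HopfAlgebra
open scoped ModuleCat

variable {k : Type u} [Field k] {H A B : Type u} [Ring H] [HopfAlgebra k H] [Ring A] [Algebra k A]
  [Ring B] [Algebra k B] (α : ModuleAlgebra k H A) {β : ComoduleAlgebra k H B}
  (hS : Function.Bijective (antipode k (A := H)))
  {X X' : ModuleCat.{u} Bᵐᵒᵖ} (χ : HopfModule β X) (χ' : HopfModule β X')
  (N N' N'' : ModuleCat.{u} Aᵐᵒᵖ) (M : ModuleCat.{u} (SmashHopf α)ᵐᵒᵖ) (n : ℕ)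

/-- The map `(p, q) ↦ (p + 1, q)`. -/
def antidiagonalShift {n : ℕ} (t : {t : ℕ × ℕ // t ∈ Finset.HasAntidiagonal.antidiagonal n}) :
    {t : ℕ × ℕ // t ∈ Finset.HasAntidiagonal.antidiagonal (n + 1)} :=
  ⟨(t.1.1 + 1, t.1.2), by
    have := Finset.HasAntidiagonal.mem_antidiagonal.1 t.2
    rw [Finset.HasAntidiagonal.mem_antidiagonal]
    omega⟩

lemma mem_antidiagonal_of_succ {n p q : ℕ}
    (h : (p + 1, q) ∈ Finset.HasAntidiagonal.antidiagonal (n + 1)) :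
    (p, q) ∈ Finset.HasAntidiagonal.antidiagonal n := by
  rw [Finset.HasAntidiagonal.mem_antidiagonal] at h ⊢
  dsimp only at h ⊢
  omega

variable (X X') in
/-- The families of elements of `Ext^p(N, M) ⊗ Ext^q(X, X')`, for `p + q = n`. -/
abbrev ExtTensorFamily : Type u :=
  ∀ t : {t : ℕ × ℕ // t ∈ Finset.HasAntidiagonal.antidiagonal n},
    Ext N ((smashRes α).obj M) t.1.1 ⊗[k] Ext X X' t.1.2

/-- The sum of the comparison maps in a given total degree. -/
noncomputable def smashExtTotal : ExtTensorFamily (k := k) α X X' N M n →ₗ[k]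
    Ext ((smashFunctor α χ).obj N) ((smashFunctor α χ').obj ((smashRes α).obj M)) n :=
  ∑ t : {t : ℕ × ℕ // t ∈ Finset.HasAntidiagonal.antidiagonal n},
    smashExtTensor α χ χ' N M (Finset.HasAntidiagonal.mem_antidiagonal.1 t.2) ∘ₗ LinearMap.proj t

variable {N N' N''} in
lemma smashExtTotal_apply (z : ExtTensorFamily (k := k) α X X' N M n) :
    smashExtTotal α χ χ' N M n z = ∑ t : {t : ℕ × ℕ // t ∈ Finset.HasAntidiagonal.antidiagonal n},
      smashExtTensor α χ χ' N M (Finset.HasAntidiagonal.mem_antidiagonal.1 t.2) (z t) := by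
  rw [smashExtTotal, LinearMap.sum_apply]
  rfl

variable {N N'}

variable (X X') in
/-- Precomposition with a morphism on families. -/
noncomputable def familyPrecomp (f : N ⟶ N') : ExtTensorFamily (k := k) α X X' N' M n →ₗ[k]
    ExtTensorFamily (k := k) α X X' N M n :=
  LinearMap.pi fun t => (extPrecomp (Ext.mk₀ f) _ (zero_add t.1.1)).rTensor _ ∘ₗ LinearMap.proj t

variable (X X') in
/-- Precomposition with an element of degree one on families. -/
noncomputable def familyConnecting (x : Ext N N' 1) :
    ExtTensorFamily (k := k) α X X' N' M n →ₗ[k] ExtTensorFamily (k := k) α X X' N M (n + 1) :=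
  LinearMap.pi fun t => match t with
    -- A connecting class raises the first degree by one, so nothing reaches the component with
    -- first degree zero.
    | ⟨(0, _), _⟩ => 0
    | ⟨(p + 1, q), h⟩ => (extPrecomp x _ (add_comm 1 p)).rTensor _ ∘ₗ
        LinearMap.proj (⟨(p, q), mem_antidiagonal_of_succ h⟩ :
          {t : ℕ × ℕ // t ∈ Finset.HasAntidiagonal.antidiagonal n})

lemma smashExtTotal_precomp (f : N ⟶ N') (z : ExtTensorFamily (k := k) α X X' N' M n) :
    smashExtTotal α χ χ' N M n (familyPrecomp α X X' M n f z) =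
      (Ext.mk₀ ((smashFunctor α χ).map f)).comp (smashExtTotal α χ χ' N' M n z) (zero_add n) := by
  rw [smashExtTotal_apply, smashExtTotal_apply, Ext.comp_sum]
  refine Finset.sum_congr rfl fun t _ => ?_
  rw [← Ext.mapExactFunctor_mk₀]
  exact smashExtTensor_precomp_left α χ χ' M _ _ _ _ _ _

lemma smashExtTotal_connecting (x : Ext N N' 1) (z : ExtTensorFamily (k := k) α X X' N' M n) :
    smashExtTotal α χ χ' N M (n + 1) (familyConnecting α X X' M n x z) =
      (x.mapExactFunctor (smashFunctor α χ)).comp (smashExtTotal α χ χ' N' M n z)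
        (add_comm 1 n) := by
  rw [smashExtTotal_apply, smashExtTotal_apply, Ext.comp_sum]
  refine (Fintype.sum_of_injective antidiagonalShift ?_ _ _ ?_ ?_).symm
  · intro s t h
    have h' := congrArg Subtype.val h
    simp only [antidiagonalShift, Prod.mk.injEq, add_left_inj] at h'
    exact Subtype.ext (Prod.ext h'.1 h'.2)
  · rintro ⟨⟨_ | p, q⟩, h⟩ ht
    · exact map_zero _
    · exact (ht ⟨⟨(p, q), mem_antidiagonal_of_succ h⟩, rfl⟩).elim
  · intro t
    exact (smashExtTensor_precomp_left α χ χ' M _ _ (add_comm 1 _) _ _ _).symm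

-- Only the component with first degree zero survives for projective N, and there the claim is
-- `smashExtTensor_bijective_of_projective`.
include hS in
lemma smashExtTotal_bijective_of_projective [Module.Finite Aᵐᵒᵖ N] [Module.Projective Aᵐᵒᵖ N]
    (hX : X.IsFPInfinity) : Function.Bijective (smashExtTotal α χ χ' N M n) := by
  let t₀ : {t : ℕ × ℕ // t ∈ Finset.HasAntidiagonal.antidiagonal n} :=
    ⟨(0, n), Finset.HasAntidiagonal.mem_antidiagonal.2 (zero_add n)⟩
  have hN : Projective N := N.projective_of_categoryTheory_projective
  have hs (t) (ht : t ≠ t₀) :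
      Subsingleton (Ext N ((smashRes α).obj M) t.1.1 ⊗[k] Ext X X' t.1.2) := by
    obtain ⟨⟨_ | p, q⟩, h⟩ := t
    · rw [Finset.HasAntidiagonal.mem_antidiagonal] at h
      exact (ht (Subtype.ext (Prod.ext rfl ((zero_add q).symm.trans h)))).elim
    · have := Ext.subsingleton_of_projective N ((smashRes α).obj M) p
      dsimp only
      infer_instance
  have hb := smashExtTensor_bijective_of_projective (N := N) α hS χ χ' M hX n
  have key (z : ExtTensorFamily (k := k) α X X' N M n) :
      smashExtTotal α χ χ' N M n z = smashExtTensor α χ χ' N M (zero_add n) (z t₀) := by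
    rw [smashExtTotal_apply, Fintype.sum_eq_single t₀]
    intro t ht
    have := hs t ht
    rw [Subsingleton.elim (z t) 0, map_zero]
  refine ⟨fun z z' h => funext fun t => ?_, fun y => ?_⟩
  · rw [key, key] at h
    by_cases ht : t = t₀
    · rw [ht]
      exact hb.1 h
    · have := hs t ht
      exact Subsingleton.elim _ _
  · obtain ⟨w, hw⟩ := hb.2 y
    refine ⟨Pi.single t₀ w, ?_⟩
    rw [key, Pi.single_eq_same, hw]

lemma exact_pi {ι : Type*} {R : Type*} [Semiring R] {V₁ V₂ V₃ : ι → Type*}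
    [∀ i, AddCommGroup (V₁ i)] [∀ i, AddCommGroup (V₂ i)] [∀ i, AddCommGroup (V₃ i)]
    [∀ i, Module R (V₁ i)] [∀ i, Module R (V₂ i)] [∀ i, Module R (V₃ i)]
    (f : ∀ i, V₁ i →ₗ[R] V₂ i) (g : ∀ i, V₂ i →ₗ[R] V₃ i) (h : ∀ i, Function.Exact (f i) (g i)) :
    Function.Exact (LinearMap.pi fun i => f i ∘ₗ LinearMap.proj (φ := V₁) i)
      (LinearMap.pi fun i => g i ∘ₗ LinearMap.proj (φ := V₂) i) := by
  intro y
  constructor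
  · intro hy
    choose x hx using fun i => (h i (y i)).1 (congrFun hy i)
    exact ⟨x, funext hx⟩
  · rintro ⟨x, rfl⟩
    exact funext fun i => (h i).apply_apply_eq_zero (x i)

section Exact

variable {S : ShortComplex (ModuleCat.{u} Aᵐᵒᵖ)} (hSe : S.ShortExact)

include hSe in
lemma rTensor_precomp_injective (q : ℕ) : Function.Injective
    ((extPrecomp (k := k) (Ext.mk₀ S.g) ((smashRes α).obj M) (zero_add 0)).rTensor
      (Ext X X' q)) :=
  Module.Flat.rTensor_preserves_injective_linearMap _ (extPrecomp_injective hSe _)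

include hSe in
lemma familyPrecomp_exact : Function.Exact (familyPrecomp (k := k) α X X' M n S.g)
    (familyPrecomp (k := k) α X X' M n S.f) :=
  exact_pi _ _ fun t => Module.Flat.rTensor_exact _ (extPrecomp_exact₂ hSe _ t.1.1)

lemma familyPrecomp_connecting_exact : Function.Exact (familyPrecomp (k := k) α X X' M n S.f)
    (familyConnecting (k := k) α X X' M n hSe.extClass) := by
  have h (p q : ℕ) := Module.Flat.rTensor_exact (Ext X X' q)
    (extPrecomp_exact₁ (k := k) hSe ((smashRes α).obj M) p)
  intro y
  constructor
  · intro hy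
    choose x hx using fun t : {t : ℕ × ℕ // t ∈ Finset.HasAntidiagonal.antidiagonal n} =>
      (h t.1.1 t.1.2 (y t)).1 (congrFun hy (antidiagonalShift t))
    exact ⟨x, funext hx⟩
  · rintro ⟨x, rfl⟩
    refine funext fun t => ?_
    obtain ⟨⟨_ | p, q⟩, ht⟩ := t
    · rfl
    · exact (h p q).apply_apply_eq_zero _

lemma familyConnecting_precomp_exact :
    Function.Exact (familyConnecting (k := k) α X X' M n hSe.extClass)
      (familyPrecomp (k := k) α X X' M (n + 1) S.g) := by
  have h (p q : ℕ) := Module.Flat.rTensor_exact (Ext X X' q)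
    (extPrecomp_exact₃ (k := k) hSe ((smashRes α).obj M) p)
  intro y
  constructor
  · intro hy
    choose x hx using fun t : {t : ℕ × ℕ // t ∈ Finset.HasAntidiagonal.antidiagonal n} =>
      (h t.1.1 t.1.2 (y (antidiagonalShift t))).1 (congrFun hy (antidiagonalShift t))
    refine ⟨x, funext fun t => ?_⟩
    obtain ⟨⟨_ | p, q⟩, ht⟩ := t
    -- In the component with first degree zero, where the connecting map is zero, exactness amounts
    -- to injectivity of the pullback along the surjection.
    · exact (rTensor_precomp_injective (k := k) (X := X) (X' := X') α M hSe q ((congrFun hy ⟨(0,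
        q), ht⟩).trans
        (map_zero _).symm)).symm
    · exact hx ⟨(p, q), mem_antidiagonal_of_succ ht⟩
  · rintro ⟨x, rfl⟩
    refine funext fun t => ?_
    obtain ⟨⟨_ | p, q⟩, ht⟩ := t
    · exact map_zero ((extPrecomp (k := k) (Ext.mk₀ S.g) ((smashRes α).obj M)
        (zero_add 0)).rTensor (Ext X X' q))
    · exact (h p q).apply_apply_eq_zero _

include hSe in
lemma familyPrecomp_injective :
    Function.Injective (familyPrecomp (k := k) α X X' M 0 S.g) := by
  intro x y h
  refine funext fun t => ?_
  have ht : t = ⟨(0, 0), Finset.HasAntidiagonal.mem_antidiagonal.2 rfl⟩ := by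
    have := Finset.HasAntidiagonal.mem_antidiagonal.1 t.2
    exact Subtype.ext (Prod.ext (by dsimp only; omega) (by dsimp only; omega))
  subst ht
  exact rTensor_precomp_injective (k := k) (X := X) (X' := X') α M hSe 0
    (congrFun h ⟨(0, 0), Finset.HasAntidiagonal.mem_antidiagonal.2 rfl⟩)

end Exact

-- Tensoring the long exact sequence of Ext(-, M) with each Ext^q(X, X') over a field keeps it
-- exact, so the families of total degree n form a cohomological functor of N. The comparison
-- respects the connecting maps, and N may be replaced by finitely generated projectives.
include hS in
lemma smashExtTotal_bijective (hN : N.IsFPInfinity) (hX : X.IsFPInfinity) :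
    Function.Bijective (smashExtTotal α χ χ' N M n) := by
  refine bijective_of_coverings (O := {N : ModuleCat.{u} Aᵐᵒᵖ // N.IsFPInfinity})
    (T := fun n N => ExtTensorFamily (k := k) α X X' N.1 M n)
    (T' := fun n N => Ext ((smashFunctor α χ).obj N.1)
      ((smashFunctor α χ').obj ((smashRes α).obj M)) n)
    (fun n N => (smashExtTotal α χ χ' N.1 M n).toAddMonoidHom) ?_ n ⟨N, hN⟩
  rintro ⟨N, hN⟩
  obtain ⟨K, P, i, p, hi, hip, hp, _, _, hK⟩ := hN.exists_cover
  have w : ModuleCat.ofHom i ≫ ModuleCat.ofHom p = 0 :=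
    ModuleCat.hom_ext (LinearMap.ext hip.apply_apply_eq_zero)
  let S := ShortComplex.mk (ModuleCat.ofHom i) (ModuleCat.ofHom p) w
  have hSe : S.ShortExact := ModuleCat.shortComplex_shortExact _ hip hi hp
  have hSe' := hSe.map_of_exact (smashFunctor α χ)
  let Z := (smashFunctor α χ').obj ((smashRes α).obj M)
  refine ⟨⟨P, P.isFPInfinity_of_projective⟩, ⟨K, hK⟩,
    fun n => (familyPrecomp α X X' M n S.g).toAddMonoidHom,
    fun n => (familyPrecomp α X X' M n S.f).toAddMonoidHom,
    fun n => (familyConnecting α X X' M n hSe.extClass).toAddMonoidHom,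
    fun n => (extPrecomp (k := k) (Ext.mk₀ ((smashFunctor α χ).map S.g)) Z
      (zero_add n)).toAddMonoidHom,
    fun n => (extPrecomp (k := k) (Ext.mk₀ ((smashFunctor α χ).map S.f)) Z
      (zero_add n)).toAddMonoidHom,
    fun n => (extPrecomp (k := k) hSe'.extClass Z (add_comm 1 n)).toAddMonoidHom,
    familyPrecomp_injective α M hSe, extPrecomp_injective (k := k) hSe' Z,
    fun n => familyPrecomp_exact α M n hSe, extPrecomp_exact₂ (k := k) hSe' Z,
    fun n => familyPrecomp_connecting_exact α M n hSe, extPrecomp_exact₁ (k := k) hSe' Z,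
    fun n => familyConnecting_precomp_exact α M n hSe, extPrecomp_exact₃ (k := k) hSe' Z,
    fun n => smashExtTotal_precomp α χ χ' M n S.g,
    fun n => smashExtTotal_precomp α χ χ' M n S.f, fun n z => ?_,
    fun n => smashExtTotal_bijective_of_projective α hS χ χ' M n hX⟩
  refine (smashExtTotal_connecting α χ χ' M n hSe.extClass z).trans ?_
  rw [Ext.mapExactFunctor_extClass]
  rfl

end SmashExtBijective

/-! ## The Yoneda algebra of the smash product module -/

section TwistedLift

variable {k A B C : Type*} [CommRing k] [Ring A] [Algebra k A] [Ring B] [Algebra k B] [Ring C]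
  [Algebra k C] (t : TwistingMap k A B) (i : A →ₐ[k] C) (j : B →ₐ[k] C)

/-- The map `a ⊗ b ↦ i(a) j(b)`. -/
noncomputable def tensorMulLift (i : A →ₐ[k] C) (j : B →ₐ[k] C) : A ⊗[k] B →ₗ[k] C :=
  TensorProduct.lift ((LinearMap.mul k C).compl₁₂ i.toLinearMap j.toLinearMap)

lemma tensorMulLift_tmul (a : A) (b : B) : tensorMulLift i j (a ⊗ₜ b) = i a * j b := rfl

lemma tensorMulLift_mul_mul (a : A) (b : B) (z : A ⊗[k] B) :
    tensorMulLift i j ((a ⊗ₜ 1) * z * (1 ⊗ₜ b)) = i a * tensorMulLift i j z * j b := by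
  induction z using TensorProduct.induction_on with
  | zero => simp
  | add x y hx hy => simp only [mul_add, add_mul, map_add, hx, hy]
  | tmul a' b' =>
    simp only [Algebra.TensorProduct.tmul_mul_tmul, tensorMulLift_tmul, one_mul, mul_one, map_mul,
      mul_assoc]

variable {i j}

lemma tensorMulLift_twistMul (h : ∀ b a, j b * i a = tensorMulLift i j (t.τ b a))
    (x y : A ⊗[k] B) : tensorMulLift i j (twistMul t.τ x y) =
      tensorMulLift i j x * tensorMulLift i j y := by
  induction x using TensorProduct.induction_on with
  | zero => simp
  | add x z hx hz => simp only [map_add, LinearMap.add_apply, add_mul, hx, hz]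
  | tmul a b =>
  induction y using TensorProduct.induction_on with
  | zero => simp
  | add y z hy hz => simp only [map_add, mul_add, hy, hz]
  | tmul a' b' =>
    rw [twistMul_tmul_tmul, tensorMulLift_mul_mul, ← h, tensorMulLift_tmul, tensorMulLift_tmul,
      mul_assoc, mul_assoc, mul_assoc]

/-- The morphism from a twisted tensor product given by morphisms from the factors that satisfy the
commutation rule. -/
noncomputable def TwistedTensor.lift (h : ∀ b a, j b * i a = tensorMulLift i j (t.τ b a)) :
    TwistedTensor t →ₐ[k] C :=
  AlgHom.ofLinearMap (R := k) (A := TwistedTensor t) (tensorMulLift i j)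
    ((tensorMulLift_tmul i j 1 1).trans (by simp)) (tensorMulLift_twistMul t h)

end TwistedLift

/-! ### The two algebra maps and their commutation. -/

section SmashYoneda

open Limits HopfAlgebra
open scoped ModuleCat

variable {k : Type u} [Field k] {H A B : Type u} [Ring H] [HopfAlgebra k H] [Ring A] [Algebra k A]
  [Ring B] [Algebra k B] (α : ModuleAlgebra k H A) {β : ComoduleAlgebra k H B}
  {X : ModuleCat.{u} Bᵐᵒᵖ} (χ : HopfModule β X) (M : ModuleCat.{u} (SmashHopf α)ᵐᵒᵖ)

/-- The morphism of Yoneda algebras given by `- # X`. -/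
noncomputable def yonedaLeft : (⨁ n, Ext ((smashRes α).obj M) ((smashRes α).obj M) n) →ₐ[k]
    ⨁ n, Ext ((smashFunctor α χ).obj ((smashRes α).obj M))
      ((smashFunctor α χ).obj ((smashRes α).obj M)) n :=
  DirectSum.toAlgebra k _
    (fun n => DirectSum.lof k ℕ _ n ∘ₗ Functor.mapExtLinearMap (smashFunctor α χ) k _ _ n)
    (congrArg (DirectSum.lof k ℕ _ 0) ((Ext.mapExactFunctor_mk₀ _ _).trans
      (congrArg Ext.mk₀ ((smashFunctor α χ).map_id _))))
    (fun {a b} x y => (congrArg (DirectSum.lof k ℕ _ (a + b))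
      (Ext.mapExactFunctor_comp _ y x (add_comm b a))).trans
        (DirectSum.of_mul_of (A := Ext ((smashFunctor α χ).obj ((smashRes α).obj M))
          ((smashFunctor α χ).obj ((smashRes α).obj M)))
          (x.mapExactFunctor (smashFunctor α χ)) (y.mapExactFunctor (smashFunctor α χ))).symm)

lemma yonedaLeft_lof (n : ℕ) (x : Ext ((smashRes α).obj M) ((smashRes α).obj M) n) :
    yonedaLeft α χ M (DirectSum.lof k ℕ _ n x) =
      DirectSum.lof k ℕ _ n (x.mapExactFunctor (smashFunctor α χ)) :=
  DirectSum.toModule_lof k (φ := fun n => DirectSum.lof k ℕ _ n ∘ₗ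
    Functor.mapExtLinearMap (smashFunctor α χ) k _ _ n) n x

/-- The morphism of Yoneda algebras given by `M # -`. -/
noncomputable def yonedaRight : (⨁ n, Ext X X n) →ₐ[k]
    ⨁ n, Ext ((smashFunctor α χ).obj ((smashRes α).obj M))
      ((smashFunctor α χ).obj ((smashRes α).obj M)) n :=
  DirectSum.toAlgebra k _ (fun n => DirectSum.lof k ℕ _ n ∘ₗ rightExt α χ χ M n)
    (congrArg (DirectSum.lof k ℕ _ 0) (rightExt_mk₀_id α χ M))
    (fun {a b} x y => (congrArg (DirectSum.lof k ℕ _ (a + b))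
      (rightExt_comp α χ χ χ M y x (add_comm b a))).trans
        (DirectSum.of_mul_of (A := Ext ((smashFunctor α χ).obj ((smashRes α).obj M))
          ((smashFunctor α χ).obj ((smashRes α).obj M)))
          (rightExt α χ χ M a x) (rightExt α χ χ M b y)).symm)

lemma yonedaRight_lof (n : ℕ) (γ : Ext X X n) :
    yonedaRight α χ M (DirectSum.lof k ℕ _ n γ) =
      DirectSum.lof k ℕ _ n (rightExt α χ χ M n γ) :=
  DirectSum.toModule_lof k (φ := fun n => DirectSum.lof k ℕ _ n ∘ₗ rightExt α χ χ M n) n γ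

lemma neg_one_pow_zsmul {V : Type*} [AddCommGroup V] [Module k V] (n : ℕ) (v : V) :
    (-1 : ℤ) ^ n • v = (-1 : k) ^ n • v := by
  rw [← Int.cast_smul_eq_zsmul k]
  push_cast
  rfl

lemma lof_mul_lof_cast {C : Type*} [Category C] [Abelian C] [HasExt.{u} C] [Linear k C] (Y : C)
    {a b c : ℕ} (x : Ext Y Y a) (y : Ext Y Y b) (h : b + a = c) :
    DirectSum.lof k ℕ (Ext Y Y) a x * DirectSum.lof k ℕ (Ext Y Y) b y =
      DirectSum.lof k ℕ (Ext Y Y) c (y.comp x h) := by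
  obtain rfl : a + b = c := (add_comm a b).trans h
  exact DirectSum.of_mul_of x y

lemma yonedaRight_mul_yonedaLeft_lof {p q n : ℕ} (e : p + q = n)
    (x : Ext ((smashRes α).obj M) ((smashRes α).obj M) p) (γ : Ext X X q) :
    yonedaRight α χ M (DirectSum.lof k ℕ _ q γ) * yonedaLeft α χ M (DirectSum.lof k ℕ _ p x) =
      DirectSum.lof k ℕ _ n (smashExt α χ χ _ M e x γ) := by
  rw [yonedaRight_lof, yonedaLeft_lof, lof_mul_lof_cast _ _ _ e]
  rfl

variable (hS : Function.Bijective (antipode k (A := H))) (hX : X.IsFPInfinity)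

/-- This is `mapExactFunctor_comp_rightExt` read in the Yoneda algebra. It is precisely the
condition under which two algebra maps extend to the twisted tensor product. -/
lemma yonedaRight_mul_yonedaLeft (γ : ⨁ n, Ext X X n)
    (x : ⨁ n, Ext ((smashRes α).obj M) ((smashRes α).obj M) n) :
    yonedaRight α χ M γ * yonedaLeft α χ M x =
      tensorMulLift (yonedaLeft α χ M) (yonedaRight α χ M)
        ((gradedSmashTwist (hopfModuleAlgebra α M hS) (extComodule hS hX χ)).τ γ x) := by
  induction γ using DirectSum.induction_on with
  | zero => simp
  | add y z hy hz => simp only [map_add, add_mul, LinearMap.add_apply, hy, hz]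
  | of q γ =>
  induction x using DirectSum.induction_on with
  | zero => simp
  | add y z hy hz => simp only [map_add, mul_add, hy, hz]
  | of p x =>
    refine (yonedaRight_mul_yonedaLeft_lof α χ M rfl x γ).trans ?_
    refine Eq.trans ?_ (congrArg (tensorMulLift (yonedaLeft α χ M) (yonedaRight α χ M))
      (gradedSmashτ_lof (hopfModuleAlgebra α M hS).toModuleAlgebra
        (extComodule hS hX χ).toComoduleAlgebra p q x γ).symm)
    rw [smashExt_apply, mapExactFunctor_comp_rightExt α χ χ hS x hX γ rfl,
      neg_one_pow_zsmul (k := k), mul_comm p q, map_smul, smashτ_apply]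
    have h₁ : (extComodule hS hX χ).coact (DirectSum.lof k ℕ (Ext X X) q γ) = _ :=
      extCoactHom_lof hS χ hX q γ
    rw [h₁]
    have h₂ (z : H ⊗[k] Ext X X q) : tensorMulLift (yonedaLeft α χ M) (yonedaRight α χ M)
        (LinearMap.rTensor (⨁ n, Ext X X n)
          ((hopfModuleAlgebra α M hS).act.toLinearMap.flip (DirectSum.lof k ℕ _ p x))
          ((DirectSum.lof k ℕ (Ext X X) q).lTensor H z)) =
        DirectSum.lof k ℕ _ (p + q) (twistPairing α χ χ x q (p + q) (add_comm q p) z) := by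
      induction z using TensorProduct.induction_on with
      | zero => simp
      | add y z hy hz => simp only [map_add, hy, hz]
      | tmul h γ =>
        have h₃ : (hopfModuleAlgebra α M hS).act h (DirectSum.lof k ℕ _ p x) = _ :=
          hopfExtAct_lof α M h p x
        rw [LinearMap.lTensor_tmul, LinearMap.rTensor_tmul, LinearMap.flip_apply,
          AlgHom.toLinearMap_apply, h₃, tensorMulLift_tmul, yonedaLeft_lof, yonedaRight_lof,
          lof_mul_lof_cast _ _ _ (add_comm q p)]
        rfl
    rw [map_smul, h₂]

end SmashYoneda

/-! ### Bijectivity of the algebra map. -/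

section SmashYonedaBijective

open Limits HopfAlgebra
open scoped ModuleCat

variable {k : Type u} [Field k] {H A B : Type u} [Ring H] [HopfAlgebra k H] [Ring A] [Algebra k A]
  [Ring B] [Algebra k B] (α : ModuleAlgebra k H A) {β : ComoduleAlgebra k H B}
  (hS : Function.Bijective (antipode k (A := H)))
  {X : ModuleCat.{u} Bᵐᵒᵖ} (χ : HopfModule β X) (M : ModuleCat.{u} (SmashHopf α)ᵐᵒᵖ)
  (hM : ((smashRes α).obj M).IsFPInfinity) (hX : X.IsFPInfinity)

variable (X) in
/-- The bigraded tensor product of the Yoneda algebras. -/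
abbrev yonedaBigraded (t : ℕ × ℕ) : Type u :=
  Ext ((smashRes α).obj M) ((smashRes α).obj M) t.1 ⊗[k] Ext X X t.2

/-- The sum of the comparison maps. -/
noncomputable def smashExtSum : (⨁ t : ℕ × ℕ, yonedaBigraded (k := k) α X M t) →ₗ[k]
    ⨁ n, Ext ((smashFunctor α χ).obj ((smashRes α).obj M))
      ((smashFunctor α χ).obj ((smashRes α).obj M)) n :=
  DirectSum.toModule k (ℕ × ℕ) _ fun t => DirectSum.lof k ℕ _ (t.1 + t.2) ∘ₗ
    smashExtTensor α χ χ ((smashRes α).obj M) M rfl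

lemma smashExtSum_lof {t : ℕ × ℕ} {n : ℕ} (e : t.1 + t.2 = n)
    (z : yonedaBigraded (k := k) α X M t) :
    smashExtSum α χ M (DirectSum.lof k (ℕ × ℕ) _ t z) =
      DirectSum.lof k ℕ _ n (smashExtTensor α χ χ ((smashRes α).obj M) M e z) := by
  subst e
  exact DirectSum.toModule_lof k _ _

/-- The component of degree n sees only the bidegrees of total degree n, so bijectivity can be
checked one degree at a time. -/
lemma component_smashExtSum (n : ℕ) (w : ⨁ t : ℕ × ℕ, yonedaBigraded (k := k) α X M t) :
    (smashExtSum α χ M w) n =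
      smashExtTotal α χ χ ((smashRes α).obj M) M n fun t => w t.1 := by
  rw [smashExtTotal_apply]
  induction w using DirectSum.induction_on with
  | zero =>
    rw [map_zero]
    refine (Finset.sum_eq_zero fun t _ => ?_).symm
    exact LinearMap.map_zero _
  | add x y hx hy =>
    rw [map_add, DirectSum.add_apply, hx, hy, ← Finset.sum_add_distrib]
    refine Finset.sum_congr rfl fun t _ => ?_
    rw [DirectSum.add_apply, map_add]
  | of t z =>
    refine (congrArg (fun v => v n) (smashExtSum_lof α χ M rfl z)).trans ?_
    by_cases h : t.1 + t.2 = n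
    · subst h
      refine (DirectSum.of_eq_same (β := fun n => Ext ((smashFunctor α χ).obj ((smashRes α).obj M))
        ((smashFunctor α χ).obj ((smashRes α).obj M)) n) _ _).trans ?_
      rw [Fintype.sum_eq_single ⟨t, Finset.HasAntidiagonal.mem_antidiagonal.2 rfl⟩]
      · rw [DirectSum.of_eq_same]
      · intro s hs
        rw [DirectSum.of_eq_of_ne, map_zero]
        exact fun h => hs (Subtype.ext h)
    · refine (DirectSum.of_eq_of_ne (β := fun n => Ext ((smashFunctor α χ).obj ((smashRes α).obj M))
        ((smashFunctor α χ).obj ((smashRes α).obj M)) n) _ _ _ (Ne.symm h)).trans ?_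
      refine (Finset.sum_eq_zero fun s _ => ?_).symm
      rw [DirectSum.of_eq_of_ne, map_zero]
      rintro rfl
      exact h (Finset.HasAntidiagonal.mem_antidiagonal.1 s.2)

include hS hM hX in
lemma exists_smashExtSum_eq (n : ℕ) (y : Ext ((smashFunctor α χ).obj ((smashRes α).obj M))
      ((smashFunctor α χ).obj ((smashRes α).obj M)) n) :
    ∃ z : ∀ t : {t : ℕ × ℕ // t ∈ Finset.HasAntidiagonal.antidiagonal n},
      yonedaBigraded (k := k) α X M t.1,
      smashExtSum α χ M
        (∑ t : {t : ℕ × ℕ // t ∈ Finset.HasAntidiagonal.antidiagonal n},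
          DirectSum.lof k (ℕ × ℕ) (yonedaBigraded (k := k) α X M) t.1 (z t)) =
      DirectSum.lof k ℕ (Ext ((smashFunctor α χ).obj ((smashRes α).obj M))
        ((smashFunctor α χ).obj ((smashRes α).obj M))) n y := by
  obtain ⟨z, rfl⟩ := (smashExtTotal_bijective α hS χ χ M n hM hX).2 y
  refine ⟨z, ?_⟩
  rw [smashExtTotal_apply, map_sum]
  refine .trans ?_ (map_sum (DirectSum.lof k ℕ _ n) _ _).symm
  exact Finset.sum_congr rfl fun t _ =>
    smashExtSum_lof α χ M (Finset.HasAntidiagonal.mem_antidiagonal.1 t.2) (z t)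

include hS hM hX in
lemma smashExtSum_bijective : Function.Bijective (smashExtSum α χ M) := by
  refine ⟨(injective_iff_map_eq_zero _).2 fun w hw => ?_, fun y => ?_⟩
  · refine DirectSum.ext_component k fun t => ?_
    have h := component_smashExtSum α χ M (t.1 + t.2) w
    rw [hw] at h
    have h' := (injective_iff_map_eq_zero _).1
      (smashExtTotal_bijective α hS χ χ M (t.1 + t.2) hM hX).1 _ h.symm
    exact congrFun h' ⟨t, Finset.HasAntidiagonal.mem_antidiagonal.2 rfl⟩
  · induction y using DirectSum.induction_on with
    | zero => exact ⟨0, map_zero _⟩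
    | add x y hx hy =>
      obtain ⟨v, rfl⟩ := hx
      obtain ⟨w, rfl⟩ := hy
      exact ⟨v + w, map_add _ _ _⟩
    | of n y =>
      obtain ⟨z, hz⟩ := exists_smashExtSum_eq α hS χ M hM hX n y
      exact ⟨_, hz⟩

variable (X) in
/-- The twist `x ⊗ γ ↦ (-1) ^ (|γ| |x|) ∑ (γ₋₁ ⇀ x) ⊗ γ₀`. -/
noncomputable def yonedaTwist : (⨁ n, Ext ((smashRes α).obj M) ((smashRes α).obj M) n) ⊗[k]
      (⨁ n, Ext X X n) →ₗ[k]
    (⨁ n, Ext ((smashRes α).obj M) ((smashRes α).obj M) n) ⊗[k] (⨁ n, Ext X X n) :=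
  TensorProduct.lift
    (gradedSmashTwist (hopfModuleAlgebra α M hS) (extComodule hS hX χ)).τ.flip

lemma tensorMulLift_yonedaTwist_tmul (x : ⨁ n, Ext ((smashRes α).obj M) ((smashRes α).obj M) n)
    (γ : ⨁ n, Ext X X n) :
    tensorMulLift (yonedaLeft α χ M) (yonedaRight α χ M) (yonedaTwist α hS X χ M hX (x ⊗ₜ γ)) =
      yonedaRight α χ M γ * yonedaLeft α χ M x :=
  (yonedaRight_mul_yonedaLeft α χ M hS hX γ x).symm

lemma tensorMulLift_yonedaTwist (z : (⨁ n, Ext ((smashRes α).obj M) ((smashRes α).obj M) n) ⊗[k]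
      (⨁ n, Ext X X n)) :
    tensorMulLift (yonedaLeft α χ M) (yonedaRight α χ M) (yonedaTwist α hS X χ M hX z) =
      smashExtSum α χ M (TensorProduct.directSum k k _ _ z) := by
  suffices h : tensorMulLift (yonedaLeft α χ M) (yonedaRight α χ M) ∘ₗ
      yonedaTwist α hS X χ M hX = smashExtSum α χ M ∘ₗ
        (TensorProduct.directSum k k _ _).toLinearMap from LinearMap.congr_fun h z
  refine TensorProduct.ext (DirectSum.linearMap_ext k fun p => LinearMap.ext fun x =>
    DirectSum.linearMap_ext k fun q => LinearMap.ext fun γ => ?_)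
  refine (tensorMulLift_yonedaTwist_tmul α hS χ M hX _ _).trans ?_
  refine (yonedaRight_mul_yonedaLeft_lof α χ M rfl x γ).trans ?_
  refine .trans ?_ (congrArg (smashExtSum α χ M) (TensorProduct.directSum_lof_tmul_lof (R := k)
    (S := k) p x q γ).symm)
  exact (smashExtSum_lof α χ M (t := (p, q)) rfl (x ⊗ₜ γ)).symm

/-- On each bihomogeneous piece the twist is, up to sign, `actTwist` for the Yoneda algebras, and
that map is onto because S is bijective. -/
lemma yonedaTwist_surjective : Function.Surjective (yonedaTwist α hS X χ M hX) := by
  let T := actTwist (hopfModuleAlgebra α M hS).toModuleAlgebra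
    (HopfModule.regular (extComodule hS hX χ).toComoduleAlgebra) hS
  have h (z) : T z ∈ LinearMap.range (yonedaTwist α hS X χ M hX) := by
    induction z using TensorProduct.induction_on with
    | zero => rw [map_zero]; exact zero_mem _
    | add x y hx hy => rw [map_add]; exact add_mem hx hy
    | tmul x γ =>
    induction x using DirectSum.induction_on with
    | zero => rw [TensorProduct.zero_tmul, map_zero]; exact zero_mem _
    | add x y hx hy => rw [TensorProduct.add_tmul, map_add]; exact add_mem hx hy
    | of p x =>
    induction γ using DirectSum.induction_on with
    | zero => rw [TensorProduct.tmul_zero, map_zero]; exact zero_mem _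
    | add x y hx hy => rw [TensorProduct.tmul_add, map_add]; exact add_mem hx hy
    | of q γ =>
      refine ⟨(-1 : k) ^ (q * p) • (DirectSum.lof k ℕ _ p x ⊗ₜ DirectSum.lof k ℕ _ q γ), ?_⟩
      rw [map_smul]
      refine (congrArg (fun z => (-1 : k) ^ (q * p) • z) (gradedSmashτ_lof
        (hopfModuleAlgebra α M hS).toModuleAlgebra (extComodule hS hX χ).toComoduleAlgebra
          p q x γ)).trans ?_
      rw [smul_smul, ← mul_pow, neg_one_mul, neg_neg, one_pow, one_smul]
      exact (actTwist_tmul (hopfModuleAlgebra α M hS).toModuleAlgebra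
        (HopfModule.regular (extComodule hS hX χ).toComoduleAlgebra) hS _ _).symm
  intro y
  obtain ⟨z, rfl⟩ := T.surjective y
  exact h z

-- The comparison map multiplies in the order opposite to that of `tensorMulLift`, and the twist
-- mediates between the two. The composite is bijective and the twist surjective, so the remaining
-- factor is bijective.
include hS hM hX in
lemma tensorMulLift_yoneda_bijective :
    Function.Bijective (tensorMulLift (yonedaLeft α χ M) (yonedaRight α χ M)) := by
  have hb := (smashExtSum_bijective α hS χ M hM hX).comp
    (TensorProduct.directSum k k (fun n => Ext ((smashRes α).obj M) ((smashRes α).obj M) n)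
      (fun n => Ext X X n)).bijective
  have hc : (tensorMulLift (yonedaLeft α χ M) (yonedaRight α χ M)) ∘
      (yonedaTwist α hS X χ M hX) = _ := funext (tensorMulLift_yonedaTwist α hS χ M hX)
  have hs := yonedaTwist_surjective α hS χ M hX
  refine ⟨fun x y h => ?_, .of_comp (g := yonedaTwist α hS X χ M hX) (hc ▸ hb.2)⟩
  obtain ⟨x, rfl⟩ := hs x
  obtain ⟨y, rfl⟩ := hs y
  rw [tensorMulLift_yonedaTwist, tensorMulLift_yonedaTwist] at h
  exact congrArg _ (hb.1 h)

end SmashYonedaBijective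

/-! ### The graded isomorphism. -/

section SmashYonedaEquiv

open Limits HopfAlgebra
open scoped ModuleCat

variable {k : Type u} [Field k] {H A B : Type u} [Ring H] [HopfAlgebra k H] [Ring A] [Algebra k A]
  [Ring B] [Algebra k B] (α : ModuleAlgebra k H A) {β : ComoduleAlgebra k H B}
  (hS : Function.Bijective (antipode k (A := H)))
  {X : ModuleCat.{u} Bᵐᵒᵖ} (χ : HopfModule β X) (M : ModuleCat.{u} (SmashHopf α)ᵐᵒᵖ)
  (hM : ((smashRes α).obj M).IsFPInfinity) (hX : X.IsFPInfinity)

lemma tmul_mem_degree {H : Type*} [Ring H] [Bialgebra k H] {Λ Γ : ℕ → Type*}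
    [∀ n, AddCommGroup (Λ n)] [∀ n, Module k (Λ n)] [DirectSum.GRing Λ] [DirectSum.GAlgebra k Λ]
    [∀ n, AddCommGroup (Γ n)] [∀ n, Module k (Γ n)] [DirectSum.GRing Γ] [DirectSum.GAlgebra k Γ]
    (E : GradedModuleAlgebra k H Λ) (F : GradedComoduleAlgebra k H Γ) {p q n : ℕ} (e : p + q = n)
    (x : Λ p) (y : Γ q) : TwistedTensor.tmul (gradedSmashTwist E F) (DirectSum.lof k ℕ Λ p x)
      (DirectSum.lof k ℕ Γ q y) ∈ GradedSmashProduct.degree E F n :=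
  Submodule.subset_span ⟨p, q, e, x, y, rfl⟩

/-- The action and the coaction preserve degrees, hence the twist preserves bidegrees. -/
lemma yonedaTwist_mem_degree {p q n : ℕ} (e : p + q = n)
    (z : Ext ((smashRes α).obj M) ((smashRes α).obj M) p ⊗[k] Ext X X q) :
    (show GradedSmashProduct (hopfModuleAlgebra α M hS) (extComodule hS hX χ) from
      yonedaTwist α hS X χ M hX (TensorProduct.map (DirectSum.lof k ℕ _ p)
        (DirectSum.lof k ℕ (Ext X X) q) z)) ∈
      GradedSmashProduct.degree (hopfModuleAlgebra α M hS) (extComodule hS hX χ) n := by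
  let W : Submodule k ((⨁ n, Ext ((smashRes α).obj M) ((smashRes α).obj M) n) ⊗[k]
    (⨁ n, Ext X X n)) :=
    GradedSmashProduct.degree (hopfModuleAlgebra α M hS) (extComodule hS hX χ) n
  change yonedaTwist α hS X χ M hX (TensorProduct.map (DirectSum.lof k ℕ _ p)
        (DirectSum.lof k ℕ (Ext X X) q) z) ∈ W
  induction z using TensorProduct.induction_on with
  | zero => rw [map_zero, map_zero]; exact zero_mem W
  | add y z hy hz => rw [map_add, map_add]; exact add_mem hy hz
  | tmul x γ =>
    have h₀ : yonedaTwist α hS X χ M hX (DirectSum.lof k ℕ _ p x ⊗ₜ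
        DirectSum.lof k ℕ (Ext X X) q γ) = _ :=
      gradedSmashτ_lof (hopfModuleAlgebra α M hS).toModuleAlgebra
        (extComodule hS hX χ).toComoduleAlgebra p q x γ
    have h₁ : (extComodule hS hX χ).coact (DirectSum.lof k ℕ (Ext X X) q γ) = _ :=
      extCoactHom_lof hS χ hX q γ
    rw [TensorProduct.map_tmul, h₀, smashτ_apply, h₁]
    refine W.smul_mem _ ?_
    generalize extCoact hS χ χ hX q γ = w
    induction w using TensorProduct.induction_on with
    | zero => rw [map_zero, map_zero]; exact zero_mem W
    | add y z hy hz => rw [map_add, map_add]; exact add_mem hy hz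
    | tmul h γ =>
      have h₃ : (hopfModuleAlgebra α M hS).act h (DirectSum.lof k ℕ _ p x) = _ :=
        hopfExtAct_lof α M h p x
      rw [LinearMap.lTensor_tmul, LinearMap.rTensor_tmul, LinearMap.flip_apply,
        AlgHom.toLinearMap_apply, h₃]
      exact tmul_mem_degree (hopfModuleAlgebra α M hS) (extComodule hS hX χ) e _ _

lemma directSum_map_lof {p q : ℕ}
    (z : Ext ((smashRes α).obj M) ((smashRes α).obj M) p ⊗[k] Ext X X q) :
    TensorProduct.directSum k k _ _ (TensorProduct.map (DirectSum.lof k ℕ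
      (Ext ((smashRes α).obj M) ((smashRes α).obj M)) p) (DirectSum.lof k ℕ (Ext X X) q) z) =
      DirectSum.lof k (ℕ × ℕ) (yonedaBigraded (k := k) α X M) (p, q) z := by
  induction z using TensorProduct.induction_on with
  | zero => simp
  | add y z hy hz => simp only [map_add, hy, hz]
  | tmul x γ => exact TensorProduct.directSum_lof_tmul_lof (R := k) (S := k) p x q γ

include hM in
/-- The Yoneda algebra of `M # X` is the graded smash product of the Yoneda algebras of `M`
and `X`. -/
theorem exists_yonedaEquiv : ∃ e : (⨁ n, Ext ((smashFunctor α χ).obj ((smashRes α).obj M))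
      ((smashFunctor α χ).obj ((smashRes α).obj M)) n) ≃ₐ[k]
        GradedSmashProduct (hopfModuleAlgebra α M hS) (extComodule hS hX χ),
    ∀ n, (LinearMap.range (DirectSum.lof k ℕ (Ext ((smashFunctor α χ).obj ((smashRes α).obj M))
      ((smashFunctor α χ).obj ((smashRes α).obj M))) n)).map e.toLinearMap =
        GradedSmashProduct.degree (hopfModuleAlgebra α M hS) (extComodule hS hX χ) n := by
  let m := TwistedTensor.lift _ (yonedaRight_mul_yonedaLeft α χ M hS hX)
  let e := AlgEquiv.ofBijective m (tensorMulLift_yoneda_bijective α hS χ M hM hX)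
  refine ⟨e.symm, fun n => le_antisymm ?_ (Submodule.span_le.2 ?_)⟩
  · rintro _ ⟨_, ⟨y, rfl⟩, rfl⟩
    -- A preimage is taken under the comparison map, where the grading is visible, and carried by
    -- the twist into the component of degree n.
    obtain ⟨z, hz⟩ := exists_smashExtSum_eq α hS χ M hM hX n y
    let w := ∑ t, TensorProduct.map (DirectSum.lof k ℕ _ t.1.1)
      (DirectSum.lof k ℕ (Ext X X) t.1.2) (z t)
    have hw : tensorMulLift (yonedaLeft α χ M) (yonedaRight α χ M)
        (yonedaTwist α hS X χ M hX w) = DirectSum.lof k ℕ _ n y := by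
      rw [tensorMulLift_yonedaTwist, ← hz, map_sum]
      exact congrArg (smashExtSum α χ M)
        (Finset.sum_congr rfl fun t _ => directSum_map_lof α M (z t))
    have he : e.symm (DirectSum.lof k ℕ _ n y) = yonedaTwist α hS X χ M hX w :=
      e.injective ((e.apply_symm_apply _).trans hw.symm)
    refine (congrArg (· ∈ GradedSmashProduct.degree (hopfModuleAlgebra α M hS)
      (extComodule hS hX χ) n) he).mpr ?_
    rw [map_sum]
    exact Submodule.sum_mem _ fun t _ => yonedaTwist_mem_degree α hS χ M hX
      (Finset.HasAntidiagonal.mem_antidiagonal.1 t.2) (z t)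
  · rintro _ ⟨p, q, rfl, x, γ, rfl⟩
    refine ⟨e (TwistedTensor.tmul _ (DirectSum.lof k ℕ _ p x) (DirectSum.lof k ℕ _ q γ)), ?_,
      e.symm_apply_apply _⟩
    refine ⟨(rightExt α χ χ M q γ).comp (x.mapExactFunctor (smashFunctor α χ)) (add_comm q p), ?_⟩
    refine (lof_mul_lof_cast _ _ _ (add_comm q p)).symm.trans ?_
    rw [← yonedaLeft_lof, ← yonedaRight_lof]
    rfl

end SmashYonedaEquiv

/-! ### Transfer to the modules of the theorem. -/

section

variable {k H : Type u} [Field k] [Ring H] [Bialgebra k H] {𝒜 ℬ 𝒯 : Type*} [Category.{u} 𝒜]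
  [Abelian 𝒜] [HasExt.{u} 𝒜] [Linear k 𝒜] [Category.{u} ℬ] [Abelian ℬ] [HasExt.{u} ℬ]
  [Linear k ℬ] [Category.{u} 𝒯] [Abelian 𝒯] [HasExt.{u} 𝒯] [Linear k 𝒯]

/-- The property of objects `Y`, `N`, `X` that the Yoneda algebra of `Y` is isomorphic to a graded
smash product of the Yoneda algebras of `N` and `X`. -/
def IsSmashYoneda (Y : 𝒯) (N : 𝒜) (X : ℬ) (E : GradedModuleAlgebra k H (Ext N N))
    (F : GradedComoduleAlgebra k H (Ext X X)) : Prop :=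
  ∃ e : (⨁ n, Ext Y Y n) ≃ₐ[k] GradedSmashProduct E F, ∀ n : ℕ,
    (LinearMap.range (DirectSum.lof k ℕ (Ext Y Y) n)).map e.toLinearMap =
      GradedSmashProduct.degree E F n

lemma IsSmashYoneda.exists_algEquiv {Y : 𝒯} {N : 𝒜} {X : ℬ}
    {E : GradedModuleAlgebra k H (Ext N N)} {F : GradedComoduleAlgebra k H (Ext X X)}
    (h : IsSmashYoneda Y N X E F) :
    ∃ e : (⨁ n, Ext Y Y n) ≃ₐ[k] GradedSmashProduct E F, ∀ n : ℕ,
      (LinearMap.range (DirectSum.lof k ℕ (Ext Y Y) n)).map e.toLinearMap =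
        GradedSmashProduct.degree E F n :=
  h

end

lemma IsSmashYoneda.exists_extAlgebra_algEquiv {k H R S T Y N X : Type u} [Field k] [Ring H]
    [Bialgebra k H] [Ring R] [Algebra k R] [Ring S] [Algebra k S] [Ring T] [Algebra k T]
    [AddCommGroup Y] [AddCommGroup N] [AddCommGroup X] [Module R Y] [Module S N] [Module T X]
    {E : GradedModuleAlgebra k H (SelfExt S N)} {F : GradedComoduleAlgebra k H (SelfExt T X)}
    (h : IsSmashYoneda (ModuleCat.of R Y) (ModuleCat.of S N) (ModuleCat.of T X) E F) :
    ∃ e : ExtAlgebra R Y ≃ₐ[k] GradedSmashProduct E F, ∀ n : ℕ,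
      (LinearMap.range (DirectSum.lof k ℕ (SelfExt R Y) n)).map e.toLinearMap =
        GradedSmashProduct.degree E F n := by
  apply IsSmashYoneda.exists_algEquiv
  exact h

open HopfAlgebra in
open scoped ModuleCat in
lemma isSmashYoneda_smashFunctor {k : Type u} [Field k] {H A B : Type u} [Ring H]
    [HopfAlgebra k H] [Ring A] [Algebra k A] [Ring B] [Algebra k B] (α : ModuleAlgebra k H A)
    {β : ComoduleAlgebra k H B} (hS : Function.Bijective (antipode k (A := H)))
    {X : ModuleCat.{u} Bᵐᵒᵖ} (χ : HopfModule β X) (M : ModuleCat.{u} (SmashHopf α)ᵐᵒᵖ)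
    (hM : ((smashRes α).obj M).IsFPInfinity) (hX : X.IsFPInfinity) :
    IsSmashYoneda (k := k) ((smashFunctor α χ).obj ((smashRes α).obj M)) ((smashRes α).obj M) X
      (hopfModuleAlgebra α M hS) (extComodule hS hX χ) :=
  exists_yonedaEquiv α hS χ M hM hX

theorem mainTheorem1 {k H A B : Type u} [Field k] [Ring H] [HopfAlgebra k H]
    (hS : Function.Bijective (HopfAlgebra.antipode k (A := H)))
    [Ring A] [Algebra k A] (α : ModuleAlgebra k H A)
    [Ring B] [Algebra k B] (β : ComoduleAlgebra k H B)
    {M : Type u} [AddCommGroup M] [Module k M] [Module Aᵐᵒᵖ M] [IsScalarTower k Aᵐᵒᵖ M]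
    [Module (SmashHopf α)ᵐᵒᵖ M]
    (hM : ∀ (a : A) (m : M), op (SmashHopf.tmul α a 1) • m = op a • m)
    (hMpc : IsPseudoCoherent Aᵐᵒᵖ M)
    {X : Type u} [AddCommGroup X] [Module k X] [Module Bᵐᵒᵖ X] [IsScalarTower k Bᵐᵒᵖ X]
    (χ : HopfModule β X)
    (hXpc : IsPseudoCoherent Bᵐᵒᵖ X) :
    Nonempty (EquivariantResolution α M) ∧ Nonempty (HopfResolution χ) ∧
    ∃ (E : GradedModuleAlgebra k H (SelfExt Aᵐᵒᵖ M))
      (F : GradedComoduleAlgebra k H (SelfExt Bᵐᵒᵖ X)),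
      (∀ P : EquivariantResolution α M, IsInducedAction P E) ∧
      (∀ Q : HopfResolution χ, IsInducedCoaction hS Q F) ∧
      ∃ e : ExtAlgebra (SmashProduct α β)ᵐᵒᵖ (SmashModule α M χ) ≃ₐ[k] GradedSmashProduct E F,
        ∀ n : ℕ,
          (LinearMap.range (DirectSum.lof k ℕ
            (SelfExt (SmashProduct α β)ᵐᵒᵖ (SmashModule α M χ)) n)).map e.toLinearMap =
          GradedSmashProduct.degree E F n := by
  -- The k-structures on X and M and the A-structure on M are determined by the actions of B, A and
  -- A # H. Substituting the canonical ones makes M literally the restriction of an A # H-module, so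
  -- the functorial results apply.
  have hk : ‹Module k X› =
      ModuleCat.moduleOfAlgebraModule (ModuleCat.of Bᵐᵒᵖ X) :=
    Module.ext' _ _ fun r x => (algebraMap_smul Bᵐᵒᵖ r x).symm
  have hA : ‹Module Aᵐᵒᵖ M› =
      ((smashRes α).obj (ModuleCat.of (SmashHopf α)ᵐᵒᵖ M)).isModule :=
    Module.ext' _ _ fun a m => (hM a.unop m).symm
  have hkM : ‹Module k M› = ModuleCat.moduleOfAlgebraModule
      (ModuleCat.of Aᵐᵒᵖ M) :=
    Module.ext' _ _ fun r x => (algebraMap_smul Aᵐᵒᵖ r x).symm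
  have hM' := ModuleCat.isFPInfinity_of_isPseudoCoherent hMpc
  have hX' := ModuleCat.isFPInfinity_of_isPseudoCoherent hXpc
  have h : Nonempty (EquivariantResolution α M) ∧
      ∃ (E : GradedModuleAlgebra k H (SelfExt Aᵐᵒᵖ M))
        (F : GradedComoduleAlgebra k H (SelfExt Bᵐᵒᵖ X)),
        (∀ P : EquivariantResolution α M, IsInducedAction P E) ∧
        (∀ Q : HopfResolution χ, IsInducedCoaction hS Q F) ∧
        Nonempty (HopfResolution χ) ∧
        IsSmashYoneda (ModuleCat.of (SmashProduct α β)ᵐᵒᵖ (SmashModule α M χ))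
          (ModuleCat.of Aᵐᵒᵖ M) (ModuleCat.of Bᵐᵒᵖ X) E F := by
    subst hk
    subst hkM
    subst hA
    let N := ModuleCat.of (SmashHopf α)ᵐᵒᵖ M
    refine ⟨exists_equivariantResolution α hS N, hopfModuleAlgebra α N hS, extComodule hS hX' χ,
      isInducedAction_hopfModuleAlgebra hS N, isInducedCoaction_extComodule hS χ hX',
      exists_hopfResolution χ hX', ?_⟩
    exact isSmashYoneda_smashFunctor (X := ModuleCat.of Bᵐᵒᵖ X) α hS χ N hM' hX'
  obtain ⟨hR, E, F, hE, hF, hQ, h⟩ := h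
  exact ⟨hR, hQ, E, F, hE, hF, h.exists_extAlgebra_algEquiv⟩
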